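/- Let $\mathbf k$ be a field of characteristic zero. **The collection $\mathsf{rpL}^*$.** For $n\ge 1$ let $\mathsf{rpL}^*(\mathbf k^n)=\mathsf{pL}^*(\mathbf k^n,\circ)/(\circ\star\circ)$, where $\mathsf{pL}^*(\mathbf k^n,\circ)$ is the free graded pre-Lie algebra on generators $e_1,\dots,e_n$ of degree $0$ and $\circ$ of degree $1$. (Here the associator $\Phi(a,b,c)=(a\star b)\star c-a\star(b\star c)$ of a graded pre-Lie algebra satisfies $\Phi(a,b,c)=(-1)^{|b||c|}\Phi(a,c,b)$.) Let $d$ be the degree $+1$ linear map on $\mathsf{rpL}^*(\mathbf k^n)$ with $d(e_i)=0$, $d(\circ)=0$ and $$d(a\star b)=d(a)\star b+(-1)^{|a|}a\star d(b)+\Phi(\circ,a,b).$$ Let $\mathsf{rpL}^*(n)\subset \mathsf{rpL}^*(\mathbf k^n)$ be the $d$-stable subspace spanned by the monomials that contain each of $e_1,\dots,e_n$ exactly once. **The Chevalley–Eilenberg complex.** For a $\mathbb Z$-graded vector space $L$ let $\downarrow\! L$ be its desuspension, $(\downarrow\! L)_p=L_{p+1}$, and let $S^c(\downarrow\! L)$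 be the cofree conilpotent graded cocommutative coalgebra cogenerated by $\downarrow\! L$. An $L_\infty$-structure on $L$ is a coderivation $\lambda$ of $S^c(\downarrow\! L)$ of degree $+1$ with $\lambda^2=0$. For a Lie algebra $L$, placed in degree $0$, $\lambda$ is the coextension of the desuspended bracket. The Chevalley–Eilenberg complex $C^*_{CE}(L;L)=\mathrm{Coder}^*(S^c(\downarrow\! L))$ is the graded space spanned by the homogeneous coderivations, with $$d_{CE}(\Theta)=-[\lambda,\Theta]=(-1)^{|\Theta|}\Theta\lambda-\lambda\Theta .$$ For a Lie algebra, coderivations of degree $n-1$ are the alternating $n$-cochains on $L$ with values in $L$, and $d_{CE}$ is on them $(-1)^{n-1}$ times the classical Chevalley–Eilenberg differential. The space $\mathrm{Coder}^*(S^c(\downarrow\! L))$ is a graded pre-Lie algebra: $\Theta\star\Omega$ is the coderivation whose corestriction to $\downarrow\! L$ is $\overline\Theta\circ\Omega$, where $\overline\Theta$ is the corestriction of $\Theta$. **Proposition.** 1. The differential $d$ exists. The collection $\mathsf{rpL}^*=\{\mathsf{rpL}^*(n)\}_{n\ge1}$ is an operad in the category of dg vector spaces. It is graded by the number of occurrences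 of $\circ$, its differential is $d$, its symmetric groups permute $e_1,\dots,e_n$, and its unit is $e_1\in\mathsf{rpL}^0(1)$. The composition $a\circ_i b$ of monomials is the substitution of $b$ for $e_i$ in $a$ (with the inputs relabelled), with the Koszul sign $(-1)^{|b|r}$, where $r$ is the number of occurrences of $\circ$ in $a$ to the right of $e_i$. 2. Let $L$ be a Lie algebra or an $L_\infty$-algebra. For homogeneous $f_1,\dots,f_n\in C^*_{CE}(L;L)$ and a monomial $U\in\mathsf{rpL}^*(n)$ let $U(f_1,\dots,f_n)$ be the value of $U$ under $e_i\mapsto f_i$, $\circ\mapsto\lambda$, computed with the product $\star$ of coderivations, times the Koszul sign of rearranging $\circ,\dots,\circ,f_1,\dots,f_n$ into the order in which these letters occur in $U$. This is well defined and makes $C^*_{CE}(L;L)$ a dg algebra over the dg operad $\mathsf{rpL}^*$. In particular $$d(U)(f_1,\dots,f_n)=d_{CE}(U(f_1,\dots,f_n))-(-1)^{|U|}\sum_{1\le i\le n}(-1)^{|f_1|+\cdots+|f_{i-1}|}U(f_1,\dots,d_{CE}(f_i),\dots,f_n).$$ 3. Consequently the structure of $\mathsf{rpL}^*$ on cocycles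 makes $H^*(\mathsf{rpL})$ a graded operad, and the action of cocycles on cocycles makes $H^*_{CE}(L;L)$ an algebra over $H^*(\mathsf{rpL})$. Statements 2 and 3 hold also when cochains of arity $0$ are included, that is, when $S^c(\downarrow\! L)=\bigoplus_{n\ge1}S^n(\downarrow\! L)$ is replaced by the counital coalgebra $\bigoplus_{n\ge0}S^n(\downarrow\! L)$ and $\lambda$ is extended by $\lambda(1)=0$. -/

import Mathlib

open scoped TensorProduct

universe u v

noncomputable section

/-! ### Koszul signs -/

/-- The standard order of the letters of a word: first `none` (the dummy variable `∘`), then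
`some 0, some 1, …`.  `letterBefore y x` says that `y` strictly precedes `x`. -/
def letterBefore {n : ℕ} : Option (Fin n) → Option (Fin n) → Bool
  | none, some _ => true
  | some i, some j => decide (i < j)
  | _, none => false

/-- Degrees of letters: `∘` has degree `1`, the letter `some i` has degree `deg i`. -/
def letterDeg {n : ℕ} (deg : Fin n → ℤ) : Option (Fin n) → ℤ
  | none => 1
  | some i => deg i

/-- Exponent of the Koszul sign of the rearrangement of graded letters from the standard order
into the order of the word `w`: the sum of `|x||y|` over all pairs (`x` left of `y` in `w`) that
are not in the standard order. -/
def koszulExp {n : ℕ} (deg : Fin n → ℤ) : List (Option (Fin n)) → ℤ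
  | [] => 0
  | x :: w =>
      (w.map fun y => if letterBefore y x then letterDeg deg x * letterDeg deg y else 0).sum
        + koszulExp deg w

/-- The Koszul sign of rearranging letters from the standard order into the order of `w`. -/
def koszulSign {n : ℕ} (deg : Fin n → ℤ) (w : List (Option (Fin n))) : ℤˣ :=
  (koszulExp deg w).negOnePow

/-! ### Dg vector spaces, cohomology -/

/-- The structure of a `ℤ`-graded cochain complex on a vector space `X`. -/
structure DGStruct (k : Type*) [Field k] (X : Type*) [AddCommGroup X] [Module k X] where
  gr : ℤ → Submodule k X
  internal : DirectSum.IsInternal gr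
  d : X →ₗ[k] X
  d_mem : ∀ p, ∀ x ∈ gr p, d x ∈ gr (p + 1)
  d_d : ∀ x, d (d x) = 0

/-- The total cohomology `Ker d / Im d`. -/
abbrev DGStruct.H {k : Type*} [Field k] {X : Type*} [AddCommGroup X] [Module k X]
    (D : DGStruct k X) : Type _ :=
  LinearMap.ker D.d ⧸ (LinearMap.range D.d).submoduleOf (LinearMap.ker D.d)

/-- The cohomology class of a cocycle. -/
def DGStruct.cls {k : Type*} [Field k] {X : Type*} [AddCommGroup X] [Module k X]
    (D : DGStruct k X) : LinearMap.ker D.d →ₗ[k] D.H :=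
  ((LinearMap.range D.d).submoduleOf (LinearMap.ker D.d)).mkQ

/-- `E` is the graded vector space `H(X)` (with zero differential), graded by the degree of
representing cocycles. -/
def DGStruct.IsCohomology {k : Type*} [Field k] {X : Type*} [AddCommGroup X] [Module k X]
    (D : DGStruct k X) (E : DGStruct k D.H) : Prop :=
  E.d = 0 ∧ ∀ p, E.gr p = ((D.gr p).comap (LinearMap.ker D.d).subtype).map D.cls

/-! ### Dg operads and their algebras

The space `P n` is the component of arity `n + 1`, whose inputs are labelled by `Fin (n + 1)`.
If `a` has arity `m + 1` and `b` has arity `n + 1`, then the partial composition `a ∘ᵢ b` has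
arity `m + n + 1`. -/

/-- The label in `a ∘ᵢ b` of the input `j ≠ i` of `a`, where `b` has arity `n + 1`. -/
def outerLabel {m : ℕ} (n : ℕ) (i j : Fin (m + 1)) : Fin (m + n + 1) :=
  if j ≤ i then ⟨j, by omega⟩ else ⟨j + n, by omega⟩

/-- The label in `a ∘ᵢ b` of the input `j` of `b`. -/
def innerLabel {m n : ℕ} (i : Fin (m + 1)) (j : Fin (n + 1)) : Fin (m + n + 1) :=
  ⟨i + j, by omega⟩

/-- Transport along an equality of arities. -/
def castArity {P : ℕ → Type*} {m n : ℕ} (h : m = n) (x : P m) : P n := h ▸ x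

/-- The structure of a (unital, symmetric) operad in the category of dg vector spaces on a
collection `P`, given by partial compositions.  The symmetric groups act from the left, `σ` moving
the input labelled `j` to the label `σ j`. -/
structure DGOperad (k : Type*) [Field k] (P : ℕ → Type*) [∀ n, AddCommGroup (P n)]
    [∀ n, Module k (P n)] where
  dg : ∀ n, DGStruct k (P n)
  perm : ∀ n, Representation k (Equiv.Perm (Fin (n + 1))) (P n)
  one : P 0
  comp : ∀ {m n : ℕ}, Fin (m + 1) → P m →ₗ[k] P n →ₗ[k] P (m + n)
  perm_mem : ∀ n σ p, ∀ x ∈ (dg n).gr p, perm n σ x ∈ (dg n).gr p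
  perm_d : ∀ n σ x, (dg n).d (perm n σ x) = perm n σ ((dg n).d x)
  one_mem : one ∈ (dg 0).gr 0
  one_d : (dg 0).d one = 0
  comp_mem : ∀ {m n : ℕ} (i : Fin (m + 1)) (p q : ℤ), ∀ a ∈ (dg m).gr p, ∀ b ∈ (dg n).gr q,
    comp i a b ∈ (dg (m + n)).gr (p + q)
  comp_d : ∀ {m n : ℕ} (i : Fin (m + 1)) (p : ℤ), ∀ a ∈ (dg m).gr p, ∀ b : P n,
    (dg (m + n)).d (comp i a b) =
      comp i ((dg m).d a) b + p.negOnePow • comp i a ((dg n).d b)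
  one_comp : ∀ {n : ℕ} (b : P n), comp 0 one b = castArity (Nat.zero_add n).symm b
  comp_one : ∀ {m : ℕ} (i : Fin (m + 1)) (a : P m), comp i a one = a
  comp_seq : ∀ {m n l : ℕ} (i : Fin (m + 1)) (j : Fin (n + 1)) (a : P m) (b : P n) (c : P l),
    castArity (Nat.add_assoc m n l) (comp (innerLabel i j) (comp i a b) c) =
      comp i a (comp j b c)
  comp_par : ∀ {m n l : ℕ} (i j : Fin (m + 1)), i ≠ j → ∀ (q r : ℤ) (a : P m),
    ∀ b ∈ (dg n).gr q, ∀ c ∈ (dg l).gr r,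
    castArity (Nat.add_right_comm m n l) (comp (outerLabel n i j) (comp i a b) c) =
      (q * r).negOnePow • comp (outerLabel l j i) (comp j a c) b
  comp_perm : ∀ {m n : ℕ} (i : Fin (m + 1)) (a : P m) (b : P n)
    (σ : Equiv.Perm (Fin (m + 1))) (τ : Equiv.Perm (Fin (n + 1)))
    (ρ : Equiv.Perm (Fin (m + n + 1))),
    (∀ j, j ≠ i → ρ (outerLabel n i j) = outerLabel n (σ i) (σ j)) →
    (∀ j, ρ (innerLabel i j) = innerLabel (σ i) (τ j)) →
    comp (σ i) (perm m σ a) (perm n τ b) = perm (m + n) ρ (comp i a b)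

/-- The structure of a dg algebra over the dg operad `𝒪` on the dg vector space `X`. -/
structure DGOperad.Algebra {k : Type*} [Field k] {P : ℕ → Type*} [∀ n, AddCommGroup (P n)]
    [∀ n, Module k (P n)] (𝒪 : DGOperad k P) {X : Type*} [AddCommGroup X] [Module k X]
    (D : DGStruct k X) where
  act : ∀ n, P n →ₗ[k] MultilinearMap k (fun _ : Fin (n + 1) => X) X
  act_mem : ∀ n (r : ℤ) (p : Fin (n + 1) → ℤ) (f : Fin (n + 1) → X), ∀ U ∈ (𝒪.dg n).gr r,
    (∀ i, f i ∈ D.gr (p i)) → act n U f ∈ D.gr (r + ∑ i, p i)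
  act_one : ∀ f, act 0 𝒪.one f = f 0
  act_comp : ∀ {m n : ℕ} (i : Fin (m + 1)) (a : P m) (q : ℤ) (b : P n)
    (p : Fin (m + n + 1) → ℤ) (f : Fin (m + n + 1) → X), b ∈ (𝒪.dg n).gr q →
    (∀ j, f j ∈ D.gr (p j)) →
    act (m + n) (𝒪.comp i a b) f =
      (q * ∑ j with j.val < i.val, p j).negOnePow •
        act m a (fun j => if j = i then act n b (fun l => f (innerLabel i l))
          else f (outerLabel n i j))
  act_perm : ∀ n (σ : Equiv.Perm (Fin (n + 1))) (U : P n) (p : Fin (n + 1) → ℤ)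
    (f : Fin (n + 1) → X), (∀ i, f i ∈ D.gr (p i)) →
    act n (𝒪.perm n σ U) f =
      koszulSign p (List.ofFn fun i => some (σ i)) • act n U (fun i => f (σ i))
  act_d : ∀ n (r : ℤ) (U : P n) (p : Fin (n + 1) → ℤ) (f : Fin (n + 1) → X),
    U ∈ (𝒪.dg n).gr r → (∀ i, f i ∈ D.gr (p i)) →
    act n ((𝒪.dg n).d U) f = D.d (act n U f) -
      r.negOnePow • ∑ i, (∑ j with j < i, p j).negOnePow •
        act n U (Function.update f i (D.d (f i)))

/-- `ℋ` is the cohomology operad of `𝒪`: its structure is induced by that of `𝒪` on cocycles. -/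
def DGOperad.IsCohomology {k : Type*} [Field k] {P : ℕ → Type*} [∀ n, AddCommGroup (P n)]
    [∀ n, Module k (P n)] (𝒪 : DGOperad k P) (ℋ : DGOperad k (fun n => (𝒪.dg n).H)) : Prop :=
  (∀ n, (𝒪.dg n).IsCohomology (ℋ.dg n)) ∧
  (∀ n σ (x y : LinearMap.ker (𝒪.dg n).d), (y : P n) = 𝒪.perm n σ x →
    ℋ.perm n σ ((𝒪.dg n).cls x) = (𝒪.dg n).cls y) ∧
  (∀ x : LinearMap.ker (𝒪.dg 0).d, (x : P 0) = 𝒪.one → ℋ.one = (𝒪.dg 0).cls x) ∧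
  (∀ (m n : ℕ) (i : Fin (m + 1)) (x : LinearMap.ker (𝒪.dg m).d)
    (y : LinearMap.ker (𝒪.dg n).d) (z : LinearMap.ker (𝒪.dg (m + n)).d),
    (z : P (m + n)) = 𝒪.comp i (x : P m) (y : P n) →
    ℋ.comp i ((𝒪.dg m).cls x) ((𝒪.dg n).cls y) = (𝒪.dg (m + n)).cls z)

/-! ### The reduced free graded pre-Lie algebra on `𝐤ⁿ` and `∘` -/

/-- The leaves of a nonassociative monomial, read from left to right. -/
def leafWord {X : Type*} : FreeMagma X → List X
  | FreeMagma.of x => [x]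
  | FreeMagma.mul a b => leafWord a ++ leafWord b

/-- The degree of a monomial in `e₁, …, eₙ` (degree `0`) and `∘` (degree `1`). -/
def circDeg {n : ℕ} (m : FreeMagma (Option (Fin n))) : ℕ := (leafWord m).count none

/-- The free nonassociative algebra on `e₁, …, eₙ` (the letters `some i`) and `∘` (`none`). -/
abbrev FreeNA (k : Type*) [Field k] (n : ℕ) : Type _ :=
  FreeNonUnitalNonAssocAlgebra k (Option (Fin n))

/-- A monomial as an element of the free nonassociative algebra. -/
def FreeNA.mono (k : Type*) [Field k] {n : ℕ} (m : FreeMagma (Option (Fin n))) : FreeNA k n :=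
  MonoidAlgebra.single m 1

/-- The associator `(a ⋆ b) ⋆ c - a ⋆ (b ⋆ c)`. -/
def FreeNA.assoc (k : Type*) [Field k] {n : ℕ} (a b c : FreeMagma (Option (Fin n))) :
    FreeNA k n :=
  FreeNA.mono k (a * b * c) - FreeNA.mono k (a * (b * c))

/-- The defining relations: the graded right pre-Lie identity
`Φ(a,b,c) = (-1)^{|b||c|} Φ(a,c,b)` and `∘ ⋆ ∘ = 0`. -/
def rplRel (k : Type*) [Field k] (n : ℕ) : Set (FreeNA k n) :=
  {x | ∃ a b c, x = FreeNA.assoc k a b c -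
      ((circDeg b * circDeg c : ℕ) : ℤ).negOnePow • FreeNA.assoc k a c b} ∪
    {FreeNA.mono k (FreeMagma.of none * FreeMagma.of none)}

/-- The two-sided ideal generated by the relations. -/
def rplIdeal (k : Type*) [Field k] (n : ℕ) : Submodule k (FreeNA k n) :=
  sInf {I | rplRel k n ⊆ I ∧ ∀ x ∈ I, ∀ y, x * y ∈ I ∧ y * x ∈ I}

theorem rplIdeal_mul_mem {k : Type*} [Field k] {n : ℕ} {x : FreeNA k n} (hx : x ∈ rplIdeal k n)
    (y : FreeNA k n) : x * y ∈ rplIdeal k n ∧ y * x ∈ rplIdeal k n := by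
  simp only [rplIdeal, Submodule.mem_sInf] at hx ⊢
  exact ⟨fun I hI => (hI.2 x (hx I hI) y).1, fun I hI => (hI.2 x (hx I hI) y).2⟩

/-- The graded pre-Lie algebra `rpL*(𝐤ⁿ) = pL*(𝐤ⁿ, ∘) / (∘ ⋆ ∘)`. -/
abbrev Rpl (k : Type*) [Field k] (n : ℕ) : Type _ := FreeNA k n ⧸ rplIdeal k n

/-- The pre-Lie product of `rpL*(𝐤ⁿ)`. -/
def Rpl.mul (k : Type*) [Field k] (n : ℕ) : Rpl k n →ₗ[k] Rpl k n →ₗ[k] Rpl k n :=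
  (rplIdeal k n).liftQ
    (LinearMap.flip ((rplIdeal k n).liftQ
      (((LinearMap.mul k (FreeNA k n)).compr₂ (rplIdeal k n).mkQ).flip)
      (fun y hy => by
        rw [LinearMap.mem_ker]
        refine LinearMap.ext fun x => ?_
        simpa using (rplIdeal_mul_mem hy x).2)))
    (fun x hx => by
      rw [LinearMap.mem_ker]
      refine LinearMap.ext fun y => ?_
      obtain ⟨y, rfl⟩ := (rplIdeal k n).mkQ_surjective y
      simpa using (rplIdeal_mul_mem hx y).1)

/-- The class of a monomial in `rpL*(𝐤ⁿ)`. -/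
def Rpl.mono (k : Type*) [Field k] {n : ℕ} (m : FreeMagma (Option (Fin n))) : Rpl k n :=
  (rplIdeal k n).mkQ (FreeNA.mono k m)

/-- The generator `eᵢ` of `rpL*(𝐤ⁿ)`. -/
def Rpl.e (k : Type*) [Field k] {n : ℕ} (i : Fin n) : Rpl k n :=
  Rpl.mono k (FreeMagma.of (some i))

/-- The dummy variable `∘` in `rpL*(𝐤ⁿ)`. -/
def Rpl.circ (k : Type*) [Field k] (n : ℕ) : Rpl k n := Rpl.mono k (FreeMagma.of none)

/-- The degree `p` part of `rpL*(𝐤ⁿ)`: monomials with `p` occurrences of `∘`. -/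
def Rpl.gr (k : Type*) [Field k] (n : ℕ) (p : ℤ) : Submodule k (Rpl k n) :=
  Submodule.span k {x | ∃ m : FreeMagma (Option (Fin n)), (circDeg m : ℤ) = p ∧ x = Rpl.mono k m}

/-- `d` is the differential of `rpL*(𝐤ⁿ)`: the degree `+1` map with `d(eᵢ) = 0`, `d(∘) = 0` and
`d(a ⋆ b) = d(a) ⋆ b + (-1)^{|a|} a ⋆ d(b) + (∘ ⋆ a) ⋆ b - ∘ ⋆ (a ⋆ b)`. -/
def Rpl.IsDifferential {k : Type*} [Field k] {n : ℕ} (d : Rpl k n →ₗ[k] Rpl k n) : Prop :=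
  (∀ p, ∀ x ∈ Rpl.gr k n p, d x ∈ Rpl.gr k n (p + 1)) ∧
  (∀ i, d (Rpl.e k i) = 0) ∧
  d (Rpl.circ k n) = 0 ∧
  ∀ (p : ℤ), ∀ a ∈ Rpl.gr k n p, ∀ b,
    d (Rpl.mul k n a b) = Rpl.mul k n (d a) b + p.negOnePow • Rpl.mul k n a (d b) +
      (Rpl.mul k n (Rpl.mul k n (Rpl.circ k n) a) b -
        Rpl.mul k n (Rpl.circ k n) (Rpl.mul k n a b))

/-- A monomial containing each `eᵢ` exactly once (and any number of `∘`). -/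
def IsMultilinearMono {n : ℕ} (m : FreeMagma (Option (Fin n))) : Prop :=
  ∀ i, (leafWord m).count (some i) = 1

/-- `rpL*(n)`: the subspace of `rpL*(𝐤ⁿ)` spanned by monomials containing each `eᵢ` once. -/
def rplMultilinear (k : Type*) [Field k] (n : ℕ) : Submodule k (Rpl k n) :=
  Submodule.span k {x | ∃ m : FreeMagma (Option (Fin n)), IsMultilinearMono m ∧ x = Rpl.mono k m}

/-- The collection `rpL*`, the entry `n` being the component `rpL*(n + 1)` of arity `n + 1`. -/
abbrev RplColl (k : Type*) [Field k] (n : ℕ) : Type _ := rplMultilinear k (n + 1)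

/-- Substitution of the monomial `b` for `eᵢ` in the monomial `a`, with the inputs relabelled. -/
def substMono {m n : ℕ} (i : Fin (m + 1)) (a : FreeMagma (Option (Fin (m + 1))))
    (b : FreeMagma (Option (Fin (n + 1)))) : FreeMagma (Option (Fin (m + n + 1))) :=
  FreeMagma.lift (fun x : Option (Fin (m + 1)) => match x with
    | none => FreeMagma.of none
    | some j => if j = i then FreeMagma.map (Option.map (innerLabel i)) b
        else FreeMagma.of (some (outerLabel n i j))) a

/-- `𝒪` is the operad structure of `rpL*`: grading by the number of `∘`, differential the
restriction of `d`, symmetric groups permuting `e₁, …, eₙ`, unit `e₁`, and composition the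
substitution of `b` for `eᵢ` (vertex insertion of trees) with the Koszul sign of moving `b` past the
occurrences of `∘` in `a` to the right of `eᵢ`. -/
def IsRplOperad {k : Type*} [Field k] (d : ∀ n, Rpl k n →ₗ[k] Rpl k n)
    (𝒪 : DGOperad k (RplColl k)) : Prop :=
  (∀ n p, (𝒪.dg n).gr p = (Rpl.gr k (n + 1) p).comap (rplMultilinear k (n + 1)).subtype) ∧
  (∀ n (x : RplColl k n), ((𝒪.dg n).d x : Rpl k (n + 1)) = d (n + 1) x) ∧
  (∀ n (σ : Equiv.Perm (Fin (n + 1))) (m : FreeMagma (Option (Fin (n + 1)))) (x : RplColl k n),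
    IsMultilinearMono m → (x : Rpl k (n + 1)) = Rpl.mono k m →
    (𝒪.perm n σ x : Rpl k (n + 1)) = Rpl.mono k (FreeMagma.map (Option.map σ) m)) ∧
  ((𝒪.one : Rpl k 1) = Rpl.e k 0) ∧
  (∀ (m n : ℕ) (i : Fin (m + 1)) (a : FreeMagma (Option (Fin (m + 1))))
    (b : FreeMagma (Option (Fin (n + 1)))) (x : RplColl k m) (y : RplColl k n),
    IsMultilinearMono a → IsMultilinearMono b →
    (x : Rpl k (m + 1)) = Rpl.mono k a → (y : Rpl k (n + 1)) = Rpl.mono k b →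
    (𝒪.comp i x y : Rpl k (m + n + 1)) =
      koszulSign (Pi.single i (circDeg b : ℤ)) (leafWord a) • Rpl.mono k (substMono i a b))

/-! ### The cofree conilpotent cocommutative coalgebra

For a graded vector space `V` over a field of characteristic zero this is the graded symmetric
(co)algebra `S(V)`, with the coproduct for which `V` is primitive. -/

section SymCoalgebra

variable {k : Type*} [Field k] {V : Type*} [AddCommGroup V] [Module k V]
  (𝒱 : ℤ → Submodule k V)

/-- Graded commutativity. -/
inductive GSymRel : TensorAlgebra k V → TensorAlgebra k V → Prop
  | comm (p q : ℤ) (x y : V) (hx : x ∈ 𝒱 p) (hy : y ∈ 𝒱 q) :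
      GSymRel (TensorAlgebra.ι k x * TensorAlgebra.ι k y)
        ((p * q).negOnePow • (TensorAlgebra.ι k y * TensorAlgebra.ι k x))

/-- The graded symmetric algebra `S(V)`. -/
def GSym : Type _ := (ringConGen (GSymRel 𝒱)).Quotient

instance : Ring (GSym 𝒱) := inferInstanceAs (Ring (ringConGen (GSymRel 𝒱)).Quotient)

instance : Algebra k (GSym 𝒱) := inferInstanceAs (Algebra k (ringConGen (GSymRel 𝒱)).Quotient)

/-- The projection of the tensor algebra onto `S(V)`. -/
def GSym.mk : TensorAlgebra k V →ₐ[k] GSym 𝒱 := RingCon.mkₐ k (ringConGen (GSymRel 𝒱))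

/-- The inclusion `V → S(V)`. -/
def GSym.ι : V →ₗ[k] GSym 𝒱 :=
  (GSym.mk 𝒱).toLinearMap ∘ₗ TensorAlgebra.ι k

theorem GSym.ι_comm {p q : ℤ} {x y : V} (hx : x ∈ 𝒱 p) (hy : y ∈ 𝒱 q) :
    GSym.ι 𝒱 x * GSym.ι 𝒱 y = (p * q).negOnePow • (GSym.ι 𝒱 y * GSym.ι 𝒱 x) := by
  have h : GSym.mk 𝒱 _ = GSym.mk 𝒱 _ :=
    (RingCon.eq _).2 (RingCon.le_ringConGen _ _ (GSymRel.comm p q x y hx hy))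
  rw [Units.smul_def, map_zsmul, map_mul, map_mul, ← Units.smul_def] at h
  exact h

/-- The degree `q` part of `S(V)`, spanned by products of homogeneous elements of `V` of total
degree `q`. -/
def GSym.gr (q : ℤ) : Submodule k (GSym 𝒱) :=
  Submodule.span k {s | ∃ l : List (Σ p, 𝒱 p),
    (l.map Sigma.fst).sum = q ∧ s = (l.map fun v => GSym.ι 𝒱 (v.2 : V)).prod}

/-- The linear extension to `S(V)` of a map out of `V` satisfying graded commutativity. -/
def GSym.lift {A : Type*} [Ring A] [Algebra k A] (f : V →ₗ[k] A)
    (hf : ∀ p q x y, x ∈ 𝒱 p → y ∈ 𝒱 q → f x * f y = (p * q).negOnePow • (f y * f x)) :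
    GSym 𝒱 →ₐ[k] A :=
  RingCon.liftₐ _ (TensorAlgebra.lift k f) (RingCon.ringConGen_le.2 fun a b h => by
    obtain ⟨p, q, x, y, hx, hy⟩ := h
    change TensorAlgebra.lift k f _ = TensorAlgebra.lift k f _
    rw [Units.smul_def, map_zsmul, map_mul, map_mul, ← Units.smul_def]
    simpa using hf p q x y hx hy)

theorem GSym.lift_ι {A : Type*} [Ring A] [Algebra k A] (f : V →ₗ[k] A) (hf) (v : V) :
    GSym.lift 𝒱 f hf (GSym.ι 𝒱 v) = f v :=
  (TensorAlgebra.lift_ι_apply f v : TensorAlgebra.lift k f (TensorAlgebra.ι k v) = f v)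

/-- The projection `S(V) → V` onto the cogenerators. -/
def GSym.proj : GSym 𝒱 →ₗ[k] V :=
  letI : Module kᵐᵒᵖ V := Module.compHom _ ((RingHom.id k).fromOpposite mul_comm)
  haveI : IsCentralScalar k V := ⟨fun _ _ => rfl⟩
  (TrivSqZeroExt.sndHom k V).comp
    (GSym.lift 𝒱 (TrivSqZeroExt.inrHom k V) (fun p q x y _ _ => by simp)).toLinearMap

variable [DirectSum.Decomposition 𝒱]

/-- A linear map out of `V` given on the homogeneous parts of `V`. -/
def homogLift {W : Type*} [AddCommMonoid W] [Module k W] (f : ℤ → V →ₗ[k] W) : V →ₗ[k] W :=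
  DirectSum.toModule k ℤ W (fun p => f p ∘ₗ (𝒱 p).subtype) ∘ₗ
    (DirectSum.decomposeLinearEquiv 𝒱).toLinearMap

theorem homogLift_of_mem {W : Type*} [AddCommMonoid W] [Module k W] (f : ℤ → V →ₗ[k] W)
    {p : ℤ} {v : V} (hv : v ∈ 𝒱 p) : homogLift 𝒱 f v = f p v := by
  have := DirectSum.decomposeLinearEquiv_apply_coe (R := k) 𝒱 p ⟨v, hv⟩
  simp only [homogLift, LinearMap.comp_apply, LinearEquiv.coe_coe]
  rw [show DirectSum.decomposeLinearEquiv 𝒱 v = _ from this]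
  simp

/-- The parity automorphism `s ↦ (-1)^{|s|} s` of the algebra `S(V)`. -/
def GSym.parity : GSym 𝒱 →ₐ[k] GSym 𝒱 :=
  GSym.lift 𝒱 (homogLift 𝒱 fun p => p.negOnePow • GSym.ι 𝒱) (fun p q x y hx hy => by
    rw [homogLift_of_mem 𝒱 _ hx, homogLift_of_mem 𝒱 _ hy]
    change (p.negOnePow • GSym.ι 𝒱 x) * (q.negOnePow • GSym.ι 𝒱 y) =
      (p * q).negOnePow • ((q.negOnePow • GSym.ι 𝒱 y) * (p.negOnePow • GSym.ι 𝒱 x))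
    simp only [Units.smul_def, smul_mul_smul_comm]
    rw [GSym.ι_comm 𝒱 hx hy, Units.smul_def, smul_comm, mul_comm (p.negOnePow : ℤ)])

/-- The map `s ↦ (-1)^{p|s|} s` of `S(V)`. -/
def GSym.paritySign (p : ℤ) : GSym 𝒱 →ₗ[k] GSym 𝒱 :=
  if Even p then LinearMap.id else (GSym.parity 𝒱).toLinearMap

/-- Multiplication by `v ⊗ 1 + 1 ⊗ v` in `S(V) ⊗ S(V)`, with the Koszul sign
`(1 ⊗ v)(a ⊗ b) = (-1)^{|v||a|} a ⊗ vb`. -/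
def GSym.primOp : V →ₗ[k] Module.End k (GSym 𝒱 ⊗[k] GSym 𝒱) :=
  homogLift 𝒱 fun p =>
    (LinearMap.rTensorHom (R := k) (GSym 𝒱) ∘ₗ LinearMap.mul k (GSym 𝒱) ∘ₗ GSym.ι 𝒱) +
    ((TensorProduct.mapBilinear (RingHom.id k) (GSym 𝒱) (GSym 𝒱) (GSym 𝒱) (GSym 𝒱)
      (GSym.paritySign 𝒱 p)) ∘ₗ LinearMap.mul k (GSym 𝒱) ∘ₗ GSym.ι 𝒱)

theorem GSym.primOp_apply {p : ℤ} {v : V} (hv : v ∈ 𝒱 p) (a b : GSym 𝒱) :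
    GSym.primOp 𝒱 v (a ⊗ₜ b) =
      (GSym.ι 𝒱 v * a) ⊗ₜ b + GSym.paritySign 𝒱 p a ⊗ₜ (GSym.ι 𝒱 v * b) := by
  rw [GSym.primOp, homogLift_of_mem 𝒱 _ hv]
  simp

theorem GSym.parity_ι {p : ℤ} {v : V} (hv : v ∈ 𝒱 p) :
    GSym.parity 𝒱 (GSym.ι 𝒱 v) = p.negOnePow • GSym.ι 𝒱 v := by
  rw [GSym.parity, GSym.lift_ι, homogLift_of_mem 𝒱 _ hv]
  rfl

theorem GSym.paritySign_ι_mul {p q : ℤ} {v : V} (hv : v ∈ 𝒱 q) (a : GSym 𝒱) :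
    GSym.paritySign 𝒱 p (GSym.ι 𝒱 v * a) =
      (p * q).negOnePow • (GSym.ι 𝒱 v * GSym.paritySign 𝒱 p a) := by
  unfold GSym.paritySign
  split_ifs with h
  · rw [Int.negOnePow_even _ (h.mul_right q)]
    simp
  · have h' : (p * q).negOnePow = q.negOnePow := by
      rw [Int.negOnePow_eq_iff, ← sub_one_mul]
      exact (Int.not_even_iff_odd.mp h |>.sub_odd odd_one).mul_right q
    simp [GSym.parity_ι 𝒱 hv, h', smul_mul_assoc]

theorem GSym.paritySign_comm (p q : ℤ) (a : GSym 𝒱) :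
    GSym.paritySign 𝒱 p (GSym.paritySign 𝒱 q a) =
      GSym.paritySign 𝒱 q (GSym.paritySign 𝒱 p a) := by
  unfold GSym.paritySign
  split_ifs <;> simp

/-- The coproduct of `S(V)`: the algebra homomorphism into the graded tensor square with
`Δ v = v ⊗ 1 + 1 ⊗ v`, i.e. `Δ (v₁ ⋯ vₙ) = (v₁ ⊗ 1 + 1 ⊗ v₁) ⋯ (vₙ ⊗ 1 + 1 ⊗ vₙ)`
(the signed sum over unshuffles). -/
def GSym.comul : GSym 𝒱 →ₗ[k] GSym 𝒱 ⊗[k] GSym 𝒱 :=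
  (LinearMap.applyₗ (1 ⊗ₜ 1 : GSym 𝒱 ⊗[k] GSym 𝒱)) ∘ₗ
    (GSym.lift 𝒱 (A := Module.End k (GSym 𝒱 ⊗[k] GSym 𝒱)) (GSym.primOp 𝒱)
      (fun p q x y hx hy => by
        refine TensorProduct.ext' fun a b => ?_
        have hxy := GSym.ι_comm 𝒱 hx hy
        simp only [Module.End.mul_apply, GSym.primOp_apply 𝒱 hx, GSym.primOp_apply 𝒱 hy, map_add,
          GSym.paritySign_ι_mul 𝒱 hx, GSym.paritySign_ι_mul 𝒱 hy, ← mul_assoc, hxy,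
          Units.smul_def, LinearMap.smul_apply, smul_add, smul_mul_assoc,
          TensorProduct.smul_tmul', GSym.paritySign_comm 𝒱 p q]
        rw [mul_comm q p, smul_smul, ← Units.val_mul, Int.units_mul_self, Units.val_one, one_smul,
          ← TensorProduct.smul_tmul]
        abel)).toLinearMap

/-- Coderivations of `S(V)` of degree `p`:
`Δ Θ = (Θ ⊗ 1 + 1 ⊗ Θ) Δ`, where `(1 ⊗ Θ)(a ⊗ b) = (-1)^{p|a|} a ⊗ Θ b`. -/
def coder (p : ℤ) : Submodule k (Module.End k (GSym 𝒱)) where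
  carrier := {Θ | (∀ q, ∀ s ∈ GSym.gr 𝒱 q, Θ s ∈ GSym.gr 𝒱 (q + p)) ∧
    GSym.comul 𝒱 ∘ₗ Θ =
      (TensorProduct.map Θ LinearMap.id + TensorProduct.map (GSym.paritySign 𝒱 p) Θ) ∘ₗ
        GSym.comul 𝒱}
  add_mem' {Θ Ω} hΘ hΩ := by
    refine ⟨fun q s hs => Submodule.add_mem _ (hΘ.1 q s hs) (hΩ.1 q s hs), ?_⟩
    rw [LinearMap.comp_add, hΘ.2, hΩ.2, TensorProduct.map_add_left, TensorProduct.map_add_right,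
      ← LinearMap.add_comp]
    congr 1
    abel
  zero_mem' := ⟨fun q s _ => Submodule.zero_mem _, by simp⟩
  smul_mem' c Θ hΘ := by
    refine ⟨fun q s hs => Submodule.smul_mem _ c (hΘ.1 q s hs), ?_⟩
    rw [LinearMap.comp_smul, hΘ.2, TensorProduct.map_smul_left, TensorProduct.map_smul_right,
      ← smul_add, LinearMap.smul_comp]

/-- Coderivations of degree `p` of the cofree conilpotent cocommutative coalgebra
`⨁ (n ≥ 1) Sⁿ(V)`: coderivations of the counital coalgebra `S(V)` that vanish on `1`. -/
def coder₀ (p : ℤ) : Submodule k (Module.End k (GSym 𝒱)) :=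
  coder 𝒱 p ⊓ LinearMap.ker (LinearMap.applyₗ (1 : GSym 𝒱))

end SymCoalgebra

/-! ### `L∞`-algebras, the Chevalley–Eilenberg complex -/

/-- The desuspension `↓L`, `(↓L)_p = L_{p+1}`. -/
def desusp {k L : Type*} [Field k] [AddCommGroup L] [Module k L] (ℒ : ℤ → Submodule k L) :
    ℤ → Submodule k L := fun p => ℒ (p + 1)

instance {k L : Type*} [Field k] [AddCommGroup L] [Module k L] (ℒ : ℤ → Submodule k L)
    [h : DirectSum.Decomposition ℒ] : DirectSum.Decomposition (desusp ℒ) :=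
  DirectSum.IsInternal.chooseDecomposition _ (by
    have h' := (DirectSum.isInternal_submodule_iff_iSupIndep_and_iSup_eq_top ℒ).1 h.isInternal
    refine (DirectSum.isInternal_submodule_iff_iSupIndep_and_iSup_eq_top _).2
      ⟨h'.1.comp (add_left_injective 1), ?_⟩
    rw [← h'.2]
    exact (Equiv.addRight (1 : ℤ)).iSup_comp (g := ℒ))

/-- A vector space regarded as a graded vector space concentrated in degree `0`. -/
def degZero (k L : Type*) [Field k] [AddCommGroup L] [Module k L] (p : ℤ) : Submodule k L :=
  if p = 0 then ⊤ else ⊥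

instance (k L : Type*) [Field k] [AddCommGroup L] [Module k L] :
    DirectSum.Decomposition (degZero k L) :=
  DirectSum.IsInternal.chooseDecomposition _ (by
    refine (DirectSum.isInternal_submodule_iff_iSupIndep_and_iSup_eq_top _).2 ⟨fun p => ?_, ?_⟩
    · by_cases hp : p = 0
      · have : (⨆ j, ⨆ (_ : j ≠ p), degZero k L j) = ⊥ := by
          simp only [iSup_eq_bot]
          intro j hj
          simp [degZero, show j ≠ 0 by rwa [hp] at hj]
        rw [this]
        exact disjoint_bot_right
      · simp [degZero, hp]
    · exact top_le_iff.1 (le_iSup_of_le 0 (by simp [degZero])))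

section CE

variable {k : Type*} [Field k] {L : Type*} [AddCommGroup L] [Module k L]
  (ℒ : ℤ → Submodule k L) [DirectSum.Decomposition ℒ]

/-- An `L∞`-structure on the graded vector space `L`: a degree `+1` coderivation `λ` of the cofree
conilpotent cocommutative coalgebra on `↓L` with `λ² = 0`. -/
def IsLInfinity (lam : Module.End k (GSym (desusp ℒ))) : Prop :=
  lam ∈ coder₀ (desusp ℒ) 1 ∧ lam ∘ₗ lam = 0

variable {ℒ}

/-- The total space of the Chevalley–Eilenberg complex whose degree `p` part is the space `𝒞 p` of
coderivations. -/
abbrev CE (𝒞 : ℤ → Submodule k (Module.End k (GSym (desusp ℒ)))) : Type _ :=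
  (⨆ p, 𝒞 p : Submodule k (Module.End k (GSym (desusp ℒ))))

/-- The value of a nonassociative monomial in the algebra `(X, star)`. -/
def evalMono {X Y : Type*} (star : X → X → X) (g : Y → X) : FreeMagma Y → X
  | FreeMagma.of y => g y
  | FreeMagma.mul a b => star (evalMono star g a) (evalMono star g b)

variable {𝒞 : ℤ → Submodule k (Module.End k (GSym (desusp ℒ)))}

/-- `star` is the pre-Lie product of coderivations: `Θ ⋆ Ω` is the coderivation whose corestriction
is the composition of the corestriction of `Θ` with `Ω`. -/
def IsCoderProduct (star : CE 𝒞 →ₗ[k] CE 𝒞 →ₗ[k] CE 𝒞) : Prop :=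
  (∀ Θ Ω : CE 𝒞, GSym.proj (desusp ℒ) ∘ₗ (star Θ Ω : Module.End k (GSym (desusp ℒ))) =
    GSym.proj (desusp ℒ) ∘ₗ (Θ : Module.End k (GSym (desusp ℒ))) ∘ₗ
      (Ω : Module.End k (GSym (desusp ℒ)))) ∧
  (∀ (p q : ℤ) (Θ Ω : CE 𝒞), (Θ : Module.End k (GSym (desusp ℒ))) ∈ 𝒞 p →
    (Ω : Module.End k (GSym (desusp ℒ))) ∈ 𝒞 q →
    (star Θ Ω : Module.End k (GSym (desusp ℒ))) ∈ 𝒞 (p + q)) ∧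
  (∀ (q r : ℤ) (Θ Ω Ξ : CE 𝒞), (Ω : Module.End k (GSym (desusp ℒ))) ∈ 𝒞 q →
    (Ξ : Module.End k (GSym (desusp ℒ))) ∈ 𝒞 r →
    star (star Θ Ω) Ξ - star Θ (star Ω Ξ) =
      (q * r).negOnePow • (star (star Θ Ξ) Ω - star Θ (star Ξ Ω)))

/-- `D` is the Chevalley–Eilenberg dg structure: the differential is the commutator with `λ`,
`d_CE Θ = (-1)^{|Θ|} Θ λ - λ Θ = -[λ, Θ]`. -/
def IsCEComplex (lam : CE 𝒞) (D : DGStruct k (CE 𝒞)) : Prop :=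
  (∀ p, D.gr p = (𝒞 p).comap (⨆ p, 𝒞 p).subtype) ∧
  ∀ (p : ℤ) (Θ : CE 𝒞), (Θ : Module.End k (GSym (desusp ℒ))) ∈ 𝒞 p →
    (D.d Θ : Module.End k (GSym (desusp ℒ))) =
      p.negOnePow • ((Θ : Module.End k (GSym (desusp ℒ))) ∘ₗ
        (lam : Module.End k (GSym (desusp ℒ)))) -
      (lam : Module.End k (GSym (desusp ℒ))) ∘ₗ (Θ : Module.End k (GSym (desusp ℒ)))

/-- The action of `rpL*` on the Chevalley–Eilenberg complex by evaluation: on homogeneous cochains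
`f₁, …, fₙ`, the class of a monomial `m` acts by its value under `eᵢ ↦ fᵢ`, `∘ ↦ λ`, computed with
the product `star`, with the Koszul sign of moving `∘, …, ∘, f₁, …, fₙ` to their positions in
`m`. -/
def IsEvaluationAction {𝒪 : DGOperad k (RplColl k)} {D : DGStruct k (CE 𝒞)}
    (star : CE 𝒞 →ₗ[k] CE 𝒞 →ₗ[k] CE 𝒞) (lam : CE 𝒞) (A : 𝒪.Algebra D) : Prop :=
  ∀ (n : ℕ) (m : FreeMagma (Option (Fin (n + 1)))) (U : RplColl k n), IsMultilinearMono m →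
    (U : Rpl k (n + 1)) = Rpl.mono k m →
    ∀ (p : Fin (n + 1) → ℤ) (f : Fin (n + 1) → CE 𝒞),
      (∀ i, (f i : Module.End k (GSym (desusp ℒ))) ∈ 𝒞 (p i)) →
      A.act n U f = koszulSign p (leafWord m) •
        evalMono (fun x y => star x y) (fun x => Option.elim x lam f) m

/-- The action of the cohomology operad on cohomology is induced by the action of cocycles on
cocycles. -/
def IsInducedAction {P : ℕ → Type*} [∀ n, AddCommGroup (P n)] [∀ n, Module k (P n)]
    {𝒪 : DGOperad k P} {ℋ : DGOperad k (fun n => (𝒪.dg n).H)} {X : Type*} [AddCommGroup X]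
    [Module k X] {D : DGStruct k X} {E : DGStruct k D.H} (A : 𝒪.Algebra D) (B : ℋ.Algebra E) :
    Prop :=
  ∀ (n : ℕ) (U : LinearMap.ker (𝒪.dg n).d) (f : Fin (n + 1) → LinearMap.ker D.d)
    (y : LinearMap.ker D.d), (y : X) = A.act n (U : P n) (fun i => (f i : X)) →
    B.act n ((𝒪.dg n).cls U) (fun i => D.cls (f i)) = D.cls y

end CE

section Conclusion

variable {k : Type*} [Field k]

/-- `rpL*` acts by evaluation on the Chevalley–Eilenberg complex `CE 𝒞` of the `L∞`-algebra
`(L, λ)`, making it a dg `𝒪`-algebra, and the cohomology operad `ℋ` acts on its cohomology in the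
induced way. -/
def RplActs (𝒪 : DGOperad k (RplColl k)) (ℋ : DGOperad k (fun n => (𝒪.dg n).H))
    {L : Type*} [AddCommGroup L] [Module k L] {ℒ : ℤ → Submodule k L} [DirectSum.Decomposition ℒ]
    {𝒞 : ℤ → Submodule k (Module.End k (GSym (desusp ℒ)))} (lam : CE 𝒞) : Prop :=
  ∃ star : CE 𝒞 →ₗ[k] CE 𝒞 →ₗ[k] CE 𝒞, IsCoderProduct star ∧
    ∃ D : DGStruct k (CE 𝒞), IsCEComplex lam D ∧
      ∃ A : 𝒪.Algebra D, IsEvaluationAction star lam A ∧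
        ∃ E : DGStruct k D.H, D.IsCohomology E ∧ ∃ B : ℋ.Algebra E, IsInducedAction A B

variable {L : Type*} [LieRing L] [LieAlgebra k L]

/-- `λ` is the coextension of the desuspended Lie bracket `↓ [-,-] (↑ ∧ ↑)`: its corestriction is
`↓x ↓y ↦ -↓[x,y]` on `S²(↓L)` (the sign comes from moving `↑` past `↓x`) and zero on the other
`Sⁿ(↓L)`. -/
def IsDesuspBracket (lam : Module.End k (GSym (desusp (degZero k L)))) : Prop :=
  (∀ x y : L, GSym.proj _ (lam (GSym.ι _ x * GSym.ι _ y)) = -⁅x, y⁆) ∧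
  ∀ l : List L, l.length ≠ 2 → GSym.proj _ (lam (l.map (GSym.ι _)).prod) = 0

/-- The classical Chevalley–Eilenberg differential with adjoint coefficients,
`∑ᵢ (-1)ⁱ [xᵢ, c(…, x̂ᵢ, …)] + ∑_{i<j} (-1)^{i+j} c([xᵢ,xⱼ], …, x̂ᵢ, …, x̂ⱼ, …)` (indices from `0`),
where `[xᵢ,xⱼ]` is written in the place of `xᵢ`, which absorbs the sign `(-1)ⁱ` for alternating
`c`. -/
def lieCEDiff {n : ℕ} (c : (Fin n → L) → L) (x : Fin (n + 1) → L) : L :=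
  ∑ i : Fin (n + 1), (-1 : ℤ) ^ (i : ℕ) • ⁅x i, c (fun l => x (i.succAbove l))⁆ +
    ∑ j : Fin (n + 1), ∑ i with i < j, (-1 : ℤ) ^ (j : ℕ) •
      c (fun l => Function.update x i ⁅x i, x j⁆ (j.succAbove l))

/-- The `n`-cochain `↓x₁ ⋯ ↓xₙ ↦ ↑ Θ̄(↓x₁ ⋯ ↓xₙ)` of a coderivation `Θ`. -/
def coderCochain (n : ℕ) (Θ : Module.End k (GSym (desusp (degZero k L)))) (x : Fin n → L) : L :=
  GSym.proj _ (Θ (List.ofFn fun i => GSym.ι _ (x i)).prod)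

/-- The identification of coderivations with the classical Chevalley–Eilenberg complex of `L` with
coefficients in itself: coderivations of degree `n - 1` are the same as alternating `n`-cochains,
and the commutator with `λ` corresponds to the classical differential, up to the sign
`(-1)^{n - 1}` in arity `n`. -/
def IsClassicalCE (lam : Module.End k (GSym (desusp (degZero k L)))) : Prop :=
  (∀ p < (-1 : ℤ), coder (desusp (degZero k L)) p = ⊥) ∧
  (∀ n : ℕ, ∃ e : coder (desusp (degZero k L)) ((n : ℤ) - 1) ≃ₗ[k] (L [⋀^Fin n]→ₗ[k] L),
    ∀ Θ x, e Θ x = coderCochain n (Θ : Module.End k (GSym (desusp (degZero k L)))) x) ∧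
  ∀ (n : ℕ), ∀ Θ ∈ coder (desusp (degZero k L)) ((n : ℤ) - 1), ∀ x : Fin (n + 1) → L,
    coderCochain (n + 1) (((n : ℤ) - 1).negOnePow • (Θ ∘ₗ lam) - lam ∘ₗ Θ) x =
      ((n : ℤ) - 1).negOnePow • lieCEDiff (coderCochain n Θ) x

end Conclusion

end

/-! Everything rests on one construction. Let `X` be a graded pre-Lie algebra with an odd element
`λ` such that `λ ⋆ λ = 0`, and let `f₁, …, fₙ` be homogeneous. Evaluating monomials under `eᵢ ↦ fᵢ`,
`∘ ↦ λ` with the Koszul sign is not an algebra map. However, once monomials with a repeated `eᵢ` are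
sent to zero, it respects the pre-Lie relation: exchanging two subwords costs the product of their
degrees in `X`, except that the circles are not counted against each other, and that discrepancy is
exactly the sign in the relation of `rpL*`. So the evaluation descends to `rpL*(𝐤ⁿ)`
(`rplIdeal_le_ker`). Only parities matter, so the grading is recorded by an involution `P`
(`SuperPreLie`). Splitting arguments into even and odd parts turns the evaluation into a multilinear
action of `rpL*(n)` on all of `X` (`SuperPreLie.act`, `act_mono`).

`rpL*(𝐤ᴺ)` is itself such an `X`, with `λ = ∘`, and `a ∘ᵢ b` is the action of `a` on the generators
with `b` put into slot `i`. The operad axioms thus become instances of laws of the action: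
substitution (`act_comp_mono`), equivariance (`act_perm`) and naturality (`map_act`). Their signs
are the combinatorial identities `koszulSign_subst` and `koszulSign_perm`, proved as identities
modulo two between sums over pairs of letters.

In any such `X` the map `δ x = (-1)^{|x|} x ⋆ λ - λ ⋆ x` squares to zero and satisfies the Leibniz
rule up to `Φ(λ, x, y)` (`delta_delta`, `delta_star`); both are the pre-Lie identity with an
argument `λ`. In `rpL*(𝐤ⁿ)` it does not kill `eᵢ`, so it is corrected by the odd derivation `D` with
`eᵢ ↦ ∘ ⋆ eᵢ - eᵢ ⋆ ∘`, `∘ ↦ 0`. Then `d = δ + D` works, because `D² = 0` and `Dδ = -δD`. On a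
multilinear monomial `a`, `D a` is up to sign the sum of all `a ∘ᵢ (∘ ⋆ e₁ - e₁ ⋆ ∘)`, and `∘ ⋆ e₁ -
e₁ ⋆ ∘` acts as `-δ`. This gives the formula for the action of `d` (`act_rplDiff_mono`). The same
formula inside `rpL*(𝐤ᴺ)`, combined with the one for `D`, gives the Leibniz rule for compositions
(`rplComp_d`).

It remains to see that coderivations of `S(↓L)` form such an algebra. Every homogeneous `S(V) → V`
extends to a coderivation `coext`, and in characteristic zero a coderivation is determined by its
corestriction (`coder_eq_zero`), so `Θ ⋆ Ω = coext (proj ∘ Θ ∘ Ω)`. Graded commutators of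
coderivations are coderivations, hence the `⋆`-commutator is the commutator of compositions
(`star_sub_star`). This yields both the pre-Lie identity (`associator_star`) and `δ = d_CE`, while
`λ² = 0` gives `λ ⋆ λ = 0`. Arity `0` plays no role beyond closure of the family under `⋆`
(`IsCoderFamily`).

The passage to cohomology is formal and is carried out for an arbitrary dg operad and dg algebra.
For a Lie algebra, `↓L` sits in degree `-1` and `S(↓L)` is an exterior algebra; the recursion
`lieLam_ι_mul` then gives `λ² = 0` from the Jacobi identity, and the comparison with the classical
differential. -/

set_option linter.unusedSectionVars false

/-! ### Sums over pairs of letters of a word. -/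

section Words

variable {α β R : Type*} [AddCommMonoid R]

/-- The sum of `b x y` over the letters `x` of `u` and `y` of `v`. -/
def crossSum (b : α → α → R) (u v : List α) : R :=
  (u.map fun x => (v.map fun y => b x y).sum).sum

/-- The sum of `b x y` over all pairs of letters of a word, `x` to the left of `y`. -/
def pairSum (b : α → α → R) : List α → R
  | [] => 0
  | x :: w => (w.map fun y => b x y).sum + pairSum b w

theorem crossSum_append_left (b : α → α → R) (u v w : List α) :
    crossSum b (u ++ v) w = crossSum b u w + crossSum b v w := by
  simp [crossSum]

theorem crossSum_append_right (b : α → α → R) (u v w : List α) :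
    crossSum b u (v ++ w) = crossSum b u v + crossSum b u w := by
  simp [crossSum, List.sum_map_add]

theorem crossSum_singleton_left (b : α → α → R) (x : α) (w : List α) :
    crossSum b [x] w = (w.map fun y => b x y).sum := by
  simp [crossSum]

theorem crossSum_singleton_right (b : α → α → R) (x : α) (w : List α) :
    crossSum b w [x] = (w.map fun y => b y x).sum := by
  simp [crossSum]

theorem pairSum_append (b : α → α → R) (u v : List α) :
    pairSum b (u ++ v) = pairSum b u + pairSum b v + crossSum b u v := by
  induction u with
  | nil => simp [pairSum, crossSum]
  | cons x u ih =>
    simp only [List.cons_append, pairSum, ih, List.map_append, List.sum_append]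
    rw [show x :: u = [x] ++ u from rfl, crossSum_append_left, crossSum_singleton_left]
    abel

theorem pairSum_singleton (b : α → α → R) (x : α) : pairSum b [x] = 0 := by
  simp [pairSum]

theorem pairSum_map (b : β → β → R) (g : α → β) (w : List α) :
    pairSum b (w.map g) = pairSum (fun x y => b (g x) (g y)) w := by
  induction w with
  | nil => rfl
  | cons x w ih => simp [pairSum, ih, Function.comp_def]

theorem crossSum_map (b : β → β → R) {γ : Type*} (g : α → β) (h : γ → β) (u : List α)
    (v : List γ) :
    crossSum b (u.map g) (v.map h) =
      (u.map fun x => (v.map fun y => b (g x) (h y)).sum).sum := by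
  simp [crossSum, Function.comp_def]

theorem pairSum_congr {b b' : α → α → R} {w : List α}
    (h : ∀ x ∈ w, ∀ y ∈ w, b x y = b' x y) : pairSum b w = pairSum b' w := by
  induction w with
  | nil => rfl
  | cons x w ih =>
    simp only [pairSum]
    rw [ih fun y hy z hz => h y (by simp [hy]) z (by simp [hz])]
    congr 2
    exact List.map_congr_left fun y hy => h x (by simp) y (by simp [hy])

theorem crossSum_congr {b b' : α → α → R} {u v : List α}
    (h : ∀ x ∈ u, ∀ y ∈ v, b x y = b' x y) : crossSum b u v = crossSum b' u v := by
  unfold crossSum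
  congr 1
  refine List.map_congr_left fun x hx => ?_
  congr 1
  exact List.map_congr_left fun y hy => h x hx y hy

theorem pairSum_add (b b' : α → α → R) (w : List α) :
    pairSum (fun x y => b x y + b' x y) w = pairSum b w + pairSum b' w := by
  induction w with
  | nil => simp [pairSum]
  | cons x w ih =>
    simp only [pairSum, ih, List.sum_map_add]
    abel

/-- A symmetric pairing does not see which of two letters stands first. The Koszul pairing is not
symmetric, but the sum of two of them in `koszulSign_perm` is. -/
theorem pairSum_perm {b : α → α → R} (hb : ∀ x y, b x y = b y x) {w w' : List α}
    (h : w.Perm w') : pairSum b w = pairSum b w' := by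
  induction h with
  | nil => rfl
  | cons x h ih =>
    simp only [pairSum, ih]
    rw [(h.map fun y => b x y).sum_eq]
  | swap x y l =>
    simp only [pairSum, List.map_cons, List.sum_cons, hb y x]
    abel
  | trans _ _ h1 h2 => exact h1.trans h2

theorem crossSum_comm (b : α → α → R) (u v : List α) :
    crossSum b u v = crossSum (fun x y => b y x) v u := by
  induction u with
  | nil => simp [crossSum]
  | cons x u ih =>
    rw [show x :: u = [x] ++ u from rfl, crossSum_append_left, crossSum_append_right,
      crossSum_singleton_left, crossSum_singleton_right, ih]

theorem crossSum_add (b b' : α → α → R) (u v : List α) :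
    crossSum (fun x y => b x y + b' x y) u v = crossSum b u v + crossSum b' u v := by
  simp [crossSum, List.sum_map_add]

end Words

/-! ### Koszul signs as pair sums modulo two. -/

section KoszulWords

variable {n : ℕ}

/-- The contribution of a letter `x` to the left of `y` to the exponent of the Koszul sign. -/
def koszulPair (deg : Fin n → ℤ) (x y : Option (Fin n)) : ZMod 2 :=
  if letterBefore y x then letterDeg deg x * letterDeg deg y else 0

theorem negOnePow_congr {a b : ℤ} (h : (a : ZMod 2) = b) : a.negOnePow = b.negOnePow := by
  rw [Int.negOnePow_eq_iff, even_iff_two_dvd]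
  exact_mod_cast (ZMod.intCast_zmod_eq_zero_iff_dvd (a - b) 2).1 (by simp [h])

theorem cast_eq_of_negOnePow_eq {a b : ℤ} (h : a.negOnePow = b.negOnePow) :
    (a : ZMod 2) = b := by
  rw [Int.negOnePow_eq_iff, even_iff_two_dvd] at h
  have := (ZMod.intCast_zmod_eq_zero_iff_dvd (a - b) 2).2 (by exact_mod_cast h)
  rw [Int.cast_sub, sub_eq_zero] at this
  exact this

/-- Only the parity of the exponent matters for the sign. Over `ZMod 2` sign identities become
identities in a commutative ring, accessible to `ring` and `linear_combination`. -/
theorem koszulExp_cast (deg : Fin n → ℤ) (w : List (Option (Fin n))) :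
    (koszulExp deg w : ZMod 2) = pairSum (koszulPair deg) w := by
  induction w with
  | nil => simp [koszulExp, pairSum]
  | cons x w ih =>
    simp only [koszulExp, pairSum, Int.cast_add, ih]
    congr 1
    change Int.castAddHom (ZMod 2) _ = _
    rw [map_list_sum, List.map_map]
    congr 1
    refine List.map_congr_left fun y _ => ?_
    simp only [Function.comp, koszulPair]
    split_ifs <;> simp

/-- The sign `(-1)^a` of a class modulo two. -/
def zsign (a : ZMod 2) : ℤˣ := (a.val : ℤ).negOnePow

theorem zsign_cast (a : ℤ) : zsign (a : ZMod 2) = a.negOnePow :=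
  negOnePow_congr (by simp)

theorem zsign_add (a b : ZMod 2) : zsign (a + b) = zsign a * zsign b := by
  obtain ⟨a, rfl⟩ := ZMod.intCast_surjective a
  obtain ⟨b, rfl⟩ := ZMod.intCast_surjective b
  rw [← Int.cast_add, zsign_cast, zsign_cast, zsign_cast, Int.negOnePow_add]

theorem zsign_zero : zsign 0 = 1 := by simp [zsign]

theorem koszulSign_eq (deg : Fin n → ℤ) (w : List (Option (Fin n))) :
    koszulSign deg w = zsign (pairSum (koszulPair deg) w) := by
  rw [← koszulExp_cast, zsign_cast, koszulSign]

theorem koszulPair_congr {p q : Fin n → ℤ} {x y : Option (Fin n)}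
    (hx : (letterDeg p x : ZMod 2) = letterDeg q x)
    (hy : (letterDeg p y : ZMod 2) = letterDeg q y) : koszulPair p x y = koszulPair q x y := by
  simp [koszulPair, hx, hy]

/-- Degrees enter the exponent only through products, hence only through their parities. This lets
integer degrees be replaced by the degrees `0` and `1` of even and odd parts. -/
theorem koszulSign_congr {p q : Fin n → ℤ} (h : ∀ i, (p i).negOnePow = (q i).negOnePow)
    (w : List (Option (Fin n))) : koszulSign p w = koszulSign q w := by
  rw [koszulSign_eq, koszulSign_eq]
  have key : ∀ x : Option (Fin n), (letterDeg p x : ZMod 2) = letterDeg q x := by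
    rintro (_ | i)
    · rfl
    · exact cast_eq_of_negOnePow_eq (h i)
  rw [pairSum_congr fun x _ y _ => koszulPair_congr (key x) (key y)]

/-- The number of occurrences of the letters. -/
def IsMultilinearWord (w : List (Option (Fin n))) : Prop := ∀ i, w.count (some i) = 1

theorem sum_map_eq_sum_count {R : Type*} [CommSemiring R] (w : List (Option (Fin n)))
    (g : Option (Fin n) → R) :
    (w.map g).sum = w.count none * g none + ∑ i, w.count (some i) * g (some i) := by
  induction w with
  | nil => simp
  | cons x w ih =>
    rw [List.map_cons, List.sum_cons, ih]
    rcases x with _ | j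
    · simp
      ring
    · simp [List.count_cons, add_mul, Finset.sum_add_distrib]
      ring

theorem sum_map_eq_of_multilinear {R : Type*} [CommSemiring R] {w : List (Option (Fin n))}
    (hw : IsMultilinearWord w) (g : Option (Fin n) → R) :
    (w.map g).sum = w.count none * g none + ∑ i, g (some i) := by
  rw [sum_map_eq_sum_count]
  simp only [hw _, Nat.cast_one, one_mul]

end KoszulWords

section Words

theorem crossSum_mul {α R : Type*} [CommSemiring R] (g h : α → R) (u v : List α) :
    crossSum (fun x y => g x * h y) u v = (u.map g).sum * (v.map h).sum := by
  simp [crossSum, List.sum_map_mul_left, List.sum_map_mul_right]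

theorem pairSum_eq_zero_of_pairwise {α R : Type*} [AddCommMonoid R] {b : α → α → R} {w : List α}
    (h : w.Pairwise fun x y => b x y = 0) : pairSum b w = 0 := by
  induction h with
  | nil => rfl
  | cons hx _ ih =>
    rw [pairSum, ih, add_zero]
    refine List.sum_eq_zero fun z hz => ?_
    obtain ⟨y, hy, rfl⟩ := List.mem_map.1 hz
    exact hx y hy

theorem sum_map_ite_none {n : ℕ} {R : Type*} [CommSemiring R] (w : List (Option (Fin n))) :
    (w.map fun x => if x = none then (1 : R) else 0).sum = w.count none := by
  rw [sum_map_eq_sum_count]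
  simp

end Words

section KoszulWords

variable {n : ℕ}

theorem exists_split_of_multilinear {w : List (Option (Fin n))} (hw : IsMultilinearWord w)
    (i : Fin n) : ∃ u v, w = u ++ some i :: v ∧ some i ∉ u ∧ some i ∉ v := by
  have hi : some i ∈ w := by
    rw [← List.count_pos_iff, hw i]
    exact one_pos
  obtain ⟨u, v, rfl⟩ := List.append_of_mem hi
  have h := hw i
  rw [List.count_append, List.count_cons_self] at h
  exact ⟨u, v, rfl, List.count_eq_zero.1 (by omega), List.count_eq_zero.1 (by omega)⟩

theorem two_eq_zero_zmod : (2 : ZMod 2) = 0 := rfl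

theorem add_self_zmod (x : ZMod 2) : x + x = 0 := by
  rw [← two_mul, two_eq_zero_zmod, zero_mul]

/-- The degree of a letter that precedes `some i` in the standard order, and zero otherwise. -/
def degBefore (p : Fin n → ℤ) (i : Fin n) (x : Option (Fin n)) : ZMod 2 :=
  if letterBefore x (some i) then (letterDeg p x : ZMod 2) else 0

/-- The degree of a letter that follows `some i` in the standard order, and zero otherwise. -/
def degAfter (p : Fin n → ℤ) (i : Fin n) (x : Option (Fin n)) : ZMod 2 :=
  if letterBefore (some i) x then (letterDeg p x : ZMod 2) else 0

theorem degBefore_add_degAfter (p : Fin n → ℤ) (i : Fin n) {x : Option (Fin n)}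
    (hx : x ≠ some i) : degBefore p i x + degAfter p i x = letterDeg p x := by
  rcases x with _ | j
  · simp [degBefore, degAfter, letterBefore]
  · have : j ≠ i := fun h => hx (by rw [h])
    rcases lt_or_gt_of_ne this with h | h <;> simp [degBefore, degAfter, letterBefore, h, h.le]

theorem sum_degBefore (p : Fin n → ℤ) (i : Fin n) {w : List (Option (Fin n))}
    (hw : IsMultilinearWord w) :
    (w.map (degBefore p i)).sum = w.count none + ∑ j with j < i, (p j : ZMod 2) := by
  rw [sum_map_eq_of_multilinear hw, Finset.sum_filter]
  simp [degBefore, letterBefore, letterDeg]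

theorem koszulPair_some_left (p : Fin n → ℤ) (i : Fin n) (x : Option (Fin n)) :
    koszulPair p (some i) x = p i * degBefore p i x := by
  simp only [koszulPair, degBefore, letterDeg]
  split_ifs <;> simp

theorem koszulPair_some_right (p : Fin n → ℤ) (i : Fin n) (x : Option (Fin n)) :
    koszulPair p x (some i) = p i * degAfter p i x := by
  simp only [koszulPair, degAfter, letterDeg]
  split_ifs <;> simp [mul_comm]

/-- Isolates what the single letter `some i` contributes: letters on its left count if they should
come after it, letters on its right if they should come before it. -/
theorem pairSum_split (p : Fin n → ℤ) (i : Fin n) (u v : List (Option (Fin n))) :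
    pairSum (koszulPair p) (u ++ some i :: v) =
      pairSum (koszulPair p) u + pairSum (koszulPair p) v + crossSum (koszulPair p) u v +
        p i * (u.map (degAfter p i)).sum + p i * (v.map (degBefore p i)).sum := by
  rw [show some i :: v = [some i] ++ v from rfl, pairSum_append, pairSum_append,
    crossSum_append_right, pairSum_singleton, crossSum_singleton_left, crossSum_singleton_right]
  simp only [koszulPair_some_left, koszulPair_some_right, List.sum_map_mul_left]
  ring

theorem sum_degAfter_add (p : Fin n → ℤ) (i : Fin n) {u : List (Option (Fin n))}
    (hu : some i ∉ u) :
    (u.map (degBefore p i)).sum + (u.map (degAfter p i)).sum =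
      (u.map fun x => (letterDeg p x : ZMod 2)).sum := by
  rw [← List.sum_map_add]
  congr 1
  refine List.map_congr_left fun x hx => degBefore_add_degAfter p i ?_
  rintro rfl
  exact hu hx

/-- For two different letters exactly one of the two orders is out of order and contributes the
product of the degrees. The only exception is a pair of circles, which contributes in neither order
although the product of the degrees is one; these pairs make up the right-hand side. -/
theorem crossSum_koszul_comm (p : Fin n → ℤ) {u v : List (Option (Fin n))}
    (h : ∀ i, some i ∈ u → some i ∉ v) :
    crossSum (koszulPair p) u v + crossSum (koszulPair p) v u +
      (u.map fun x => (letterDeg p x : ZMod 2)).sum *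
        (v.map fun x => (letterDeg p x : ZMod 2)).sum =
      u.count none * v.count none := by
  rw [crossSum_comm _ v u, ← crossSum_mul, ← crossSum_add, ← crossSum_add,
    ← sum_map_ite_none, ← sum_map_ite_none, ← crossSum_mul]
  refine crossSum_congr fun x hx y hy => ?_
  rcases x with _ | i
  · rcases y with _ | j
    · simp [koszulPair, letterBefore, letterDeg]
    · simp [koszulPair, letterBefore, letterDeg, add_self_zmod]
  · rcases y with _ | j
    · simp [koszulPair, letterBefore, letterDeg, add_self_zmod]
    · have hij : i ≠ j := by
        rintro rfl
        exact h i hx hy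
      rcases lt_or_gt_of_ne hij with h | h <;>
        simp [koszulPair, letterBefore, letterDeg, h, h.not_gt, mul_comm, add_self_zmod]

/-- The effect on the Koszul sign of raising the degree of one letter. -/
theorem koszulSign_succ (p : Fin n → ℤ) (i : Fin n) {u v : List (Option (Fin n))}
    (hw : IsMultilinearWord (u ++ some i :: v)) (hu : some i ∉ u) (hv : some i ∉ v) :
    koszulSign p (u ++ some i :: v) * zsign (u.map fun x => (letterDeg p x : ZMod 2)).sum =
      ((((u ++ some i :: v).count none : ℕ) : ℤ) + ∑ j with j < i, p j).negOnePow *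
        koszulSign (Function.update p i (p i + 1)) (u ++ some i :: v) := by
  set p' := Function.update p i (p i + 1) with hp'
  have hne : ∀ x, x ≠ some i → letterDeg p' x = letterDeg p x := by
    rintro (_ | j) hj
    · rfl
    · have : j ≠ i := fun h => hj (by rw [h])
      simp [letterDeg, hp', this]
  have hpair : ∀ s t : List (Option (Fin n)), some i ∉ s → some i ∉ t →
      ∀ x ∈ s, ∀ y ∈ t, koszulPair p' x y = koszulPair p x y := by
    intro s t hs ht x hx y hy
    refine koszulPair_congr ?_ ?_ <;> rw [hne]
    · rintro rfl; exact hs hx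
    · rintro rfl; exact ht hy
  have hB : ∀ s : List (Option (Fin n)), some i ∉ s →
      s.map (degBefore p' i) = s.map (degBefore p i) := by
    intro s hs
    refine List.map_congr_left fun x hx => ?_
    simp only [degBefore]
    rw [hne]
    rintro rfl; exact hs hx
  have hA : ∀ s : List (Option (Fin n)), some i ∉ s →
      s.map (degAfter p' i) = s.map (degAfter p i) := by
    intro s hs
    refine List.map_congr_left fun x hx => ?_
    simp only [degAfter]
    rw [hne]
    rintro rfl; exact hs hx
  -- The letters that precede `some i` in the standard order are all circles and the `some j` with
  -- `j < i`. Splitting their total degree according to whether they lie in `u` or in `v` links the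
  -- two sides.
  have htot := sum_degBefore p i hw
  rw [List.map_append, List.map_cons, List.sum_append, List.sum_cons] at htot
  have hi0 : degBefore p i (some i) = 0 := by simp [degBefore, letterBefore]
  rw [← zsign_cast, koszulSign_eq, koszulSign_eq, ← zsign_add, ← zsign_add]
  congr 1
  push_cast
  rw [← htot, hi0, pairSum_split, pairSum_split, hB v hv, hA u hu,
    pairSum_congr (hpair u u hu hu), pairSum_congr (hpair v v hv hv),
    crossSum_congr (hpair u v hu hv), ← sum_degAfter_add p i hu]
  simp only [hp', Function.update_self, Int.cast_add, Int.cast_one]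
  linear_combination (-(v.map (degBefore p i)).sum) * two_eq_zero_zmod

theorem koszulSign_zero (w : List (Option (Fin n))) :
    koszulSign (0 : Fin n → ℤ) w = 1 := by
  rw [koszulSign_eq, pairSum_eq_zero_of_pairwise, zsign_zero]
  rw [List.pairwise_iff_getElem]
  intro i j _ _ _
  generalize w[i] = x
  generalize w[j] = y
  rcases x with _ | a <;> rcases y with _ | b <;> simp [koszulPair, letterBefore, letterDeg]

/-- The Koszul sign of a relabelled word. -/
theorem koszulSign_perm (p : Fin n → ℤ) (σ : Equiv.Perm (Fin n)) {w : List (Option (Fin n))}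
    (hw : IsMultilinearWord w) :
    koszulSign p (w.map (Option.map σ)) =
      koszulSign p (List.ofFn fun i => some (σ i)) * koszulSign (fun i => p (σ i)) w := by
  -- The discrepancy between the pairings before and after relabelling is symmetric and vanishes on
  -- circles. So its pair sum may be computed on the sorted word, with the circles dropped.
  set h : Option (Fin n) → Option (Fin n) → ZMod 2 := fun x y =>
    koszulPair p (Option.map σ x) (Option.map σ y) + koszulPair (fun i => p (σ i)) x y with hh
  have hsymm : ∀ x y, h x y = h y x := by
    rintro (_ | a) (_ | b)
    · rfl
    · simp [hh, koszulPair, letterBefore, letterDeg, add_self_zmod]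
    · simp [hh, koszulPair, letterBefore, letterDeg, add_self_zmod]
    · simp only [hh, koszulPair, letterBefore, letterDeg, Option.map, decide_eq_true_eq]
      rcases lt_trichotomy a b with hab | rfl | hab
      · rcases lt_or_gt_of_ne (σ.injective.ne hab.ne) with h' | h' <;>
          simp [hab, hab.not_gt, h', h'.not_gt, mul_comm, add_self_zmod]
      · rfl
      · rcases lt_or_gt_of_ne (σ.injective.ne hab.ne) with h' | h' <;>
          simp [hab, hab.not_gt, h', h'.not_gt, mul_comm, add_self_zmod]
  have hnone : ∀ y, h none y = 0 := by
    rintro (_ | b) <;> simp [hh, koszulPair, letterBefore]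
  have hperm : w.Perm (List.replicate (w.count none) none ++ List.ofFn fun i : Fin n => some i) := by
    rw [List.perm_iff_count]
    rintro (_ | i)
    · rw [List.count_append, List.count_replicate_self,
        (List.count_eq_zero (l := List.ofFn fun i : Fin n => some i)).2 (by simp), add_zero]
    · rw [hw i, List.count_append,
        (List.count_eq_zero (l := List.replicate _ none)).2 (by simp [List.mem_replicate]), zero_add,
        List.count_eq_one_of_mem]
      · exact List.nodup_ofFn.2 (Option.some_injective _)
      · simp
  have hrep : ∀ (c : ℕ) (l : List (Option (Fin n))),
      pairSum h (List.replicate c none ++ l) = pairSum h l := by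
    intro c l
    induction c with
    | zero => rfl
    | succ c ih =>
      rw [List.replicate_succ, List.cons_append, pairSum, ih]
      simp [hnone]
  have hpw := pairSum_perm hsymm hperm
  rw [hrep, hh, pairSum_add, pairSum_add, ← pairSum_map (koszulPair p) (Option.map σ),
    ← pairSum_map (koszulPair p) (Option.map σ), List.map_ofFn] at hpw
  have hz : pairSum (koszulPair fun i => p (σ i)) (List.ofFn fun i : Fin n => some i) = 0 := by
    refine pairSum_eq_zero_of_pairwise (List.pairwise_ofFn.2 fun i j hij => ?_)
    simp [koszulPair, letterBefore, hij.not_gt]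
  rw [hz, add_zero] at hpw
  rw [koszulSign_eq, koszulSign_eq, koszulSign_eq, ← zsign_add]
  congr 1
  rw [show (List.ofFn fun i => some (σ i)) = List.ofFn (Option.map σ ∘ fun i => some i) from rfl,
    ← hpw, add_assoc, add_self_zmod, add_zero]

end KoszulWords

/-! ### The Koszul sign of a substituted word. -/

section KoszulSubst

variable {m n : ℕ}

theorem outerLabel_lt_outerLabel (i : Fin (m + 1)) {a b : Fin (m + 1)} :
    outerLabel n i a < outerLabel n i b ↔ a < b := by
  simp only [outerLabel]
  split_ifs with h1 h2 h2 <;> simp only [Fin.lt_def, Fin.le_def] at * <;> omega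

theorem outerLabel_injective (i : Fin (m + 1)) : Function.Injective (outerLabel n i) := by
  intro a b h
  rcases lt_trichotomy a b with h' | h' | h'
  · exact absurd h ((outerLabel_lt_outerLabel i).2 h').ne
  · exact h'
  · exact absurd h ((outerLabel_lt_outerLabel i).2 h').ne'

theorem innerLabel_injective (i : Fin (m + 1)) :
    Function.Injective (innerLabel i : Fin (n + 1) → _) := by
  intro a b h
  simp only [innerLabel, Fin.mk.injEq] at h
  exact Fin.ext (by omega)

theorem innerLabel_lt_innerLabel (i : Fin (m + 1)) {a b : Fin (n + 1)} :
    innerLabel i a < innerLabel i b ↔ a < b := by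
  simp only [innerLabel, Fin.lt_def]
  omega

theorem innerLabel_lt_outerLabel {i j : Fin (m + 1)} (h : j ≠ i) (l : Fin (n + 1)) :
    innerLabel i l < outerLabel n i j ↔ i < j := by
  have h' : (j : ℕ) ≠ i := fun h' => h (Fin.ext h')
  simp only [outerLabel, innerLabel]
  split_ifs with h1 <;> simp only [Fin.lt_def, Fin.le_def] at * <;> omega

theorem outerLabel_lt_innerLabel {i j : Fin (m + 1)} (h : j ≠ i) (l : Fin (n + 1)) :
    outerLabel n i j < innerLabel i l ↔ j < i := by
  have h' : (j : ℕ) ≠ i := fun h' => h (Fin.ext h')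
  simp only [outerLabel, innerLabel]
  split_ifs with h1 <;> simp only [Fin.lt_def, Fin.le_def] at * <;> omega

theorem innerLabel_ne_outerLabel {i j : Fin (m + 1)} (h : j ≠ i) (l : Fin (n + 1)) :
    innerLabel i l ≠ outerLabel n i j := by
  intro h'
  rcases lt_or_gt_of_ne h with h1 | h1
  · exact absurd h' ((outerLabel_lt_innerLabel h l).2 h1).ne'
  · exact absurd h' ((innerLabel_lt_outerLabel h l).2 h1).ne

theorem sum_lt_outerLabel {M : Type*} [AddCommMonoid M] (i : Fin (m + 1))
    (p : Fin (m + n + 1) → M) :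
    ∑ j with j.val < i.val, p j = ∑ j with j < i, p (outerLabel n i j) := by
  symm
  refine Finset.sum_bij (fun j _ => outerLabel n i j) ?_ ?_ ?_ ?_
  · intro j hj
    have hj' := (Finset.mem_filter.1 hj).2
    rw [Finset.mem_filter, outerLabel, if_pos hj'.le]
    exact ⟨Finset.mem_univ _, hj'⟩
  · intro a _ b _ h
    exact outerLabel_injective i h
  · intro b hb
    simp only [Finset.mem_filter, Finset.mem_univ, true_and] at hb
    refine ⟨⟨b, by omega⟩, ?_, ?_⟩
    · exact Finset.mem_filter.2 ⟨Finset.mem_univ _, hb⟩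
    · exact if_pos (show (⟨b, _⟩ : Fin (m + 1)) ≤ i from hb.le)
  · intro _ _
    rfl

/-- The word substituted for a letter in the composition `a ∘ᵢ b`. -/
def substLetter (i : Fin (m + 1)) (wb : List (Option (Fin (n + 1)))) :
    Option (Fin (m + 1)) → List (Option (Fin (m + n + 1)))
  | none => [none]
  | some j => if j = i then wb.map (Option.map (innerLabel i)) else [some (outerLabel n i j)]

theorem flatMap_substLetter {i : Fin (m + 1)} (wb : List (Option (Fin (n + 1))))
    {u : List (Option (Fin (m + 1)))} (hu : some i ∉ u) :
    u.flatMap (substLetter i wb) = u.map (Option.map (outerLabel n i)) := by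
  induction u with
  | nil => rfl
  | cons x u ih =>
    rw [List.mem_cons, not_or] at hu
    rw [List.flatMap_cons, ih hu.2, List.map_cons]
    rcases x with _ | j
    · rfl
    · have : j ≠ i := fun h => hu.1 (by rw [h])
      simp [substLetter, this]

/-- The word `wa` is cut at `some i` and all pairs are sorted by type. Pairs inside the inserted
block give the sign of `wb`, and pairs outside it agree with those of `wa`. Pairs with one letter in
the block nearly agree with those of a single letter of total degree `q + ∑ p`. The defect comes
from the `q` circles of the block, which the standard order moves to the front instead of to
position `i`; it is balanced by the composition sign on the left and by the factor with `j < i` on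
the right. -/
theorem koszulSign_subst (i : Fin (m + 1)) {wa : List (Option (Fin (m + 1)))}
    {wb : List (Option (Fin (n + 1)))} (ha : IsMultilinearWord wa) (hb : IsMultilinearWord wb)
    (p : Fin (m + n + 1) → ℤ) (q : ℤ) (hq : q = wb.count none) :
    koszulSign (Pi.single i q) wa * koszulSign p (wa.flatMap (substLetter i wb)) =
      (q * ∑ j with j.val < i.val, p j).negOnePow *
        koszulSign (fun j => if j = i then q + ∑ l, p (innerLabel i l) else p (outerLabel n i j))
          wa *
        koszulSign (fun l => p (innerLabel i l)) wb := by
  set p' : Fin (m + 1) → ℤ :=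
    fun j => if j = i then q + ∑ l, p (innerLabel i l) else p (outerLabel n i j) with hp'
  obtain ⟨u, v, rfl, hu, hv⟩ := exists_split_of_multilinear ha i
  have hdeg : ∀ x, x ≠ some i →
      letterDeg p (Option.map (outerLabel n i) x) = letterDeg p' x := by
    rintro (_ | j) hj
    · rfl
    · have : j ≠ i := fun h => hj (by rw [h])
      simp [letterDeg, hp', this]
  have hpair : ∀ x, x ≠ some i → ∀ y, y ≠ some i → koszulPair p (Option.map (outerLabel n i) x)
      (Option.map (outerLabel n i) y) = koszulPair p' x y := by
    intro x hx y hy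
    simp only [koszulPair, hdeg x hx, hdeg y hy]
    congr 1
    rcases x with _ | a <;> rcases y with _ | b <;>
      simp [letterBefore, outerLabel_lt_outerLabel]
  have hmem : ∀ s : List (Option (Fin (m + 1))), some i ∉ s → ∀ x ∈ s, x ≠ some i := by
    rintro s hs x hx rfl
    exact hs hx
  -- A letter of `u` is out of order with every circle of the block to its right, unless it is a
  -- circle itself; hence the correction `if x = none`.
  have hub : ∀ x ∈ u, (wb.map fun y => koszulPair p (Option.map (outerLabel n i) x)
      (Option.map (innerLabel i) y)).sum =
        q * ((letterDeg p' x : ZMod 2) + if x = none then 1 else 0) +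
        (∑ l, (p (innerLabel i l) : ZMod 2)) * degAfter p' i x := by
    intro x hx
    rw [sum_map_eq_of_multilinear hb, hq]
    rcases x with _ | j
    · simp [koszulPair, letterBefore, letterDeg, degAfter, add_self_zmod]
    · have hj : j ≠ i := fun h => hu (by rw [← h]; exact hx)
      have h1 := hdeg (some j) (hmem u hu _ hx)
      simp only [Option.map, letterDeg] at h1
      simp only [koszulPair, letterBefore, letterDeg, degAfter, Option.map, if_true, h1,
        innerLabel_lt_outerLabel hj, decide_eq_true_eq, reduceCtorEq, if_false, add_zero]
      split_ifs
      · simp only [Int.cast_one, mul_one, Int.cast_natCast, ← Finset.mul_sum]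
        ring
      · simp
  have hbv : ∀ y ∈ v, (wb.map fun x => koszulPair p (Option.map (innerLabel i) x)
      (Option.map (outerLabel n i) y)).sum =
        (∑ l, (p (innerLabel i l) : ZMod 2)) * degBefore p' i y := by
    intro y hy
    rw [sum_map_eq_of_multilinear hb]
    rcases y with _ | j
    · simp [koszulPair, letterBefore, letterDeg, degBefore]
    · have hj : j ≠ i := fun h => hv (by rw [← h]; exact hy)
      have h1 := hdeg (some j) (hmem v hv _ hy)
      simp only [Option.map, letterDeg] at h1
      simp only [koszulPair, letterBefore, letterDeg, degBefore, Option.map, h1,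
        outerLabel_lt_innerLabel hj, decide_eq_true_eq, Bool.false_eq_true, if_false, mul_zero,
        zero_add]
      split_ifs
      · rw [Finset.sum_mul]
      · simp
  have hbb : pairSum (koszulPair p) (wb.map (Option.map (innerLabel i))) =
      pairSum (koszulPair fun l => p (innerLabel i l)) wb := by
    rw [pairSum_map]
    refine pairSum_congr fun x _ y _ => ?_
    rcases x with _ | a <;> rcases y with _ | b <;>
      simp [koszulPair, letterBefore, letterDeg, innerLabel_lt_innerLabel]
  have hcub : crossSum (koszulPair p) (u.map (Option.map (outerLabel n i)))
      (wb.map (Option.map (innerLabel i))) =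
      q * ((u.map (degBefore p' i)).sum + (u.map (degAfter p' i)).sum +
        (u.map fun x => if x = none then (1 : ZMod 2) else 0).sum) +
      (∑ l, (p (innerLabel i l) : ZMod 2)) * (u.map (degAfter p' i)).sum := by
    rw [crossSum_map, List.map_congr_left hub, List.sum_map_add, List.sum_map_mul_left,
      List.sum_map_mul_left, List.sum_map_add, sum_degAfter_add p' i hu]
  have hcbv : crossSum (koszulPair p) (wb.map (Option.map (innerLabel i)))
      (v.map (Option.map (outerLabel n i))) =
      (∑ l, (p (innerLabel i l) : ZMod 2)) * (v.map (degBefore p' i)).sum := by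
    rw [crossSum_comm, crossSum_map, List.map_congr_left hbv, List.sum_map_mul_left]
  have hcuv : crossSum (koszulPair p) (u.map (Option.map (outerLabel n i)))
      (v.map (Option.map (outerLabel n i))) = crossSum (koszulPair p') u v := by
    rw [crossSum_map]
    exact crossSum_congr fun x hx y hy => hpair x (hmem u hu x hx) y (hmem v hv y hy)
  have hpp : ∀ s, some i ∉ s → pairSum (koszulPair p) (s.map (Option.map (outerLabel n i))) =
      pairSum (koszulPair p') s := fun s hs => by
    rw [pairSum_map]
    exact pairSum_congr fun x hx y hy => hpair x (hmem s hs x hx) y (hmem s hs y hy)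
  -- With all degrees but the `i`-th zero, only the circles to the right of `some i` count. This is
  -- the sign `(-1)^{|b| r}` of the operadic composition.
  have hsing : pairSum (koszulPair (Pi.single i q)) (u ++ some i :: v) =
      q * (v.map fun x => if x = none then (1 : ZMod 2) else 0).sum := by
    have hzero : ∀ s t : List (Option (Fin (m + 1))), some i ∉ s → some i ∉ t →
        ∀ x ∈ s, ∀ y ∈ t, koszulPair (Pi.single i q) x y = 0 := by
      intro s t hs ht x hx y hy
      rcases x with _ | a
      · simp [koszulPair, letterBefore]
      · have : a ≠ i := fun h => hs (by rw [← h]; exact hx)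
        simp [koszulPair, letterDeg, this]
    have hz : ∀ s t : List (Option (Fin (m + 1))), some i ∉ s → some i ∉ t →
        crossSum (koszulPair (Pi.single i q)) s t = 0 := fun s t hs ht => by
      rw [crossSum_congr (hzero s t hs ht)]
      simp [crossSum]
    have hz' : ∀ s : List (Option (Fin (m + 1))), some i ∉ s →
        pairSum (koszulPair (Pi.single i q)) s = 0 := fun s hs => by
      rw [pairSum_congr (hzero s s hs hs)]
      exact pairSum_eq_zero_of_pairwise (List.pairwise_of_forall fun _ _ => rfl)
    have hA : u.map (degAfter (Pi.single i q) i) = u.map fun _ => 0 := by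
      refine List.map_congr_left fun x hx => ?_
      rcases x with _ | a
      · simp [degAfter, letterBefore]
      · have : a ≠ i := fun h => hu (by rw [← h]; exact hx)
        simp [degAfter, letterDeg, this]
    have hB : v.map (degBefore (Pi.single i q) i) =
        v.map fun x => if x = none then (1 : ZMod 2) else 0 := by
      refine List.map_congr_left fun x hx => ?_
      rcases x with _ | a
      · simp [degBefore, letterBefore, letterDeg]
      · have : a ≠ i := fun h => hv (by rw [← h]; exact hx)
        simp [degBefore, letterDeg, this]
    rw [pairSum_split, hz u v hu hv, hz' u hu, hz' v hv, hA, hB]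
    simp
  -- The total degree of what precedes `some i` in the standard order, distributed over `u` and `v`;
  -- multiplied by `q` it accounts for the whole defect.
  have htot := sum_degBefore p' i ha
  have hi0 : degBefore p' i (some i) = 0 := by simp [degBefore, letterBefore]
  rw [← sum_map_ite_none, List.map_append, List.map_append, List.map_cons, List.map_cons,
    List.sum_append, List.sum_append, List.sum_cons, List.sum_cons, hi0] at htot
  have hlt : ∑ j with j < i, (p' j : ZMod 2) =
      ∑ j with j < i, (p (outerLabel n i j) : ZMod 2) := by
    refine Finset.sum_congr rfl fun j hj => ?_
    simp [hp', (Finset.mem_filter.1 hj).2.ne]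
  have hpi : (p' i : ZMod 2) = q + ∑ l, (p (innerLabel i l) : ZMod 2) := by
    simp [hp']
  rw [← zsign_cast, koszulSign_eq, koszulSign_eq, koszulSign_eq, koszulSign_eq, ← zsign_add,
    ← zsign_add, ← zsign_add]
  congr 1
  push_cast
  rw [sum_lt_outerLabel, ← hlt, hsing, pairSum_split, List.flatMap_append, List.flatMap_cons,
    flatMap_substLetter wb hu, flatMap_substLetter wb hv,
    show substLetter i wb (some i) = wb.map (Option.map (innerLabel i)) by simp [substLetter],
    pairSum_append, pairSum_append, crossSum_append_right, hbb, hcub, hcbv, hcuv, hpp u hu, hpp v hv,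
    hpi]
  rw [if_neg (by simp)] at htot
  linear_combination (-(q : ZMod 2)) * htot + ((q : ZMod 2) *
    ((u.map (degBefore p' i)).sum - ∑ j with j < i, (p' j : ZMod 2))) * two_eq_zero_zmod

end KoszulSubst

/-! ### Signed evaluation of monomials in a pre-Lie algebra with an odd element of square zero. -/

noncomputable section

section SuperPreLie

variable {k : Type*} [Field k] {X : Type*} [AddCommGroup X] [Module k X]

/-- A graded pre-Lie algebra, of which only the parity of the grading is recorded, with an odd
element `lam` of square zero. -/
structure SuperPreLie (k : Type*) [Field k] (X : Type*) [AddCommGroup X] [Module k X] where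
  P : X →ₗ[k] X
  star : X →ₗ[k] X →ₗ[k] X
  lam : X
  P_P : ∀ x, P (P x) = x
  P_star : ∀ x y, P (star x y) = star (P x) (P y)
  P_lam : P lam = -lam
  star_lam_lam : star lam lam = 0
  preLie : ∀ (q r : ℤ) (x y z : X), P y = q.negOnePow • y → P z = r.negOnePow • z →
    star (star x y) z - star x (star y z) =
      (q * r).negOnePow • (star (star x z) y - star x (star z y))

namespace SuperPreLie

variable (A : SuperPreLie k X) {n : ℕ}

/-- The value of a monomial under `eᵢ ↦ fᵢ`, `∘ ↦ λ`. -/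
abbrev evalM (f : Fin n → X) (m : FreeMagma (Option (Fin n))) : X :=
  evalMono (fun x y => A.star x y) (fun x => Option.elim x A.lam f) m

theorem evalM_mul (f : Fin n → X) (a b : FreeMagma (Option (Fin n))) :
    A.evalM f (a * b) = A.star (A.evalM f a) (A.evalM f b) := rfl

theorem evalM_some (f : Fin n → X) (i : Fin n) : A.evalM f (FreeMagma.of (some i)) = f i := rfl

theorem evalM_none (f : Fin n → X) : A.evalM f (FreeMagma.of none) = A.lam := rfl

end SuperPreLie

theorem leafWord_mul {α : Type*} (a b : FreeMagma α) :
    leafWord (a * b) = leafWord a ++ leafWord b := rfl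

theorem leafWord_of {α : Type*} (x : α) : leafWord (FreeMagma.of x) = [x] := rfl

theorem leafWord_map {α β : Type*} (g : α → β) (m : FreeMagma α) :
    leafWord (FreeMagma.map g m) = (leafWord m).map g := by
  induction m with
  | ih1 x => rfl
  | ih2 a b iha ihb => rw [map_mul, leafWord_mul, leafWord_mul, iha, ihb, List.map_append]

theorem circDeg_mul {n : ℕ} (a b : FreeMagma (Option (Fin n))) :
    circDeg (a * b) = circDeg a + circDeg b := by
  simp [circDeg, leafWord_mul]

/-- The degree of a monomial under a choice of degrees of the letters, modulo two. -/
def monoDeg {n : ℕ} (p : Fin n → ℤ) (m : FreeMagma (Option (Fin n))) : ZMod 2 :=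
  ((leafWord m).map fun x => (letterDeg p x : ZMod 2)).sum

theorem monoDeg_mul {n : ℕ} (p : Fin n → ℤ) (a b : FreeMagma (Option (Fin n))) :
    monoDeg p (a * b) = monoDeg p a + monoDeg p b := by
  simp [monoDeg, leafWord_mul]

/-- Each letter `eᵢ` occurs at most once. -/
def AtMostOnce {n : ℕ} (m : FreeMagma (Option (Fin n))) : Prop :=
  ∀ i, (leafWord m).count (some i) ≤ 1

theorem IsMultilinearMono.atMostOnce {n : ℕ} {m : FreeMagma (Option (Fin n))}
    (h : IsMultilinearMono m) : AtMostOnce m := fun i => (h i).le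

theorem AtMostOnce.left {n : ℕ} {a b : FreeMagma (Option (Fin n))} (h : AtMostOnce (a * b)) :
    AtMostOnce a := fun i => by
  have := h i
  rw [leafWord_mul, List.count_append] at this
  omega

theorem AtMostOnce.right {n : ℕ} {a b : FreeMagma (Option (Fin n))} (h : AtMostOnce (a * b)) :
    AtMostOnce b := fun i => by
  have := h i
  rw [leafWord_mul, List.count_append] at this
  omega

theorem AtMostOnce.notMem {n : ℕ} {a b : FreeMagma (Option (Fin n))} (h : AtMostOnce (a * b))
    (i : Fin n) (hi : some i ∈ leafWord a) : some i ∉ leafWord b := fun hi' => by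
  have := h i
  rw [leafWord_mul, List.count_append] at this
  have h1 := List.count_pos_iff.2 hi
  have h2 := List.count_pos_iff.2 hi'
  omega

/-- The cross term of the Koszul sign of a product. -/
def crossSign {n : ℕ} (p : Fin n → ℤ) (a b : FreeMagma (Option (Fin n))) : ℤˣ :=
  zsign (crossSum (koszulPair p) (leafWord a) (leafWord b))

theorem koszulSign_mul {n : ℕ} (p : Fin n → ℤ) (a b : FreeMagma (Option (Fin n))) :
    koszulSign p (leafWord (a * b)) =
      koszulSign p (leafWord a) * koszulSign p (leafWord b) * crossSign p a b := by
  rw [leafWord_mul, koszulSign_eq, pairSum_append, zsign_add, zsign_add, koszulSign_eq,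
    koszulSign_eq, crossSign]

theorem crossSign_mul_left {n : ℕ} (p : Fin n → ℤ) (a b c : FreeMagma (Option (Fin n))) :
    crossSign p (a * b) c = crossSign p a c * crossSign p b c := by
  rw [crossSign, leafWord_mul, crossSum_append_left, zsign_add, crossSign, crossSign]

theorem crossSign_mul_right {n : ℕ} (p : Fin n → ℤ) (a b c : FreeMagma (Option (Fin n))) :
    crossSign p a (b * c) = crossSign p a b * crossSign p a c := by
  rw [crossSign, leafWord_mul, crossSum_append_right, zsign_add, crossSign, crossSign]

/-- The comparison of two sign rules: on the left the degrees `p` as seen in the target algebra, on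
the right only circles, as in the defining relation of `rpL*`. Without common `eᵢ` this is
`crossSum_koszul_comm`. -/
theorem crossSign_comm {n : ℕ} (p : Fin n → ℤ) {a b : FreeMagma (Option (Fin n))}
    (h : ∀ i, some i ∈ leafWord a → some i ∉ leafWord b) :
    crossSign p a b * zsign (monoDeg p a * monoDeg p b) =
      crossSign p b a * ((circDeg a * circDeg b : ℕ) : ℤ).negOnePow := by
  rw [crossSign, crossSign, ← zsign_cast, ← zsign_add, ← zsign_add]
  congr 1
  have := crossSum_koszul_comm p h
  rw [monoDeg, monoDeg, circDeg, circDeg]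
  push_cast
  linear_combination this - crossSum (koszulPair p) (leafWord b) (leafWord a) * two_eq_zero_zmod

namespace SuperPreLie

variable (A : SuperPreLie k X) {n : ℕ}

theorem P_evalM {p : Fin n → ℤ} {f : Fin n → X} (hf : ∀ i, A.P (f i) = (p i).negOnePow • f i)
    (m : FreeMagma (Option (Fin n))) :
    A.P (A.evalM f m) = zsign (monoDeg p m) • A.evalM f m := by
  induction m with
  | ih1 x =>
    rcases x with _ | i
    · rw [evalM_none, A.P_lam, monoDeg, leafWord_of]
      simp [letterDeg, zsign, ZMod.val_one]
    · rw [evalM_some, hf, monoDeg, leafWord_of]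
      simp [letterDeg, zsign_cast]
  | ih2 a b iha ihb =>
    rw [evalM_mul, A.P_star, iha, ihb, monoDeg_mul, zsign_add]
    simp only [Units.smul_def, map_zsmul, LinearMap.smul_apply, Units.val_mul, smul_smul]
    rw [mul_comm]

theorem preLie' {q r : ZMod 2} {x y z : X} (hy : A.P y = zsign q • y) (hz : A.P z = zsign r • z) :
    A.star (A.star x y) z - A.star x (A.star y z) =
      zsign (q * r) • (A.star (A.star x z) y - A.star x (A.star z y)) := by
  rw [A.preLie q.val r.val x y z hy hz]
  congr 1
  rw [← zsign_cast]
  simp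

/-- The signed value of a monomial, zero if some `eᵢ` occurs more than once. -/
def signedEval (p : Fin n → ℤ) (f : Fin n → X) (m : FreeMagma (Option (Fin n))) : X :=
  haveI := Classical.dec (AtMostOnce m)
  if AtMostOnce m then koszulSign p (leafWord m) • A.evalM f m else 0

theorem signedEval_mul (p : Fin n → ℤ) (f : Fin n → X) {a b : FreeMagma (Option (Fin n))}
    (h : AtMostOnce (a * b)) : A.signedEval p f (a * b) =
      crossSign p a b • A.star (A.signedEval p f a) (A.signedEval p f b) := by
  rw [signedEval, signedEval, signedEval, if_pos h, if_pos h.left, if_pos h.right, evalM_mul,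
    koszulSign_mul]
  simp only [Units.smul_def, map_zsmul, LinearMap.smul_apply, Units.val_mul, smul_smul]
  congr 1
  ring

theorem signedEval_of_not (p : Fin n → ℤ) (f : Fin n → X) {m : FreeMagma (Option (Fin n))}
    (h : ¬ AtMostOnce m) : A.signedEval p f m = 0 := by
  rw [signedEval, if_neg h]

end SuperPreLie

/-- The linear extension to the free nonassociative algebra of a map on monomials. -/
def FreeNA.lin {n : ℕ} {W : Type*} [AddCommGroup W] [Module k W]
    (g : FreeMagma (Option (Fin n)) → W) : FreeNA k n →ₗ[k] W :=
  Finsupp.lift W k (FreeMagma (Option (Fin n))) g ∘ₗ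
    (MonoidAlgebra.coeffLinearEquiv k).toLinearMap

theorem FreeNA.lin_mono {n : ℕ} {W : Type*} [AddCommGroup W] [Module k W]
    (g : FreeMagma (Option (Fin n)) → W) (m : FreeMagma (Option (Fin n))) :
    FreeNA.lin g (FreeNA.mono k m) = g m := by
  simp [FreeNA.lin, FreeNA.mono]

theorem FreeNA.mono_mul_mono {n : ℕ} (a b : FreeMagma (Option (Fin n))) :
    FreeNA.mono k a * FreeNA.mono k b = FreeNA.mono k (a * b) := by
  simp [FreeNA.mono, MonoidAlgebra.single_mul_single]

theorem FreeNA.span_mono (n : ℕ) :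
    Submodule.span k (Set.range (FreeNA.mono k (n := n))) = ⊤ := by
  rw [eq_top_iff]
  rintro x -
  induction x using MonoidAlgebra.induction_linear with
  | zero => exact zero_mem _
  | add x y hx hy => exact add_mem hx hy
  | single m r =>
    have : (MonoidAlgebra.single m r : FreeNA k n) = r • FreeNA.mono k m := by
      simp [FreeNA.mono]
    rw [this]
    exact Submodule.smul_mem _ _ (Submodule.subset_span ⟨m, rfl⟩)

theorem FreeNA.induction {n : ℕ} {C : FreeNA k n → Prop} (x : FreeNA k n)
    (mono : ∀ m, C (FreeNA.mono k m)) (zero : C 0) (add : ∀ x y, C x → C y → C (x + y))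
    (smul : ∀ (c : k) x, C x → C (c • x)) : C x := by
  have hx : x ∈ Submodule.span k (Set.range (FreeNA.mono k (n := n))) := by
    rw [FreeNA.span_mono]
    trivial
  induction hx using Submodule.span_induction with
  | mem x h =>
    obtain ⟨m, rfl⟩ := h
    exact mono m
  | zero => exact zero
  | add x y _ _ hx hy => exact add x y hx hy
  | smul c x _ hx => exact smul c x hx

/-- The free algebra is spanned by monomials, so stability under multiplication by monomials
suffices. This is the criterion by which every map out of `rpL*(𝐤ⁿ)` is constructed. -/
theorem rplIdeal_le {n : ℕ} {J : Submodule k (FreeNA k n)} (h : rplRel k n ⊆ J)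
    (hmul : ∀ x ∈ J, ∀ m, x * FreeNA.mono k m ∈ J ∧ FreeNA.mono k m * x ∈ J) :
    rplIdeal k n ≤ J := by
  refine sInf_le ⟨h, fun x hx y => ?_⟩
  induction y using FreeNA.induction with
  | mono m => exact hmul x hx m
  | zero => simp
  | add y z hy hz =>
    rw [mul_add, add_mul]
    exact ⟨add_mem hy.1 hz.1, add_mem hy.2 hz.2⟩
  | smul c y hy =>
    rw [mul_smul_comm, smul_mul_assoc]
    exact ⟨J.smul_mem c hy.1, J.smul_mem c hy.2⟩

/-- The span of the monomials with the same letters as a given one. -/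
def FreeNA.homog (k : Type*) [Field k] {n : ℕ} (a : FreeMagma (Option (Fin n))) :
    Submodule k (FreeNA k n) :=
  Submodule.span k {x | ∃ m, (leafWord m).Perm (leafWord a) ∧ x = FreeNA.mono k m}

theorem FreeNA.mono_mem_homog {n : ℕ} {a m : FreeMagma (Option (Fin n))}
    (h : (leafWord m).Perm (leafWord a)) : FreeNA.mono k m ∈ FreeNA.homog k a :=
  Submodule.subset_span ⟨m, h, rfl⟩

theorem crossSum_perm {α R : Type*} [AddCommMonoid R] (b : α → α → R) {u u' : List α}
    (h : u.Perm u') (v : List α) : crossSum b u v = crossSum b u' v :=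
  (h.map _).sum_eq

theorem atMostOnce_congr {n : ℕ} {a b : FreeMagma (Option (Fin n))}
    (h : (leafWord a).Perm (leafWord b)) : AtMostOnce a ↔ AtMostOnce b :=
  forall_congr' fun _ => by rw [h.count_eq]

namespace SuperPreLie

variable (A : SuperPreLie k X) {n : ℕ}

/-- Every letter of one word is paired with every letter of the other, so the order within each word
is irrelevant. -/
theorem crossSign_congr (p : Fin n → ℤ) {a a' : FreeMagma (Option (Fin n))}
    (h : (leafWord a).Perm (leafWord a')) (b : FreeMagma (Option (Fin n))) :
    crossSign p a b = crossSign p a' b ∧ crossSign p b a = crossSign p b a' := by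
  rw [crossSign, crossSign, crossSign, crossSign, crossSum_comm _ (leafWord b),
    crossSum_comm _ (leafWord b), crossSum_perm _ h, crossSum_perm _ h]
  exact ⟨rfl, rfl⟩

/-- The signed evaluation is multiplicative only up to `crossSign`, which depends on the letters of
both factors. On combinations of monomials with the same letters this sign is constant, so there,
and only there, kernel elements can be multiplied. If the product repeats some `eᵢ`, everything is
zero. -/
theorem lin_homog_mul (p : Fin n → ℤ) (f : Fin n → X) {a u : FreeMagma (Option (Fin n))}
    {x : FreeNA k n} (hx : x ∈ FreeNA.homog k a)
    (h0 : FreeNA.lin (A.signedEval p f) x = 0) :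
    FreeNA.lin (A.signedEval p f) (x * FreeNA.mono k u) = 0 ∧
      FreeNA.lin (A.signedEval p f) (FreeNA.mono k u * x) = 0 := by
  by_cases h : AtMostOnce (a * u)
  · have key : FreeNA.lin (A.signedEval p f) (x * FreeNA.mono k u) = crossSign p a u •
          A.star (FreeNA.lin (A.signedEval p f) x) (A.signedEval p f u) ∧
        FreeNA.lin (A.signedEval p f) (FreeNA.mono k u * x) = crossSign p u a •
          A.star (A.signedEval p f u) (FreeNA.lin (A.signedEval p f) x) := by
      clear h0
      induction hx using Submodule.span_induction with
      | mem x hx =>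
        obtain ⟨m, hm, rfl⟩ := hx
        have h1 : AtMostOnce (m * u) := by
          rwa [atMostOnce_congr (b := a * u)]
          exact hm.append_right _
        have h2 : AtMostOnce (u * m) := by
          rwa [atMostOnce_congr (b := a * u)]
          exact List.perm_append_comm.trans (hm.append_right _)
        rw [FreeNA.mono_mul_mono, FreeNA.mono_mul_mono, FreeNA.lin_mono, FreeNA.lin_mono,
          FreeNA.lin_mono, A.signedEval_mul p f h1, A.signedEval_mul p f h2,
          (crossSign_congr p hm u).1, (crossSign_congr p hm u).2]
        exact ⟨rfl, rfl⟩
      | zero => simp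
      | add x y _ _ hx hy =>
        simp only [add_mul, mul_add, map_add, hx.1, hx.2, hy.1, hy.2, smul_add,
          LinearMap.add_apply, and_self]
      | smul c x _ hx =>
        simp only [smul_mul_assoc, mul_smul_comm, map_smul, hx.1, hx.2, LinearMap.smul_apply,
          smul_comm c, and_self]
    rw [key.1, key.2, h0]
    simp
  · clear h0
    induction hx using Submodule.span_induction with
    | mem x hx =>
      obtain ⟨m, hm, rfl⟩ := hx
      have h1 : ¬ AtMostOnce (m * u) := by
        rwa [atMostOnce_congr (b := a * u)]
        exact hm.append_right _
      have h2 : ¬ AtMostOnce (u * m) := by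
        rwa [atMostOnce_congr (b := a * u)]
        exact List.perm_append_comm.trans (hm.append_right _)
      rw [FreeNA.mono_mul_mono, FreeNA.mono_mul_mono, FreeNA.lin_mono, FreeNA.lin_mono,
        A.signedEval_of_not p f h1, A.signedEval_of_not p f h2]
      exact ⟨rfl, rfl⟩
    | zero => simp
    | add x y _ _ hx hy =>
      simp only [add_mul, mul_add, map_add, hx.1, hx.2, hy.1, hy.2, add_zero, and_self]
    | smul c x _ hx =>
      simp only [smul_mul_assoc, mul_smul_comm, map_smul, hx.1, hx.2, smul_zero, and_self]

theorem P_signedEval {p : Fin n → ℤ} {f : Fin n → X}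
    (hf : ∀ i, A.P (f i) = (p i).negOnePow • f i) (m : FreeMagma (Option (Fin n))) :
    A.P (A.signedEval p f m) = zsign (monoDeg p m) • A.signedEval p f m := by
  rw [signedEval]
  split_ifs
  · rw [Units.smul_def, map_zsmul, A.P_evalM hf]
    simp only [Units.smul_def, smul_smul]
    rw [mul_comm]
  · simp

/-- By `crossSign_comm`, exchanging the words of `b` and `c` costs the sign of the relation times
the sign of the pre-Lie identity at the values in `X`, so the relation becomes that identity. All
four monomials have the same letters, hence either all or none of them repeat some `eᵢ`. -/
theorem lin_signedEval_rel {p : Fin n → ℤ} {f : Fin n → X}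
    (hf : ∀ i, A.P (f i) = (p i).negOnePow • f i) (a b c : FreeMagma (Option (Fin n))) :
    FreeNA.lin (A.signedEval p f) (FreeNA.assoc k a b c -
      ((circDeg b * circDeg c : ℕ) : ℤ).negOnePow • FreeNA.assoc k a c b) = 0 := by
  rw [map_sub, Units.smul_def, map_zsmul, FreeNA.assoc, FreeNA.assoc, map_sub, map_sub,
    FreeNA.lin_mono, FreeNA.lin_mono, FreeNA.lin_mono, FreeNA.lin_mono]
  have hcomm : (leafWord (b * c)).Perm (leafWord (c * b)) := List.perm_append_comm
  have p1 : (leafWord (a * (b * c))).Perm (leafWord (a * b * c)) := by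
    simp [leafWord_mul]
  have p3 : (leafWord (a * (c * b))).Perm (leafWord (a * b * c)) :=
    (hcomm.symm.append_left (leafWord a)).trans p1
  have p2 : (leafWord (a * c * b)).Perm (leafWord (a * b * c)) := by
    refine List.Perm.trans ?_ p3
    simp [leafWord_mul]
  by_cases h : AtMostOnce (a * b * c)
  · have h1 := (atMostOnce_congr p1).2 h
    have h2 := (atMostOnce_congr p2).2 h
    have h3 := (atMostOnce_congr p3).2 h
    have hpl := A.preLie' (x := A.signedEval p f a) (A.P_signedEval hf b) (A.P_signedEval hf c)
    have hcs := crossSign_comm p h1.right.notMem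
    rw [A.signedEval_mul p f h, A.signedEval_mul p f h.left, A.signedEval_mul p f h1,
      A.signedEval_mul p f h1.right, A.signedEval_mul p f h2, A.signedEval_mul p f h2.left,
      A.signedEval_mul p f h3, A.signedEval_mul p f h3.right, crossSign_mul_left,
      crossSign_mul_left, crossSign_mul_right, crossSign_mul_right]
    have e1 : crossSign p b c = crossSign p c b * ((circDeg b * circDeg c : ℕ) : ℤ).negOnePow *
        zsign (monoDeg p b * monoDeg p c) := by
      rw [← hcs, mul_assoc, Int.units_mul_self, mul_one]
    rw [e1]
    -- Only the identity `hpl` between three elements of `X` and five unknown signs remain; the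
    -- signs are eliminated by cases.
    generalize A.signedEval p f a = x at *
    generalize A.signedEval p f b = y at *
    generalize A.signedEval p f c = z at *
    generalize zsign (monoDeg p b * monoDeg p c) = s at *
    generalize ((circDeg b * circDeg c : ℕ) : ℤ).negOnePow = t at *
    rcases Int.units_eq_one_or s with rfl | rfl <;> rcases Int.units_eq_one_or t with rfl | rfl <;>
    rcases Int.units_eq_one_or (crossSign p a b) with h | h <;>
    rcases Int.units_eq_one_or (crossSign p a c) with h' | h' <;>
    rcases Int.units_eq_one_or (crossSign p c b) with h'' | h'' <;>
    simp [h, h', h''] at hpl ⊢ <;> rw [sub_eq_iff_eq_add] at hpl <;> rw [hpl] <;> abel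
  · rw [A.signedEval_of_not p f h, A.signedEval_of_not p f (mt (atMostOnce_congr p1).1 h),
      A.signedEval_of_not p f (mt (atMostOnce_congr p2).1 h),
      A.signedEval_of_not p f (mt (atMostOnce_congr p3).1 h)]
    simp

/-- The kernel is not visibly an ideal, by the failure of multiplicativity. The sum over all letter
contents of its homogeneous parts is an ideal, and it contains the relations because each of them
has a single letter content. -/
theorem rplIdeal_le_ker {p : Fin n → ℤ} {f : Fin n → X}
    (hf : ∀ i, A.P (f i) = (p i).negOnePow • f i) :
    rplIdeal k n ≤ LinearMap.ker (FreeNA.lin (k := k) (A.signedEval p f)) := by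
  refine (rplIdeal_le (J := ⨆ a, FreeNA.homog k a ⊓
    LinearMap.ker (FreeNA.lin (k := k) (A.signedEval p f))) ?_ ?_).trans
    (iSup_le fun a => inf_le_right)
  · rintro x (⟨a, b, c, rfl⟩ | hx)
    · refine Submodule.mem_iSup_of_mem (a * b * c) ⟨?_, A.lin_signedEval_rel hf a b c⟩
      refine sub_mem (sub_mem ?_ ?_) ?_
      · exact FreeNA.mono_mem_homog (List.Perm.refl _)
      · exact FreeNA.mono_mem_homog (by simp [leafWord_mul])
      · rw [Units.smul_def]
        refine zsmul_mem (sub_mem ?_ ?_) _ <;> refine FreeNA.mono_mem_homog ?_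
        · simp only [leafWord_mul, List.append_assoc]
          exact List.perm_append_comm.append_left _
        · simp only [leafWord_mul, List.append_assoc]
          exact List.perm_append_comm.append_left _
    · rw [Set.mem_singleton_iff] at hx
      subst hx
      refine Submodule.mem_iSup_of_mem _ ⟨FreeNA.mono_mem_homog (List.Perm.refl _), ?_⟩
      change FreeNA.lin _ _ = 0
      rw [FreeNA.lin_mono, signedEval]
      split_ifs
      · rw [evalM_mul, evalM_none, A.star_lam_lam, smul_zero]
      · rfl
  · intro x hx m
    induction hx using Submodule.iSup_induction' with
    | mem a x hx =>
      have h := A.lin_homog_mul p f (u := m) hx.1 hx.2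
      refine ⟨Submodule.mem_iSup_of_mem (a * m) ⟨?_, h.1⟩,
        Submodule.mem_iSup_of_mem (m * a) ⟨?_, h.2⟩⟩
      · have hx1 := hx.1
        clear h hx
        induction hx1 using Submodule.span_induction with
        | mem x hx =>
          obtain ⟨m', hm, rfl⟩ := hx
          rw [FreeNA.mono_mul_mono]
          exact FreeNA.mono_mem_homog (hm.append_right _)
        | zero => simp
        | add x y _ _ hx hy =>
          rw [add_mul]
          exact add_mem hx hy
        | smul c x _ hx =>
          rw [smul_mul_assoc]
          exact Submodule.smul_mem _ _ hx
      · have hx1 := hx.1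
        clear h hx
        induction hx1 using Submodule.span_induction with
        | mem x hx =>
          obtain ⟨m', hm, rfl⟩ := hx
          rw [FreeNA.mono_mul_mono]
          exact FreeNA.mono_mem_homog (hm.append_left _)
        | zero => simp
        | add x y _ _ hx hy =>
          rw [mul_add]
          exact add_mem hx hy
        | smul c x _ hx =>
          rw [mul_smul_comm]
          exact Submodule.smul_mem _ _ hx
    | zero => simp
    | add x y _ _ hx hy =>
      rw [add_mul, mul_add]
      exact ⟨add_mem hx.1 hy.1, add_mem hx.2 hy.2⟩

/-- The signed evaluation at homogeneous elements. -/
def ev (p : Fin n → ℤ) (f : Fin n → X) (hf : ∀ i, A.P (f i) = (p i).negOnePow • f i) :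
    Rpl k n →ₗ[k] X :=
  (rplIdeal k n).liftQ (FreeNA.lin (A.signedEval p f)) (A.rplIdeal_le_ker hf)

theorem ev_mono {p : Fin n → ℤ} {f : Fin n → X} (hf : ∀ i, A.P (f i) = (p i).negOnePow • f i)
    {m : FreeMagma (Option (Fin n))} (hm : IsMultilinearMono m) :
    A.ev p f hf (Rpl.mono k m) = koszulSign p (leafWord m) • A.evalM f m := by
  rw [ev, Rpl.mono, Submodule.mkQ_apply, Submodule.liftQ_apply, FreeNA.lin_mono, signedEval,
    if_pos hm.atMostOnce]

end SuperPreLie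

end SuperPreLie

end

/-! ### The multilinear action on elements that need not be homogeneous. -/

noncomputable section

section Action

variable {k : Type*} [Field k] {X : Type*} [AddCommGroup X] [Module k X]

theorem rplMultilinear_induction {n : ℕ} {C : Rpl k n → Prop}
    (mono : ∀ m, IsMultilinearMono m → C (Rpl.mono k m)) (zero : C 0)
    (add : ∀ x y, C x → C y → C (x + y)) (smul : ∀ (c : k) x, C x → C (c • x))
    {x : Rpl k n} (hx : x ∈ rplMultilinear k n) : C x := by
  induction hx using Submodule.span_induction with
  | mem x h =>
    obtain ⟨m, hm, rfl⟩ := h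
    exact mono m hm
  | zero => exact zero
  | add x y _ _ hx hy => exact add x y hx hy
  | smul c x _ hx => exact smul c x hx

theorem mono_mem_rplMultilinear {n : ℕ} {m : FreeMagma (Option (Fin n))}
    (h : IsMultilinearMono m) : Rpl.mono k m ∈ rplMultilinear k n :=
  Submodule.subset_span ⟨m, h, rfl⟩

namespace SuperPreLie

variable (A : SuperPreLie k X) {n : ℕ}

theorem evalM_congr {f g : Fin n → X} {m : FreeMagma (Option (Fin n))}
    (h : ∀ i, some i ∈ leafWord m → f i = g i) : A.evalM f m = A.evalM g m := by
  induction m with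
  | ih1 x =>
    rcases x with _ | i
    · rfl
    · exact h i (by simp [leafWord_of])
  | ih2 a b iha ihb =>
    rw [evalM_mul, evalM_mul, iha fun i hi => h i (by simp [leafWord_mul, hi]),
      ihb fun i hi => h i (by simp [leafWord_mul, hi])]

theorem evalM_update_of_notMem (f : Fin n → X) {i : Fin n} (x : X)
    {m : FreeMagma (Option (Fin n))} (h : some i ∉ leafWord m) :
    A.evalM (Function.update f i x) m = A.evalM f m :=
  A.evalM_congr fun j hj => Function.update_of_ne (by rintro rfl; exact h hj) _ _

/-- Along the path to the unique occurrence of the letter every factor is fixed, so the value is a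
composite of left and right multiplications. Stating this as the existence of `ℓ` gives additivity
and homogeneity at once. -/
theorem exists_evalM_update (f : Fin n → X) (i : Fin n) {m : FreeMagma (Option (Fin n))}
    (h : (leafWord m).count (some i) = 1) :
    ∃ ℓ : X →ₗ[k] X, ∀ x, A.evalM (Function.update f i x) m = ℓ x := by
  induction m with
  | ih1 x =>
    rcases x with _ | j
    · simp [leafWord_of] at h
    · obtain rfl : j = i := by
        by_contra hji
        simp [leafWord_of, hji] at h
      exact ⟨LinearMap.id, fun x => by rw [evalM_some, Function.update_self]; rfl⟩
  | ih2 a b iha ihb =>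
    rw [leafWord_mul, List.count_append] at h
    rcases Nat.eq_zero_or_pos ((leafWord a).count (some i)) with ha | ha
    · obtain ⟨ℓ, hℓ⟩ := ihb (by omega)
      refine ⟨A.star (A.evalM f a) ∘ₗ ℓ, fun x => ?_⟩
      rw [evalM_mul, hℓ, A.evalM_update_of_notMem f x (List.count_eq_zero.1 ha)]
      rfl
    · obtain ⟨ℓ, hℓ⟩ := iha (by omega)
      refine ⟨A.star.flip (A.evalM f b) ∘ₗ ℓ, fun x => ?_⟩
      rw [evalM_mul, hℓ, A.evalM_update_of_notMem f x (List.count_eq_zero.1 (by omega))]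
      rfl

/-- The degree of a parity. -/
def parityDeg (b : Bool) : ℤ := if b then 1 else 0

/-- The projection onto the elements of a given parity. -/
def part (b : Bool) : X →ₗ[k] X := (2⁻¹ : k) • (LinearMap.id + (parityDeg b).negOnePow • A.P)

theorem P_part (b : Bool) (x : X) : A.P (A.part b x) = (parityDeg b).negOnePow • A.part b x := by
  cases b <;> simp [part, parityDeg, A.P_P, smul_add, add_comm]

theorem part_of_parity [CharZero k] {q : ℤ} {x : X} (hx : A.P x = q.negOnePow • x) (b : Bool) :
    A.part b x = if b = decide (Odd q) then x else 0 := by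
  have h2 : (2⁻¹ : k) • (x + x) = x := by
    rw [← two_smul k x, smul_smul, inv_mul_cancel₀ two_ne_zero, one_smul]
  rw [smul_add] at h2
  rcases Int.even_or_odd q with hq | hq
  · have h1 : A.P x = x := by rw [hx, Int.negOnePow_even q hq, one_smul]
    cases b <;> simp [part, parityDeg, h1, h2, Int.not_odd_iff_even.2 hq]
  · have h1 : A.P x = -x := by rw [hx, Int.negOnePow_odd q hq]; simp
    cases b <;> simp [part, parityDeg, h1, h2, hq]

/-- The action of an element of the free algebra on arbitrary elements. -/
def act₀ (U : Rpl k n) (f : Fin n → X) : X :=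
  -- Each argument is split into its even and odd part; the sum runs over all choices of parities,
  -- each evaluated with its own Koszul signs.
  ∑ ε : Fin n → Bool, A.ev (fun i => parityDeg (ε i)) (fun i => A.part (ε i) (f i))
    (fun i => A.P_part (ε i) (f i)) U

theorem exists_act₀_update {U : Rpl k n} (hU : U ∈ rplMultilinear k n) (f : Fin n → X)
    (i : Fin n) : ∃ ℓ : X →ₗ[k] X, ∀ x, A.act₀ U (Function.update f i x) = ℓ x := by
  refine rplMultilinear_induction (C := fun U => ∃ ℓ : X →ₗ[k] X, ∀ x,
    A.act₀ U (Function.update f i x) = ℓ x) ?_ ?_ ?_ ?_ hU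
  · intro m hm
    choose ℓ hℓ using fun ε : Fin n → Bool =>
      A.exists_evalM_update (fun j => A.part (ε j) (f j)) i (hm i)
    refine ⟨∑ ε : Fin n → Bool, koszulSign (fun i => parityDeg (ε i)) (leafWord m) •
      (ℓ ε ∘ₗ A.part (ε i)), fun x => ?_⟩
    rw [act₀, LinearMap.sum_apply]
    refine Finset.sum_congr rfl fun ε _ => ?_
    rw [A.ev_mono _ hm, LinearMap.smul_apply, LinearMap.comp_apply, ← hℓ]
    congr 2
    funext j
    by_cases hj : j = i
    · subst hj
      simp
    · simp [hj]
  · exact ⟨0, fun x => by simp [act₀]⟩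
  · rintro U V ⟨ℓ, hℓ⟩ ⟨ℓ', hℓ'⟩
    refine ⟨ℓ + ℓ', fun x => ?_⟩
    rw [LinearMap.add_apply, ← hℓ, ← hℓ']
    simp [act₀, Finset.sum_add_distrib]
  · rintro c U ⟨ℓ, hℓ⟩
    refine ⟨c • ℓ, fun x => ?_⟩
    rw [LinearMap.smul_apply, ← hℓ]
    simp [act₀, Finset.smul_sum]

/-- The action of multilinear elements. -/
def act (n : ℕ) : rplMultilinear k n →ₗ[k] MultilinearMap k (fun _ : Fin n => X) X where
  toFun U :=
    { toFun := A.act₀ (U : Rpl k n)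
      map_update_add' := by
        intro inst f i x y
        -- The axioms of a multilinear map quantify over the decidability instance used by
        -- `Function.update`.
        rw [Subsingleton.elim inst (instDecidableEqFin n)]
        obtain ⟨ℓ, hℓ⟩ := A.exists_act₀_update U.2 f i
        rw [hℓ, hℓ, hℓ, map_add]
      map_update_smul' := by
        intro inst f i c x
        rw [Subsingleton.elim inst (instDecidableEqFin n)]
        obtain ⟨ℓ, hℓ⟩ := A.exists_act₀_update U.2 f i
        rw [hℓ, hℓ, map_smul] }
  map_add' U V := by
    ext f
    simp [act₀, Finset.sum_add_distrib]
  map_smul' c U := by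
    ext f
    simp [act₀, Finset.smul_sum]

theorem act_apply (U : rplMultilinear k n) (f : Fin n → X) : A.act n U f = A.act₀ U f := rfl

/-- For homogeneous arguments only the summand with the correct parities survives: in any other one
some argument is zero, and the value is linear in it. In the surviving one the integer degrees may
replace the parities by `koszulSign_congr`. -/
theorem act_mono [CharZero k] {p : Fin n → ℤ} {f : Fin n → X} (hf : ∀ i, A.P (f i) = (p i).negOnePow • f i)
    {m : FreeMagma (Option (Fin n))} (hm : IsMultilinearMono m) {U : rplMultilinear k n}
    (hU : (U : Rpl k n) = Rpl.mono k m) :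
    A.act n U f = koszulSign p (leafWord m) • A.evalM f m := by
  rw [act_apply, act₀, hU]
  rw [Finset.sum_eq_single fun i => decide (Odd (p i))]
  · rw [A.ev_mono _ hm]
    congr 1
    · refine koszulSign_congr (fun i => ?_) _
      rcases Int.even_or_odd (p i) with h | h
      · simp [parityDeg, Int.not_odd_iff_even.2 h, Int.negOnePow_even _ h]
      · simp [parityDeg, h, Int.negOnePow_odd _ h]
    · congr 1
      funext i
      rw [A.part_of_parity (hf i), if_pos rfl]
  · intro ε _ hε
    obtain ⟨i, hi⟩ := Function.ne_iff.1 hε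
    rw [A.ev_mono _ hm]
    obtain ⟨ℓ, hℓ⟩ := A.exists_evalM_update (fun j => A.part (ε j) (f j)) i (hm i)
    have h0 : A.part (ε i) (f i) = 0 := by rw [A.part_of_parity (hf i), if_neg hi]
    have := hℓ (A.part (ε i) (f i))
    rw [Function.update_eq_self, h0, map_zero] at this
    rw [this, smul_zero]
  · intro h
    exact absurd (Finset.mem_univ _) h

/-- Naturality of the action. -/
theorem map_act {Y : Type*} [AddCommGroup Y] [Module k Y] (B : SuperPreLie k Y) (φ : X →ₗ[k] Y)
    (hP : ∀ x, φ (A.P x) = B.P (φ x)) (hs : ∀ x y, φ (A.star x y) = B.star (φ x) (φ y))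
    (hlam : φ A.lam = B.lam) (U : rplMultilinear k n) (f : Fin n → X) :
    φ (A.act n U f) = B.act n U (fun i => φ (f i)) := by
  have hpart : ∀ b x, φ (A.part b x) = B.part b (φ x) := by
    intro b x
    cases b <;> simp [part, parityDeg, hP]
  have heval : ∀ (f : Fin n → X) m, φ (A.evalM f m) = B.evalM (fun i => φ (f i)) m := by
    intro f m
    induction m with
    | ih1 x =>
      rcases x with _ | i
      · exact hlam
      · rfl
    | ih2 a b iha ihb => rw [evalM_mul, hs, iha, ihb, evalM_mul]
  rw [act_apply, act_apply]
  refine rplMultilinear_induction (C := fun U => φ (A.act₀ U f) = B.act₀ U fun i => φ (f i))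
    ?_ ?_ ?_ ?_ U.2
  · intro m hm
    rw [act₀, act₀, map_sum]
    refine Finset.sum_congr rfl fun ε _ => ?_
    rw [A.ev_mono _ hm, B.ev_mono _ hm, Units.smul_def, map_zsmul, heval, Units.smul_def]
    simp only [hpart]
  · simp [act₀]
  · intro U V hU hV
    simp only [act₀, map_add, Finset.sum_add_distrib] at *
    rw [hU, hV]
  · intro c U hU
    simp only [act₀, map_smul, ← Finset.smul_sum] at *
    rw [hU]

end SuperPreLie

end Action

end

/-! ### The algebra `rpL*(𝐤ⁿ)`: relations and substitutions. -/

noncomputable section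

section RplAlgebra

variable {k : Type*} [Field k]

theorem Rpl.mul_mkQ {n : ℕ} (x y : FreeNA k n) :
    Rpl.mul k n ((rplIdeal k n).mkQ x) ((rplIdeal k n).mkQ y) = (rplIdeal k n).mkQ (x * y) := rfl

theorem Rpl.mul_mono {n : ℕ} (a b : FreeMagma (Option (Fin n))) :
    Rpl.mul k n (Rpl.mono k a) (Rpl.mono k b) = Rpl.mono k (a * b) := by
  rw [Rpl.mono, Rpl.mono, Rpl.mul_mkQ, FreeNA.mono_mul_mono, Rpl.mono]

theorem Rpl.induction {n : ℕ} {C : Rpl k n → Prop} (x : Rpl k n)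
    (mono : ∀ m, C (Rpl.mono k m)) (zero : C 0) (add : ∀ x y, C x → C y → C (x + y))
    (smul : ∀ (c : k) x, C x → C (c • x)) : C x := by
  obtain ⟨x, rfl⟩ := (rplIdeal k n).mkQ_surjective x
  induction x using FreeNA.induction with
  | mono m => exact mono m
  | zero => rwa [map_zero]
  | add x y hx hy =>
    rw [map_add]
    exact add _ _ hx hy
  | smul c x hx =>
    rw [map_smul]
    exact smul _ _ hx

theorem Rpl.linearMap_ext {n : ℕ} {W : Type*} [AddCommGroup W] [Module k W]
    {f g : Rpl k n →ₗ[k] W} (h : ∀ m, f (Rpl.mono k m) = g (Rpl.mono k m)) : f = g := by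
  ext x
  change f ((rplIdeal k n).mkQ _) = g ((rplIdeal k n).mkQ _)
  generalize MonoidAlgebra.single x 1 = y
  refine Rpl.induction (C := fun y => f y = g y) _ h ?_ ?_ ?_
  · simp
  · intro x y hx hy
    rw [map_add, map_add, hx, hy]
  · intro c x hx
    rw [map_smul, map_smul, hx]

theorem rplRel_subset_rplIdeal (n : ℕ) : rplRel k n ⊆ rplIdeal k n := fun x hx => by
  simp only [rplIdeal, SetLike.mem_coe, Submodule.mem_sInf]
  exact fun I hI => hI.1 hx

theorem Rpl.mul_circ_circ (n : ℕ) : Rpl.mul k n (Rpl.circ k n) (Rpl.circ k n) = 0 := by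
  rw [Rpl.circ, Rpl.mul_mono]
  exact (Submodule.Quotient.mk_eq_zero _).2 (rplRel_subset_rplIdeal n (Or.inr rfl))

theorem Rpl.mkQ_assoc {n : ℕ} (a b c : FreeMagma (Option (Fin n))) :
    (rplIdeal k n).mkQ (FreeNA.assoc k a b c) =
      Rpl.mono k (a * b * c) - Rpl.mono k (a * (b * c)) := rfl

theorem Rpl.preLie_mono {n : ℕ} (a b c : FreeMagma (Option (Fin n))) :
    Rpl.mono k (a * b * c) - Rpl.mono k (a * (b * c)) =
      ((circDeg b * circDeg c : ℕ) : ℤ).negOnePow •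
        (Rpl.mono k (a * c * b) - Rpl.mono k (a * (c * b))) := by
  rw [← Rpl.mkQ_assoc, ← Rpl.mkQ_assoc, ← sub_eq_zero, Units.smul_def, ← map_zsmul, ← map_sub,
    ← Units.smul_def]
  exact (Submodule.Quotient.mk_eq_zero _).2 (rplRel_subset_rplIdeal n (Or.inl ⟨a, b, c, rfl⟩))

/-- The substitution `∘ ↦ t ∘`, `eᵢ ↦ e_{g i}` on the free algebra. -/
def freeRelabel {n N : ℕ} (t : k) (g : Fin n → Fin N) : FreeNA k n →ₗ[k] Rpl k N :=
  FreeNA.lin fun m => t ^ circDeg m • Rpl.mono k (FreeMagma.map (Option.map g) m)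

theorem freeRelabel_mul_mono {n N : ℕ} (t : k) (g : Fin n → Fin N) (x : FreeNA k n)
    (m : FreeMagma (Option (Fin n))) :
    freeRelabel t g (x * FreeNA.mono k m) =
        Rpl.mul k N (freeRelabel t g x) (freeRelabel t g (FreeNA.mono k m)) ∧
      freeRelabel t g (FreeNA.mono k m * x) =
        Rpl.mul k N (freeRelabel t g (FreeNA.mono k m)) (freeRelabel t g x) := by
  induction x using FreeNA.induction with
  | mono a =>
    simp only [freeRelabel, FreeNA.mono_mul_mono, FreeNA.lin_mono, map_mul, circDeg_mul, map_smul,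
      LinearMap.smul_apply, Rpl.mul_mono, smul_smul, pow_add]
    refine ⟨?_, ?_⟩ <;> rw [mul_comm]
  | zero => simp
  | add x y hx hy => simp [add_mul, mul_add, hx, hy]
  | smul c x hx => rw [smul_mul_assoc, mul_smul_comm]; simp [hx]

theorem circDeg_map {n N : ℕ} (g : Fin n → Fin N) (m : FreeMagma (Option (Fin n))) :
    circDeg (FreeMagma.map (Option.map g) m) = circDeg m := by
  rw [circDeg, leafWord_map, circDeg]
  induction leafWord m with
  | nil => rfl
  | cons x w ih => rcases x with _ | i <;> simp [ih]

theorem rplIdeal_le_ker_freeRelabel {n N : ℕ} (t : k) (g : Fin n → Fin N) :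
    rplIdeal k n ≤ LinearMap.ker (freeRelabel t g) := by
  refine rplIdeal_le ?_ ?_
  · rintro x (⟨a, b, c, rfl⟩ | hx)
    · change freeRelabel t g _ = 0
      have h := Rpl.preLie_mono (k := k) (FreeMagma.map (Option.map g) a)
        (FreeMagma.map (Option.map g) b) (FreeMagma.map (Option.map g) c)
      rw [circDeg_map, circDeg_map] at h
      simp only [Units.smul_def, map_sub, map_zsmul, FreeNA.assoc, freeRelabel, FreeNA.lin_mono,
        circDeg_mul, map_mul] at h ⊢
      rw [← add_assoc, ← add_assoc, add_right_comm _ (circDeg c), ← smul_sub, h, ← smul_sub,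
        smul_comm, sub_self]
    · rw [Set.mem_singleton_iff] at hx
      subst hx
      change freeRelabel t g _ = 0
      have := Rpl.mul_circ_circ (k := k) N
      rw [Rpl.circ, Rpl.mul_mono] at this
      rw [freeRelabel, FreeNA.lin_mono]
      simp only [map_mul, FreeMagma.map_of, Option.map]
      rw [this, smul_zero]
  · intro x hx m
    rw [LinearMap.mem_ker] at hx
    have h := freeRelabel_mul_mono t g x m
    rw [hx] at h
    simpa using h

/-- The map `∘ ↦ t ∘`, `eᵢ ↦ e_{g i}`. -/
def Rpl.scaledRelabel {n N : ℕ} (t : k) (g : Fin n → Fin N) : Rpl k n →ₗ[k] Rpl k N :=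
  (rplIdeal k n).liftQ (freeRelabel t g) (rplIdeal_le_ker_freeRelabel t g)

/-- One family of substitutions serves three purposes: `t = 1` relabels the generators, `t = -1` is
the parity involution, and `t = 2` has eigenspaces that separate the degrees. -/
theorem Rpl.scaledRelabel_mono {n N : ℕ} (t : k) (g : Fin n → Fin N)
    (m : FreeMagma (Option (Fin n))) : Rpl.scaledRelabel t g (Rpl.mono k m) =
      t ^ circDeg m • Rpl.mono k (FreeMagma.map (Option.map g) m) := by
  rw [Rpl.scaledRelabel, Rpl.mono, Submodule.mkQ_apply, Submodule.liftQ_apply, freeRelabel,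
    FreeNA.lin_mono]

theorem Rpl.scaledRelabel_mul {n N : ℕ} (t : k) (g : Fin n → Fin N) (x y : Rpl k n) :
    Rpl.scaledRelabel t g (Rpl.mul k n x y) =
      Rpl.mul k N (Rpl.scaledRelabel t g x) (Rpl.scaledRelabel t g y) := by
  induction x using Rpl.induction with
  | mono a =>
    induction y using Rpl.induction with
    | mono b =>
      simp only [Rpl.mul_mono, Rpl.scaledRelabel_mono, circDeg_mul, map_mul, map_smul,
        LinearMap.smul_apply, smul_smul, pow_add, mul_comm]
    | zero => simp
    | add x y hx hy => simp [hx, hy]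
    | smul c x hx => simp [hx]
  | zero => simp
  | add x y hx hy => simp [hx, hy]
  | smul c x hx => simp [hx]

/-- The relabelling `eᵢ ↦ e_{g i}`. -/
def Rpl.relabel (k : Type*) [Field k] {n N : ℕ} (g : Fin n → Fin N) : Rpl k n →ₗ[k] Rpl k N :=
  Rpl.scaledRelabel 1 g

theorem Rpl.relabel_mono {n N : ℕ} (g : Fin n → Fin N) (m : FreeMagma (Option (Fin n))) :
    Rpl.relabel k g (Rpl.mono k m) = Rpl.mono k (FreeMagma.map (Option.map g) m) := by
  rw [Rpl.relabel, Rpl.scaledRelabel_mono, one_pow, one_smul]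

theorem Rpl.relabel_mul {n N : ℕ} (g : Fin n → Fin N) (x y : Rpl k n) :
    Rpl.relabel k g (Rpl.mul k n x y) =
      Rpl.mul k N (Rpl.relabel k g x) (Rpl.relabel k g y) := Rpl.scaledRelabel_mul 1 g x y

theorem Rpl.relabel_e {n N : ℕ} (g : Fin n → Fin N) (i : Fin n) :
    Rpl.relabel k g (Rpl.e k i) = Rpl.e k (g i) := by
  rw [Rpl.e, Rpl.relabel_mono]
  rfl

theorem Rpl.relabel_circ {n N : ℕ} (g : Fin n → Fin N) :
    Rpl.relabel k g (Rpl.circ k n) = Rpl.circ k N := by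
  rw [Rpl.circ, Rpl.relabel_mono]
  rfl

theorem Rpl.relabel_relabel {n N M : ℕ} (g : Fin n → Fin N) (h : Fin N → Fin M) (x : Rpl k n) :
    Rpl.relabel k h (Rpl.relabel k g x) = Rpl.relabel k (fun i => h (g i)) x := by
  change (Rpl.relabel k h ∘ₗ Rpl.relabel k g) x = _
  congr 1
  refine Rpl.linearMap_ext fun m => ?_
  rw [LinearMap.comp_apply, Rpl.relabel_mono, Rpl.relabel_mono, Rpl.relabel_mono]
  congr 1
  induction m with
  | ih1 x => rcases x with _ | i <;> rfl
  | ih2 a b iha ihb => simp only [map_mul, iha, ihb]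

theorem Rpl.relabel_id {n : ℕ} (x : Rpl k n) : Rpl.relabel k (fun i => i) x = x := by
  change _ = (LinearMap.id : Rpl k n →ₗ[k] Rpl k n) x
  congr 1
  refine Rpl.linearMap_ext fun m => ?_
  rw [Rpl.relabel_mono]
  congr 1
  induction m with
  | ih1 x => rcases x with _ | i <;> rfl
  | ih2 a b iha ihb => rw [map_mul, iha, ihb]

/-- The parity involution of `rpL*(𝐤ⁿ)`. -/
def Rpl.parity (k : Type*) [Field k] (n : ℕ) : Rpl k n →ₗ[k] Rpl k n :=
  Rpl.scaledRelabel (-1) fun i => i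

theorem FreeMagma.map_option_id {n : ℕ} (m : FreeMagma (Option (Fin n))) :
    FreeMagma.map (Option.map fun i => i) m = m := by
  induction m with
  | ih1 x => rcases x with _ | i <;> rfl
  | ih2 a b iha ihb => rw [map_mul, iha, ihb]

theorem Rpl.parity_mono {n : ℕ} (m : FreeMagma (Option (Fin n))) :
    Rpl.parity k n (Rpl.mono k m) = (circDeg m : ℤ).negOnePow • Rpl.mono k m := by
  rw [Rpl.parity, Rpl.scaledRelabel_mono, FreeMagma.map_option_id]
  rcases Nat.even_or_odd (circDeg m) with h | h
  · rw [h.neg_one_pow, Int.negOnePow_even _ (by exact_mod_cast h), one_smul, one_smul]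
  · rw [h.neg_one_pow, Int.negOnePow_odd _ (by exact_mod_cast h), Units.neg_smul, neg_smul,
      one_smul, one_smul]

end RplAlgebra

/-! ### The graded pre-Lie identity as a trilinear identity. -/

section PreLieCriterion

variable {k : Type*} [Field k] {X : Type*} [AddCommGroup X] [Module k X]

theorem eq_of_two_smul [CharZero k] {x y : X} (h : (2 : k) • x = (2 : k) • y) : x = y :=
  smul_right_injective X (two_ne_zero (α := k)) h

/-- The associator of a bilinear product. -/
def associator3 (star : X →ₗ[k] X →ₗ[k] X) (x y z : X) : X :=
  star (star x y) z - star x (star y z)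

/-- The graded pre-Lie identity in terms of the parity involution. -/
theorem preLie_of_parity [CharZero k] {star : X →ₗ[k] X →ₗ[k] X} {P : X →ₗ[k] X}
    (h : ∀ x y z, (2 : k) • associator3 star x y z = associator3 star x z y +
      associator3 star x (P z) y + associator3 star x z (P y) - associator3 star x (P z) (P y))
    (q r : ℤ) (x y z : X) (hy : P y = q.negOnePow • y) (hz : P z = r.negOnePow • z) :
    star (star x y) z - star x (star y z) =
      (q * r).negOnePow • (star (star x z) y - star x (star z y)) := by
  have h1 := h x y z
  refine eq_of_two_smul (k := k) (h1.trans ?_)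
  rw [hy, hz, ← associator3]
  rcases Int.even_or_odd q with hq | hq <;> rcases Int.even_or_odd r with hr | hr
  · rw [Int.negOnePow_even _ hq, Int.negOnePow_even _ hr, Int.negOnePow_even _ (hq.mul_right _)]
    simp [two_smul]
  · rw [Int.negOnePow_even _ hq, Int.negOnePow_odd _ hr, Int.negOnePow_even _ (hq.mul_right _)]
    simp [two_smul, associator3]
    abel
  · rw [Int.negOnePow_odd _ hq, Int.negOnePow_even _ hr, Int.negOnePow_even _ (hr.mul_left _)]
    simp [two_smul, associator3]
  · rw [Int.negOnePow_odd _ hq, Int.negOnePow_odd _ hr, Int.negOnePow_odd _ (hq.mul hr)]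
    simp [two_smul, associator3]
    abel

/-- The four signs on the right add up to `2` unless both arguments are odd, when they add up to
`-2`. This form makes no hypothesis on parities and is trilinear, so it can be checked on a spanning
set. -/
theorem parity_identity {star : X →ₗ[k] X →ₗ[k] X} {P : X →ₗ[k] X} {q r : ℤ} {x y z : X}
    (hy : P y = q.negOnePow • y) (hz : P z = r.negOnePow • z)
    (h : associator3 star x y z = (q * r).negOnePow • associator3 star x z y) :
    (2 : k) • associator3 star x y z = associator3 star x z y +
      associator3 star x (P z) y + associator3 star x z (P y) - associator3 star x (P z) (P y) := by
  rw [hy, hz, h]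
  rcases Int.even_or_odd q with hq | hq <;> rcases Int.even_or_odd r with hr | hr
  · rw [Int.negOnePow_even _ hq, Int.negOnePow_even _ hr, Int.negOnePow_even _ (hq.mul_right _)]
    simp [two_smul]
  · rw [Int.negOnePow_even _ hq, Int.negOnePow_odd _ hr, Int.negOnePow_even _ (hq.mul_right _)]
    simp [two_smul, associator3]
    abel
  · rw [Int.negOnePow_odd _ hq, Int.negOnePow_even _ hr, Int.negOnePow_even _ (hr.mul_left _)]
    simp [two_smul, associator3]
  · rw [Int.negOnePow_odd _ hq, Int.negOnePow_odd _ hr, Int.negOnePow_odd _ (hq.mul hr)]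
    simp [two_smul, associator3]
    abel

/-- The relations give the identity on monomials, whereas `SuperPreLie` requires it for every
eigenvector of the parity involution. The trilinear form carries it from monomials to all elements
without decomposing eigenvectors. -/
theorem Rpl.two_smul_associator {n : ℕ} (x y z : Rpl k n) :
    (2 : k) • associator3 (Rpl.mul k n) x y z = associator3 (Rpl.mul k n) x z y +
      associator3 (Rpl.mul k n) x (Rpl.parity k n z) y +
      associator3 (Rpl.mul k n) x z (Rpl.parity k n y) -
      associator3 (Rpl.mul k n) x (Rpl.parity k n z) (Rpl.parity k n y) := by
  induction x using Rpl.induction with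
  | mono a =>
    induction y using Rpl.induction with
    | mono b =>
      induction z using Rpl.induction with
      | mono c =>
        refine parity_identity (Rpl.parity_mono b) (Rpl.parity_mono c) ?_
        simp only [associator3, Rpl.mul_mono]
        exact_mod_cast Rpl.preLie_mono a b c
      | zero => simp [associator3]
      | add x y hx hy =>
        simp only [associator3, map_add, LinearMap.add_apply, smul_add, smul_sub] at hx hy ⊢
        linear_combination (norm := module) hx + hy
      | smul c x hx =>
        simp only [associator3, map_smul, LinearMap.smul_apply, smul_comm (2 : k) c, ← smul_sub,
          ← smul_add] at hx ⊢
        rw [hx]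
    | zero => simp [associator3]
    | add x y hx hy =>
      simp only [associator3, map_add, LinearMap.add_apply, smul_add, smul_sub] at hx hy ⊢
      linear_combination (norm := module) hx + hy
    | smul c x hx =>
      simp only [associator3, map_smul, LinearMap.smul_apply, smul_comm (2 : k) c, ← smul_sub,
        ← smul_add] at hx ⊢
      rw [hx]
  | zero => simp [associator3]
  | add x y hx hy =>
    simp only [associator3, map_add, LinearMap.add_apply, smul_add, smul_sub] at hx hy ⊢
    linear_combination (norm := module) hx + hy
  | smul c x hx =>
    simp only [associator3, map_smul, LinearMap.smul_apply, smul_comm (2 : k) c, ← smul_sub,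
      ← smul_add] at hx ⊢
    rw [hx]

/-- `rpL*(𝐤ⁿ)` as a graded pre-Lie algebra with the odd element `∘` of square zero. -/
def Rpl.superPreLie (k : Type*) [Field k] [CharZero k] (n : ℕ) : SuperPreLie k (Rpl k n) where
  P := Rpl.parity k n
  star := Rpl.mul k n
  lam := Rpl.circ k n
  P_P x := by
    change (Rpl.parity k n ∘ₗ Rpl.parity k n) x = (LinearMap.id : Rpl k n →ₗ[k] Rpl k n) x
    congr 1
    refine Rpl.linearMap_ext fun m => ?_
    rw [LinearMap.comp_apply, Rpl.parity_mono, Units.smul_def, map_zsmul, Rpl.parity_mono,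
      ← Units.smul_def, smul_smul, Int.units_mul_self, one_smul, LinearMap.id_apply]
  P_star x y := Rpl.scaledRelabel_mul (-1) _ x y
  P_lam := by
    rw [Rpl.circ, Rpl.parity_mono]
    simp [circDeg, leafWord_of]
  star_lam_lam := Rpl.mul_circ_circ n
  preLie := preLie_of_parity Rpl.two_smul_associator

end PreLieCriterion

end

/-! ### The operator `-[λ, ·]` in a graded pre-Lie algebra. -/

noncomputable section

section Delta

variable {k : Type*} [Field k] {X : Type*} [AddCommGroup X] [Module k X]

namespace SuperPreLie

variable (A : SuperPreLie k X)

/-- The differential `x ↦ -[λ, x] = (-1)^{|x|} x ⋆ λ - λ ⋆ x`. -/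
def delta : X →ₗ[k] X := A.star.flip A.lam ∘ₗ A.P - A.star A.lam

theorem delta_apply (x : X) : A.delta x = A.star (A.P x) A.lam - A.star A.lam x := rfl

theorem part_add_part [CharZero k] (x : X) : A.part false x + A.part true x = x := by
  simp only [part, parityDeg]
  have h2 : (2⁻¹ : k) • (x + x) = x := by
    rw [← two_smul k x, smul_smul, inv_mul_cancel₀ two_ne_zero, one_smul]
  rw [smul_add] at h2
  simp
  linear_combination (norm := module) h2

theorem P_lam' : A.P A.lam = (1 : ℤ).negOnePow • A.lam := by
  rw [A.P_lam]
  simp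

/-- As `λ` is odd, the sign `(-1)^{|y|}` of the exchange is the one by which `P` acts on `y`;
additivity over the even and odd part of `y` removes the homogeneity. -/
theorem associator_lam [CharZero k] (x y : X) :
    associator3 A.star x y A.lam = associator3 A.star x A.lam (A.P y) := by
  have h : ∀ b, associator3 A.star x (A.part b y) A.lam =
      associator3 A.star x A.lam (A.P (A.part b y)) := by
    intro b
    have := A.preLie _ _ x _ _ (A.P_part b y) A.P_lam'
    rw [associator3, this, mul_one, A.P_part, associator3]
    simp only [Units.smul_def, map_zsmul, smul_sub]
  have e1 := h false
  have e2 := h true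
  rw [← A.part_add_part y]
  simp only [associator3, map_add, LinearMap.add_apply] at e1 e2 ⊢
  linear_combination (norm := module) e1 + e2

/-- Exchanging two equal odd arguments shows that `Φ(x, λ, λ)` is its own negative. Since `λ ⋆ λ =
0`, only `(x ⋆ λ) ⋆ λ` is left of it. -/
theorem star_star_lam_lam [CharZero k] (x : X) : A.star (A.star x A.lam) A.lam = 0 := by
  have h := A.associator_lam x A.lam
  rw [A.P_lam] at h
  simp only [associator3, map_neg, A.star_lam_lam, sub_zero, map_zero] at h
  have h2 : (2 : k) • A.star (A.star x A.lam) A.lam = (2 : k) • (0 : X) := by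
    linear_combination (norm := module) h
  exact eq_of_two_smul h2

theorem P_delta (x : X) : A.P (A.delta x) = -A.delta (A.P x) := by
  rw [A.delta_apply, A.delta_apply, map_sub, A.P_star, A.P_star, A.P_lam]
  simp
  abel

/-- The term `(x ⋆ λ) ⋆ λ` vanishes, and the other three cancel by `Φ(λ, P x, λ) = Φ(λ, λ, x)`
together with `λ ⋆ λ = 0`. -/
theorem delta_delta [CharZero k] (x : X) : A.delta (A.delta x) = 0 := by
  have h := A.associator_lam A.lam (A.P x)
  rw [A.P_P] at h
  simp only [associator3, A.star_lam_lam, map_zero, LinearMap.zero_apply] at h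
  rw [A.delta_apply (A.delta x), P_delta, A.delta_apply, A.delta_apply, A.P_P]
  simp only [map_sub, map_neg, LinearMap.neg_apply, LinearMap.sub_apply, A.star_star_lam_lam]
  linear_combination (norm := module) h

/-- Right multiplication by `λ` fails to be a derivation by associators that match under `Φ(P x, P
y, λ) = Φ(P x, λ, y)`. Left multiplication leaves over `Φ(λ, x, y)`, the extra term in the
definition of `d`. -/
theorem delta_star [CharZero k] (x y : X) : A.delta (A.star x y) =
    A.star (A.delta x) y + A.star (A.P x) (A.delta y) + associator3 A.star A.lam x y := by
  have h := A.associator_lam (A.P x) (A.P y)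
  rw [A.P_P] at h
  simp only [associator3, A.delta_apply, map_sub, LinearMap.sub_apply, A.P_star] at h ⊢
  linear_combination (norm := module) h

end SuperPreLie

end Delta

/-! ### The differential of `rpL*(𝐤ⁿ)` as the sum of `-[∘, ·]` and a derivation. -/

section Differential

variable {k : Type*} [Field k] {n : ℕ}

/-- The values on monomials of the derivation with `eᵢ ↦ ∘ ⋆ eᵢ - eᵢ ⋆ ∘` and `∘ ↦ 0`. -/
def rplDerMono (k : Type*) [Field k] {n : ℕ} : FreeMagma (Option (Fin n)) → Rpl k n
  | FreeMagma.of none => 0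
  | FreeMagma.of (some i) => Rpl.mul k n (Rpl.circ k n) (Rpl.e k i) -
      Rpl.mul k n (Rpl.e k i) (Rpl.circ k n)
  | FreeMagma.mul a b => Rpl.mul k n (rplDerMono k a) (Rpl.mono k b) +
      (circDeg a : ℤ).negOnePow • Rpl.mul k n (Rpl.mono k a) (rplDerMono k b)

theorem rplDerMono_mul (a b : FreeMagma (Option (Fin n))) : rplDerMono k (a * b) =
    Rpl.mul k n (rplDerMono k a) (Rpl.mono k b) +
      (circDeg a : ℤ).negOnePow • Rpl.mul k n (Rpl.mono k a) (rplDerMono k b) := rfl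

theorem circDeg_none : circDeg (FreeMagma.of (none : Option (Fin n))) = 1 := by
  simp [circDeg, leafWord_of]

theorem circDeg_some (i : Fin n) : circDeg (FreeMagma.of (some i)) = 0 := by
  simp [circDeg, leafWord_of]

theorem Rpl.mono_mem_gr (m : FreeMagma (Option (Fin n))) :
    Rpl.mono k m ∈ Rpl.gr k n (circDeg m) :=
  Submodule.subset_span ⟨m, rfl, rfl⟩

theorem Rpl.mul_mem_gr {p q : ℤ} {x y : Rpl k n} (hx : x ∈ Rpl.gr k n p)
    (hy : y ∈ Rpl.gr k n q) : Rpl.mul k n x y ∈ Rpl.gr k n (p + q) := by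
  induction hx using Submodule.span_induction with
  | mem x hx =>
    obtain ⟨a, ha, rfl⟩ := hx
    induction hy using Submodule.span_induction with
    | mem y hy =>
      obtain ⟨b, hb, rfl⟩ := hy
      rw [Rpl.mul_mono]
      exact Submodule.subset_span ⟨_, by rw [circDeg_mul, ← ha, ← hb]; push_cast; rfl, rfl⟩
    | zero => simp
    | add x y _ _ hx hy =>
      rw [map_add]
      exact add_mem hx hy
    | smul c x _ hx =>
      rw [map_smul]
      exact Submodule.smul_mem _ _ hx
  | zero => simp
  | add x y _ _ hx hy =>
    rw [map_add]
    exact add_mem hx hy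
  | smul c x _ hx =>
    rw [map_smul]
    exact Submodule.smul_mem _ _ hx

theorem Rpl.parity_of_mem_gr {p : ℤ} {x : Rpl k n} (hx : x ∈ Rpl.gr k n p) :
    Rpl.parity k n x = p.negOnePow • x := by
  induction hx using Submodule.span_induction with
  | mem x hx =>
    obtain ⟨a, rfl, rfl⟩ := hx
    exact Rpl.parity_mono a
  | zero => simp
  | add x y _ _ hx hy => rw [map_add, hx, hy, smul_add]
  | smul c x _ hx => rw [map_smul, hx, smul_comm]

theorem rplDerMono_mem_gr (m : FreeMagma (Option (Fin n))) :
    rplDerMono k m ∈ Rpl.gr k n (circDeg m + 1) := by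
  induction m with
  | ih1 x =>
    rcases x with _ | i
    · exact zero_mem _
    · have h1 := Rpl.mono_mem_gr (k := k) (FreeMagma.of (none : Option (Fin n)))
      have h2 := Rpl.mono_mem_gr (k := k) (FreeMagma.of (some i))
      rw [circDeg_none] at h1
      rw [circDeg_some] at h2
      rw [circDeg_some]
      refine sub_mem ?_ ?_
      · rw [add_comm]
        exact Rpl.mul_mem_gr h1 h2
      · exact Rpl.mul_mem_gr h2 h1
  | ih2 a b iha ihb =>
    rw [rplDerMono_mul, circDeg_mul]
    refine add_mem ?_ ?_
    · convert Rpl.mul_mem_gr iha (Rpl.mono_mem_gr b) using 1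
      push_cast
      ring_nf
    · rw [Units.smul_def]
      refine zsmul_mem ?_ _
      convert Rpl.mul_mem_gr (Rpl.mono_mem_gr a) ihb using 1
      push_cast
      ring_nf

theorem rplDer_mul_mono (x : FreeNA k n) (m : FreeMagma (Option (Fin n))) :
    FreeNA.lin (k := k) (rplDerMono k) (x * FreeNA.mono k m) =
        Rpl.mul k n (FreeNA.lin (rplDerMono k) x) (Rpl.mono k m) +
          Rpl.mul k n (Rpl.parity k n ((rplIdeal k n).mkQ x)) (rplDerMono k m) ∧
      FreeNA.lin (k := k) (rplDerMono k) (FreeNA.mono k m * x) =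
        Rpl.mul k n (rplDerMono k m) ((rplIdeal k n).mkQ x) +
          Rpl.mul k n (Rpl.parity k n (Rpl.mono k m)) (FreeNA.lin (rplDerMono k) x) := by
  induction x using FreeNA.induction with
  | mono a =>
    change _ = _ + Rpl.mul k n (Rpl.parity k n (Rpl.mono k a)) _ ∧
      _ = Rpl.mul k n _ (Rpl.mono k a) + _
    simp only [FreeNA.mono_mul_mono, FreeNA.lin_mono, rplDerMono_mul, Rpl.parity_mono,
      Units.smul_def, map_zsmul, LinearMap.smul_apply, and_self]
  | zero => simp
  | add x y hx hy =>
    simp only [add_mul, mul_add, map_add, hx.1, hx.2, hy.1, hy.2, LinearMap.add_apply]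
    constructor <;> abel
  | smul c x hx =>
    simp only [smul_mul_assoc, mul_smul_comm, map_smul, hx.1, hx.2, LinearMap.smul_apply, smul_add,
      and_self]

theorem Rpl.preLie [CharZero k] {q r : ℤ} (x : Rpl k n) {y z : Rpl k n}
    (hy : Rpl.parity k n y = q.negOnePow • y) (hz : Rpl.parity k n z = r.negOnePow • z) :
    Rpl.mul k n (Rpl.mul k n x y) z - Rpl.mul k n x (Rpl.mul k n y z) =
      (q * r).negOnePow •
        (Rpl.mul k n (Rpl.mul k n x z) y - Rpl.mul k n x (Rpl.mul k n z y)) :=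
  (Rpl.superPreLie k n).preLie q r x y z hy hz

/-- Applying the derivation to a relation gives the sum of three instances of the pre-Lie identity,
with the derivation moved into the first, second or third argument. Multiplied by the sign of
passing the earlier arguments, these are `h1`, `h2` and `h3`. -/
theorem rplDer_rel [CharZero k] (a b c : FreeMagma (Option (Fin n))) :
    FreeNA.lin (k := k) (rplDerMono k) (FreeNA.assoc k a b c -
      ((circDeg b * circDeg c : ℕ) : ℤ).negOnePow • FreeNA.assoc k a c b) = 0 := by
  have hP : ∀ m, Rpl.parity k n (Rpl.mono k m) = (circDeg m : ℤ).negOnePow • Rpl.mono k m :=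
    Rpl.parity_mono
  have hPD : ∀ m, Rpl.parity k n (rplDerMono k m) = (circDeg m + 1 : ℤ).negOnePow • rplDerMono k m :=
    fun m => Rpl.parity_of_mem_gr (rplDerMono_mem_gr m)
  have h1 := Rpl.preLie (rplDerMono k a) (hP b) (hP c)
  have h2 := congrArg (fun x => (circDeg a : ℤ).negOnePow • x)
    (Rpl.preLie (Rpl.mono k a) (hPD b) (hP c))
  have h3 := congrArg (fun x => ((circDeg a : ℤ) + circDeg b).negOnePow • x)
    (Rpl.preLie (Rpl.mono k a) (hP b) (hPD c))
  rw [map_sub, Units.smul_def, map_zsmul, FreeNA.assoc, FreeNA.assoc, map_sub, map_sub,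
    FreeNA.lin_mono, FreeNA.lin_mono, FreeNA.lin_mono, FreeNA.lin_mono]
  simp only [rplDerMono_mul, circDeg_mul, map_add, LinearMap.add_apply, Units.smul_def, map_zsmul,
    LinearMap.smul_apply, ← Rpl.mul_mono] at h1 h2 h3 ⊢
  push_cast at h1 h2 h3 ⊢
  simp only [add_mul, mul_add, one_mul, mul_one, Int.negOnePow_add, Units.val_mul] at h1 h2 h3 ⊢
  generalize ((circDeg b : ℤ) * circDeg c).negOnePow = s at *
  generalize (circDeg a : ℤ).negOnePow = sa at *
  generalize (circDeg b : ℤ).negOnePow = sb at *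
  generalize (circDeg c : ℤ).negOnePow = sc at *
  rcases Int.units_eq_one_or s with rfl | rfl <;> rcases Int.units_eq_one_or sa with rfl | rfl <;>
  rcases Int.units_eq_one_or sb with rfl | rfl <;> rcases Int.units_eq_one_or sc with rfl | rfl <;>
  simp only [Units.val_one, Units.val_neg, one_smul, neg_smul, mul_one, mul_neg, neg_neg]
    at h1 h2 h3 ⊢ <;> linear_combination (norm := abel) h1 + h2 + h3

/-- The odd derivation of `rpL*(𝐤ⁿ)` with `eᵢ ↦ ∘ ⋆ eᵢ - eᵢ ⋆ ∘` and `∘ ↦ 0`. -/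
def Rpl.der (k : Type*) [Field k] [CharZero k] (n : ℕ) : Rpl k n →ₗ[k] Rpl k n :=
  (rplIdeal k n).liftQ (FreeNA.lin (rplDerMono k)) (by
    -- The kernel alone is not an ideal: `D (x m)` contains a term with `x` undifferentiated.
    -- Intersecting with the ideal makes that term vanish in the quotient.
    refine (rplIdeal_le (J := rplIdeal k n ⊓ LinearMap.ker (FreeNA.lin (rplDerMono k)))
      ?_ ?_).trans inf_le_right
    · intro x hx
      refine ⟨rplRel_subset_rplIdeal n hx, ?_⟩
      change FreeNA.lin (rplDerMono k) x = 0
      rcases hx with ⟨a, b, c, rfl⟩ | hx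
      · exact rplDer_rel a b c
      · rw [Set.mem_singleton_iff] at hx
        subst hx
        rw [FreeNA.lin_mono, rplDerMono_mul]
        simp [rplDerMono]
    · rintro x ⟨hx, hx'⟩ m
      have h0 : (rplIdeal k n).mkQ x = 0 := (Submodule.Quotient.mk_eq_zero _).2 hx
      have h1 := rplDer_mul_mono x m
      rw [LinearMap.mem_ker.1 hx', h0] at h1
      simp only [map_zero, LinearMap.zero_apply, add_zero] at h1
      exact ⟨⟨(rplIdeal_mul_mem hx _).1, h1.1⟩, ⟨(rplIdeal_mul_mem hx _).2, h1.2⟩⟩)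

theorem Rpl.parity_e (i : Fin n) : Rpl.parity k n (Rpl.e k i) = Rpl.e k i := by
  rw [Rpl.e, Rpl.parity_mono, circDeg_some]
  simp

variable [CharZero k]

theorem Rpl.der_mono (m : FreeMagma (Option (Fin n))) :
    Rpl.der k n (Rpl.mono k m) = rplDerMono k m := by
  rw [Rpl.der, Rpl.mono, Submodule.mkQ_apply, Submodule.liftQ_apply, FreeNA.lin_mono]

theorem Rpl.der_mul (x y : Rpl k n) : Rpl.der k n (Rpl.mul k n x y) =
    Rpl.mul k n (Rpl.der k n x) y + Rpl.mul k n (Rpl.parity k n x) (Rpl.der k n y) := by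
  induction x using Rpl.induction with
  | mono a =>
    induction y using Rpl.induction with
    | mono b =>
      simp only [Rpl.mul_mono, Rpl.der_mono, rplDerMono_mul, Rpl.parity_mono, Units.smul_def,
        map_zsmul, LinearMap.smul_apply]
    | zero => simp
    | add x y hx hy =>
      simp only [map_add, hx, hy]
      abel
    | smul c x hx => simp only [map_smul, hx, smul_add]
  | zero => simp
  | add x y hx hy =>
    simp only [map_add, hx, hy, LinearMap.add_apply]
    abel
  | smul c x hx => simp only [map_smul, hx, smul_add, LinearMap.smul_apply]

theorem Rpl.der_mem_gr {p : ℤ} {x : Rpl k n} (hx : x ∈ Rpl.gr k n p) :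
    Rpl.der k n x ∈ Rpl.gr k n (p + 1) := by
  induction hx using Submodule.span_induction with
  | mem x hx =>
    obtain ⟨a, rfl, rfl⟩ := hx
    rw [Rpl.der_mono]
    exact rplDerMono_mem_gr a
  | zero => simp
  | add x y _ _ hx hy =>
    rw [map_add]
    exact add_mem hx hy
  | smul c x _ hx =>
    rw [map_smul]
    exact Submodule.smul_mem _ _ hx

theorem Rpl.parity_der (x : Rpl k n) :
    Rpl.parity k n (Rpl.der k n x) = -Rpl.der k n (Rpl.parity k n x) := by
  induction x using Rpl.induction with
  | mono a =>
    rw [Rpl.parity_mono, Rpl.der_mono, Rpl.parity_of_mem_gr (rplDerMono_mem_gr a),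
      Int.negOnePow_succ]
    simp only [Units.smul_def, map_zsmul, Rpl.der_mono, Units.val_neg, neg_smul]
  | zero => simp
  | add x y hx hy =>
    simp only [map_add, hx, hy]
    abel
  | smul c x hx => simp only [map_smul, hx, smul_neg]

theorem Rpl.der_circ : Rpl.der k n (Rpl.circ k n) = 0 := by
  rw [Rpl.circ, Rpl.der_mono]
  rfl

theorem Rpl.delta_apply (x : Rpl k n) : (Rpl.superPreLie k n).delta x =
    Rpl.mul k n (Rpl.parity k n x) (Rpl.circ k n) - Rpl.mul k n (Rpl.circ k n) x := rfl

theorem Rpl.parity_circ : Rpl.parity k n (Rpl.circ k n) = -Rpl.circ k n :=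
  (Rpl.superPreLie k n).P_lam

theorem Rpl.der_e (i : Fin n) :
    Rpl.der k n (Rpl.e k i) = -(Rpl.superPreLie k n).delta (Rpl.e k i) := by
  rw [Rpl.delta_apply, Rpl.parity_e, Rpl.e, Rpl.der_mono, rplDerMono, neg_sub]
  rfl

/-- An odd derivation that kills `∘` anticommutes with left and right multiplication by `∘`, up to
the parity signs present in `δ`. -/
theorem Rpl.der_delta (x : Rpl k n) : Rpl.der k n ((Rpl.superPreLie k n).delta x) =
    -(Rpl.superPreLie k n).delta (Rpl.der k n x) := by
  rw [Rpl.delta_apply, Rpl.delta_apply, map_sub, Rpl.der_mul, Rpl.der_mul, Rpl.der_circ,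
    Rpl.parity_der, Rpl.parity_circ]
  simp only [map_zero, map_neg, LinearMap.neg_apply, LinearMap.zero_apply]
  abel

/-- In the square of an odd derivation the mixed terms of the Leibniz rule cancel, so it suffices to
look at generators. There `D eᵢ = -δ eᵢ`, and `D² eᵢ = -D δ eᵢ = δ D eᵢ = -δ² eᵢ = 0`. -/
theorem Rpl.der_der (x : Rpl k n) : Rpl.der k n (Rpl.der k n x) = 0 := by
  have h : Rpl.der k n ∘ₗ Rpl.der k n = 0 := by
    refine Rpl.linearMap_ext fun m => ?_
    change Rpl.der k n (Rpl.der k n (Rpl.mono k m)) = 0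
    induction m with
    | ih1 x =>
      rcases x with _ | i
      · change Rpl.der k n (Rpl.der k n (Rpl.circ k n)) = 0
        rw [Rpl.der_circ, map_zero]
      · change Rpl.der k n (Rpl.der k n (Rpl.e k i)) = 0
        rw [Rpl.der_e, map_neg, Rpl.der_delta, Rpl.der_e, map_neg, SuperPreLie.delta_delta]
        simp
    | ih2 a b iha ihb =>
      rw [← Rpl.mul_mono, Rpl.der_mul, map_add, Rpl.der_mul, Rpl.der_mul, iha, ihb,
        Rpl.parity_der]
      simp
  exact LinearMap.congr_fun h x

/-- The differential of `rpL*(𝐤ⁿ)`. -/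
def Rpl.diff (k : Type*) [Field k] [CharZero k] (n : ℕ) : Rpl k n →ₗ[k] Rpl k n :=
  (Rpl.superPreLie k n).delta + Rpl.der k n

theorem Rpl.diff_diff (x : Rpl k n) : Rpl.diff k n (Rpl.diff k n x) = 0 := by
  simp only [Rpl.diff, LinearMap.add_apply, map_add, SuperPreLie.delta_delta, Rpl.der_delta,
    Rpl.der_der]
  abel

theorem Rpl.diff_e (i : Fin n) : Rpl.diff k n (Rpl.e k i) = 0 := by
  rw [Rpl.diff, LinearMap.add_apply, Rpl.der_e, add_neg_cancel]

theorem Rpl.diff_mem_gr {p : ℤ} {x : Rpl k n} (hx : x ∈ Rpl.gr k n p) :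
    Rpl.diff k n x ∈ Rpl.gr k n (p + 1) := by
  have hc : Rpl.circ k n ∈ Rpl.gr k n 1 := by
    have := Rpl.mono_mem_gr (k := k) (FreeMagma.of (none : Option (Fin n)))
    rwa [circDeg_none] at this
  rw [Rpl.diff, LinearMap.add_apply, Rpl.delta_apply, Rpl.parity_of_mem_gr hx]
  refine add_mem (sub_mem ?_ ?_) (Rpl.der_mem_gr hx)
  · rw [Units.smul_def, map_zsmul, LinearMap.smul_apply]
    exact zsmul_mem (Rpl.mul_mem_gr hx hc) _
  · rw [add_comm]
    exact Rpl.mul_mem_gr hc hx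

/-- `δ` contributes the associator in the twisted Leibniz rule, `D` is a true derivation and leaves
it unchanged, and the value of `D` on `eᵢ` was chosen to cancel that of `δ`. -/
theorem Rpl.isDifferential_diff : Rpl.IsDifferential (Rpl.diff k n) := by
  refine ⟨fun p x hx => Rpl.diff_mem_gr hx, Rpl.diff_e, ?_, fun p a ha b => ?_⟩
  · rw [Rpl.diff, LinearMap.add_apply, Rpl.delta_apply, Rpl.der_circ, Rpl.parity_circ]
    simp [Rpl.mul_circ_circ]
  · have h := (Rpl.superPreLie k n).delta_star a b
    change (Rpl.superPreLie k n).delta (Rpl.mul k n a b) =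
      Rpl.mul k n ((Rpl.superPreLie k n).delta a) b +
        Rpl.mul k n (Rpl.parity k n a) ((Rpl.superPreLie k n).delta b) +
        associator3 (Rpl.mul k n) (Rpl.circ k n) a b at h
    rw [Rpl.diff, LinearMap.add_apply, h, Rpl.der_mul, Rpl.parity_of_mem_gr ha, associator3]
    simp only [LinearMap.add_apply, map_add, Units.smul_def, map_zsmul, LinearMap.smul_apply,
      smul_add]
    abel

end Differential

end

/-! ### Substitution of monomials into monomials. -/

noncomputable section

section Substitution

variable {m n : ℕ}

theorem label_cases (i : Fin (m + 1)) (t : Fin (m + n + 1)) :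
    (∃ l : Fin (n + 1), t = innerLabel i l) ∨ ∃ j, j ≠ i ∧ t = outerLabel n i j := by
  rcases lt_or_ge t.val i.val with h | h
  · refine Or.inr ⟨⟨t, by omega⟩, fun h' => ?_, ?_⟩
    · rw [← h'] at h
      exact lt_irrefl _ h
    · rw [outerLabel, if_pos (show (⟨t, _⟩ : Fin (m + 1)) ≤ i from h.le)]
  · rcases Nat.lt_or_ge t.val (i.val + n + 1) with h1 | h1
    · refine Or.inl ⟨⟨t - i, by omega⟩, Fin.ext ?_⟩
      simp only [innerLabel]
      omega
    · refine Or.inr ⟨⟨t - n, by omega⟩, fun h' => ?_, ?_⟩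
      · have := congrArg Fin.val h'
        simp only at this
        omega
      · rw [outerLabel, if_neg]
        · refine Fin.ext ?_
          simp only
          omega
        · rw [Fin.le_def]
          simp only
          omega

theorem substMono_mul (i : Fin (m + 1)) (a a' : FreeMagma (Option (Fin (m + 1))))
    (b : FreeMagma (Option (Fin (n + 1)))) :
    substMono i (a * a') b = substMono i a b * substMono i a' b := by
  simp [substMono]

theorem substMono_some (i j : Fin (m + 1)) (b : FreeMagma (Option (Fin (n + 1)))) :
    substMono i (FreeMagma.of (some j)) b =
      if j = i then FreeMagma.map (Option.map (innerLabel i)) b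
        else FreeMagma.of (some (outerLabel n i j)) := rfl

theorem leafWord_substMono (i : Fin (m + 1)) (a : FreeMagma (Option (Fin (m + 1))))
    (b : FreeMagma (Option (Fin (n + 1)))) :
    leafWord (substMono i a b) = (leafWord a).flatMap (substLetter i (leafWord b)) := by
  induction a with
  | ih1 x =>
    rcases x with _ | j
    · rfl
    · rw [substMono_some, leafWord_of, List.flatMap_singleton, substLetter]
      split_ifs
      · rw [leafWord_map]
      · rfl
  | ih2 a a' ih ih' =>
    rw [substMono_mul, leafWord_mul, leafWord_mul, List.flatMap_append, ih, ih']

theorem IsMultilinearMono.substMono (i : Fin (m + 1)) {a : FreeMagma (Option (Fin (m + 1)))}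
    {b : FreeMagma (Option (Fin (n + 1)))} (ha : IsMultilinearMono a)
    (hb : IsMultilinearMono b) : IsMultilinearMono (substMono i a b) := by
  intro t
  obtain ⟨u, v, hw, hu, hv⟩ := exists_split_of_multilinear (w := leafWord a) ha i
  rw [leafWord_substMono, hw, List.flatMap_append, List.flatMap_cons, flatMap_substLetter _ hu,
    flatMap_substLetter _ hv, List.count_append, List.count_append]
  have hsub : substLetter i (leafWord b) (some i) = (leafWord b).map (Option.map (innerLabel i)) :=
    if_pos rfl
  rw [hsub]
  rcases label_cases i t with ⟨l, rfl⟩ | ⟨j, hj, rfl⟩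
  · have h1 : ∀ s : List (Option (Fin (m + 1))), some i ∉ s →
        (s.map (Option.map (outerLabel n i))).count (some (innerLabel i l)) = 0 := by
      intro s hs
      rw [List.count_eq_zero]
      intro h
      obtain ⟨x, hx, hx'⟩ := List.mem_map.1 h
      rcases x with _ | j
      · simp at hx'
      · have hj : j ≠ i := fun h => hs (by rw [← h]; exact hx)
        exact innerLabel_ne_outerLabel hj l (Option.some_injective _ hx').symm
    rw [h1 u hu, h1 v hv, show (some (innerLabel i l) : Option (Fin (m + n + 1))) =
      Option.map (innerLabel i) (some l) from rfl,
      List.count_map_of_injective _ _ (Option.map_injective (innerLabel_injective i)), hb l]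
  · have h1 : ((leafWord b).map (Option.map (innerLabel i))).count (some (outerLabel n i j)) = 0 := by
      rw [List.count_eq_zero]
      intro h
      obtain ⟨x, hx, hx'⟩ := List.mem_map.1 h
      rcases x with _ | l
      · simp at hx'
      · exact innerLabel_ne_outerLabel hj l (Option.some_injective _ hx')
    have h2 := ha j
    rw [hw, List.count_append, List.count_cons_of_ne (by simpa using hj.symm)] at h2
    rw [h1, show (some (outerLabel n i j) : Option (Fin (m + n + 1))) =
      Option.map (outerLabel n i) (some j) from rfl,
      List.count_map_of_injective _ _ (Option.map_injective (outerLabel_injective i)),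
      List.count_map_of_injective _ _ (Option.map_injective (outerLabel_injective i))]
    omega

theorem IsMultilinearMono.map_perm (σ : Equiv.Perm (Fin n)) {a : FreeMagma (Option (Fin n))}
    (ha : IsMultilinearMono a) : IsMultilinearMono (FreeMagma.map (Option.map σ) a) := by
  intro t
  rw [leafWord_map, show (some t : Option (Fin n)) = Option.map σ (some (σ.symm t)) by simp,
    List.count_map_of_injective _ _ (Option.map_injective σ.injective), ha]

end Substitution

/-! ### Operadic composition as an action, and the composition law of actions. -/

section ActionLaws

variable {k : Type*} [Field k] {X : Type*} [AddCommGroup X] [Module k X]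

namespace SuperPreLie

variable (A : SuperPreLie k X) {m n : ℕ}

theorem evalM_map {N : ℕ} (g : Fin n → Fin N) (f : Fin N → X) (a : FreeMagma (Option (Fin n))) :
    A.evalM f (FreeMagma.map (Option.map g) a) = A.evalM (fun i => f (g i)) a := by
  induction a with
  | ih1 x => rcases x with _ | j <;> rfl
  | ih2 a b iha ihb => rw [map_mul, evalM_mul, evalM_mul, iha, ihb]

theorem evalM_substMono (i : Fin (m + 1)) (f : Fin (m + n + 1) → X)
    (a : FreeMagma (Option (Fin (m + 1)))) (b : FreeMagma (Option (Fin (n + 1)))) :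
    A.evalM f (substMono i a b) = A.evalM (fun j => if j = i
      then A.evalM (fun l => f (innerLabel i l)) b else f (outerLabel n i j)) a := by
  induction a with
  | ih1 x =>
    rcases x with _ | j
    · rfl
    · rw [substMono_some, evalM_some]
      split_ifs
      · rw [evalM_map]
      · rfl
  | ih2 a a' ih ih' => rw [substMono_mul, evalM_mul, evalM_mul, ih, ih']

theorem evalM_update_smul (f : Fin n → X) (i : Fin n) (s : ℤˣ) (x : X)
    {a : FreeMagma (Option (Fin n))} (ha : IsMultilinearMono a) :
    A.evalM (Function.update f i (s • x)) a = s • A.evalM (Function.update f i x) a := by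
  obtain ⟨ℓ, hℓ⟩ := A.exists_evalM_update f i (ha i)
  rw [hℓ, hℓ, Units.smul_def, map_zsmul]
  rfl

end SuperPreLie

theorem ite_eq_update {α β : Type*} [DecidableEq α] (i : α) (x : β) (f : α → β) :
    (fun j => if j = i then x else f j) = Function.update f i x := by
  funext j
  by_cases h : j = i
  · subst h
    simp
  · simp [h]

theorem rplMultilinear_mono_induction {n : ℕ} {C : rplMultilinear k n → Prop}
    (mono : ∀ (m : FreeMagma (Option (Fin n))) (x : rplMultilinear k n), IsMultilinearMono m →
      (x : Rpl k n) = Rpl.mono k m → C x) (zero : C 0)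
    (add : ∀ x y, C x → C y → C (x + y)) (smul : ∀ (c : k) x, C x → C (c • x))
    (x : rplMultilinear k n) : C x := by
  obtain ⟨x, hx⟩ := x
  induction hx using Submodule.span_induction with
  | mem x h =>
    obtain ⟨m, hm, rfl⟩ := h
    exact mono m _ hm rfl
  | zero => exact zero
  | add x y h1 h2 hx hy => exact add ⟨x, h1⟩ ⟨y, h2⟩ hx hy
  | smul c x h hx => exact smul c ⟨x, h⟩ hx

/-- The action of a permutation on `rpL*(n)`. -/
def rplPerm (k : Type*) [Field k] {n : ℕ} (σ : Equiv.Perm (Fin n)) :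
    rplMultilinear k n →ₗ[k] rplMultilinear k n :=
  (Rpl.relabel k σ).restrict fun x hx => by
    induction hx using Submodule.span_induction with
    | mem x h =>
      obtain ⟨m, hm, rfl⟩ := h
      rw [Rpl.relabel_mono]
      exact mono_mem_rplMultilinear (hm.map_perm σ)
    | zero => simp
    | add x y h1 h2 hx hy =>
      rw [map_add]
      exact add_mem hx hy
    | smul c x h hx =>
      rw [map_smul]
      exact Submodule.smul_mem _ _ hx

theorem coe_rplPerm {n : ℕ} (σ : Equiv.Perm (Fin n)) (x : rplMultilinear k n) :
    (rplPerm k σ x : Rpl k n) = Rpl.relabel k σ x := rfl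

variable [CharZero k] {m n : ℕ}

/-- Partial composition in `rpL*`, with values in the pre-Lie algebra. -/
def rplCompAux (k : Type*) [Field k] [CharZero k] {m n : ℕ} (i : Fin (m + 1)) :
    rplMultilinear k (m + 1) →ₗ[k] rplMultilinear k (n + 1) →ₗ[k] Rpl k (m + n + 1) :=
  LinearMap.mk₂ k (fun a b => (Rpl.superPreLie k (m + n + 1)).act (m + 1) a
      (Function.update (fun j => Rpl.e k (outerLabel n i j)) i
        (Rpl.relabel k (innerLabel i) (b : Rpl k (n + 1)))))
    (fun a a' b => by rw [map_add, add_apply])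
    (fun c a b => by rw [map_smul, smul_apply])
    (fun a b b' => by rw [Submodule.coe_add, map_add, MultilinearMap.map_update_add])
    (fun c a b => by rw [Submodule.coe_smul, map_smul, MultilinearMap.map_update_smul])

theorem rplCompAux_apply (i : Fin (m + 1)) (a : rplMultilinear k (m + 1))
    (b : rplMultilinear k (n + 1)) : rplCompAux k i a b =
      (Rpl.superPreLie k (m + n + 1)).act (m + 1) a
        (Function.update (fun j => Rpl.e k (outerLabel n i j)) i
          (Rpl.relabel k (innerLabel i) (b : Rpl k (n + 1)))) := rfl

/-- Evaluation at the generators gives back the monomial. This makes composition in `rpL*` a case of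
the action on pre-Lie algebras. -/
theorem evalM_e (a : FreeMagma (Option (Fin n))) :
    (Rpl.superPreLie k n).evalM (Rpl.e k) a = Rpl.mono k a := by
  induction a with
  | ih1 x => rcases x with _ | j <;> rfl
  | ih2 a b iha ihb =>
    rw [SuperPreLie.evalM_mul, iha, ihb]
    exact Rpl.mul_mono a b

theorem evalM_relabel_e {N : ℕ} (g : Fin n → Fin N) (a : FreeMagma (Option (Fin n))) :
    (Rpl.superPreLie k N).evalM (fun i => Rpl.e k (g i)) a =
      Rpl.mono k (FreeMagma.map (Option.map g) a) := by
  rw [← evalM_e, SuperPreLie.evalM_map]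

/-- The generators have degree zero, so only slot `i`, holding `b`, carries a degree. The Koszul
sign of the action is then the one at `Pi.single i |b|`. -/
theorem rplCompAux_mono (i : Fin (m + 1)) {a : FreeMagma (Option (Fin (m + 1)))}
    {b : FreeMagma (Option (Fin (n + 1)))} (ha : IsMultilinearMono a)
    {x : rplMultilinear k (m + 1)} {y : rplMultilinear k (n + 1)}
    (hx : (x : Rpl k (m + 1)) = Rpl.mono k a) (hy : (y : Rpl k (n + 1)) = Rpl.mono k b) :
    rplCompAux k i x y =
      koszulSign (Pi.single i (circDeg b : ℤ)) (leafWord a) • Rpl.mono k (substMono i a b) := by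
  rw [rplCompAux_apply, hy, SuperPreLie.act_mono (p := Pi.single i (circDeg b : ℤ)) _ _ ha hx]
  · congr 1
    rw [← evalM_e (substMono i a b), SuperPreLie.evalM_substMono, ite_eq_update]
    congr 1
    rw [evalM_relabel_e, Rpl.relabel_mono]
  · intro j
    change Rpl.parity k _ _ = _
    by_cases h : j = i
    · subst h
      rw [Function.update_self, Pi.single_eq_same, Rpl.relabel_mono, Rpl.parity_mono, circDeg_map]
    · rw [Function.update_of_ne h, Pi.single_eq_of_ne h, Rpl.parity_e]
      simp

theorem rplCompAux_mem (i : Fin (m + 1)) (a : rplMultilinear k (m + 1))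
    (b : rplMultilinear k (n + 1)) : rplCompAux k i a b ∈ rplMultilinear k (m + n + 1) := by
  induction a using rplMultilinear_mono_induction with
  | mono a x ha hx =>
    induction b using rplMultilinear_mono_induction with
    | mono b y hb hy =>
      rw [rplCompAux_mono i ha hx hy, Units.smul_def]
      exact zsmul_mem (mono_mem_rplMultilinear (ha.substMono i hb)) _
    | zero => simp
    | add y y' hy hy' =>
      rw [map_add]
      exact add_mem hy hy'
    | smul c y hy =>
      rw [map_smul]
      exact Submodule.smul_mem _ _ hy
  | zero => simp
  | add y y' hy hy' =>
    rw [map_add]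
    exact add_mem hy hy'
  | smul c y hy =>
    rw [map_smul]
    exact Submodule.smul_mem _ _ hy

/-- Partial composition in `rpL*`. -/
def rplComp (k : Type*) [Field k] [CharZero k] {m n : ℕ} (i : Fin (m + 1)) :
    rplMultilinear k (m + 1) →ₗ[k] rplMultilinear k (n + 1) →ₗ[k] rplMultilinear k (m + n + 1) :=
  LinearMap.mk₂ k (fun a b => ⟨rplCompAux k i a b, rplCompAux_mem i a b⟩)
    (fun a a' b => Subtype.ext (by simp))
    (fun c a b => Subtype.ext (by simp))
    (fun a b b' => Subtype.ext (by simp))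
    (fun c a b => Subtype.ext (by simp))

theorem coe_rplComp (i : Fin (m + 1)) (a : rplMultilinear k (m + 1))
    (b : rplMultilinear k (n + 1)) : (rplComp k i a b : Rpl k (m + n + 1)) =
      (Rpl.superPreLie k (m + n + 1)).act (m + 1) a
        (Function.update (fun j => Rpl.e k (outerLabel n i j)) i
          (Rpl.relabel k (innerLabel i) (b : Rpl k (n + 1)))) := rfl

theorem rplComp_mono (i : Fin (m + 1)) {a : FreeMagma (Option (Fin (m + 1)))}
    {b : FreeMagma (Option (Fin (n + 1)))} (ha : IsMultilinearMono a)
    {x : rplMultilinear k (m + 1)} {y : rplMultilinear k (n + 1)}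
    (hx : (x : Rpl k (m + 1)) = Rpl.mono k a) (hy : (y : Rpl k (n + 1)) = Rpl.mono k b) :
    (rplComp k i x y : Rpl k (m + n + 1)) =
      koszulSign (Pi.single i (circDeg b : ℤ)) (leafWord a) • Rpl.mono k (substMono i a b) :=
  rplCompAux_mono i ha hx hy

namespace SuperPreLie

variable (A : SuperPreLie k X)

theorem P_act_mono {p : Fin n → ℤ} {f : Fin n → X} (hf : ∀ i, A.P (f i) = (p i).negOnePow • f i)
    {b : FreeMagma (Option (Fin n))} (hb : IsMultilinearMono b) {y : rplMultilinear k n}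
    (hy : (y : Rpl k n) = Rpl.mono k b) :
    A.P (A.act n y f) = ((circDeg b : ℤ) + ∑ i, p i).negOnePow • A.act n y f := by
  rw [A.act_mono hf hb hy, Units.smul_def, map_zsmul, A.P_evalM hf, ← Units.smul_def, smul_comm,
    monoDeg, sum_map_eq_of_multilinear (w := leafWord b) hb, ← zsign_cast]
  simp [letterDeg, circDeg, Units.smul_def]

/-- Both sides evaluate the same substituted monomial (`evalM_substMono`). The four signs, those of
the composition, of the composite and of the two actions, match by `koszulSign_subst`. -/
theorem act_comp_mono (i : Fin (m + 1)) {a : FreeMagma (Option (Fin (m + 1)))}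
    {b : FreeMagma (Option (Fin (n + 1)))} (ha : IsMultilinearMono a) (hb : IsMultilinearMono b)
    {x : rplMultilinear k (m + 1)} {y : rplMultilinear k (n + 1)}
    (hx : (x : Rpl k (m + 1)) = Rpl.mono k a) (hy : (y : Rpl k (n + 1)) = Rpl.mono k b)
    {p : Fin (m + n + 1) → ℤ} {f : Fin (m + n + 1) → X}
    (hf : ∀ i, A.P (f i) = (p i).negOnePow • f i) :
    A.act (m + n + 1) (rplComp k i x y) f =
      ((circDeg b : ℤ) * ∑ j with j.val < i.val, p j).negOnePow •
        A.act (m + 1) x (fun j => if j = i then A.act (n + 1) y (fun l => f (innerLabel i l))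
          else f (outerLabel n i j)) := by
  have hz : ∀ z : rplMultilinear k (m + n + 1), (z : Rpl k (m + n + 1)) =
      Rpl.mono k (_root_.substMono i a b) →
      rplComp k i x y = koszulSign (Pi.single i (circDeg b : ℤ)) (leafWord a) • z := by
    intro z hz
    refine Subtype.ext ?_
    rw [rplComp_mono i ha hx hy, ← hz]
    rfl
  have hs := koszulSign_subst i (wa := leafWord a) (wb := leafWord b) ha hb p (circDeg b) rfl
  have hm := ha.substMono i hb
  rw [hz ⟨_, mono_mem_rplMultilinear hm⟩ rfl, Units.smul_def, map_zsmul, ← Units.smul_def,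
    smul_apply, A.act_mono hf hm rfl, smul_smul, leafWord_substMono, hs,
    A.act_mono (fun l => hf (innerLabel i l)) hb hy]
  rw [A.act_mono (p := fun j => if j = i then (circDeg b : ℤ) + ∑ l, p (innerLabel i l)
    else p (outerLabel n i j)) _ ha hx, ite_eq_update (β := X), evalM_update_smul _ _ _ _ _ ha,
    evalM_substMono, ite_eq_update (β := X), smul_smul, smul_smul, mul_assoc]
  intro j
  by_cases h : j = i
  · rw [if_pos h, if_pos h, ← A.act_mono (fun l => hf (innerLabel i l)) hb hy,
      A.P_act_mono (fun l => hf (innerLabel i l)) hb hy]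
  · rw [if_neg h, if_neg h, hf]

end SuperPreLie

theorem SuperPreLie.act_perm (A : SuperPreLie k X) (σ : Equiv.Perm (Fin n))
    (U : rplMultilinear k n) {p : Fin n → ℤ} {f : Fin n → X}
    (hf : ∀ i, A.P (f i) = (p i).negOnePow • f i) :
    A.act n (rplPerm k σ U) f =
      koszulSign p (List.ofFn fun i => some (σ i)) • A.act n U (fun i => f (σ i)) := by
  induction U using rplMultilinear_mono_induction with
  | mono m x hm hx =>
    rw [A.act_mono hf (hm.map_perm σ) (by rw [coe_rplPerm, hx, Rpl.relabel_mono]),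
      A.act_mono (fun i => hf (σ i)) hm hx, smul_smul, leafWord_map, koszulSign_perm p σ hm,
      A.evalM_map]
  | zero => simp
  | add x y hx hy => simp only [map_add, add_apply, hx, hy, smul_add]
  | smul c x hx => simp only [map_smul, smul_apply, hx, smul_comm c]

end ActionLaws

end

/-! ### Odd derivations and the action. -/

noncomputable section

section Derivation

variable {k : Type*} [Field k] {X : Type*} [AddCommGroup X] [Module k X] {n : ℕ}

/-- The total degree of the letters to the left of `some i`. -/
def prefixDeg (p : Fin n → ℤ) (i : Fin n) : List (Option (Fin n)) → ZMod 2
  | [] => 0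
  | x :: w => if x = some i then 0 else letterDeg p x + prefixDeg p i w

theorem prefixDeg_append_of_mem (p : Fin n → ℤ) (i : Fin n) {u : List (Option (Fin n))}
    (v : List (Option (Fin n))) (h : some i ∈ u) :
    prefixDeg p i (u ++ v) = prefixDeg p i u := by
  induction u with
  | nil => simp at h
  | cons x u ih =>
    by_cases hx : x = some i
    · simp [prefixDeg, hx]
    · rw [List.cons_append, prefixDeg, prefixDeg, if_neg hx, if_neg hx, ih]
      exact (List.mem_cons.1 h).resolve_left fun h => hx h.symm

theorem prefixDeg_append_of_notMem (p : Fin n → ℤ) (i : Fin n) {u : List (Option (Fin n))}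
    (v : List (Option (Fin n))) (h : some i ∉ u) :
    prefixDeg p i (u ++ v) =
      (u.map fun x => (letterDeg p x : ZMod 2)).sum + prefixDeg p i v := by
  induction u with
  | nil => simp
  | cons x u ih =>
    rw [List.mem_cons, not_or] at h
    rw [List.cons_append, prefixDeg, if_neg (Ne.symm h.1), ih h.2, List.map_cons, List.sum_cons,
      add_assoc]

namespace SuperPreLie

variable (A : SuperPreLie k X)

/-- An odd derivation that vanishes on `λ`. -/
structure IsOddDerivation (D : X →ₗ[k] X) : Prop where
  star : ∀ x y, D (A.star x y) = A.star (D x) y + A.star (A.P x) (D y)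
  lam : D A.lam = 0
  parity : ∀ x, A.P (D x) = -D (A.P x)

variable {A} {D : X →ₗ[k] X}

theorem IsOddDerivation.parity_eq (hD : A.IsOddDerivation D) {q : ℤ} {x : X}
    (hx : A.P x = q.negOnePow • x) : A.P (D x) = (q + 1).negOnePow • D x := by
  rw [hD.parity, hx, Int.negOnePow_succ]
  simp [Units.smul_def]

/-- The derivation travels through the word from the left and picks up the sign of the letters it
passes. Circles are killed, so only the arguments contribute. -/
theorem IsOddDerivation.evalM (hD : A.IsOddDerivation D) {p : Fin n → ℤ} {f : Fin n → X}
    (hf : ∀ i, A.P (f i) = (p i).negOnePow • f i) {m : FreeMagma (Option (Fin n))}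
    (hm : AtMostOnce m) :
    D (A.evalM f m) = ∑ i, if some i ∈ leafWord m then
      zsign (prefixDeg p i (leafWord m)) • A.evalM (Function.update f i (D (f i))) m else 0 := by
  induction m with
  | ih1 x =>
    rcases x with _ | j
    · rw [evalM_none, hD.lam]
      simp [leafWord_of]
    · rw [evalM_some, Finset.sum_eq_single j]
      · simp [leafWord_of, prefixDeg, zsign_zero, evalM_some]
      · intro i _ hi
        rw [leafWord_of, if_neg]
        simpa using hi
      · simp
  | ih2 a b iha ihb =>
    rw [evalM_mul, hD.star, iha hm.left, ihb hm.right, map_sum, map_sum, LinearMap.sum_apply,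
      ← Finset.sum_add_distrib]
    refine Finset.sum_congr rfl fun i _ => ?_
    rw [A.P_evalM hf]
    by_cases hia : some i ∈ leafWord a
    · have hib := hm.notMem i hia
      rw [if_pos hia, if_neg hib, if_pos (by simp [leafWord_mul, hia]), map_zero, add_zero,
        leafWord_mul, prefixDeg_append_of_mem p i _ hia, evalM_mul,
        A.evalM_update_of_notMem f _ hib]
      simp only [Units.smul_def, map_zsmul, LinearMap.smul_apply]
    · by_cases hib : some i ∈ leafWord b
      · rw [if_neg hia, if_pos hib, if_pos (by simp [leafWord_mul, hib]), map_zero,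
          LinearMap.zero_apply, zero_add, leafWord_mul, prefixDeg_append_of_notMem p i _ hia,
          evalM_mul, A.evalM_update_of_notMem f _ hia, ← monoDeg, zsign_add]
        simp only [Units.smul_def, map_zsmul, LinearMap.smul_apply, smul_smul, Units.val_mul]
        rw [mul_comm]
      · rw [if_neg hia, if_neg hib, if_neg (by simp [leafWord_mul, hia, hib])]
        simp

/-- By `koszulSign_succ`, raising the degree of slot `i` by one absorbs the sign for the letters to
the left of `eᵢ` in the word. What remains is the sign of passing all circles and the `f_j` with `j
< i`, independent of the shape of the monomial. -/
theorem IsOddDerivation.act_mono [CharZero k] (hD : A.IsOddDerivation D) {p : Fin n → ℤ}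
    {f : Fin n → X} (hf : ∀ i, A.P (f i) = (p i).negOnePow • f i)
    {m : FreeMagma (Option (Fin n))} (hm : IsMultilinearMono m) {U : rplMultilinear k n}
    (hU : (U : Rpl k n) = Rpl.mono k m) :
    D (A.act n U f) = (circDeg m : ℤ).negOnePow • ∑ i, (∑ j with j < i, p j).negOnePow •
      A.act n U (Function.update f i (D (f i))) := by
  rw [A.act_mono hf hm hU, Units.smul_def, map_zsmul, hD.evalM hf hm.atMostOnce, Finset.smul_sum,
    Finset.smul_sum]
  refine Finset.sum_congr rfl fun i _ => ?_
  obtain ⟨u, v, hw, hu, hv⟩ := exists_split_of_multilinear (w := leafWord m) hm i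
  have hs := koszulSign_succ p i (u := u) (v := v) (by rw [← hw]; exact hm) hu hv
  have hpre : prefixDeg p i (leafWord m) =
      (u.map fun x => (letterDeg p x : ZMod 2)).sum := by
    rw [hw, prefixDeg_append_of_notMem p i _ hu]
    simp [prefixDeg]
  rw [← hw, ← hpre] at hs
  rw [if_pos (by rw [hw]; simp), A.act_mono (p := Function.update p i (p i + 1)) _ hm hU,
    smul_smul, smul_smul, ← Int.negOnePow_add, ← Units.smul_def, smul_smul]
  · rw [hs]
    rfl
  · intro j
    by_cases h : j = i
    · subst h
      rw [Function.update_self, Function.update_self, hD.parity_eq (hf j)]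
    · rw [Function.update_of_ne h, Function.update_of_ne h, hf]

end SuperPreLie

end Derivation

/-! ### Independence of the degrees in `rpL*`. -/

section Grading

variable {k : Type*} [Field k] {n : ℕ}

/-- In a quotient it is not evident that the images of the degrees are independent. The substitution
`∘ ↦ 2 ∘` acts on degree `p` by `2ᵖ`, and eigenspaces for distinct eigenvalues are independent. -/
theorem Rpl.gr_le_eigenspace (n : ℕ) (p : ℤ) : Rpl.gr k n p ≤
    Module.End.eigenspace (Rpl.scaledRelabel (2 : k) fun i : Fin n => i) ((2 : k) ^ p) := by
  refine Submodule.span_le.2 ?_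
  rintro x ⟨m, rfl, rfl⟩
  rw [SetLike.mem_coe, Module.End.mem_eigenspace_iff, Rpl.scaledRelabel_mono,
    FreeMagma.map_option_id, zpow_natCast]

theorem two_zpow_injective [CharZero k] : Function.Injective fun p : ℤ => (2 : k) ^ p := by
  intro a b h
  have h1 : ((2 : ℚ) ^ a : ℚ) = (2 : ℚ) ^ b := by
    have : (((2 : ℚ) ^ a : ℚ) : k) = (((2 : ℚ) ^ b : ℚ) : k) := by
      push_cast
      exact h
    exact_mod_cast this
  exact zpow_right_injective₀ (by norm_num) (by norm_num) h1

theorem Rpl.iSupIndep_gr [CharZero k] (n : ℕ) : iSupIndep (Rpl.gr k n) :=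
  ((Module.End.eigenspaces_iSupIndep (Rpl.scaledRelabel (2 : k) fun i : Fin n => i)).comp
    two_zpow_injective).mono fun p => Rpl.gr_le_eigenspace n p

/-- Write `x` as its part in `N i` plus a sum of the other parts. The latter also lies in `G i`, and
independence of the larger family makes it zero. -/
theorem mem_of_mem_iSup_of_iSupIndep {ι R M : Type*} [Ring R] [AddCommGroup M] [Module R M]
    {G N : ι → Submodule R M} (hG : iSupIndep G) (hN : ∀ i, N i ≤ G i) {x : M} {i : ι}
    (hx : x ∈ ⨆ i, N i) (hx' : x ∈ G i) : x ∈ N i := by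
  have h : x ∈ N i ⊔ ⨆ j, ⨆ (_ : j ≠ i), N j := by
    refine (iSup_le fun j => ?_ : (⨆ i, N i) ≤ _) hx
    by_cases hj : j = i
    · subst hj
      exact le_sup_left
    · exact le_sup_of_le_right (le_iSup₂_of_le j hj le_rfl)
  obtain ⟨y, hy, z, hz, rfl⟩ := Submodule.mem_sup.1 h
  have hz' : z ∈ G i := by
    have := sub_mem hx' (hN i hy)
    rwa [add_sub_cancel_left] at this
  have h0 := Submodule.disjoint_def.1 (hG i) z hz' ((iSup₂_mono fun j _ => hN j) hz)
  rwa [h0, add_zero]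

/-- The grading of `rpL*(n)`. -/
def rplGr (k : Type*) [Field k] (n : ℕ) (p : ℤ) : Submodule k (rplMultilinear k n) :=
  (Rpl.gr k n p).comap (rplMultilinear k n).subtype

theorem mem_rplGr_of_mono {m : FreeMagma (Option (Fin n))} {x : rplMultilinear k n}
    (hx : (x : Rpl k n) = Rpl.mono k m) : x ∈ rplGr k n (circDeg m) := by
  change (x : Rpl k n) ∈ Rpl.gr k n _
  rw [hx]
  exact Rpl.mono_mem_gr m

theorem rplGr_isInternal [CharZero k] (n : ℕ) : DirectSum.IsInternal (rplGr k n) := by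
  refine (DirectSum.isInternal_submodule_iff_iSupIndep_and_iSup_eq_top _).2 ⟨?_, ?_⟩
  · rw [iSupIndep_def]
    intro p
    rw [Submodule.disjoint_def]
    intro x hx hx'
    refine Subtype.ext ?_
    refine Submodule.disjoint_def.1 (Rpl.iSupIndep_gr n p) (x : Rpl k n) hx ?_
    have := Submodule.mem_map_of_mem (f := (rplMultilinear k n).subtype) hx'
    simp only [Submodule.map_iSup] at this
    exact (iSup₂_mono fun j _ => Submodule.map_comap_le _ _) this
  · rw [eq_top_iff]
    rintro x -
    induction x using rplMultilinear_mono_induction with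
    | mono m x hm hx => exact Submodule.mem_iSup_of_mem _ (mem_rplGr_of_mono hx)
    | zero => exact zero_mem _
    | add x y hx hy => exact add_mem hx hy
    | smul c x hx => exact Submodule.smul_mem _ _ hx

/-- An element that is multilinear and also of degree `p` is a combination of monomials with both
properties. This is not immediate from the two spans separately; it follows since the spans `N p`
exhaust the multilinear elements while the degrees are independent. -/
theorem rplGr_induction [CharZero k] {p : ℤ} {C : rplMultilinear k n → Prop}
    (mono : ∀ (m : FreeMagma (Option (Fin n))) (x : rplMultilinear k n), IsMultilinearMono m →
      (x : Rpl k n) = Rpl.mono k m → (circDeg m : ℤ) = p → C x) (zero : C 0)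
    (add : ∀ x y, C x → C y → C (x + y)) (smul : ∀ (c : k) x, C x → C (c • x))
    {x : rplMultilinear k n} (hx : x ∈ rplGr k n p) : C x := by
  set N : ℤ → Submodule k (rplMultilinear k n) := fun p => Submodule.span k
    {x | ∃ m : FreeMagma (Option (Fin n)), IsMultilinearMono m ∧ (circDeg m : ℤ) = p ∧
      (x : Rpl k n) = Rpl.mono k m} with hN
  have hle : ∀ p, N p ≤ rplGr k n p := by
    intro p
    refine Submodule.span_le.2 ?_
    rintro x ⟨m, hm, rfl, hx⟩
    exact mem_rplGr_of_mono hx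
  have htop : x ∈ ⨆ p, N p := by
    clear hx
    induction x using rplMultilinear_mono_induction with
    | mono m x hm hx =>
      exact Submodule.mem_iSup_of_mem _ (Submodule.subset_span ⟨m, hm, rfl, hx⟩)
    | zero => exact zero_mem _
    | add x y hx hy => exact add_mem hx hy
    | smul c x hx => exact Submodule.smul_mem _ _ hx
  have h := mem_of_mem_iSup_of_iSupIndep
    ((DirectSum.isInternal_submodule_iff_iSupIndep_and_iSup_eq_top _).1 (rplGr_isInternal n)).1
    hle htop hx
  clear htop hx
  induction h using Submodule.span_induction with
  | mem x h =>
    obtain ⟨m, hm, hp, hx⟩ := h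
    exact mono m x hm hx hp
  | zero => exact zero
  | add x y _ _ hx hy => exact add x y hx hy
  | smul c x _ hx => exact smul c x hx

end Grading

/-! ### The differential on multilinear elements and its action. -/

section RplDifferential

variable {k : Type*} [Field k] [CharZero k] {X : Type*} [AddCommGroup X] [Module k X] {m n : ℕ}

theorem Rpl.isOddDerivation_der (n : ℕ) : (Rpl.superPreLie k n).IsOddDerivation (Rpl.der k n) where
  star := Rpl.der_mul
  lam := Rpl.der_circ
  parity := Rpl.parity_der

theorem act_e (U : rplMultilinear k n) : (Rpl.superPreLie k n).act n U (Rpl.e k) = U := by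
  induction U using rplMultilinear_mono_induction with
  | mono m x hm hx =>
    rw [SuperPreLie.act_mono (p := 0) _ _ hm hx, koszulSign_zero, one_smul, evalM_e, hx]
    intro i
    change Rpl.parity k n _ = _
    rw [Rpl.parity_e]
    simp
  | zero => simp
  | add x y hx hy => simp only [map_add, add_apply, hx, hy, Submodule.coe_add]
  | smul c x hx => simp only [map_smul, smul_apply, hx, Submodule.coe_smul]

/-- The element `∘ ⋆ e₁ - e₁ ⋆ ∘` of `rpL*(1)`. -/
def rplBracket (k : Type*) [Field k] : rplMultilinear k 1 :=
  ⟨Rpl.mono k (FreeMagma.of none * FreeMagma.of (some 0)) -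
    Rpl.mono k (FreeMagma.of (some 0) * FreeMagma.of none), by
    refine sub_mem (mono_mem_rplMultilinear ?_) (mono_mem_rplMultilinear ?_) <;> intro i <;>
      rw [Subsingleton.elim i 0] <;> rfl⟩

theorem outerLabel_zero (i j : Fin (m + 1)) : outerLabel 0 i j = j := by
  unfold outerLabel
  split_ifs <;> rfl

theorem relabel_rplBracket (i : Fin (m + 1)) :
    Rpl.relabel k (innerLabel i) (rplBracket k : Rpl k 1) =
      (Rpl.der k (m + 1) (Rpl.e k i) : Rpl k (m + 1)) := by
  rw [Rpl.e, Rpl.der_mono, rplBracket, map_sub, Rpl.relabel_mono, Rpl.relabel_mono, rplDerMono,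
    Rpl.circ, Rpl.e, Rpl.mul_mono, Rpl.mul_mono]
  rfl

/-- The derivation replaces one generator `eᵢ` at a time by `∘ ⋆ eᵢ - eᵢ ⋆ ∘`, which is composition
with `rplBracket` at `i`. Hence it preserves the multilinear part, and its action on any algebra is
governed by the composition law. -/
theorem der_eq_sum_comp {a : FreeMagma (Option (Fin (m + 1)))} (ha : IsMultilinearMono a)
    {x : rplMultilinear k (m + 1)} (hx : (x : Rpl k (m + 1)) = Rpl.mono k a) :
    Rpl.der k (m + 1) x =
      (((circDeg a : ℤ).negOnePow • ∑ i, rplComp k i x (rplBracket k) :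
        rplMultilinear k (m + 1)) : Rpl k (m + 1)) := by
  have h := (Rpl.isOddDerivation_der (k := k) (m + 1)).act_mono (p := 0) (f := Rpl.e k)
    (fun i => by
      change Rpl.parity k _ _ = _
      rw [Rpl.parity_e]
      simp) ha hx
  rw [act_e] at h
  rw [h]
  simp only [Units.smul_def, Submodule.coe_smul_of_tower, Submodule.coe_sum]
  congr 1
  refine Finset.sum_congr rfl fun i _ => ?_
  refine Eq.trans ?_ (coe_rplComp i x (rplBracket k)).symm
  rw [relabel_rplBracket]
  simp only [Pi.zero_apply, Finset.sum_const_zero, Int.negOnePow_zero, Units.val_one, one_smul]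
  congr 2
  funext j
  rw [outerLabel_zero]

theorem mono_mul_none_mem {a : FreeMagma (Option (Fin n))} (ha : IsMultilinearMono a) :
    IsMultilinearMono (a * FreeMagma.of none) := by
  intro i
  rw [leafWord_mul, List.count_append, ha i]
  simp [leafWord_of]

theorem none_mul_mono_mem {a : FreeMagma (Option (Fin n))} (ha : IsMultilinearMono a) :
    IsMultilinearMono (FreeMagma.of none * a) := by
  intro i
  rw [leafWord_mul, List.count_append, ha i]
  simp [leafWord_of]

theorem delta_mono (a : FreeMagma (Option (Fin n))) :
    (Rpl.superPreLie k n).delta (Rpl.mono k a) =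
      (circDeg a : ℤ).negOnePow • Rpl.mono k (a * FreeMagma.of none) -
        Rpl.mono k (FreeMagma.of none * a) := by
  rw [Rpl.delta_apply, Rpl.parity_mono, Units.smul_def, map_zsmul, LinearMap.smul_apply, Rpl.circ,
    Rpl.mul_mono, Rpl.mul_mono, Units.smul_def]

theorem Rpl.diff_mem {x : Rpl k (m + 1)} (hx : x ∈ rplMultilinear k (m + 1)) :
    Rpl.diff k (m + 1) x ∈ rplMultilinear k (m + 1) := by
  induction hx using Submodule.span_induction with
  | mem x h =>
    obtain ⟨a, ha, rfl⟩ := h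
    rw [Rpl.diff, LinearMap.add_apply, delta_mono, Units.smul_def]
    refine add_mem (sub_mem (zsmul_mem (mono_mem_rplMultilinear (mono_mul_none_mem ha)) _)
      (mono_mem_rplMultilinear (none_mul_mono_mem ha))) ?_
    rw [der_eq_sum_comp (x := ⟨Rpl.mono k a, mono_mem_rplMultilinear ha⟩) ha rfl]
    exact Subtype.mem _
  | zero => simp
  | add x y h1 h2 hx hy =>
    rw [map_add]
    exact add_mem hx hy
  | smul c x h hx =>
    rw [map_smul]
    exact Submodule.smul_mem _ _ hx

/-- The differential of `rpL*(n)`. -/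
def rplDiff (k : Type*) [Field k] [CharZero k] (m : ℕ) :
    rplMultilinear k (m + 1) →ₗ[k] rplMultilinear k (m + 1) :=
  (Rpl.diff k (m + 1)).restrict fun _ hx => Rpl.diff_mem hx

theorem coe_rplDiff (x : rplMultilinear k (m + 1)) :
    (rplDiff k m x : Rpl k (m + 1)) = Rpl.diff k (m + 1) x := rfl

namespace SuperPreLie

variable (A : SuperPreLie k X)

theorem act_rplBracket {q : ℤ} {f : Fin 1 → X} (hf : A.P (f 0) = q.negOnePow • f 0) :
    A.act 1 (rplBracket k) f = -A.delta (f 0) := by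
  have hf' : ∀ i, A.P (f i) = ((fun _ => q) i : ℤ).negOnePow • f i := by
    intro i
    rw [Subsingleton.elim i 0]
    exact hf
  have h1 : IsMultilinearMono (FreeMagma.of none * FreeMagma.of (some 0) :
      FreeMagma (Option (Fin 1))) := by
    intro i
    rw [Subsingleton.elim i 0]
    rfl
  have h2 : IsMultilinearMono (FreeMagma.of (some 0) * FreeMagma.of none :
      FreeMagma (Option (Fin 1))) := by
    intro i
    rw [Subsingleton.elim i 0]
    rfl
  have h : rplBracket k = ⟨_, mono_mem_rplMultilinear h1⟩ - ⟨_, mono_mem_rplMultilinear h2⟩ := rfl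
  rw [h, map_sub, sub_apply, A.act_mono hf' h1 rfl, A.act_mono hf' h2 rfl, evalM_mul, evalM_mul,
    evalM_none, evalM_some, A.delta_apply, hf, neg_sub]
  have s1 : koszulSign (fun _ : Fin 1 => q) (leafWord (FreeMagma.of none * FreeMagma.of (some 0)))
      = 1 := by
    simp [leafWord_mul, leafWord_of, koszulSign, koszulExp, letterBefore]
  have s2 : koszulSign (fun _ : Fin 1 => q) (leafWord (FreeMagma.of (some 0) * FreeMagma.of none))
      = q.negOnePow := by
    simp [leafWord_mul, leafWord_of, koszulSign, koszulExp, letterBefore, letterDeg]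
  rw [s1, s2, one_smul, Units.smul_def, Units.smul_def, map_zsmul, LinearMap.smul_apply]

/-- The summand `δ` of the differential acts as `δ` on the value, because `a ⋆ ∘` and `∘ ⋆ a`
evaluate to products with `λ`. The summand `D` is the sum of compositions with `rplBracket`, which
acts as `-δ`, and yields the correction terms with `δ` on one argument. -/
theorem act_rplDiff_mono {a : FreeMagma (Option (Fin (m + 1)))} (ha : IsMultilinearMono a)
    {x : rplMultilinear k (m + 1)} (hx : (x : Rpl k (m + 1)) = Rpl.mono k a)
    {p : Fin (m + 1) → ℤ} {f : Fin (m + 1) → X} (hf : ∀ i, A.P (f i) = (p i).negOnePow • f i) :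
    A.act (m + 1) (rplDiff k m x) f = A.delta (A.act (m + 1) x f) -
      (circDeg a : ℤ).negOnePow • ∑ i, (∑ j with j < i, p j).negOnePow •
        A.act (m + 1) x (Function.update f i (A.delta (f i))) := by
  have h1 := mono_mul_none_mem ha
  have h2 := none_mul_mono_mem ha
  have hd : rplDiff k m x = (circDeg a : ℤ).negOnePow • ⟨_, mono_mem_rplMultilinear h1⟩ -
      ⟨_, mono_mem_rplMultilinear h2⟩ +
      (circDeg a : ℤ).negOnePow • ∑ i, rplComp k i x (rplBracket k) := by
    refine Subtype.ext ?_
    rw [coe_rplDiff, Rpl.diff, LinearMap.add_apply, der_eq_sum_comp ha hx, hx, delta_mono]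
    rfl
  -- The composition law is available for monomials, so the two monomials of `rplBracket` are
  -- treated separately; both have degree one and so receive the same sign.
  have hcomp : ∀ i, A.act (m + 1) (rplComp k i x (rplBracket k)) f =
      -((∑ j with j < i, p j).negOnePow •
        A.act (m + 1) x (Function.update f i (A.delta (f i)))) := by
    intro i
    have hb1 : IsMultilinearMono (FreeMagma.of none * FreeMagma.of (some 0) :
        FreeMagma (Option (Fin 1))) := by
      intro i
      rw [Subsingleton.elim i 0]
      rfl
    have hb2 : IsMultilinearMono (FreeMagma.of (some 0) * FreeMagma.of none :
        FreeMagma (Option (Fin 1))) := by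
      intro i
      rw [Subsingleton.elim i 0]
      rfl
    have hb : rplBracket k =
      ⟨_, mono_mem_rplMultilinear hb1⟩ - ⟨_, mono_mem_rplMultilinear hb2⟩ := rfl
    have e1 := A.act_comp_mono (n := 0) i ha hb1 hx
      (y := ⟨_, mono_mem_rplMultilinear hb1⟩) rfl hf
    have e2 := A.act_comp_mono (n := 0) i ha hb2 hx
      (y := ⟨_, mono_mem_rplMultilinear hb2⟩) rfl hf
    rw [ite_eq_update] at e1 e2
    have hf0 := A.act_rplBracket (q := p i) (f := fun l : Fin 1 => f (innerLabel (n := 0) i l))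
      (hf (innerLabel (n := 0) i 0))
    rw [hb, map_sub, sub_apply] at hf0
    have e3 : A.act (m + 1) (rplComp k i x (rplBracket k)) f =
        A.act (m + 1) (rplComp k i x ⟨_, mono_mem_rplMultilinear hb1⟩) f -
        A.act (m + 1) (rplComp k i x ⟨_, mono_mem_rplMultilinear hb2⟩) f := by
      rw [hb, map_sub, map_sub, sub_apply]
    rw [e3]
    refine (congrArg₂ (· - ·) e1 e2).trans ?_
    have hc1 : circDeg (FreeMagma.of none * FreeMagma.of (some 0) :
      FreeMagma (Option (Fin 1))) = 1 := rfl
    have hc2 : circDeg (FreeMagma.of (some 0) * FreeMagma.of none :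
      FreeMagma (Option (Fin 1))) = 1 := rfl
    rw [hc1, hc2, ← smul_sub, ← MultilinearMap.map_update_sub, hf0, Nat.cast_one, one_mul,
      MultilinearMap.map_update_neg, smul_neg]
    congr 3
    funext j
    have : ∀ j, outerLabel 0 i j = j := outerLabel_zero i
    simp only [this]
    rfl
  -- For `a ⋆ ∘` the circle must pass all arguments, which supplies the part of the parity of the
  -- value that is not the degree of `a`.
  have hδ : A.delta (A.act (m + 1) x f) =
      A.act (m + 1) ((circDeg a : ℤ).negOnePow • ⟨_, mono_mem_rplMultilinear h1⟩ -
        ⟨_, mono_mem_rplMultilinear h2⟩) f := by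
    have hc1 : crossSign p a (FreeMagma.of none) = (∑ i, p i).negOnePow := by
      rw [crossSign, leafWord_of, crossSum_singleton_right,
        sum_map_eq_of_multilinear (w := leafWord a) ha, ← zsign_cast]
      simp [koszulPair, letterBefore, letterDeg]
    have hc2 : crossSign p (FreeMagma.of none) a = 1 := by
      rw [crossSign, leafWord_of, crossSum_singleton_left]
      simp [koszulPair, letterBefore, zsign_zero]
    have hn : koszulSign p (leafWord (FreeMagma.of none)) = 1 := by
      rw [koszulSign_eq, leafWord_of, pairSum_singleton, zsign_zero]
    have hR : A.act (m + 1) ((circDeg a : ℤ).negOnePow • ⟨_, mono_mem_rplMultilinear h1⟩ -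
        ⟨_, mono_mem_rplMultilinear h2⟩) f =
        (circDeg a : ℤ).negOnePow • A.act (m + 1) ⟨_, mono_mem_rplMultilinear h1⟩ f -
        A.act (m + 1) ⟨_, mono_mem_rplMultilinear h2⟩ f := by
      rw [map_sub, sub_apply, Units.smul_def, map_zsmul, ← Units.smul_def, smul_apply]
    rw [hR, A.delta_apply, A.P_act_mono hf ha hx,
      A.act_mono hf h1 (U := ⟨_, mono_mem_rplMultilinear h1⟩) rfl,
      A.act_mono hf h2 (U := ⟨_, mono_mem_rplMultilinear h2⟩) rfl, A.act_mono hf ha hx,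
      koszulSign_mul, koszulSign_mul, hc1, hc2, hn, evalM_mul, evalM_mul, evalM_none, Int.negOnePow_add]
    simp only [Units.smul_def, map_zsmul, LinearMap.smul_apply, smul_smul, Units.val_mul, mul_one,
      one_mul]
    congr 2
    ring
  rw [hd, hδ, map_add, add_apply, sub_eq_add_neg _ ((circDeg a : ℤ).negOnePow • _), ← smul_neg,
    ← Finset.sum_neg_distrib]
  congr 1
  rw [Units.smul_def, map_zsmul, map_sum, ← Units.smul_def, smul_apply, sum_apply]
  congr 1
  exact Finset.sum_congr rfl fun i _ => hcomp i

end SuperPreLie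

end RplDifferential

end

/-! ### The operad axioms for `rpL*`. -/

noncomputable section

section RplOperad

variable {k : Type*} [Field k] [CharZero k] {m n l : ℕ}

theorem Rpl.relabel_parity {N : ℕ} (g : Fin n → Fin N) (x : Rpl k n) :
    Rpl.relabel k g (Rpl.parity k n x) = Rpl.parity k N (Rpl.relabel k g x) := by
  induction x using Rpl.induction with
  | mono a =>
    rw [Rpl.parity_mono, Rpl.relabel_mono, Rpl.parity_mono, circDeg_map, Units.smul_def, map_zsmul,
      Rpl.relabel_mono, Units.smul_def]
  | zero => simp
  | add x y hx hy => simp only [map_add, hx, hy]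
  | smul c x hx => simp only [map_smul, hx]

theorem Rpl.relabel_delta {N : ℕ} (g : Fin n → Fin N) (x : Rpl k n) :
    Rpl.relabel k g ((Rpl.superPreLie k n).delta x) =
      (Rpl.superPreLie k N).delta (Rpl.relabel k g x) := by
  rw [Rpl.delta_apply, Rpl.delta_apply, map_sub, Rpl.relabel_mul, Rpl.relabel_mul,
    Rpl.relabel_parity, Rpl.relabel_circ]

theorem Rpl.relabel_der {N : ℕ} (g : Fin n → Fin N) (x : Rpl k n) :
    Rpl.relabel k g (Rpl.der k n x) = Rpl.der k N (Rpl.relabel k g x) := by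
  induction x using Rpl.induction with
  | mono a =>
    induction a with
    | ih1 y =>
      rcases y with _ | i
      · change Rpl.relabel k g (Rpl.der k n (Rpl.circ k n)) =
          Rpl.der k N (Rpl.relabel k g (Rpl.circ k n))
        rw [Rpl.relabel_circ, Rpl.der_circ, Rpl.der_circ, map_zero]
      · change Rpl.relabel k g (Rpl.der k n (Rpl.e k i)) =
          Rpl.der k N (Rpl.relabel k g (Rpl.e k i))
        rw [Rpl.relabel_e, Rpl.der_e, Rpl.der_e, map_neg, Rpl.relabel_delta, Rpl.relabel_e]
    | ih2 a b iha ihb =>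
      rw [← Rpl.mul_mono, Rpl.der_mul, map_add, Rpl.relabel_mul, Rpl.relabel_mul, Rpl.relabel_mul,
        Rpl.der_mul, iha, ihb, Rpl.relabel_parity]
  | zero => simp
  | add x y hx hy => simp only [map_add, hx, hy]
  | smul c x hx => simp only [map_smul, hx]

theorem Rpl.relabel_diff {N : ℕ} (g : Fin n → Fin N) (x : Rpl k n) :
    Rpl.relabel k g (Rpl.diff k n x) = Rpl.diff k N (Rpl.relabel k g x) := by
  rw [Rpl.diff, Rpl.diff, LinearMap.add_apply, LinearMap.add_apply, map_add, Rpl.relabel_delta,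
    Rpl.relabel_der]

theorem Rpl.relabel_mem_gr {N : ℕ} (g : Fin n → Fin N) {p : ℤ} {x : Rpl k n}
    (hx : x ∈ Rpl.gr k n p) : Rpl.relabel k g x ∈ Rpl.gr k N p := by
  induction hx using Submodule.span_induction with
  | mem x h =>
    obtain ⟨m, rfl, rfl⟩ := h
    rw [Rpl.relabel_mono, ← circDeg_map g m]
    exact Rpl.mono_mem_gr _
  | zero => simp
  | add x y _ _ hx hy =>
    rw [map_add]
    exact add_mem hx hy
  | smul c x _ hx =>
    rw [map_smul]
    exact Submodule.smul_mem _ _ hx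

/-- The dg vector space `rpL*(n + 1)`. -/
def rplDG (k : Type*) [Field k] [CharZero k] (n : ℕ) : DGStruct k (RplColl k n) where
  gr := rplGr k (n + 1)
  internal := rplGr_isInternal (n + 1)
  d := rplDiff k n
  d_mem _ _ hx := Rpl.diff_mem_gr hx
  d_d x := Subtype.ext (Rpl.diff_diff (x : Rpl k (n + 1)))

/-- The unit of `rpL*`. -/
def rplOne (k : Type*) [Field k] : RplColl k 0 :=
  ⟨Rpl.e k 0, mono_mem_rplMultilinear (by
    intro i
    rw [show i = 0 from Fin.fin_one_eq_zero i]
    rfl)⟩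

/-- The symmetric group action on `rpL*(n + 1)`. -/
def rplRep (k : Type*) [Field k] (n : ℕ) :
    Representation k (Equiv.Perm (Fin (n + 1))) (RplColl k n) where
  toFun σ := rplPerm k σ
  map_one' := LinearMap.ext fun x => Subtype.ext (by
    rw [coe_rplPerm]
    exact Rpl.relabel_id _)
  map_mul' σ τ := LinearMap.ext fun x => Subtype.ext (by
    rw [coe_rplPerm, Module.End.mul_apply, coe_rplPerm, coe_rplPerm, Rpl.relabel_relabel]
    rfl)

/-- Transport between equal arities is a relabelling, so axioms stated with `castArity` can be
checked in the ambient pre-Lie algebra. -/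
theorem coe_castArity (h : m = n) (x : RplColl k m) :
    ((castArity h x : RplColl k n) : Rpl k (n + 1)) =
      Rpl.relabel k (Fin.cast (congrArg (· + 1) h)) (x : Rpl k (m + 1)) := by
  subst h
  exact (Rpl.relabel_id _).symm

theorem castArity_add (h : m = n) (x y : RplColl k m) :
    castArity (P := RplColl k) h (x + y) = castArity (P := RplColl k) h x + castArity (P := RplColl k) h y := by
  subst h
  rfl

theorem castArity_smul {S : Type*} [∀ n, SMul S (RplColl k n)] (h : m = n) (c : S)
    (x : RplColl k m) :
    castArity (P := RplColl k) h (c • x) = c • castArity (P := RplColl k) h x := by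
  subst h
  rfl

theorem castArity_zero (h : m = n) : castArity (P := RplColl k) h 0 = 0 := by
  subst h
  rfl

theorem circDeg_substMono {i : Fin (m + 1)} {a : FreeMagma (Option (Fin (m + 1)))}
    (ha : IsMultilinearMono a) (b : FreeMagma (Option (Fin (n + 1)))) :
    circDeg (substMono i a b) = circDeg a + circDeg b := by
  obtain ⟨u, v, hw, hu, hv⟩ := exists_split_of_multilinear (w := leafWord a) ha i
  have h : ∀ {N M : ℕ} (g : Fin N → Fin M) (s : List (Option (Fin N))),
      (s.map (Option.map g)).count none = s.count none := by
    intro N M g s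
    induction s with
    | nil => rfl
    | cons x s ih => rcases x with _ | x <;> simp [ih]
  have hsub : substLetter i (leafWord b) (some i) = (leafWord b).map (Option.map (innerLabel i)) :=
    if_pos rfl
  rw [circDeg, leafWord_substMono, circDeg, circDeg, hw, List.flatMap_append, List.flatMap_cons,
    flatMap_substLetter _ hu, flatMap_substLetter _ hv, hsub, List.count_append, List.count_append,
    h, h, h, List.count_append, List.count_cons_of_ne (by simp)]
  omega

theorem rplComp_mem (i : Fin (m + 1)) {p q : ℤ} {a : RplColl k m} (ha : a ∈ rplGr k (m + 1) p)
    {b : RplColl k n} (hb : b ∈ rplGr k (n + 1) q) :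
    rplComp k i a b ∈ rplGr k (m + n + 1) (p + q) := by
  refine rplGr_induction (C := fun a => rplComp k i a b ∈ rplGr k (m + n + 1) (p + q))
    (fun a x ha hx hp => ?_) (by simp) (fun x y hx hy => ?_) (fun c x hx => ?_) ha
  · refine rplGr_induction (C := fun b => rplComp k i x b ∈ rplGr k (m + n + 1) (p + q))
      (fun b y hb hy hq => ?_) (by simp) (fun x y hx hy => ?_) (fun c x hx => ?_) hb
    · change (rplComp k i x y : Rpl k (m + n + 1)) ∈ Rpl.gr k _ _
      rw [rplComp_mono i ha hx hy, ← hp, ← hq, Units.smul_def]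
      refine zsmul_mem ?_ _
      have := Rpl.mono_mem_gr (k := k) (substMono i a b)
      rwa [circDeg_substMono ha, Nat.cast_add] at this
    · rw [map_add]
      exact add_mem hx hy
    · rw [map_smul]
      exact Submodule.smul_mem _ _ hx
  · rw [map_add]
    exact add_mem hx hy
  · rw [map_smul]
    exact Submodule.smul_mem _ _ hx

/-- The arguments at which the first factor of a composition is evaluated. -/
def compArgs (i : Fin (m + 1)) (b : Rpl k (n + 1)) : Fin (m + 1) → Rpl k (m + n + 1) :=
  Function.update (fun j => Rpl.e k (outerLabel n i j)) i (Rpl.relabel k (innerLabel i) b)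

theorem compArgs_self (i : Fin (m + 1)) (b : Rpl k (n + 1)) :
    compArgs i b i = Rpl.relabel k (innerLabel i) b :=
  Function.update_self _ _ _

theorem compArgs_of_ne {i j : Fin (m + 1)} (h : j ≠ i) (b : Rpl k (n + 1)) :
    compArgs i b j = Rpl.e k (outerLabel n i j) :=
  Function.update_of_ne h _ _

theorem coe_rplComp' (i : Fin (m + 1)) (a : RplColl k m) (b : RplColl k n) :
    (rplComp k i a b : Rpl k (m + n + 1)) =
      (Rpl.superPreLie k (m + n + 1)).act (m + 1) a (compArgs i (b : Rpl k (n + 1))) := rfl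

theorem parity_update_e {N M : ℕ} (g : Fin N → Fin M) (i : Fin N) {x : Rpl k M} {q : ℤ}
    (hx : Rpl.parity k M x = q.negOnePow • x) (j : Fin N) :
    (Rpl.superPreLie k M).P (Function.update (fun j => Rpl.e k (g j)) i x j) =
      ((Pi.single i q : Fin N → ℤ) j).negOnePow •
        (Function.update (fun j => Rpl.e k (g j)) i x j) := by
  change Rpl.parity k _ _ = _
  by_cases h : j = i
  · subst h
    rw [Function.update_self, Pi.single_eq_same, hx]
  · rw [Function.update_of_ne h, Pi.single_eq_of_ne h, Rpl.parity_e]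
    simp

theorem parity_relabel_mono {N M : ℕ} (g : Fin N → Fin M) {b : FreeMagma (Option (Fin N))}
    {y : Rpl k N} (hy : y = Rpl.mono k b) :
    Rpl.parity k M (Rpl.relabel k g y) = (circDeg b : ℤ).negOnePow • Rpl.relabel k g y := by
  rw [hy, Rpl.relabel_mono, Rpl.parity_mono, circDeg_map]

/-- A composite is a value of the action, so `act_rplDiff_mono` computes `δ` of it and
`IsOddDerivation.act_mono` computes `D` of it. Added up, each correction term has the full
differential applied to one argument. It kills the generators and leaves only slot `i`. -/
theorem rplComp_d (i : Fin (m + 1)) {p : ℤ} {a : RplColl k m} (ha : a ∈ rplGr k (m + 1) p)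
    (b : RplColl k n) : rplDiff k (m + n) (rplComp k i a b) =
      rplComp k i (rplDiff k m a) b + p.negOnePow • rplComp k i a (rplDiff k n b) := by
  refine rplGr_induction (C := fun a => rplDiff k (m + n) (rplComp k i a b) =
      rplComp k i (rplDiff k m a) b + p.negOnePow • rplComp k i a (rplDiff k n b))
    (fun a x ha hx hp => ?_) (by simp) (fun x x' hx hx' => ?_) (fun c x hx => ?_) ha
  · induction b using rplMultilinear_mono_induction with
    | mono b y hb hy =>
      refine Subtype.ext ?_
      have hf := parity_update_e (outerLabel n i) i (parity_relabel_mono (innerLabel i) hy)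
      have h1 := SuperPreLie.act_rplDiff_mono _ ha hx hf
      have h2 := (Rpl.isOddDerivation_der (k := k) (m + n + 1)).act_mono hf ha hx
      rw [eq_sub_iff_add_eq] at h1
      have h3 : Rpl.diff k (m + n + 1) (rplComp k i x y : Rpl k (m + n + 1)) = _ :=
        congrArg₂ (· + ·) h1.symm h2
      rw [coe_rplDiff, h3]
      refine (add_assoc _ _ _).trans ?_
      rw [← smul_add, ← Finset.sum_add_distrib]
      refine congrArg₂ (· + ·) rfl ?_
      rw [Units.smul_def, Submodule.coe_smul_of_tower, ← Units.smul_def, hp]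
      congr 1
      -- All slots before `i` have degree zero, so the term for `j = i` comes without sign.
      have h4 : ∀ j, (∑ t with t < j, (Pi.single i (circDeg b : ℤ) : Fin (m + 1) → ℤ) t).negOnePow •
          (Rpl.superPreLie k (m + n + 1)).act (m + 1) x
            (Function.update (compArgs i (y : Rpl k (n + 1))) j
              ((Rpl.superPreLie k (m + n + 1)).delta (compArgs i (y : Rpl k (n + 1)) j))) +
          (∑ t with t < j, (Pi.single i (circDeg b : ℤ) : Fin (m + 1) → ℤ) t).negOnePow •
          (Rpl.superPreLie k (m + n + 1)).act (m + 1) x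
            (Function.update (compArgs i (y : Rpl k (n + 1))) j
              (Rpl.der k (m + n + 1) (compArgs i (y : Rpl k (n + 1)) j))) =
          if j = i then (rplComp k i x (rplDiff k n y) : Rpl k (m + n + 1)) else 0 := by
        intro j
        rw [← smul_add, ← MultilinearMap.map_update_add]
        change _ • (Rpl.superPreLie k (m + n + 1)).act (m + 1) x
          (Function.update _ j (Rpl.diff k _ _)) = _
        by_cases hj : j = i
        · subst hj
          rw [if_pos rfl, Finset.sum_eq_zero, Int.negOnePow_zero, one_smul, coe_rplComp', compArgs,
            compArgs, Function.update_idem, Function.update_self, ← Rpl.relabel_diff, coe_rplDiff]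
          intro t ht
          rw [Pi.single_eq_of_ne (Finset.mem_filter.1 ht).2.ne]
        · rw [if_neg hj, compArgs, Function.update_of_ne hj, Rpl.diff_e]
          rw [MultilinearMap.map_coord_zero _ j (Function.update_self _ _ _), smul_zero]
      refine (Finset.sum_congr rfl fun j _ => h4 j).trans ?_
      rw [Finset.sum_ite_eq' Finset.univ i, if_pos (Finset.mem_univ _)]
    | zero => simp
    | add y y' hy hy' =>
      simp only [map_add, hy, hy', smul_add]
      abel
    | smul c y hy => simp only [map_smul, hy, smul_add, smul_comm c]
  · simp only [map_add, LinearMap.add_apply, hx, hx', smul_add]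
    abel
  · simp only [map_smul, LinearMap.smul_apply, hx, smul_add, smul_comm c]

theorem SuperPreLie.act_one {X : Type*} [AddCommGroup X] [Module k X] (A : SuperPreLie k X)
    (f : Fin 1 → X) : A.act 1 (rplOne k) f = f 0 := by
  have h : ∀ b x, A.act 1 (rplOne k) (Function.update f 0 (A.part b x)) = A.part b x := by
    intro b x
    rw [A.act_mono (p := fun _ => parityDeg b) (m := FreeMagma.of (some 0)) _ _ rfl, evalM_some,
      Function.update_self, koszulSign_eq, leafWord_of, pairSum_singleton, zsign_zero, one_smul]
    · intro i
      rw [Subsingleton.elim i 0, Function.update_self, A.P_part]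
    · intro i
      rw [Subsingleton.elim i 0]
      rfl
  have h' := congrArg₂ (· + ·) (h false (f 0)) (h true (f 0))
  rwa [← MultilinearMap.map_update_add, part_add_part, Function.update_eq_self] at h'

theorem act_relabel_e {N M : ℕ} (g : Fin N → Fin M) (U : rplMultilinear k N) :
    (Rpl.superPreLie k M).act N U (fun i => Rpl.e k (g i)) = Rpl.relabel k g (U : Rpl k N) := by
  have h := SuperPreLie.map_act (Rpl.superPreLie k N) (Rpl.superPreLie k M) (Rpl.relabel k g)
    (Rpl.relabel_parity g) (Rpl.relabel_mul g) (Rpl.relabel_circ g) U (Rpl.e k)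
  rw [act_e] at h
  rw [h]
  simp only [Rpl.relabel_e]

theorem relabel_act {N M L : ℕ} (g : Fin N → Fin M) (U : rplMultilinear k L)
    (f : Fin L → Rpl k N) : Rpl.relabel k g ((Rpl.superPreLie k N).act L U f) =
      (Rpl.superPreLie k M).act L U (fun i => Rpl.relabel k g (f i)) :=
  SuperPreLie.map_act (Rpl.superPreLie k N) (Rpl.superPreLie k M) (Rpl.relabel k g)
    (Rpl.relabel_parity g) (Rpl.relabel_mul g) (Rpl.relabel_circ g) U f

theorem rplOne_comp (b : RplColl k n) :
    rplComp k 0 (rplOne k) b = castArity (Nat.zero_add n).symm b := by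
  refine Subtype.ext ?_
  rw [coe_castArity]
  refine (SuperPreLie.act_one _ _).trans ?_
  rw [Function.update_self]
  congr 1
  congr 1
  funext j
  exact Fin.ext (Nat.zero_add _)

theorem rplComp_one (i : Fin (m + 1)) (a : RplColl k m) : rplComp k i a (rplOne k) = a := by
  refine Subtype.ext ?_
  rw [coe_rplComp', compArgs]
  refine Eq.trans ?_ (act_e a)
  congr 1
  funext j
  by_cases h : j = i
  · subst h
    rw [Function.update_self]
    exact Rpl.relabel_e _ _
  · rw [Function.update_of_ne h, outerLabel_zero]

/-- The iterated composition evaluated in the ambient pre-Lie algebra. -/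
theorem coe_rplComp_rplComp (i : Fin (m + 1)) (t : Fin (m + n + 1))
    {a : FreeMagma (Option (Fin (m + 1)))} {b : FreeMagma (Option (Fin (n + 1)))}
    {c : FreeMagma (Option (Fin (l + 1)))} (ha : IsMultilinearMono a) (hb : IsMultilinearMono b)
    {x : RplColl k m} {y : RplColl k n} {z : RplColl k l} (hx : (x : Rpl k (m + 1)) = Rpl.mono k a)
    (hy : (y : Rpl k (n + 1)) = Rpl.mono k b) (hz : (z : Rpl k (l + 1)) = Rpl.mono k c) :
    (rplComp k t (rplComp k i x y : RplColl k (m + n)) z : Rpl k (m + n + l + 1)) =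
      ((circDeg b : ℤ) * if t.val < i.val then (circDeg c : ℤ) else 0).negOnePow •
        (Rpl.superPreLie k (m + n + l + 1)).act (m + 1) x (fun j => if j = i then
          (Rpl.superPreLie k (m + n + l + 1)).act (n + 1) y
            (fun s => compArgs t (z : Rpl k (l + 1)) (innerLabel i s))
          else compArgs t (z : Rpl k (l + 1)) (outerLabel n i j)) := by
  rw [coe_rplComp']
  have h := SuperPreLie.act_comp_mono (Rpl.superPreLie k (m + n + l + 1)) i ha hb hx hy
    (parity_update_e (outerLabel l t) t (parity_relabel_mono (innerLabel t) hz))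
  refine h.trans ?_
  have hs : ∑ j : Fin (m + n + 1) with j.val < i.val,
      (Pi.single t (circDeg c : ℤ) : Fin (m + n + 1) → ℤ) j =
      if t.val < i.val then (circDeg c : ℤ) else 0 := by
    rw [Finset.sum_filter]
    simp only [Pi.single_apply]
    rw [Finset.sum_eq_single t]
    · simp
    · intro j _ hj
      simp [hj]
    · simp
  rw [hs]
  rfl

/-- Both sides are the action of `a` on arguments in the algebra on `m + n + l + 1` generators, so
the arguments are compared slot by slot. Slot `i` is again an action, of `b`, compared in the same
way; the rest is arithmetic of labels. -/
theorem rplComp_seq (i : Fin (m + 1)) (j : Fin (n + 1)) (a : RplColl k m) (b : RplColl k n)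
    (c : RplColl k l) :
    castArity (P := RplColl k) (Nat.add_assoc m n l)
      (rplComp k (innerLabel i j) (rplComp k i a b : RplColl k (m + n)) c) =
      rplComp k i a (rplComp k j b c : RplColl k (n + l)) := by
  induction a using rplMultilinear_mono_induction with
  | mono a x ha hx =>
    induction b using rplMultilinear_mono_induction with
    | mono b y hb hy =>
      induction c using rplMultilinear_mono_induction with
      | mono c z hc hz =>
        refine Subtype.ext ?_
        -- The label `innerLabel i j` is never smaller than `i`, so the sign from
        -- `coe_rplComp_rplComp` is trivial.
        rw [coe_castArity, coe_rplComp_rplComp i _ ha hb hx hy hz,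
          if_neg (by simp [innerLabel]), mul_zero, Int.negOnePow_zero, one_smul, relabel_act,
          coe_rplComp']
        congr 1
        funext t
        by_cases ht : t = i
        · subst ht
          rw [if_pos rfl, compArgs_self, coe_rplComp', relabel_act, relabel_act]
          congr 1
          funext s
          by_cases hs : s = j
          · subst hs
            rw [compArgs_self, compArgs_self,
              Rpl.relabel_relabel, Rpl.relabel_relabel]
            congr 1
            congr 1
            funext r
            refine Fin.ext ?_
            simp only [innerLabel, Fin.val_cast]
            omega
          · rw [compArgs_of_ne hs, compArgs_of_ne ((innerLabel_injective t).ne hs), Rpl.relabel_e, Rpl.relabel_e]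
            congr 1
            refine Fin.ext ?_
            have hs' : (s : ℕ) ≠ j := fun h => hs (Fin.ext h)
            simp only [innerLabel, outerLabel, Fin.le_def]
            split_ifs <;> simp only [Fin.val_cast] <;> omega
        · have h1 : outerLabel n i t ≠ innerLabel i j := (innerLabel_ne_outerLabel ht j).symm
          rw [if_neg ht, compArgs_of_ne ht, compArgs_of_ne h1, Rpl.relabel_e]
          congr 1
          refine Fin.ext ?_
          have ht' : (t : ℕ) ≠ i := fun h => ht (Fin.ext h)
          simp only [innerLabel, outerLabel, Fin.le_def]
          split_ifs <;> simp only [Fin.val_cast] at * <;> omega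
      | zero => simp [castArity_zero]
      | add z z' hz hz' => simp only [map_add, castArity_add, hz, hz']
      | smul r z hz => simp only [map_smul, castArity_smul, hz]
    | zero => simp [castArity_zero]
    | add y y' hy hy' => simp only [map_add, LinearMap.add_apply, castArity_add, hy, hy']
    | smul r y hy => simp only [map_smul, LinearMap.smul_apply, castArity_smul, hy]
  | zero => simp [castArity_zero]
  | add x x' hx hx' => simp only [map_add, LinearMap.add_apply, castArity_add, hx, hx']
  | smul r x hx => simp only [map_smul, LinearMap.smul_apply, castArity_smul, hx]

theorem val_innerLabel (i : Fin (m + 1)) (j : Fin (n + 1)) : (innerLabel i j : ℕ) = i + j := rfl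

theorem val_outerLabel (i j : Fin (m + 1)) :
    (outerLabel n i j : ℕ) = if (j : ℕ) ≤ i then (j : ℕ) else j + n := by
  unfold outerLabel
  simp only [Fin.le_def]
  split_ifs <;> rfl

/-- Both iterated composites are the action of `a` with `b` in slot `i` and `c` in slot `j`. Exactly
one of the two orders performs its second insertion before the slot of the first, and only that one
carries the sign `(-1)^{qr}`. -/
theorem rplComp_par_mono {i j : Fin (m + 1)} (hij : i ≠ j)
    {a : FreeMagma (Option (Fin (m + 1)))} {b : FreeMagma (Option (Fin (n + 1)))}
    {c : FreeMagma (Option (Fin (l + 1)))} (ha : IsMultilinearMono a) (hb : IsMultilinearMono b)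
    (hc : IsMultilinearMono c) {x : RplColl k m} {y : RplColl k n} {z : RplColl k l}
    (hx : (x : Rpl k (m + 1)) = Rpl.mono k a) (hy : (y : Rpl k (n + 1)) = Rpl.mono k b)
    (hz : (z : Rpl k (l + 1)) = Rpl.mono k c) {q r : ℤ} (hq : (circDeg b : ℤ) = q)
    (hr : (circDeg c : ℤ) = r) :
    castArity (P := RplColl k) (Nat.add_right_comm m n l)
      (rplComp k (outerLabel n i j) (rplComp k i x y : RplColl k (m + n)) z) =
      (q * r).negOnePow •
        rplComp k (outerLabel l j i) (rplComp k j x z : RplColl k (m + l)) y := by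
  refine Subtype.ext ?_
  rw [coe_castArity, Units.smul_def, Submodule.coe_smul_of_tower, ← Units.smul_def,
    coe_rplComp_rplComp i _ ha hb hx hy hz, coe_rplComp_rplComp j _ ha hc hx hz hy,
    Units.smul_def, map_zsmul, ← Units.smul_def, smul_smul, relabel_act, hq, hr]
  have hij' : (i : ℕ) ≠ j := fun h => hij (Fin.ext h)
  congr 1
  · rw [← Int.negOnePow_add]
    simp only [val_outerLabel]
    rcases lt_or_gt_of_ne hij' with h | h
    · rw [if_neg (by split_ifs <;> omega), if_pos (by split_ifs <;> omega), mul_zero,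
        mul_comm (r : ℤ), ← two_mul (q * r), Int.negOnePow_even _ (even_two_mul _),
        Int.negOnePow_zero]
    · rw [if_pos (by split_ifs <;> omega), if_neg (by split_ifs <;> omega), mul_zero,
        add_zero]
  · congr 1
    funext t
    by_cases hti : t = i
    · subst hti
      rw [if_pos rfl, if_neg hij, compArgs_self, relabel_act, ← act_relabel_e]
      congr 1
      funext s
      rw [compArgs_of_ne (innerLabel_ne_outerLabel hij.symm s), Rpl.relabel_e]
      congr 1
      refine Fin.ext ?_
      simp only [val_innerLabel, val_outerLabel, Fin.val_cast]
      split_ifs <;> omega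
    · by_cases htj : t = j
      · subst htj
        rw [if_neg hti, if_pos rfl, compArgs_self, Rpl.relabel_relabel, ← act_relabel_e]
        congr 1
        funext s
        rw [compArgs_of_ne (innerLabel_ne_outerLabel hij s)]
        congr 1
        refine Fin.ext ?_
        simp only [val_innerLabel, val_outerLabel, Fin.val_cast]
        split_ifs <;> omega
      · rw [if_neg hti, if_neg htj, compArgs_of_ne ((outerLabel_injective i).ne htj),
          compArgs_of_ne ((outerLabel_injective j).ne hti), Rpl.relabel_e]
        congr 1
        refine Fin.ext ?_
        have h1 : (t : ℕ) ≠ i := fun h => hti (Fin.ext h)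
        have h2 : (t : ℕ) ≠ j := fun h => htj (Fin.ext h)
        simp only [val_outerLabel, Fin.val_cast]
        split_ifs <;> omega

theorem rplComp_par (i j : Fin (m + 1)) (hij : i ≠ j) (q r : ℤ) (a : RplColl k m)
    {b : RplColl k n} (hb : b ∈ rplGr k (n + 1) q) {c : RplColl k l}
    (hc : c ∈ rplGr k (l + 1) r) :
    castArity (P := RplColl k) (Nat.add_right_comm m n l)
      (rplComp k (outerLabel n i j) (rplComp k i a b : RplColl k (m + n)) c) =
      (q * r).negOnePow •
        rplComp k (outerLabel l j i) (rplComp k j a c : RplColl k (m + l)) b := by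
  induction a using rplMultilinear_mono_induction with
  | mono a x ha hx =>
    refine rplGr_induction (C := fun b => castArity (P := RplColl k) (Nat.add_right_comm m n l)
      (rplComp k (outerLabel n i j) (rplComp k i x b : RplColl k (m + n)) c) =
      (q * r).negOnePow •
        rplComp k (outerLabel l j i) (rplComp k j x c : RplColl k (m + l)) b)
      (fun b y hb hy hq => ?_) (by simp [castArity_zero]) (fun y y' hy hy' => ?_)
      (fun s y hy => ?_) hb
    · refine rplGr_induction (C := fun c => castArity (P := RplColl k) (Nat.add_right_comm m n l)
        (rplComp k (outerLabel n i j) (rplComp k i x y : RplColl k (m + n)) c) =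
        (q * r).negOnePow •
          rplComp k (outerLabel l j i) (rplComp k j x c : RplColl k (m + l)) y)
        (fun c z hc hz hr => ?_) (by simp [castArity_zero]) (fun y y' hy hy' => ?_)
        (fun s y hy => ?_) hc
      · exact rplComp_par_mono hij ha hb hc hx hy hz hq hr
      · simp only [map_add, LinearMap.add_apply, castArity_add, hy, hy', smul_add]
      · simp only [map_smul, LinearMap.smul_apply, castArity_smul, hy, smul_comm s]
    · simp only [map_add, LinearMap.add_apply, castArity_add, hy, hy', smul_add]
    · simp only [map_smul, LinearMap.smul_apply, castArity_smul, hy, smul_comm s]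
  | zero => simp [castArity_zero]
  | add x x' hx hx' => simp only [map_add, LinearMap.add_apply, castArity_add, hx, hx', smul_add]
  | smul s x hx => simp only [map_smul, LinearMap.smul_apply, castArity_smul, hx, smul_comm s]

/-- Without circles and with a single nonzero degree, every pair of distinct letters has a factor
zero. -/
theorem koszulSign_single_ofFn (σ : Equiv.Perm (Fin n)) (i : Fin n) (q : ℤ) :
    koszulSign (Pi.single i q) (List.ofFn fun j => some (σ j)) = 1 := by
  rw [koszulSign_eq, pairSum_eq_zero_of_pairwise, zsign_zero]
  rw [List.pairwise_ofFn]
  intro a b hab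
  have h : σ a ≠ σ b := σ.injective.ne hab.ne
  simp only [koszulPair, letterDeg, Pi.single_apply]
  by_cases ha : σ a = i
  · have hb : σ b ≠ i := fun hb => h (ha.trans hb.symm)
    simp [hb]
  · simp [ha]

/-- Equivariance of the action in the ambient algebra, where the sign is trivial since only one
argument has a degree. The two conditions on `ρ` say that the permuted arguments are the relabelled
ones. -/
theorem rplComp_perm (i : Fin (m + 1)) (a : RplColl k m) (b : RplColl k n)
    (σ : Equiv.Perm (Fin (m + 1))) (τ : Equiv.Perm (Fin (n + 1)))
    (ρ : Equiv.Perm (Fin (m + n + 1)))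
    (h1 : ∀ j, j ≠ i → ρ (outerLabel n i j) = outerLabel n (σ i) (σ j))
    (h2 : ∀ j, ρ (innerLabel i j) = innerLabel (σ i) (τ j)) :
    rplComp k (σ i) (rplPerm k σ a) (rplPerm k τ b) = rplPerm k ρ (rplComp k i a b) := by
  induction b using rplMultilinear_mono_induction with
  | mono b y hb hy =>
    refine Subtype.ext ?_
    have hy' : (rplPerm k τ y : Rpl k (n + 1)) = Rpl.mono k (FreeMagma.map (Option.map τ) b) := by
      rw [coe_rplPerm, hy, Rpl.relabel_mono]
    rw [coe_rplPerm, coe_rplComp', coe_rplComp', relabel_act]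
    refine ((Rpl.superPreLie k (m + n + 1)).act_perm σ a (parity_update_e (outerLabel n (σ i)) (σ i)
      (parity_relabel_mono (innerLabel (σ i)) hy'))).trans ?_
    rw [koszulSign_single_ofFn, one_smul]
    congr 1
    funext t
    change compArgs (σ i) (rplPerm k τ y : Rpl k (n + 1)) (σ t) = _
    by_cases ht : t = i
    · subst ht
      rw [compArgs_self, compArgs_self, coe_rplPerm, Rpl.relabel_relabel, Rpl.relabel_relabel]
      congr 1
      congr 1
      funext j
      exact (h2 j).symm
    · rw [compArgs_of_ne (σ.injective.ne ht), compArgs_of_ne ht, Rpl.relabel_e, h1 t ht]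
  | zero => simp
  | add y y' hy hy' => simp only [map_add, hy, hy']
  | smul c y hy => simp only [map_smul, hy]

/-- The dg operad `rpL*`. -/
def rplOperad (k : Type*) [Field k] [CharZero k] : DGOperad k (RplColl k) where
  dg := rplDG k
  perm := rplRep k
  one := rplOne k
  comp i := rplComp k i
  perm_mem n σ p x hx := by
    change (rplPerm k σ x).1 ∈ Rpl.gr k (n + 1) p
    rw [coe_rplPerm]
    exact Rpl.relabel_mem_gr _ hx
  perm_d n σ x := Subtype.ext (by
    change (rplDiff k n (rplPerm k σ x)).1 = (rplPerm k σ (rplDiff k n x)).1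
    rw [coe_rplDiff, coe_rplPerm, coe_rplPerm, coe_rplDiff, Rpl.relabel_diff])
  one_mem := Rpl.mono_mem_gr (k := k) (FreeMagma.of (some (0 : Fin 1)))
  one_d := Subtype.ext (Rpl.diff_e (k := k) (0 : Fin 1))
  comp_mem i _ _ _ ha _ hb := rplComp_mem i ha hb
  comp_d i _ _ ha b := rplComp_d i ha b
  one_comp := rplOne_comp
  comp_one := rplComp_one
  comp_seq := rplComp_seq
  comp_par i j hij q r a _ hb _ hc := rplComp_par i j hij q r a hb hc
  comp_perm := rplComp_perm

theorem isRplOperad_rplOperad (k : Type*) [Field k] [CharZero k] :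
    IsRplOperad (Rpl.diff k) (rplOperad k) := by
  refine ⟨fun _ _ => rfl, fun n x => coe_rplDiff x, fun n σ m x _ hx => ?_, rfl,
    fun m n i a b x y ha hb hx hy => ?_⟩
  · refine (coe_rplPerm σ x).trans ?_
    rw [hx, Rpl.relabel_mono]
  · exact rplComp_mono i ha hx hy

end RplOperad

end

/-! ### Cohomology of a dg vector space. -/

noncomputable section

namespace DGStruct

variable {k : Type*} [Field k] {X : Type*} [AddCommGroup X] [Module k X] (D : DGStruct k X)

theorem induction {C : X → Prop} (mem : ∀ p, ∀ x ∈ D.gr p, C x) (add : ∀ x y, C x → C y → C (x + y))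
    (x : X) : C x := by
  have hx : x ∈ ⨆ p, D.gr p := by
    rw [D.internal.submodule_iSup_eq_top]
    trivial
  exact Submodule.iSup_induction _ (motive := C) hx mem (mem 0 0 (zero_mem _)) add

/-- The projection onto the component of degree `p`. -/
def component (p : ℤ) : X →ₗ[k] X :=
  letI := D.internal.chooseDecomposition
  (D.gr p).subtype ∘ₗ DirectSum.component k ℤ (fun p => D.gr p) p ∘ₗ
    (DirectSum.decomposeLinearEquiv D.gr).toLinearMap

theorem component_of_mem {p : ℤ} {x : X} (hx : x ∈ D.gr p) : D.component p x = x := by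
  let := D.internal.chooseDecomposition
  exact DirectSum.decompose_of_mem_same D.gr hx

theorem component_of_mem_ne {p q : ℤ} {x : X} (hx : x ∈ D.gr q) (h : q ≠ p) :
    D.component p x = 0 := by
  let := D.internal.chooseDecomposition
  exact DirectSum.decompose_of_mem_ne D.gr hx h

theorem d_component (p : ℤ) (x : X) : D.d (D.component p x) = D.component (p + 1) (D.d x) := by
  induction x using D.induction with
  | mem q x hx =>
    by_cases h : q = p
    · subst h
      rw [D.component_of_mem hx, D.component_of_mem (D.d_mem _ _ hx)]
    · rw [D.component_of_mem_ne hx h, map_zero,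
        D.component_of_mem_ne (D.d_mem _ _ hx) (by omega)]
  | add x y hx hy => simp only [map_add, hx, hy]

/-- The differential is homogeneous, so the components of a cocycle are cocycles. This reduces signs
that depend on degrees to the homogeneous case. -/
theorem ker_le_iSup : LinearMap.ker D.d ≤ ⨆ p, D.gr p ⊓ LinearMap.ker D.d := by
  intro x hx
  classical
  let := D.internal.chooseDecomposition
  rw [← DirectSum.sum_support_decompose D.gr x]
  refine Submodule.sum_mem _ fun p _ => Submodule.mem_iSup_of_mem p ⟨Subtype.coe_prop _, ?_⟩
  change D.d (D.component p x) = 0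
  rw [d_component, LinearMap.mem_ker.1 hx, map_zero]

theorem le_iSup_gr (x : X) : x ∈ ⨆ p, D.gr p := by
  rw [D.internal.submodule_iSup_eq_top]
  trivial

/-- The class of a cocycle. -/
def clsMk (x : X) (hx : D.d x = 0) : D.H := D.cls ⟨x, hx⟩

theorem exists_clsMk (h : D.H) : ∃ x, ∃ hx : D.d x = 0, h = D.clsMk x hx := by
  obtain ⟨x, rfl⟩ := Submodule.mkQ_surjective _ h
  exact ⟨x, x.2, rfl⟩

theorem clsMk_eq_clsMk {x y : X} {hx : D.d x = 0} {hy : D.d y = 0} :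
    D.clsMk x hx = D.clsMk y hy ↔ x - y ∈ LinearMap.range D.d :=
  Submodule.Quotient.eq _

theorem clsMk_congr {x y : X} {hx : D.d x = 0} {hy : D.d y = 0} (h : x = y) :
    D.clsMk x hx = D.clsMk y hy := by
  subst h
  rfl

theorem clsMk_eq_zero {x : X} {hx : D.d x = 0} (h : x ∈ LinearMap.range D.d) :
    D.clsMk x hx = 0 :=
  (Submodule.Quotient.mk_eq_zero _).2 h

theorem smul_clsMk (s : ℤˣ) {x : X} (hx : D.d x = 0) :
    s • D.clsMk x hx = D.clsMk (s • x) (by rw [Units.smul_def, map_zsmul, hx, smul_zero]) := by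
  rw [Units.smul_def, clsMk, ← map_zsmul]
  rfl

/-- A linear choice of representing cocycles. -/
def rep : D.H →ₗ[k] LinearMap.ker D.d :=
  (LinearMap.exists_rightInverse_of_surjective D.cls
    (LinearMap.range_eq_top.2 (Submodule.mkQ_surjective _))).choose

theorem cls_rep (h : D.H) : D.cls (D.rep h) = h :=
  LinearMap.congr_fun (LinearMap.exists_rightInverse_of_surjective D.cls
    (LinearMap.range_eq_top.2 (Submodule.mkQ_surjective _))).choose_spec h

theorem rep_clsMk_sub (x : X) (hx : D.d x = 0) :
    (D.rep (D.clsMk x hx) : X) - x ∈ LinearMap.range D.d :=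
  (D.clsMk_eq_clsMk (hx := (D.rep (D.clsMk x hx)).2) (hy := hx)).1 (D.cls_rep (D.clsMk x hx))

/-- The grading of the cohomology. -/
def grH (p : ℤ) : Submodule k D.H :=
  ((D.gr p).comap (LinearMap.ker D.d).subtype).map D.cls

theorem exists_clsMk_of_mem {p : ℤ} {h : D.H} (hh : h ∈ D.grH p) :
    ∃ x, ∃ hx : D.d x = 0, x ∈ D.gr p ∧ h = D.clsMk x hx := by
  obtain ⟨x, hx, rfl⟩ := hh
  exact ⟨x, x.2, hx, rfl⟩

theorem clsMk_mem {p : ℤ} {x : X} {hx : D.d x = 0} (h : x ∈ D.gr p) : D.clsMk x hx ∈ D.grH p :=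
  ⟨⟨x, hx⟩, h, rfl⟩

/-- The projection of the cohomology onto the component of degree `p`. -/
def componentH (p : ℤ) : D.H →ₗ[k] D.H :=
  Submodule.mapQ _ _ ((D.component p).restrict (p := LinearMap.ker D.d) (q := LinearMap.ker D.d)
    (fun x hx => by rw [LinearMap.mem_ker, d_component, LinearMap.mem_ker.1 hx, map_zero])) (by
    rintro ⟨_, _⟩ ⟨y, rfl⟩
    exact ⟨D.component (p - 1) y, by
      rw [d_component, sub_add_cancel]
      rfl⟩)

theorem componentH_clsMk (p : ℤ) (x : X) (hx : D.d x = 0) :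
    D.componentH p (D.clsMk x hx) =
      D.clsMk (D.component p x) (by rw [d_component, hx, map_zero]) := rfl

/-- The projection to degree `p` induces a map on cohomology that is the identity on classes of
degree `p` and zero on those of any other degree. Generation is the decomposition of cocycles into
homogeneous cocycles. -/
theorem isInternal_grH : DirectSum.IsInternal D.grH := by
  refine (DirectSum.isInternal_submodule_iff_iSupIndep_and_iSup_eq_top _).2 ⟨fun p => ?_, ?_⟩
  · rw [Submodule.disjoint_def]
    intro h hh hh'
    have h1 : D.componentH p h = h := by
      obtain ⟨x, hx, hp, rfl⟩ := D.exists_clsMk_of_mem hh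
      rw [componentH_clsMk]
      exact D.clsMk_congr (D.component_of_mem hp)
    have h2 : (⨆ q, ⨆ (_ : q ≠ p), D.grH q) ≤ LinearMap.ker (D.componentH p) := by
      refine iSup₂_le fun q hq h hh => ?_
      obtain ⟨x, hx, hp, rfl⟩ := D.exists_clsMk_of_mem hh
      rw [LinearMap.mem_ker, componentH_clsMk]
      refine D.clsMk_eq_zero ?_
      rw [D.component_of_mem_ne hp hq]
      exact zero_mem _
    rw [← h1]
    exact h2 hh'
  · rw [eq_top_iff]
    rintro h -
    obtain ⟨x, hx, rfl⟩ := D.exists_clsMk h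
    refine Submodule.iSup_induction' _ (motive := fun x _ => ∀ hx : D.d x = 0,
      D.clsMk x hx ∈ ⨆ p, D.grH p) (fun p x h hx => ?_) (fun hx => ?_) (fun x y h h' ih ih' hx => ?_)
      (D.ker_le_iSup hx) hx
    · exact Submodule.mem_iSup_of_mem p (D.clsMk_mem h.1)
    · rw [D.clsMk_eq_zero (zero_mem _)]
      exact zero_mem _
    · have key : ∀ x ∈ ⨆ p, D.gr p ⊓ LinearMap.ker D.d, D.d x = 0 := fun x h =>
        (iSup_le fun p => inf_le_right : ⨆ p, D.gr p ⊓ LinearMap.ker D.d ≤ LinearMap.ker D.d) h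
      exact add_mem (ih (key x h)) (ih' (key y h'))

/-- The cohomology with zero differential. -/
def cohomology : DGStruct k D.H where
  gr := D.grH
  internal := D.isInternal_grH
  d := 0
  d_mem _ _ _ := zero_mem _
  d_d _ := rfl

theorem isCohomology_cohomology : D.IsCohomology D.cohomology := ⟨rfl, fun _ => rfl⟩

end DGStruct

/-! ### The cohomology operad. -/

namespace DGOperad

variable {k : Type*} [Field k] {P : ℕ → Type*} [∀ n, AddCommGroup (P n)] [∀ n, Module k (P n)]
  (𝒪 : DGOperad k P) {m n l : ℕ}

/-- The sign in the Leibniz rule sits on the term with the differential of `b`. When that is zero,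
`a` need not be homogeneous. -/
theorem d_comp_of_right (i : Fin (m + 1)) (a : P m) {b : P n} (hb : (𝒪.dg n).d b = 0) :
    (𝒪.dg (m + n)).d (𝒪.comp i a b) = 𝒪.comp i ((𝒪.dg m).d a) b := by
  induction a using (𝒪.dg m).induction with
  | mem p a ha => rw [𝒪.comp_d i p a ha, hb, map_zero, smul_zero, add_zero]
  | add x y hx hy => simp only [map_add, LinearMap.add_apply, hx, hy]

theorem d_comp_eq_zero (i : Fin (m + 1)) {a : P m} {b : P n} (ha : (𝒪.dg m).d a = 0)
    (hb : (𝒪.dg n).d b = 0) : (𝒪.dg (m + n)).d (𝒪.comp i a b) = 0 := by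
  rw [𝒪.d_comp_of_right i a hb, ha, map_zero, LinearMap.zero_apply]

theorem comp_mem_range_left (i : Fin (m + 1)) {a : P m} {b : P n}
    (ha : a ∈ LinearMap.range (𝒪.dg m).d) (hb : (𝒪.dg n).d b = 0) :
    𝒪.comp i a b ∈ LinearMap.range (𝒪.dg (m + n)).d := by
  obtain ⟨a, rfl⟩ := ha
  exact ⟨_, 𝒪.d_comp_of_right i a hb⟩

/-- Here the sign depends on the degree of `a`, so a primitive is built separately for each
homogeneous component of `a`, itself a cocycle. -/
theorem comp_mem_range_right (i : Fin (m + 1)) {a : P m} {b : P n} (ha : (𝒪.dg m).d a = 0)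
    (hb : b ∈ LinearMap.range (𝒪.dg n).d) :
    𝒪.comp i a b ∈ LinearMap.range (𝒪.dg (m + n)).d := by
  obtain ⟨b, rfl⟩ := hb
  refine Submodule.iSup_induction _ (motive := fun a => 𝒪.comp i a ((𝒪.dg n).d b) ∈
    LinearMap.range (𝒪.dg (m + n)).d) ((𝒪.dg m).ker_le_iSup ha) (fun p a h => ?_) (by simp)
    (fun a a' h h' => ?_)
  · refine ⟨p.negOnePow • 𝒪.comp i a b, ?_⟩
    rw [Units.smul_def, map_zsmul, 𝒪.comp_d i p a h.1, LinearMap.mem_ker.1 h.2, map_zero,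
      LinearMap.zero_apply, zero_add, ← Units.smul_def, smul_smul, Int.units_mul_self, one_smul]
  · rw [map_add]
    exact add_mem h h'

/-- Composition of cohomology classes. -/
def compH (i : Fin (m + 1)) : (𝒪.dg m).H →ₗ[k] (𝒪.dg n).H →ₗ[k] (𝒪.dg (m + n)).H :=
  LinearMap.mk₂ k (fun a b => (𝒪.dg (m + n)).clsMk
      (𝒪.comp i ((𝒪.dg m).rep a : P m) ((𝒪.dg n).rep b : P n))
      (𝒪.d_comp_eq_zero i ((𝒪.dg m).rep a).2 ((𝒪.dg n).rep b).2))
    (fun a a' b => by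
      rw [DGStruct.clsMk, DGStruct.clsMk, DGStruct.clsMk, ← map_add]
      exact congrArg _ (Subtype.ext (by simp)))
    (fun c a b => by
      rw [DGStruct.clsMk, DGStruct.clsMk, ← map_smul]
      exact congrArg _ (Subtype.ext (by simp)))
    (fun a b b' => by
      rw [DGStruct.clsMk, DGStruct.clsMk, DGStruct.clsMk, ← map_add]
      exact congrArg _ (Subtype.ext (by simp)))
    (fun c a b => by
      rw [DGStruct.clsMk, DGStruct.clsMk, ← map_smul]
      exact congrArg _ (Subtype.ext (by simp)))

/-- Composition on cohomology is defined through a linear choice of representatives, which makes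
bilinearity automatic. This lemma removes the choice, and all axioms are then checked on arbitrary
cocycles. -/
theorem compH_clsMk (i : Fin (m + 1)) {a : P m} {b : P n} (ha : (𝒪.dg m).d a = 0)
    (hb : (𝒪.dg n).d b = 0) : 𝒪.compH i ((𝒪.dg m).clsMk a ha) ((𝒪.dg n).clsMk b hb) =
      (𝒪.dg (m + n)).clsMk (𝒪.comp i a b) (𝒪.d_comp_eq_zero i ha hb) := by
  refine (𝒪.dg (m + n)).clsMk_eq_clsMk.2 ?_
  have h1 := 𝒪.comp_mem_range_left i ((𝒪.dg m).rep_clsMk_sub a ha)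
    ((𝒪.dg n).rep ((𝒪.dg n).clsMk b hb)).2
  have h2 := 𝒪.comp_mem_range_right i ha ((𝒪.dg n).rep_clsMk_sub b hb)
  have h3 := add_mem h1 h2
  rwa [map_sub, LinearMap.sub_apply, map_sub, sub_add_sub_cancel] at h3

theorem d_perm_eq_zero (σ : Equiv.Perm (Fin (n + 1))) {a : P n} (ha : (𝒪.dg n).d a = 0) :
    (𝒪.dg n).d (𝒪.perm n σ a) = 0 := by
  rw [𝒪.perm_d, ha, map_zero]

/-- The action of a permutation on cohomology classes. -/
def permH (σ : Equiv.Perm (Fin (n + 1))) : (𝒪.dg n).H →ₗ[k] (𝒪.dg n).H :=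
  Submodule.mapQ _ _ ((𝒪.perm n σ).restrict (p := LinearMap.ker (𝒪.dg n).d)
    (q := LinearMap.ker (𝒪.dg n).d) (fun _ hx => 𝒪.d_perm_eq_zero σ hx)) (by
    rintro ⟨_, _⟩ ⟨y, rfl⟩
    exact ⟨𝒪.perm n σ y, 𝒪.perm_d n σ y⟩)

theorem permH_clsMk (σ : Equiv.Perm (Fin (n + 1))) {a : P n} (ha : (𝒪.dg n).d a = 0) :
    𝒪.permH σ ((𝒪.dg n).clsMk a ha) =
      (𝒪.dg n).clsMk (𝒪.perm n σ a) (𝒪.d_perm_eq_zero σ ha) := rfl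

theorem d_castArity (h : m = n) {x : P m} (hx : (𝒪.dg m).d x = 0) :
    (𝒪.dg n).d (castArity h x) = 0 := by
  subst h
  exact hx

theorem castArity_clsMk (h : m = n) {x : P m} (hx : (𝒪.dg m).d x = 0) :
    castArity (P := fun n => (𝒪.dg n).H) h ((𝒪.dg m).clsMk x hx) =
      (𝒪.dg n).clsMk (castArity h x) (𝒪.d_castArity h hx) := by
  subst h
  rfl

/-- The cohomology operad. -/
def cohomology : DGOperad k (fun n => (𝒪.dg n).H) where
  dg n := (𝒪.dg n).cohomology
  perm n :=
    { toFun := fun σ => 𝒪.permH σ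
      map_one' := LinearMap.ext fun h => by
        obtain ⟨x, hx, rfl⟩ := (𝒪.dg n).exists_clsMk h
        rw [permH_clsMk]
        exact (𝒪.dg n).clsMk_congr (by rw [map_one]; rfl)
      map_mul' := fun σ τ => LinearMap.ext fun h => by
        obtain ⟨x, hx, rfl⟩ := (𝒪.dg n).exists_clsMk h
        rw [permH_clsMk, Module.End.mul_apply, permH_clsMk, permH_clsMk]
        exact (𝒪.dg n).clsMk_congr (by rw [map_mul]; rfl) }
  one := (𝒪.dg 0).clsMk 𝒪.one 𝒪.one_d
  comp i := 𝒪.compH i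
  perm_mem n σ p h hh := by
    obtain ⟨x, hx, hp, rfl⟩ := (𝒪.dg n).exists_clsMk_of_mem hh
    exact (𝒪.dg n).clsMk_mem (𝒪.perm_mem n σ p x hp)
  perm_d n σ x := (map_zero (𝒪.permH σ)).symm
  one_mem := (𝒪.dg 0).clsMk_mem 𝒪.one_mem
  one_d := rfl
  comp_mem {m n} i p q a ha b hb := by
    obtain ⟨x, hx, hp, rfl⟩ := (𝒪.dg m).exists_clsMk_of_mem ha
    obtain ⟨y, hy, hq, rfl⟩ := (𝒪.dg n).exists_clsMk_of_mem hb
    rw [compH_clsMk]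
    exact (𝒪.dg (m + n)).clsMk_mem (𝒪.comp_mem i p q x hp y hq)
  comp_d {m n} i p a _ b := by
    change (0 : (𝒪.dg (m + n)).H) = 𝒪.compH i 0 b + p.negOnePow • 𝒪.compH i a 0
    rw [map_zero, map_zero, LinearMap.zero_apply, smul_zero, add_zero]
  one_comp {n} b := by
    obtain ⟨y, hy, rfl⟩ := (𝒪.dg n).exists_clsMk b
    rw [compH_clsMk, castArity_clsMk]
    exact DGStruct.clsMk_congr _ (𝒪.one_comp y)
  comp_one {m} i a := by
    obtain ⟨x, hx, rfl⟩ := (𝒪.dg m).exists_clsMk a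
    exact (𝒪.compH_clsMk i hx 𝒪.one_d).trans (DGStruct.clsMk_congr _ (𝒪.comp_one i x))
  comp_seq {m n l} i j a b c := by
    obtain ⟨x, hx, rfl⟩ := (𝒪.dg m).exists_clsMk a
    obtain ⟨y, hy, rfl⟩ := (𝒪.dg n).exists_clsMk b
    obtain ⟨z, hz, rfl⟩ := (𝒪.dg l).exists_clsMk c
    rw [compH_clsMk, compH_clsMk, compH_clsMk, compH_clsMk, castArity_clsMk]
    exact DGStruct.clsMk_congr _ (𝒪.comp_seq i j x y z)
  comp_par {m n l} i j hij q r a b hb c hc := by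
    obtain ⟨x, hx, rfl⟩ := (𝒪.dg m).exists_clsMk a
    obtain ⟨y, hy, hq, rfl⟩ := (𝒪.dg n).exists_clsMk_of_mem hb
    obtain ⟨z, hz, hr, rfl⟩ := (𝒪.dg l).exists_clsMk_of_mem hc
    rw [compH_clsMk, compH_clsMk, compH_clsMk, compH_clsMk, castArity_clsMk, DGStruct.smul_clsMk]
    exact DGStruct.clsMk_congr _ (𝒪.comp_par i j hij q r x y hq z hr)
  comp_perm {m n} i a b σ τ ρ h1 h2 := by
    obtain ⟨x, hx, rfl⟩ := (𝒪.dg m).exists_clsMk a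
    obtain ⟨y, hy, rfl⟩ := (𝒪.dg n).exists_clsMk b
    change 𝒪.compH (σ i) (𝒪.permH σ _) (𝒪.permH τ _) = 𝒪.permH ρ (𝒪.compH i _ _)
    rw [compH_clsMk, permH_clsMk, permH_clsMk, compH_clsMk, permH_clsMk]
    exact DGStruct.clsMk_congr _ (𝒪.comp_perm i x y σ τ ρ h1 h2)

theorem isCohomology_cohomology : 𝒪.IsCohomology 𝒪.cohomology := by
  refine ⟨fun n => (𝒪.dg n).isCohomology_cohomology, fun n σ x y hy => ?_, fun x hx => ?_,
    fun m n i x y z hz => ?_⟩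
  · exact (𝒪.permH_clsMk σ x.2).trans (DGStruct.clsMk_congr _ hy.symm)
  · exact DGStruct.clsMk_congr (𝒪.dg 0) hx.symm
  · exact (𝒪.compH_clsMk i x.2 y.2).trans (DGStruct.clsMk_congr _ hz.symm)

end DGOperad

end

/-! ### Multilinear maps on sums of homogeneous elements. -/

noncomputable section

section Multilinear

variable {k : Type*} [Field k] {X Y : Type*} [AddCommGroup X] [Module k X] [AddCommGroup Y]
  [Module k Y] {n : ℕ}

/-- A multilinear map sends sums of homogeneous elements to a subspace if it does so for homogeneous
elements. -/
theorem multilinear_mem_of_homogeneous (M : MultilinearMap k (fun _ : Fin n => X) Y)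
    (G : Fin n → ℤ → Submodule k X) (N : Submodule k Y)
    (h : ∀ (p : Fin n → ℤ) f, (∀ i, f i ∈ G i (p i)) → M f ∈ N) (f : Fin n → X)
    (hf : ∀ i, f i ∈ ⨆ p, G i p) : M f ∈ N := by
  have key : ∀ S : Finset (Fin n), ∀ f : Fin n → X, (∀ i ∉ S, ∃ p, f i ∈ G i p) →
      (∀ i, f i ∈ ⨆ p, G i p) → M f ∈ N := by
    intro S
    induction S using Finset.induction_on with
    | empty =>
      intro f hf _
      choose p hp using fun i => hf i (Finset.notMem_empty i)
      exact h p f hp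
    | insert i S hi ih =>
      intro f hf hf'
      rw [← Function.update_eq_self i f]
      refine Submodule.iSup_induction _ (motive := fun x => M (Function.update f i x) ∈ N) (hf' i)
        (fun p x hx => ?_) ?_ (fun x y hx hy => ?_)
      · refine ih _ (fun j hj => ?_) (fun j => ?_)
        · by_cases hji : j = i
          · subst hji
            exact ⟨p, by rwa [Function.update_self]⟩
          · rw [Function.update_of_ne hji]
            exact hf j (by simp [hji, hj])
        · by_cases hji : j = i
          · subst hji
            rw [Function.update_self]
            exact Submodule.mem_iSup_of_mem p hx
          · rw [Function.update_of_ne hji]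
            exact hf' j
      · rw [M.map_coord_zero i (Function.update_self _ _ _)]
        exact zero_mem _
      · rw [M.map_update_add]
        exact add_mem hx hy
  exact key Finset.univ f (by simp) hf

/-- The value of a multilinear map modulo a subspace can be computed by replacing the arguments one
by one. -/
theorem multilinear_sub_mem (M : MultilinearMap k (fun _ : Fin n => X) Y) (C : Set X)
    (B : Submodule k X) (N : Submodule k Y)
    (h : ∀ i f x, (∀ j, f j ∈ C) → x ∈ B → M (Function.update f i x) ∈ N) {f g : Fin n → X}
    (hf : ∀ i, f i ∈ C) (hg : ∀ i, g i ∈ C) (hfg : ∀ i, f i - g i ∈ B) : M f - M g ∈ N := by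
  have key : ∀ S : Finset (Fin n), M f - M (fun i => if i ∈ S then g i else f i) ∈ N := by
    intro S
    induction S using Finset.induction_on with
    | empty => simp
    | insert i S hi ih =>
      rw [← sub_add_sub_cancel _ (M fun i => if i ∈ S then g i else f i)]
      refine add_mem ih ?_
      have h1 : (fun j => if j ∈ insert i S then g j else f j) =
          Function.update (fun j => if j ∈ S then g j else f j) i (g i) := by
        funext j
        by_cases hji : j = i
        · subst hji
          simp
        · simp [hji]
      have h2 : (fun j => if j ∈ S then g j else f j) =
          Function.update (fun j => if j ∈ S then g j else f j) i (f i) := by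
        funext j
        by_cases hji : j = i
        · subst hji
          simp [hi]
        · simp [hji]
      rw [h1]
      nth_rewrite 1 [h2]
      rw [← M.map_update_sub]
      refine h i _ _ (fun j => ?_) (hfg i)
      split_ifs
      · exact hg j
      · exact hf j
  simpa using key Finset.univ

end Multilinear

/-! ### The action on cohomology. -/

namespace DGOperad.Algebra

variable {k : Type*} [Field k] {P : ℕ → Type*} [∀ n, AddCommGroup (P n)] [∀ n, Module k (P n)]
  {𝒪 : DGOperad k P} {X : Type*} [AddCommGroup X] [Module k X] {D : DGStruct k X}
  (A : 𝒪.Algebra D) {m n : ℕ}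

/-- On homogeneous cocycles the correction terms of `act_d` vanish and the value is a coboundary;
multilinearity extends this to all cocycles. -/
theorem act_d_mem_range (U : P n) {f : Fin (n + 1) → X} (hf : ∀ i, D.d (f i) = 0) :
    A.act n ((𝒪.dg n).d U) f ∈ LinearMap.range D.d := by
  induction U using (𝒪.dg n).induction with
  | mem r U hU =>
    refine multilinear_mem_of_homogeneous _ (fun _ p => D.gr p ⊓ LinearMap.ker D.d) _
      (fun p f hf => ?_) f fun i => D.ker_le_iSup (hf i)
    refine ⟨A.act n U f, ?_⟩
    rw [A.act_d n r U p f hU fun i => (hf i).1, Finset.sum_eq_zero, smul_zero, sub_zero]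
    intro i _
    rw [LinearMap.mem_ker.1 (hf i).2, (A.act n U).map_coord_zero i (Function.update_self _ _ _),
      smul_zero]
  | add U U' h h' =>
    rw [map_add, map_add]
    exact add_mem h h'

theorem d_act_eq_zero {U : P n} (hU : (𝒪.dg n).d U = 0) {f : Fin (n + 1) → X}
    (hf : ∀ i, D.d (f i) = 0) : D.d (A.act n U f) = 0 := by
  refine Submodule.iSup_induction _ (motive := fun U => D.d (A.act n U f) = 0)
    ((𝒪.dg n).ker_le_iSup hU) (fun r U hU => ?_) (by simp) (fun U U' h h' => by
      rw [map_add, add_apply, map_add, h, h', add_zero])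
  refine multilinear_mem_of_homogeneous (A.act n U) (fun _ p => D.gr p ⊓ LinearMap.ker D.d)
    (LinearMap.ker D.d) (fun p f hf => ?_) f fun i => D.ker_le_iSup (hf i)
  have h := A.act_d n r U p f hU.1 fun i => (hf i).1
  rw [Finset.sum_eq_zero, smul_zero, sub_zero, LinearMap.mem_ker.1 hU.2, map_zero,
    zero_apply] at h
  · exact h.symm
  · intro i _
    rw [LinearMap.mem_ker.1 (hf i).2, (A.act n U).map_coord_zero i (Function.update_self _ _ _),
      smul_zero]

/-- If `U` and all arguments other than the `i`-th are homogeneous cocycles, then `act_d` has a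
single correction term, so `U(…, d x, …)` is up to sign the differential of `U(…, x, …)`. -/
theorem act_update_d_mem_range {U : P n} (hU : (𝒪.dg n).d U = 0) (i : Fin (n + 1))
    {f : Fin (n + 1) → X} (hf : ∀ j, D.d (f j) = 0) {x : X} (hx : x ∈ LinearMap.range D.d) :
    A.act n U (Function.update f i x) ∈ LinearMap.range D.d := by
  refine Submodule.iSup_induction _ (motive := fun U => A.act n U (Function.update f i x) ∈
    LinearMap.range D.d) ((𝒪.dg n).ker_le_iSup hU) (fun r U hU => ?_) (by simp)
    (fun U U' h h' => by
      rw [map_add, add_apply]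
      exact add_mem h h')
  obtain ⟨x, rfl⟩ := hx
  -- The differential is built into slot `i`, so that `x` can be decomposed into arbitrary
  -- homogeneous elements there, while the other slots are decomposed into homogeneous cocycles.
  have key := multilinear_mem_of_homogeneous ((A.act n U).compLinearMap
    (fun j => if j = i then D.d else LinearMap.id))
    (fun j p => if j = i then D.gr p else D.gr p ⊓ LinearMap.ker D.d) (LinearMap.range D.d)
    (fun p f hf => ?_) (Function.update f i x) (fun j => ?_)
  · rw [MultilinearMap.compLinearMap_apply] at key
    convert key using 2
    funext j
    by_cases hj : j = i
    · subst hj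
      simp
    · simp [hj]
  · have hf' : ∀ j, f j ∈ D.gr (p j) := by
      intro j
      have := hf j
      split_ifs at this
      · exact this
      · exact this.1
    have hd : ∀ j ≠ i, D.d (f j) = 0 := by
      intro j hj
      have := hf j
      rw [if_neg hj] at this
      exact this.2
    have h := A.act_d n r U p f hU.1 hf'
    rw [LinearMap.mem_ker.1 hU.2, map_zero, zero_apply, Finset.sum_eq_single i,
      smul_smul, ← Int.negOnePow_add, eq_comm, sub_eq_zero] at h
    · have h2 : (fun j => (if j = i then D.d else LinearMap.id) (f j)) =
          Function.update f i (D.d (f i)) := by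
        funext j
        by_cases hj : j = i
        · subst hj
          simp
        · simp [hj]
      rw [MultilinearMap.compLinearMap_apply, h2]
      refine ⟨(r + ∑ j with j < i, p j).negOnePow • A.act n U f, ?_⟩
      rw [Units.smul_def, map_zsmul, h, ← Units.smul_def, smul_smul, Int.units_mul_self, one_smul]
    · intro j _ hj
      rw [hd j hj, (A.act n U).map_coord_zero j (Function.update_self _ _ _), smul_zero]
    · simp
  · by_cases hj : j = i
    · subst hj
      simpa using D.le_iSup_gr x
    · simpa [hj] using D.ker_le_iSup (hf j)

/-- The arguments are exchanged one at a time, with the operation fixed; then the operation is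
exchanged, with the arguments fixed. -/
theorem act_sub_act_mem_range {U V : P n} (hU : (𝒪.dg n).d U = 0)
    (hUV : U - V ∈ LinearMap.range (𝒪.dg n).d) {f g : Fin (n + 1) → X} (hf : ∀ j, D.d (f j) = 0)
    (hg : ∀ j, D.d (g j) = 0) (hfg : ∀ j, f j - g j ∈ LinearMap.range D.d) :
    A.act n U f - A.act n V g ∈ LinearMap.range D.d := by
  rw [← sub_add_sub_cancel _ (A.act n U g)]
  refine add_mem ?_ ?_
  · exact multilinear_sub_mem (A.act n U) {x | D.d x = 0} (LinearMap.range D.d) _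
      (fun i f x hf hx => A.act_update_d_mem_range hU i hf hx) hf hg hfg
  · obtain ⟨W, hW⟩ := hUV
    rw [← sub_apply, ← map_sub, ← hW]
    exact A.act_d_mem_range W hg

/-- The action of cohomology classes on cohomology classes. -/
def actH (n : ℕ) : (𝒪.dg n).H →ₗ[k] MultilinearMap k (fun _ : Fin (n + 1) => D.H) D.H where
  toFun U := D.cls.compMultilinearMap
    (((A.act n ((𝒪.dg n).rep U : P n)).compLinearMap
      (fun _ => (LinearMap.ker D.d).subtype ∘ₗ D.rep)).codRestrict (LinearMap.ker D.d)
        (fun f => A.d_act_eq_zero ((𝒪.dg n).rep U).2 fun i => (D.rep (f i)).2))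
  map_add' U V := MultilinearMap.ext fun f => by
    rw [add_apply, LinearMap.compMultilinearMap_apply,
      LinearMap.compMultilinearMap_apply, LinearMap.compMultilinearMap_apply, ← map_add]
    refine congrArg _ (Subtype.ext ?_)
    simp
    rfl
  map_smul' c U := MultilinearMap.ext fun f => by
    rw [smul_apply, LinearMap.compMultilinearMap_apply,
      LinearMap.compMultilinearMap_apply, RingHom.id_apply, ← map_smul]
    refine congrArg _ (Subtype.ext ?_)
    simp
    rfl

theorem actH_clsMk {U : P n} (hU : (𝒪.dg n).d U = 0) {f : Fin (n + 1) → X}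
    (hf : ∀ i, D.d (f i) = 0) :
    A.actH n ((𝒪.dg n).clsMk U hU) (fun i => D.clsMk (f i) (hf i)) =
      D.clsMk (A.act n U f) (A.d_act_eq_zero hU hf) :=
  D.clsMk_eq_clsMk.2 (A.act_sub_act_mem_range ((𝒪.dg n).rep _).2 ((𝒪.dg n).rep_clsMk_sub U hU)
    (fun _ => (D.rep _).2) hf fun i => D.rep_clsMk_sub (f i) (hf i))

/-- The induced algebra structure on cohomology. -/
def cohomology : 𝒪.cohomology.Algebra D.cohomology where
  act := A.actH
  act_mem n r p f U hU hf := by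
    obtain ⟨U, hU, hr, rfl⟩ := (𝒪.dg n).exists_clsMk_of_mem hU
    choose g hg hp h using fun i => D.exists_clsMk_of_mem (hf i)
    obtain rfl : f = _ := funext h
    rw [actH_clsMk]
    exact D.clsMk_mem (A.act_mem n r p g U hr hp)
  act_one f := by
    choose g hg h using fun i => D.exists_clsMk (f i)
    obtain rfl : f = _ := funext h
    exact (A.actH_clsMk 𝒪.one_d hg).trans (D.clsMk_congr (A.act_one g))
  act_comp {m n} i a q b p f hb hf := by
    obtain ⟨x, hx, rfl⟩ := (𝒪.dg m).exists_clsMk a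
    obtain ⟨y, hy, hq, rfl⟩ := (𝒪.dg n).exists_clsMk_of_mem hb
    choose g hg hp h using fun i => D.exists_clsMk_of_mem (hf i)
    obtain rfl : f = _ := funext h
    have h1 := A.act_comp i x q y p g hq hp
    have h2 : (fun j => if j = i then A.actH n ((𝒪.dg n).clsMk y hy)
        (fun l => D.clsMk (g (innerLabel i l)) (hg _)) else
          D.clsMk (g (outerLabel n i j)) (hg _)) = fun j => D.clsMk
        (if j = i then A.act n y (fun l => g (innerLabel i l)) else g (outerLabel n i j)) (by
          split_ifs
          · exact A.d_act_eq_zero hy fun l => hg _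
          · exact hg _) := by
      funext j
      by_cases hj : j = i
      · subst hj
        rw [if_pos rfl, actH_clsMk]
        exact D.clsMk_congr (if_pos rfl).symm
      · rw [if_neg hj]
        exact D.clsMk_congr (if_neg hj).symm
    rw [h2, actH_clsMk, DGStruct.smul_clsMk]
    change A.actH (m + n) (𝒪.compH i _ _) _ = _
    rw [compH_clsMk, actH_clsMk]
    exact D.clsMk_congr h1
  act_perm n σ U p f hf := by
    obtain ⟨U, hU, rfl⟩ := (𝒪.dg n).exists_clsMk U
    choose g hg hp h using fun i => D.exists_clsMk_of_mem (hf i)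
    obtain rfl : f = _ := funext h
    rw [actH_clsMk A hU (f := fun i => g (σ i)) fun i => hg (σ i), DGStruct.smul_clsMk]
    change A.actH n (𝒪.permH σ _) _ = _
    rw [permH_clsMk, actH_clsMk]
    exact D.clsMk_congr (A.act_perm n σ U p g hp)
  act_d n r U p f _ _ := by
    change A.actH n 0 f = 0 - _
    rw [map_zero, zero_apply, Finset.sum_eq_zero, smul_zero, sub_zero]
    intro i _
    change _ • A.actH n U (Function.update f i 0) = 0
    rw [(A.actH n U).map_coord_zero i (Function.update_self _ _ _), smul_zero]

end DGOperad.Algebra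

end

noncomputable section

theorem DGOperad.Algebra.isInducedAction_cohomology {k : Type*} [Field k] {P : ℕ → Type*}
    [∀ n, AddCommGroup (P n)] [∀ n, Module k (P n)] {𝒪 : DGOperad k P} {X : Type*}
    [AddCommGroup X] [Module k X] {D : DGStruct k X} (A : 𝒪.Algebra D) :
    IsInducedAction A A.cohomology := fun _ U f _ hy =>
  (A.actH_clsMk U.2 fun i => (f i).2).trans (D.clsMk_congr hy.symm)

end

/-! ### Coextension of linear maps to coderivations of `S(V)`. -/

noncomputable section

namespace GSym

variable {k : Type*} [Field k] {V : Type*} [AddCommGroup V] [Module k V] (𝒱 : ℤ → Submodule k V)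

theorem mk_surjective : Function.Surjective (GSym.mk 𝒱) := fun x => Quotient.inductionOn x
  fun a => ⟨a, rfl⟩

theorem one_mem_gr : (1 : GSym 𝒱) ∈ gr 𝒱 0 := Submodule.subset_span ⟨[], rfl, rfl⟩

theorem ι_mul_mem_gr {p q : ℤ} {v : V} (hv : v ∈ 𝒱 p) {s : GSym 𝒱} (hs : s ∈ gr 𝒱 q) :
    ι 𝒱 v * s ∈ gr 𝒱 (p + q) := by
  induction hs using Submodule.span_induction with
  | mem s h =>
    obtain ⟨l, rfl, rfl⟩ := h
    exact Submodule.subset_span ⟨⟨p, v, hv⟩ :: l, by simp, by simp⟩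
  | zero => simp
  | add s t _ _ hs ht =>
    rw [mul_add]
    exact add_mem hs ht
  | smul c s _ hs =>
    rw [mul_smul_comm]
    exact Submodule.smul_mem _ _ hs

theorem ι_mem_gr {p : ℤ} {v : V} (hv : v ∈ 𝒱 p) : ι 𝒱 v ∈ gr 𝒱 p := by
  simpa using ι_mul_mem_gr 𝒱 hv (one_mem_gr 𝒱)

/-- Induction on the degree `q` part of `S(V)`. -/
theorem gr_induction {C : ℤ → GSym 𝒱 → Prop} (one : C 0 1)
    (ι_mul : ∀ p q, ∀ v ∈ 𝒱 p, ∀ s ∈ gr 𝒱 q, C q s → C (p + q) (ι 𝒱 v * s))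
    (zero : ∀ q, C q 0) (add : ∀ q s t, C q s → C q t → C q (s + t))
    (smul : ∀ q (c : k) s, C q s → C q (c • s)) {q : ℤ} {s : GSym 𝒱} (hs : s ∈ gr 𝒱 q) :
    C q s := by
  induction hs using Submodule.span_induction with
  | mem s h =>
    obtain ⟨l, rfl, rfl⟩ := h
    induction l with
    | nil => exact one
    | cons v l ih => exact ι_mul _ _ _ v.2.2 _ (Submodule.subset_span ⟨l, rfl, rfl⟩) ih
  | zero => exact zero q
  | add s t _ _ hs ht => exact add q s t hs ht
  | smul c s _ hs => exact smul q c s hs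

variable [DirectSum.Decomposition 𝒱]

theorem mem_iSup_of_decomposition (v : V) : v ∈ ⨆ p, 𝒱 p := by
  rw [(DirectSum.Decomposition.isInternal 𝒱).submodule_iSup_eq_top]
  trivial

variable {𝒱}

theorem induction {C : GSym 𝒱 → Prop} (one : C 1)
    (ι_mul : ∀ p, ∀ v ∈ 𝒱 p, ∀ s, C s → C (ι 𝒱 v * s)) (add : ∀ s t, C s → C t → C (s + t))
    (smul : ∀ (c : k) s, C s → C (c • s)) (s : GSym 𝒱) : C s := by
  obtain ⟨t, rfl⟩ := mk_surjective 𝒱 s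
  have key : ∀ s, C s → C (mk 𝒱 t * s) := by
    induction t using TensorAlgebra.induction with
    | algebraMap r =>
      intro s hs
      rw [AlgHom.commutes, ← Algebra.smul_def]
      exact smul r s hs
    | ι v =>
      intro s hs
      refine Submodule.iSup_induction 𝒱 (motive := fun v => C (ι 𝒱 v * s))
        (mem_iSup_of_decomposition 𝒱 v) (fun p v hv => ι_mul p v hv s hs) ?_ (fun v w hv hw => ?_)
      · simpa using smul 0 s hs
      · rw [map_add, add_mul]
        exact add _ _ hv hw
    | mul a b ha hb =>
      intro s hs
      rw [map_mul, mul_assoc]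
      exact ha _ (hb s hs)
    | add a b ha hb =>
      intro s hs
      rw [map_add, add_mul]
      exact add _ _ (ha s hs) (hb s hs)
  simpa using key 1 one

theorem mem_iSup_gr (s : GSym 𝒱) : s ∈ ⨆ q, gr 𝒱 q := by
  induction s using GSym.induction with
  | one => exact Submodule.mem_iSup_of_mem 0 (one_mem_gr 𝒱)
  | ι_mul p v hv s hs =>
    refine Submodule.iSup_induction (gr 𝒱) (motive := fun s => ι 𝒱 v * s ∈ ⨆ q, gr 𝒱 q) hs
      (fun q s hs => Submodule.mem_iSup_of_mem _ (ι_mul_mem_gr 𝒱 hv hs)) (by simp)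
      (fun s t hs ht => ?_)
    rw [mul_add]
    exact add_mem hs ht
  | add s t hs ht => exact add_mem hs ht
  | smul c s hs => exact Submodule.smul_mem _ _ hs

section LinearMapExt

variable {W : Type*} [AddCommGroup W] [Module k W]

theorem linearMap_ext_gr {f g : GSym 𝒱 →ₗ[k] W} (h : ∀ q, ∀ s ∈ gr 𝒱 q, f s = g s) : f = g :=
  LinearMap.ext fun s => Submodule.iSup_induction (gr 𝒱) (motive := fun s => f s = g s)
    (mem_iSup_gr s) h (by simp) fun s t hs ht => by rw [map_add, map_add, hs, ht]

end LinearMapExt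

theorem paritySign_one (p : ℤ) : paritySign 𝒱 p 1 = 1 := by
  unfold paritySign
  split_ifs <;> simp

theorem paritySign_of_mem (p : ℤ) {q : ℤ} {s : GSym 𝒱} (hs : s ∈ gr 𝒱 q) :
    paritySign 𝒱 p s = (p * q).negOnePow • s := by
  refine gr_induction 𝒱 (C := fun q s => paritySign 𝒱 p s = (p * q).negOnePow • s) ?_
    (fun r q v hv s _ ih => ?_) (by simp) (fun q s t hs ht => ?_) (fun q c s hs => ?_) hs
  · simp [paritySign_one]
  · rw [paritySign_ι_mul 𝒱 hv, ih, mul_add, Int.negOnePow_add, Units.smul_def (_ : ℤˣ) s,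
      mul_smul_comm, ← Units.smul_def, smul_smul]
  · rw [map_add, hs, ht, smul_add]
  · rw [map_smul, hs, smul_comm]

theorem paritySign_paritySign (p q : ℤ) (s : GSym 𝒱) :
    paritySign 𝒱 p (paritySign 𝒱 q s) = paritySign 𝒱 (p + q) s := by
  have h : paritySign 𝒱 p ∘ₗ paritySign 𝒱 q = paritySign 𝒱 (p + q) := by
    refine linearMap_ext_gr fun r s hs => ?_
    rw [LinearMap.comp_apply, paritySign_of_mem q hs, Units.smul_def, map_zsmul,
      paritySign_of_mem p hs, paritySign_of_mem _ hs, ← Units.smul_def, smul_smul,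
      ← Int.negOnePow_add]
    congr 2
    ring
  exact LinearMap.congr_fun h s

theorem paritySign_map {p : ℤ} {Θ : Module.End k (GSym 𝒱)}
    (h : ∀ q, ∀ s ∈ gr 𝒱 q, Θ s ∈ gr 𝒱 (q + p)) (r : ℤ) (s : GSym 𝒱) :
    paritySign 𝒱 r (Θ s) = (r * p).negOnePow • Θ (paritySign 𝒱 r s) := by
  have h' : paritySign 𝒱 r ∘ₗ Θ = (r * p).negOnePow • (Θ ∘ₗ paritySign 𝒱 r) := by
    refine linearMap_ext_gr fun q s hs => ?_
    rw [LinearMap.comp_apply, paritySign_of_mem r (h q s hs), Units.smul_def (r * p).negOnePow,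
      LinearMap.smul_apply, LinearMap.comp_apply, paritySign_of_mem r hs, Units.smul_def (r * q).negOnePow,
      map_zsmul, ← Units.smul_def, ← Units.smul_def, smul_smul, ← Int.negOnePow_add]
    congr 2
    ring
  rw [← LinearMap.comp_apply, h', Units.smul_def, Units.smul_def]
  rfl

/-- Left multiplication by an element of `V`. -/
abbrev mulι (v : V) : Module.End k (GSym 𝒱) := LinearMap.mulLeft k (ι 𝒱 v)

theorem comul_one : comul 𝒱 1 = 1 ⊗ₜ 1 := by simp [comul]

theorem comul_ι_mul (v : V) (s : GSym 𝒱) : comul 𝒱 (ι 𝒱 v * s) = primOp 𝒱 v (comul 𝒱 s) := by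
  simp [comul, lift_ι]

theorem primOp_eq {p : ℤ} {v : V} (hv : v ∈ 𝒱 p) : primOp 𝒱 v =
    TensorProduct.map (mulι v) LinearMap.id + TensorProduct.map (paritySign 𝒱 p) (mulι v) :=
  TensorProduct.ext' fun a b => by rw [primOp_apply 𝒱 hv]; rfl

/-- The convolution product of linear endomorphisms of `S(V)`. -/
def conv (f g : Module.End k (GSym 𝒱)) : Module.End k (GSym 𝒱) :=
  LinearMap.mul' k (GSym 𝒱) ∘ₗ TensorProduct.map f g ∘ₗ comul 𝒱

theorem conv_one (f g : Module.End k (GSym 𝒱)) : conv f g 1 = f 1 * g 1 := by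
  simp [conv, comul_one]

/-- `Δ (v s) = (v ⊗ 1 + 1 ⊗ v) Δ s` turns a convolution at `v s` into two convolutions at `s`.
Arguments by induction on the length use this in place of unshuffles. -/
theorem conv_ι_mul (f g : Module.End k (GSym 𝒱)) {p : ℤ} {v : V} (hv : v ∈ 𝒱 p) (s : GSym 𝒱) :
    conv f g (ι 𝒱 v * s) =
      conv (f ∘ₗ mulι v) g s + conv (f ∘ₗ paritySign 𝒱 p) (g ∘ₗ mulι v) s := by
  simp only [conv, LinearMap.comp_apply, comul_ι_mul, primOp_eq hv, LinearMap.add_apply, map_add]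
  simp only [TensorProduct.map_map, LinearMap.comp_id]

theorem conv_apply_coder {p : ℤ} {Θ : Module.End k (GSym 𝒱)} (hΘ : Θ ∈ coder 𝒱 p)
    (f g : Module.End k (GSym 𝒱)) (s : GSym 𝒱) :
    conv f g (Θ s) = conv (f ∘ₗ Θ) g s + conv (f ∘ₗ paritySign 𝒱 p) (g ∘ₗ Θ) s := by
  have h := LinearMap.congr_fun hΘ.2 s
  simp only [LinearMap.comp_apply, LinearMap.add_apply] at h
  simp only [conv, LinearMap.comp_apply, h, map_add]
  simp only [TensorProduct.map_map, LinearMap.comp_id]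

/-- A linear map `S(V) → V` of degree `p`. -/
def IsHomog (f : GSym 𝒱 →ₗ[k] V) (p : ℤ) : Prop := ∀ q, ∀ s ∈ gr 𝒱 q, f s ∈ 𝒱 (q + p)

theorem IsHomog.comp_mulι {f : GSym 𝒱 →ₗ[k] V} {p r : ℤ} (hf : IsHomog f p) {v : V}
    (hv : v ∈ 𝒱 r) : IsHomog (f ∘ₗ mulι v) (r + p) := fun q s hs => by
  have := hf _ _ (ι_mul_mem_gr 𝒱 hv hs)
  rwa [add_comm r q, add_assoc] at this

theorem IsHomog.ι_paritySign_mul_ι {f : GSym 𝒱 →ₗ[k] V} {p r : ℤ} (hf : IsHomog f p) {v : V}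
    (hv : v ∈ 𝒱 r) (s : GSym 𝒱) :
    ι 𝒱 (f (paritySign 𝒱 r s)) * ι 𝒱 v = (p * r).negOnePow • (ι 𝒱 v * ι 𝒱 (f s)) := by
  refine Submodule.iSup_induction (gr 𝒱) (motive := fun s =>
    ι 𝒱 (f (paritySign 𝒱 r s)) * ι 𝒱 v = (p * r).negOnePow • (ι 𝒱 v * ι 𝒱 (f s)))
    (mem_iSup_gr s) (fun q s hs => ?_) (by simp) (fun s t hs ht => ?_)
  · rw [paritySign_of_mem r hs, ι_comm 𝒱 hv (hf q s hs), smul_smul, ← Int.negOnePow_add,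
      Units.smul_def, map_zsmul, map_zsmul, smul_mul_assoc, ← Units.smul_def]
    congr 1
    rw [Int.negOnePow_eq_iff]
    exact ⟨-(p * r), by ring⟩
  · simp only [map_add, add_mul, mul_add, smul_add, hs, ht]

/-- The coextension of a linear map `S(V) → V` to a coderivation. -/
def coext : (GSym 𝒱 →ₗ[k] V) →ₗ[k] Module.End k (GSym 𝒱) where
  toFun f := conv (ι 𝒱 ∘ₗ f) LinearMap.id
  map_add' f g := by
    simp only [conv, LinearMap.comp_add, TensorProduct.map_add_left, LinearMap.add_comp]
  map_smul' c f := by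
    simp only [conv, LinearMap.comp_smul, TensorProduct.map_smul_left, LinearMap.smul_comp,
      RingHom.id_apply]

theorem coext_one (f : GSym 𝒱 →ₗ[k] V) : coext f 1 = ι 𝒱 (f 1) :=
  (conv_one _ _).trans (mul_one _)

/-- Either `v` is fed to `f`, or it stays outside and `f` is moved past it. As `f ∘ₗ mulι v` is
again homogeneous, claims about coextensions follow by induction on the length, with `f`
generalised. -/
theorem coext_ι_mul {f : GSym 𝒱 →ₗ[k] V} {p r : ℤ} (hf : IsHomog f p) {v : V}
    (hv : v ∈ 𝒱 r) (s : GSym 𝒱) : coext f (ι 𝒱 v * s) =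
      coext (f ∘ₗ mulι v) s + (p * r).negOnePow • (ι 𝒱 v * coext f s) := by
  refine (conv_ι_mul _ _ hv s).trans (congrArg₂ (· + ·) rfl ?_)
  have h : LinearMap.mul' k (GSym 𝒱) ∘ₗ
      TensorProduct.map ((ι 𝒱 ∘ₗ f) ∘ₗ paritySign 𝒱 r) (LinearMap.id ∘ₗ mulι v) =
      (p * r).negOnePow • (mulι v ∘ₗ LinearMap.mul' k (GSym 𝒱) ∘ₗ
        TensorProduct.map (ι 𝒱 ∘ₗ f) LinearMap.id) := by
    refine TensorProduct.ext' fun a b => ?_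
    change ι 𝒱 (f (paritySign 𝒱 r a)) * (ι 𝒱 v * b) =
      (p * r).negOnePow • (ι 𝒱 v * (ι 𝒱 (f a) * b))
    rw [← mul_assoc, hf.ι_paritySign_mul_ι hv, smul_mul_assoc, mul_assoc]
  exact LinearMap.congr_fun h (comul 𝒱 s)

theorem coext_mem_gr {f : GSym 𝒱 →ₗ[k] V} {p : ℤ} (hf : IsHomog f p) {q : ℤ} {s : GSym 𝒱}
    (hs : s ∈ gr 𝒱 q) : coext f s ∈ gr 𝒱 (q + p) := by
  refine gr_induction 𝒱 (C := fun q s => ∀ f p, IsHomog f p → coext f s ∈ gr 𝒱 (q + p))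
    (fun f p hf => ?_) (fun r q v hv s _ ih f p hf => ?_) (by simp)
    (fun q s t hs ht f p hf => ?_) (fun q c s hs f p hf => ?_) hs f p hf
  · rw [coext_one]
    exact ι_mem_gr 𝒱 (hf 0 1 (one_mem_gr 𝒱))
  · rw [coext_ι_mul hf hv, Units.smul_def]
    refine add_mem ?_ (zsmul_mem ?_ _)
    · have := ih _ _ (hf.comp_mulι hv)
      rwa [← add_assoc, add_comm q r] at this
    · have := ι_mul_mem_gr 𝒱 hv (ih _ _ hf)
      rwa [← add_assoc] at this
  · rw [map_add]
    exact add_mem (hs f p hf) (ht f p hf)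
  · rw [map_smul]
    exact Submodule.smul_mem _ _ (hs f p hf)

/-- By induction on the length with `f` and its degree arbitrary, the coderivation property for `f`
at `v s` follows from those for `f ∘ₗ mulι v` and `f` at `s`. The sign check is done on pure
tensors. -/
theorem coext_mem_coder {f : GSym 𝒱 →ₗ[k] V} {p : ℤ} (hf : IsHomog f p) :
    coext f ∈ coder 𝒱 p := by
  refine ⟨fun q s hs => coext_mem_gr hf hs, LinearMap.ext fun s => ?_⟩
  rw [LinearMap.comp_apply, LinearMap.comp_apply]
  induction s using GSym.induction generalizing f p with
  | one =>
    rw [coext_one, comul_one, ← mul_one (ι 𝒱 (f 1)), comul_ι_mul, comul_one,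
      primOp_apply 𝒱 (hf 0 1 (one_mem_gr 𝒱))]
    simp [coext_one, paritySign_one]
  | ι_mul r v hv s ih =>
    rw [coext_ι_mul hf hv, map_add, ih (hf.comp_mulι hv), Units.smul_def, map_zsmul,
      comul_ι_mul, ih hf, comul_ι_mul, ← Units.smul_def]
    generalize comul 𝒱 s = t
    induction t using TensorProduct.induction_on with
    | zero => simp
    | tmul a b =>
      simp only [LinearMap.add_apply, TensorProduct.map_tmul, LinearMap.id_apply, map_add,
        primOp_apply 𝒱 hv, coext_ι_mul hf hv, paritySign_ι_mul 𝒱 hv, paritySign_paritySign,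
        paritySign_map fun q s hs => coext_mem_gr hf hs, TensorProduct.add_tmul,
        TensorProduct.tmul_add, Units.smul_def, TensorProduct.smul_tmul', smul_add,
        TensorProduct.tmul_smul]
      rw [mul_comm r p, smul_smul, ← Units.val_mul, Int.units_mul_self, Units.val_one, one_smul,
        add_comm r p]
      abel
    | add a b ha hb =>
      simp only [map_add, smul_add, Units.smul_def] at ha hb ⊢
      linear_combination (norm := module) ha + hb
  | add s t hs ht => simp only [map_add, hs hf, ht hf]
  | smul c s hs => simp only [map_smul, hs hf]

end GSym

end

/-! ### Counit, corestriction, and uniqueness of coderivations. -/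

noncomputable section

namespace GSym

variable {k : Type*} [Field k] {V : Type*} [AddCommGroup V] [Module k V] {𝒱 : ℤ → Submodule k V}
  [DirectSum.Decomposition 𝒱]

variable (𝒱) in
/-- The counit of `S(V)`. -/
def counit : GSym 𝒱 →ₐ[k] k := GSym.lift 𝒱 0 (fun _ _ _ _ _ _ => by simp)

theorem counit_ι (v : V) : counit 𝒱 (ι 𝒱 v) = 0 := lift_ι 𝒱 _ _ v

theorem counit_ι_mul (v : V) (s : GSym 𝒱) : counit 𝒱 (ι 𝒱 v * s) = 0 := by
  rw [map_mul, counit_ι, zero_mul]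

theorem proj_one : proj 𝒱 1 = 0 := by
  let : Module kᵐᵒᵖ V := Module.compHom _ ((RingHom.id k).fromOpposite mul_comm)
  have : IsCentralScalar k V := ⟨fun _ _ => rfl⟩
  change (TrivSqZeroExt.sndHom k V)
    (GSym.lift 𝒱 (TrivSqZeroExt.inrHom k V) (fun p q x y _ _ => by simp) 1) = 0
  rw [map_one]
  rfl

/-- The projection is the second component of a map to the square-zero extension by `V`, whose first
component is the counit; there `(0, v) t` has second component the first component of `t` times `v`.
-/
theorem proj_ι_mul (v : V) (s : GSym 𝒱) : proj 𝒱 (ι 𝒱 v * s) = counit 𝒱 s • v := by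
  let : Module kᵐᵒᵖ V := Module.compHom _ ((RingHom.id k).fromOpposite mul_comm)
  have : IsCentralScalar k V := ⟨fun _ _ => rfl⟩
  have hf : ∀ p q x y, x ∈ 𝒱 p → y ∈ 𝒱 q → TrivSqZeroExt.inrHom k V x * TrivSqZeroExt.inrHom k V y =
      (p * q).negOnePow • (TrivSqZeroExt.inrHom k V y * TrivSqZeroExt.inrHom k V x) :=
    fun p q x y _ _ => by simp
  have h : (TrivSqZeroExt.fstHom k k V).comp (GSym.lift 𝒱 (TrivSqZeroExt.inrHom k V) hf) =
      counit 𝒱 := by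
    refine AlgHom.ext fun s => ?_
    induction s using GSym.induction with
    | one => rw [map_one, map_one]
    | ι_mul p v hv s _ =>
      rw [counit_ι_mul, AlgHom.comp_apply, map_mul, map_mul, lift_ι]
      simp
    | add s t hs ht => rw [map_add, map_add, hs, ht]
    | smul c s hs => rw [map_smul, map_smul, hs]
  have h' : TrivSqZeroExt.fst (GSym.lift 𝒱 (TrivSqZeroExt.inrHom k V) hf s) = counit 𝒱 s :=
    DFunLike.congr_fun h s
  change (TrivSqZeroExt.sndHom k V) (GSym.lift 𝒱 (TrivSqZeroExt.inrHom k V) hf (ι 𝒱 v * s)) = _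
  rw [map_mul, lift_ι, ← h']
  simp

theorem proj_ι (v : V) : proj 𝒱 (ι 𝒱 v) = v := by
  rw [← mul_one (ι 𝒱 v), proj_ι_mul, map_one, one_smul]

theorem isHomog_proj : IsHomog (proj 𝒱) 0 := by
  intro q s hs
  rw [add_zero]
  induction hs using Submodule.span_induction with
  | mem s h =>
    obtain ⟨l, rfl, rfl⟩ := h
    rcases l with _ | ⟨v, _ | ⟨w, l⟩⟩
    · simp [proj_one]
    · simp [proj_ι]
    · simp [proj_ι_mul, counit_ι_mul]
  | zero => simp
  | add s t _ _ hs ht =>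
    rw [map_add]
    exact add_mem hs ht
  | smul c s _ hs =>
    rw [map_smul]
    exact Submodule.smul_mem _ _ hs

theorem counit_paritySign (p : ℤ) (s : GSym 𝒱) : counit 𝒱 (paritySign 𝒱 p s) = counit 𝒱 s := by
  induction s using GSym.induction with
  | one => rw [paritySign_one]
  | ι_mul q v hv s _ =>
    rw [paritySign_ι_mul 𝒱 hv, Units.smul_def, map_zsmul, counit_ι_mul, counit_ι_mul, smul_zero]
  | add s t hs ht => rw [map_add, map_add, map_add, hs, ht]
  | smul c s hs => rw [map_smul, map_smul, map_smul, hs]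

theorem counit_coext {f : GSym 𝒱 →ₗ[k] V} {p : ℤ} (hf : IsHomog f p) (s : GSym 𝒱) :
    counit 𝒱 (coext f s) = 0 := by
  induction s using GSym.induction generalizing f p with
  | one => rw [coext_one, counit_ι]
  | ι_mul q v hv s ih =>
    rw [coext_ι_mul hf hv, map_add, ih (hf.comp_mulι hv), Units.smul_def, map_zsmul, counit_ι_mul,
      smul_zero, add_zero]
  | add s t hs ht => rw [map_add, map_add, hs hf, ht hf, add_zero]
  | smul c s hs => rw [map_smul, map_smul, hs hf, smul_zero]

/-- The corestriction of a coextension. -/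
theorem proj_coext {f : GSym 𝒱 →ₗ[k] V} {p : ℤ} (hf : IsHomog f p) (s : GSym 𝒱) :
    proj 𝒱 (coext f s) = f s := by
  induction s using GSym.induction generalizing f p with
  | one => rw [coext_one, proj_ι]
  | ι_mul q v hv s ih =>
    rw [coext_ι_mul hf hv, map_add, ih (hf.comp_mulι hv), Units.smul_def, map_zsmul, proj_ι_mul,
      counit_coext hf, zero_smul, smul_zero, add_zero]
    rfl
  | add s t hs ht => rw [map_add, map_add, map_add, hs hf, ht hf]
  | smul c s hs => rw [map_smul, map_smul, map_smul, hs hf]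

variable (𝒱) in
/-- The counit as an endomorphism of `S(V)`. -/
def counitEnd : Module.End k (GSym 𝒱) := Algebra.linearMap k (GSym 𝒱) ∘ₗ (counit 𝒱).toLinearMap

theorem counitEnd_apply (s : GSym 𝒱) : counitEnd 𝒱 s = algebraMap k (GSym 𝒱) (counit 𝒱 s) := rfl

theorem counitEnd_comp_mulι (v : V) : counitEnd 𝒱 ∘ₗ mulι v = 0 := LinearMap.ext fun s => by
  rw [LinearMap.comp_apply, counitEnd_apply]
  change algebraMap k (GSym 𝒱) (counit 𝒱 (ι 𝒱 v * s)) = 0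
  rw [counit_ι_mul, map_zero]

theorem counitEnd_comp_paritySign (p : ℤ) : counitEnd 𝒱 ∘ₗ paritySign 𝒱 p = counitEnd 𝒱 :=
  LinearMap.ext fun s => by
    rw [LinearMap.comp_apply, counitEnd_apply, counitEnd_apply, counit_paritySign]

theorem conv_zero_left (g : Module.End k (GSym 𝒱)) (s : GSym 𝒱) : conv 0 g s = 0 := by
  simp [conv]

theorem conv_zero_right (f : Module.End k (GSym 𝒱)) (s : GSym 𝒱) : conv f 0 s = 0 := by
  simp [conv]

theorem conv_counitEnd_left (g : Module.End k (GSym 𝒱)) (s : GSym 𝒱) :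
    conv (counitEnd 𝒱) g s = g s := by
  induction s using GSym.induction generalizing g with
  | one => rw [conv_one, counitEnd_apply, map_one, map_one, one_mul]
  | ι_mul p v hv s ih =>
    rw [conv_ι_mul _ _ hv, counitEnd_comp_mulι, conv_zero_left, counitEnd_comp_paritySign, ih,
      zero_add]
    rfl
  | add s t hs ht => rw [map_add, map_add, hs, ht]
  | smul c s hs => rw [map_smul, map_smul, hs]

theorem conv_counitEnd_right (f : Module.End k (GSym 𝒱)) (s : GSym 𝒱) :
    conv f (counitEnd 𝒱) s = f s := by
  induction s using GSym.induction generalizing f with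
  | one => rw [conv_one, counitEnd_apply, map_one (counit 𝒱), map_one (algebraMap k (GSym 𝒱)), mul_one]
  | ι_mul p v hv s ih =>
    rw [conv_ι_mul _ _ hv, counitEnd_comp_mulι, conv_zero_right, ih, add_zero]
    rfl
  | add s t hs ht => rw [map_add, map_add, hs, ht]
  | smul c s hs => rw [map_smul, map_smul, hs]

/-- Applying the counit to both factors of the coderivation identity gives `ε Θ = ε Θ + ε Θ`. -/
theorem counit_coder {p : ℤ} {Θ : Module.End k (GSym 𝒱)} (hΘ : Θ ∈ coder 𝒱 p) (s : GSym 𝒱) :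
    counit 𝒱 (Θ s) = 0 := by
  have h := conv_apply_coder hΘ (counitEnd 𝒱) (counitEnd 𝒱) s
  rw [conv_counitEnd_left, counitEnd_comp_paritySign, conv_counitEnd_left, conv_counitEnd_right,
    LinearMap.comp_apply, left_eq_add, counitEnd_apply] at h
  simpa using congrArg (counit 𝒱) h

theorem conv_smul_counit (v : V) (c : k) (g : Module.End k (GSym 𝒱)) (s : GSym 𝒱) :
    conv (c • (mulι v ∘ₗ counitEnd 𝒱)) g s = c • (ι 𝒱 v * g s) := by
  have h : LinearMap.mul' k (GSym 𝒱) ∘ₗ TensorProduct.map (c • (mulι v ∘ₗ counitEnd 𝒱)) g =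
      c • (mulι v ∘ₗ LinearMap.mul' k (GSym 𝒱) ∘ₗ TensorProduct.map (counitEnd 𝒱) g) :=
    TensorProduct.ext' fun a b => by simp [mul_assoc]
  rw [← conv_counitEnd_left g s]
  exact LinearMap.congr_fun h (comul 𝒱 s)

theorem coext_smulRight_counit (v : V) (s : GSym 𝒱) :
    coext ((counit 𝒱).toLinearMap.smulRight v) s = ι 𝒱 v * s := by
  have h : ι 𝒱 ∘ₗ (counit 𝒱).toLinearMap.smulRight v = (1 : k) • (mulι v ∘ₗ counitEnd 𝒱) :=
    LinearMap.ext fun s => by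
      simp [counitEnd_apply, Algebra.algebraMap_eq_smul_one]
  change conv (ι 𝒱 ∘ₗ (counit 𝒱).toLinearMap.smulRight v) LinearMap.id s = _
  rw [h, conv_smul_counit, one_smul, LinearMap.id_apply]

variable (𝒱) in
/-- The operator multiplying a product of `n` elements of `V` by `n`. -/
def lengthOp : Module.End k (GSym 𝒱) := coext (proj 𝒱)

/-- The coextension of the projection is the derivation that is the identity on `V`, the Euler
operator. -/
theorem lengthOp_ι_mul (v : V) (s : GSym 𝒱) :
    lengthOp 𝒱 (ι 𝒱 v * s) = ι 𝒱 v * s + ι 𝒱 v * lengthOp 𝒱 s := by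
  refine Submodule.iSup_induction 𝒱 (motive := fun v => lengthOp 𝒱 (ι 𝒱 v * s) =
    ι 𝒱 v * s + ι 𝒱 v * lengthOp 𝒱 s) (mem_iSup_of_decomposition 𝒱 v) (fun p v hv => ?_) (by simp)
    (fun v w hv hw => ?_)
  · rw [lengthOp, coext_ι_mul isHomog_proj hv, zero_mul, Int.negOnePow_zero, one_smul]
    congr 1
    rw [show proj 𝒱 ∘ₗ mulι v = (counit 𝒱).toLinearMap.smulRight v from
      LinearMap.ext fun s => proj_ι_mul v s, coext_smulRight_counit]
  · simp only [map_add, add_mul, hv, hw]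
    abel

variable (𝒱) in
/-- The span of the products of `n` elements of `V`. -/
def lengthGr (n : ℕ) : Submodule k (GSym 𝒱) :=
  Submodule.span k {s | ∃ l : List V, l.length = n ∧ s = (l.map (ι 𝒱)).prod}

theorem ι_mul_mem_lengthGr (v : V) {n : ℕ} {s : GSym 𝒱} (hs : s ∈ lengthGr 𝒱 n) :
    ι 𝒱 v * s ∈ lengthGr 𝒱 (n + 1) := by
  induction hs using Submodule.span_induction with
  | mem s h =>
    obtain ⟨l, rfl, rfl⟩ := h
    exact Submodule.subset_span ⟨v :: l, by simp, by simp⟩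
  | zero => simp
  | add s t _ _ hs ht =>
    rw [mul_add]
    exact add_mem hs ht
  | smul c s _ hs =>
    rw [mul_smul_comm]
    exact Submodule.smul_mem _ _ hs

theorem mem_iSup_lengthGr (s : GSym 𝒱) : s ∈ ⨆ n, lengthGr 𝒱 n := by
  induction s using GSym.induction with
  | one => exact Submodule.mem_iSup_of_mem 0 (Submodule.subset_span ⟨[], rfl, rfl⟩)
  | ι_mul p v hv s hs =>
    refine Submodule.iSup_induction (lengthGr 𝒱) (motive := fun s => ι 𝒱 v * s ∈ ⨆ q, lengthGr 𝒱 q)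
      hs (fun q s hs => Submodule.mem_iSup_of_mem _ (ι_mul_mem_lengthGr v hs)) (by simp)
      (fun s t hs ht => ?_)
    rw [mul_add]
    exact add_mem hs ht
  | add s t hs ht => exact add_mem hs ht
  | smul c s hs => exact Submodule.smul_mem _ _ hs

theorem lengthGr_le_eigenspace (n : ℕ) :
    lengthGr 𝒱 n ≤ Module.End.eigenspace (lengthOp 𝒱) (n : k) := by
  refine Submodule.span_le.2 ?_
  rintro _ ⟨l, rfl, rfl⟩
  refine Module.End.mem_eigenspace_iff.2 ?_
  induction l with
  | nil =>
    change lengthOp 𝒱 1 = _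
    rw [lengthOp, coext_one, proj_one, map_zero]
    simp
  | cons v l ih =>
    rw [List.map_cons, List.prod_cons, lengthOp_ι_mul, ih, List.length_cons, Nat.cast_succ, add_smul,
      one_smul, mul_smul_comm, add_comm]

/-- In characteristic zero the lengths are distinct eigenvalues of the Euler operator, so its kernel
consists of scalars, and scalars are detected by the counit. -/
theorem eq_zero_of_lengthOp_eq_zero [CharZero k] {s : GSym 𝒱} (h : lengthOp 𝒱 s = 0)
    (h' : counit 𝒱 s = 0) : s = 0 := by
  have hs : s ∈ lengthGr 𝒱 0 := by
    refine mem_of_mem_iSup_of_iSupIndep ((Module.End.eigenspaces_iSupIndep (lengthOp 𝒱)).comp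
      (Nat.cast_injective (R := k))) lengthGr_le_eigenspace (mem_iSup_lengthGr s) ?_
    refine Module.End.mem_eigenspace_iff.2 ?_
    rw [h]
    simp
  have hs' : s ∈ Submodule.span k {(1 : GSym 𝒱)} := by
    refine Submodule.span_mono ?_ hs
    rintro _ ⟨l, hl, rfl⟩
    rw [List.length_eq_zero_iff.1 hl]
    rfl
  obtain ⟨c, rfl⟩ := Submodule.mem_span_singleton.1 hs'
  rw [map_smul, map_one, smul_eq_mul, mul_one] at h'
  rw [h', zero_smul]

/-- The projection in the left factor extracts exactly one letter, so `Ψ` is evaluated only on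
products that are shorter by one. In the induction the first letter is either extracted or absorbed
into `Ψ`. -/
theorem conv_proj_eq_zero {n : ℕ} {Ψ : Module.End k (GSym 𝒱)}
    (h : ∀ l : List (Σ p, 𝒱 p), l.length ≤ n → Ψ (l.map fun v => ι 𝒱 (v.2 : V)).prod = 0) (r : ℤ)
    (l : List (Σ p, 𝒱 p)) (hl : l.length ≤ n + 1) :
    conv (ι 𝒱 ∘ₗ proj 𝒱 ∘ₗ paritySign 𝒱 r) Ψ (l.map fun v => ι 𝒱 (v.2 : V)).prod = 0 := by
  have hnil : ∀ (r : ℤ) (Ψ : Module.End k (GSym 𝒱)),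
      conv (ι 𝒱 ∘ₗ proj 𝒱 ∘ₗ paritySign 𝒱 r) Ψ 1 = 0 := by
    intro r Ψ
    rw [conv_one]
    simp [paritySign_one, proj_one]
  induction l generalizing n Ψ r with
  | nil => exact hnil r Ψ
  | cons v l ih =>
    obtain ⟨p, v, hv⟩ := v
    rw [List.length_cons, Nat.add_le_add_iff_right] at hl
    rw [List.map_cons, List.prod_cons, conv_ι_mul _ _ hv]
    have h1 : (ι 𝒱 ∘ₗ proj 𝒱 ∘ₗ paritySign 𝒱 r) ∘ₗ mulι v =
        (((r * p).negOnePow : ℤ) : k) • (mulι v ∘ₗ counitEnd 𝒱) := LinearMap.ext fun s => by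
      change ι 𝒱 (proj 𝒱 (paritySign 𝒱 r (ι 𝒱 v * s))) =
        (((r * p).negOnePow : ℤ) : k) • (ι 𝒱 v * counitEnd 𝒱 s)
      rw [paritySign_ι_mul 𝒱 hv, Units.smul_def, map_zsmul, proj_ι_mul, counit_paritySign,
        Int.cast_smul_eq_zsmul, map_zsmul, map_smul, counitEnd_apply, Algebra.algebraMap_eq_smul_one,
        mul_smul_comm, mul_one]
    have h2 : (ι 𝒱 ∘ₗ proj 𝒱 ∘ₗ paritySign 𝒱 r) ∘ₗ paritySign 𝒱 p =
        ι 𝒱 ∘ₗ proj 𝒱 ∘ₗ paritySign 𝒱 (r + p) := LinearMap.ext fun s => by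
      simp [paritySign_paritySign]
    rw [h1, h2, conv_smul_counit, h l hl, mul_zero, smul_zero, zero_add]
    rcases n with _ | n
    · rw [List.length_eq_zero_iff.1 (Nat.le_zero.1 hl)]
      exact hnil _ _
    · refine ih (fun l hl => ?_) _ hl
      have := h (⟨p, v, hv⟩ :: l) (by simpa using hl)
      simpa using this

/-- A coderivation is determined by its corestriction. -/
theorem coder_eq_zero [CharZero k] {p : ℤ} {Θ : Module.End k (GSym 𝒱)} (hΘ : Θ ∈ coder 𝒱 p)
    (h : proj 𝒱 ∘ₗ Θ = 0) : Θ = 0 := by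
  -- With zero corestriction, one of the two terms of the coderivation identity vanishes. The other
  -- expresses the Euler operator of `Θ s` through values of `Θ` on shorter products, so that `Θ =
  -- 0` follows by induction on the length.
  have hN : ∀ s, lengthOp 𝒱 (Θ s) = conv (ι 𝒱 ∘ₗ proj 𝒱 ∘ₗ paritySign 𝒱 p) Θ s := by
    intro s
    refine (conv_apply_coder hΘ _ _ s).trans ?_
    rw [LinearMap.comp_assoc, h, LinearMap.comp_zero, conv_zero_left, zero_add]
    rfl
  have key : ∀ n, ∀ l : List (Σ p, 𝒱 p), l.length ≤ n →
      Θ (l.map fun v => ι 𝒱 (v.2 : V)).prod = 0 := by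
    intro n
    induction n with
    | zero =>
      intro l hl
      rw [List.length_eq_zero_iff.1 (Nat.le_zero.1 hl)]
      refine eq_zero_of_lengthOp_eq_zero ?_ (counit_coder hΘ _)
      rw [hN]
      change conv _ _ 1 = 0
      rw [conv_one]
      simp [paritySign_one, proj_one]
    | succ n ih =>
      intro l hl
      refine eq_zero_of_lengthOp_eq_zero ?_ (counit_coder hΘ _)
      rw [hN]
      exact conv_proj_eq_zero ih p l hl
  refine linearMap_ext_gr fun q s hs => ?_
  have : gr 𝒱 q ≤ LinearMap.ker Θ := Submodule.span_le.2 (by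
    rintro _ ⟨l, _, rfl⟩
    exact key _ l le_rfl)
  exact this hs

theorem IsHomog.proj_comp {p : ℤ} {Θ : Module.End k (GSym 𝒱)}
    (h : ∀ q, ∀ s ∈ gr 𝒱 q, Θ s ∈ gr 𝒱 (q + p)) : IsHomog (proj 𝒱 ∘ₗ Θ) p := fun q s hs => by
  have := isHomog_proj (q + p) _ (h q s hs)
  rwa [add_zero] at this

theorem coext_proj_comp [CharZero k] {p : ℤ} {Θ : Module.End k (GSym 𝒱)} (hΘ : Θ ∈ coder 𝒱 p) :
    coext (proj 𝒱 ∘ₗ Θ) = Θ := by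
  have hf := IsHomog.proj_comp hΘ.1
  rw [← sub_eq_zero]
  refine coder_eq_zero (sub_mem (coext_mem_coder hf) hΘ) (LinearMap.ext fun s => ?_)
  rw [LinearMap.comp_apply, LinearMap.sub_apply, map_sub, proj_coext hf]
  exact sub_self _

/-- The graded commutator of coderivations is a coderivation. -/
theorem commutator_mem_coder {p q : ℤ} {Θ Ω : Module.End k (GSym 𝒱)} (hΘ : Θ ∈ coder 𝒱 p)
    (hΩ : Ω ∈ coder 𝒱 q) : Θ ∘ₗ Ω - (p * q).negOnePow • (Ω ∘ₗ Θ) ∈ coder 𝒱 (p + q) := by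
  refine ⟨fun r s hs => ?_, LinearMap.ext fun s => ?_⟩
  · rw [LinearMap.sub_apply, Units.smul_def, LinearMap.smul_apply]
    refine sub_mem ?_ (zsmul_mem ?_ _)
    · have := hΘ.1 _ _ (hΩ.1 r s hs)
      rwa [add_assoc, add_comm q p] at this
    · have := hΩ.1 _ _ (hΘ.1 r s hs)
      rwa [add_assoc] at this
  · have h1 : ∀ s, comul 𝒱 (Θ s) = _ := fun s => LinearMap.congr_fun hΘ.2 s
    have h2 : ∀ s, comul 𝒱 (Ω s) = _ := fun s => LinearMap.congr_fun hΩ.2 s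
    simp only [LinearMap.comp_apply, LinearMap.sub_apply, Units.smul_def, LinearMap.smul_apply,
      map_sub, map_zsmul, h1, h2, LinearMap.add_apply]
    generalize comul 𝒱 s = t
    induction t using TensorProduct.induction_on with
    | zero => simp
    | tmul a b =>
      simp only [map_add, TensorProduct.map_tmul, LinearMap.id_apply, paritySign_map hΘ.1,
        paritySign_map hΩ.1, paritySign_paritySign, LinearMap.sub_apply, LinearMap.smul_apply,
        LinearMap.comp_apply, Units.smul_def, TensorProduct.sub_tmul, TensorProduct.tmul_sub,
        TensorProduct.tmul_smul, ← TensorProduct.smul_tmul', smul_add]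
      rw [mul_comm q p, smul_smul, ← Units.val_mul, Int.units_mul_self, Units.val_one, one_smul,
        add_comm q p]
      abel
    | add a b ha hb =>
      simp only [map_add, smul_add] at ha hb ⊢
      linear_combination (norm := module) ha + hb

/-- For an odd coderivation the graded commutator with itself is twice the square. -/
theorem comp_self_mem_coder [CharZero k] {Θ : Module.End k (GSym 𝒱)} (hΘ : Θ ∈ coder 𝒱 1) :
    Θ ∘ₗ Θ ∈ coder 𝒱 (1 + 1) := by
  have h := commutator_mem_coder hΘ hΘ
  rw [show ((1 : ℤ) * 1).negOnePow = -1 from rfl, Units.smul_def, Units.val_neg, Units.val_one,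
    neg_one_smul, sub_neg_eq_add, ← two_smul k (Θ ∘ₗ Θ)] at h
  exact (Submodule.smul_mem_iff _ two_ne_zero).1 h

variable (𝒱) in
/-- The automorphism of `S(V)` acting on the component of degree `p` by `cᵖ`. -/
def scale (c : k) : GSym 𝒱 →ₐ[k] GSym 𝒱 :=
  GSym.lift 𝒱 (homogLift 𝒱 fun p => c ^ p • GSym.ι 𝒱) (fun p q x y hx hy => by
    rw [homogLift_of_mem 𝒱 _ hx, homogLift_of_mem 𝒱 _ hy]
    change (c ^ p • GSym.ι 𝒱 x) * (c ^ q • GSym.ι 𝒱 y) =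
      (p * q).negOnePow • ((c ^ q • GSym.ι 𝒱 y) * (c ^ p • GSym.ι 𝒱 x))
    rw [smul_mul_smul_comm, smul_mul_smul_comm, GSym.ι_comm 𝒱 hx hy, smul_comm, mul_comm (c ^ p)])

theorem scale_of_mem (c : k) (hc : c ≠ 0) {q : ℤ} {s : GSym 𝒱} (hs : s ∈ gr 𝒱 q) :
    scale 𝒱 c s = c ^ q • s := by
  refine gr_induction 𝒱 (C := fun q s => scale 𝒱 c s = c ^ q • s) (by simp)
    (fun r q v hv s _ ih => ?_) (by simp) (fun q s t hs ht => ?_) (fun q c s hs => ?_) hs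
  · rw [map_mul, ih, scale, lift_ι, homogLift_of_mem 𝒱 _ hv, LinearMap.smul_apply,
      smul_mul_smul_comm, zpow_add₀ hc]
  · rw [map_add, hs, ht, smul_add]
  · rw [map_smul, hs, smul_comm]

/-- Conjugation by the automorphism scaling degree `q` by `2^q` multiplies a coderivation of degree
`p` by `2ᵖ`, so the degrees lie in different eigenspaces. -/
theorem iSupIndep_coder [CharZero k] : iSupIndep (coder 𝒱) := by
  have h2 : (2 : k) ≠ 0 := two_ne_zero
  let T : Module.End k (Module.End k (GSym 𝒱)) :=
    LinearMap.lcomp k _ (scale 𝒱 2⁻¹).toLinearMap ∘ₗ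
      LinearMap.llcomp k _ _ _ (scale 𝒱 2).toLinearMap
  refine ((Module.End.eigenspaces_iSupIndep T).comp two_zpow_injective).mono fun p Θ hΘ => ?_
  refine Module.End.mem_eigenspace_iff.2 (linearMap_ext_gr fun q s hs => ?_)
  change scale 𝒱 2 (Θ (scale 𝒱 2⁻¹ s)) = (2 : k) ^ p • Θ s
  rw [scale_of_mem _ (inv_ne_zero h2) hs, map_smul, map_smul, scale_of_mem _ h2 (hΘ.1 q s hs), smul_smul,
    inv_zpow, zpow_add₀ h2, inv_mul_cancel_left₀ (zpow_ne_zero q h2)]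

end GSym

end

/-! ### Dg algebras over `rpL*` from graded pre-Lie algebras. -/

noncomputable section

section RplAlgebraOfSuperPreLie

variable {k : Type*} [Field k] [CharZero k] {X : Type*} [AddCommGroup X] [Module k X]

/-- The grading and the differential of a dg vector space come from a graded pre-Lie algebra with an
element `lam` of degree `1`. -/
structure SuperPreLie.IsGraded (A : SuperPreLie k X) (D : DGStruct k X) : Prop where
  P_eq : ∀ p, ∀ x ∈ D.gr p, A.P x = p.negOnePow • x
  star_mem : ∀ p q, ∀ x ∈ D.gr p, ∀ y ∈ D.gr q, A.star x y ∈ D.gr (p + q)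
  lam_mem : A.lam ∈ D.gr 1
  d_eq : ∀ x, D.d x = A.delta x

namespace SuperPreLie.IsGraded

variable {A : SuperPreLie k X} {D : DGStruct k X} (h : A.IsGraded D) {m n : ℕ}
include h

theorem evalM_mem {p : Fin n → ℤ} {f : Fin n → X} (hf : ∀ i, f i ∈ D.gr (p i))
    (a : FreeMagma (Option (Fin n))) :
    A.evalM f a ∈ D.gr ((leafWord a).map (letterDeg p)).sum := by
  induction a with
  | ih1 y =>
    rcases y with _ | i
    · simpa [leafWord_of, letterDeg, evalM_none] using h.lam_mem
    · simpa [leafWord_of, letterDeg, evalM_some] using hf i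
  | ih2 a b iha ihb =>
    rw [leafWord_mul, List.map_append, List.sum_append, evalM_mul]
    exact h.star_mem _ _ _ iha _ ihb

theorem act_mem {r : ℤ} {p : Fin n → ℤ} {f : Fin n → X} (hf : ∀ i, f i ∈ D.gr (p i))
    {U : rplMultilinear k n} (hU : U ∈ rplGr k n r) : A.act n U f ∈ D.gr (r + ∑ i, p i) := by
  refine rplGr_induction (C := fun U => A.act n U f ∈ D.gr (r + ∑ i, p i))
    (fun a x ha hx hr => ?_) (by simp) (fun x y hx hy => ?_) (fun c x hx => ?_) hU
  · rw [A.act_mono (fun i => h.P_eq _ _ (hf i)) ha hx, Units.smul_def]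
    refine zsmul_mem ?_ _
    have := h.evalM_mem hf a
    rw [sum_map_eq_of_multilinear (w := leafWord a) ha] at this
    rw [← hr]
    simpa [letterDeg, circDeg] using this
  · rw [map_add]
    exact add_mem hx hy
  · rw [map_smul]
    exact Submodule.smul_mem _ _ hx

theorem act_comp (i : Fin (m + 1)) (a : RplColl k m) {q : ℤ} {b : RplColl k n}
    {p : Fin (m + n + 1) → ℤ} {f : Fin (m + n + 1) → X} (hb : b ∈ rplGr k (n + 1) q)
    (hf : ∀ j, f j ∈ D.gr (p j)) :
    A.act (m + n + 1) (rplComp k i a b) f = (q * ∑ j with j.val < i.val, p j).negOnePow •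
      A.act (m + 1) a (fun j => if j = i then A.act (n + 1) b (fun l => f (innerLabel i l))
        else f (outerLabel n i j)) := by
  refine rplGr_induction (C := fun b => A.act (m + n + 1) (rplComp k i a b) f =
      (q * ∑ j with j.val < i.val, p j).negOnePow •
      A.act (m + 1) a (fun j => if j = i then A.act (n + 1) b (fun l => f (innerLabel i l))
        else f (outerLabel n i j)))
    (fun b y hb hy hq => ?_) ?_ (fun x y hx hy => ?_) (fun c x hx => ?_) hb
  · induction a using rplMultilinear_mono_induction with
    | mono a x ha hx =>
      rw [← hq]
      exact A.act_comp_mono i ha hb hx hy fun i => h.P_eq _ _ (hf i)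
    | zero => simp
    | add x x' hx hx' => simp only [map_add, LinearMap.add_apply, add_apply, hx, hx', smul_add]
    | smul c x hx =>
      simp only [map_smul, LinearMap.smul_apply, smul_apply, hx, smul_comm c]
  · rw [map_zero, map_zero, (A.act (m + 1) a).map_coord_zero i (by simp), smul_zero]
    rfl
  · simp only [ite_eq_update (β := X)] at hx hy ⊢
    rw [map_add, map_add, add_apply, hx, hy, map_add, add_apply, MultilinearMap.map_update_add,
      smul_add]
  · simp only [ite_eq_update (β := X)] at hx ⊢
    rw [map_smul, map_smul, smul_apply, hx, map_smul, smul_apply, MultilinearMap.map_update_smul,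
      smul_comm c]

theorem act_d {r : ℤ} {U : RplColl k n} {p : Fin (n + 1) → ℤ} {f : Fin (n + 1) → X}
    (hU : U ∈ rplGr k (n + 1) r) (hf : ∀ i, f i ∈ D.gr (p i)) :
    A.act (n + 1) (rplDiff k n U) f = D.d (A.act (n + 1) U f) -
      r.negOnePow • ∑ i, (∑ j with j < i, p j).negOnePow •
        A.act (n + 1) U (Function.update f i (D.d (f i))) := by
  simp only [h.d_eq]
  refine rplGr_induction (C := fun U => A.act (n + 1) (rplDiff k n U) f =
      A.delta (A.act (n + 1) U f) - r.negOnePow • ∑ i, (∑ j with j < i, p j).negOnePow •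
        A.act (n + 1) U (Function.update f i (A.delta (f i))))
    (fun a x ha hx hr => ?_) (by simp) (fun x y hx hy => ?_) (fun c x hx => ?_) hU
  · rw [← hr]
    exact A.act_rplDiff_mono ha hx fun i => h.P_eq _ _ (hf i)
  · simp only [map_add, add_apply, hx, hy, smul_add, Finset.sum_add_distrib]
    abel
  · simp only [map_smul, smul_apply, hx, smul_sub, Finset.smul_sum, smul_comm c]

/-- The action of the dg operad `rpL*` by evaluation of monomials. -/
def rplAlgebra : (rplOperad k).Algebra D where
  act n := A.act (n + 1)
  act_mem _ _ _ _ _ hU hf := h.act_mem hf hU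
  act_one f := A.act_one f
  act_comp i a _ _ _ _ hb hf := h.act_comp i a hb hf
  act_perm _ σ U _ _ hf := A.act_perm σ U fun i => h.P_eq _ _ (hf i)
  act_d _ _ _ _ _ hU hf := h.act_d hU hf

end SuperPreLie.IsGraded

end RplAlgebraOfSuperPreLie

theorem isInternal_comap_iSup {ι R M : Type*} [DecidableEq ι] [Ring R] [AddCommGroup M] [Module R M]
    {G : ι → Submodule R M} (hG : iSupIndep G) :
    DirectSum.IsInternal fun i => (G i).comap (⨆ i, G i).subtype := by
  refine (DirectSum.isInternal_submodule_iff_iSupIndep_and_iSup_eq_top _).2 ⟨fun i => ?_, ?_⟩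
  · rw [Submodule.disjoint_def]
    intro x hx hx'
    refine Subtype.ext (Submodule.disjoint_def.1 (hG i) (x : M) hx ?_)
    have := Submodule.mem_map_of_mem (f := (⨆ i, G i).subtype) hx'
    simp only [Submodule.map_iSup] at this
    exact (iSup₂_mono fun j _ => Submodule.map_comap_le _ _) this
  · rw [eq_top_iff]
    rintro ⟨x, hx⟩ -
    exact Submodule.iSup_induction' G (motive := fun x hx => (⟨x, hx⟩ : (⨆ i, G i : Submodule R M)) ∈
      ⨆ i, (G i).comap (⨆ i, G i).subtype) (fun i x hx => Submodule.mem_iSup_of_mem i hx)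
      (zero_mem _) (fun x y _ _ h h' => add_mem h h') hx

/-! ### The total space of a graded family with a pre-Lie product. -/

section GradedFamily

variable {k : Type*} [Field k] [CharZero k] {M : Type*} [AddCommGroup M] [Module k M]

theorem units_smul_eq {X : Type*} [AddCommGroup X] [Module k X] (s : ℤˣ) (x : X) :
    s • x = ((s : ℤ) : k) • x := by
  rw [Units.smul_def, Int.cast_smul_eq_zsmul]

/-- It suffices to check the graded pre-Lie identity on homogeneous elements. -/
theorem two_smul_associator_of_homogeneous {X : Type*} [AddCommGroup X] [Module k X]
    {star : X →ₗ[k] X →ₗ[k] X} {P : X →ₗ[k] X} (M : ℤ → X → Prop)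
    (ind : ∀ C : X → Prop, (∀ p x, M p x → C x) → (∀ x y, C x → C y → C (x + y)) → ∀ x, C x)
    (hP : ∀ p x, M p x → P x = ((p.negOnePow : ℤ) : k) • x)
    (h : ∀ x q r y z, M q y → M r z → associator3 star x y z =
      (((q * r).negOnePow : ℤ) : k) • associator3 star x z y) (x y z : X) :
    (2 : k) • associator3 star x y z = associator3 star x z y +
      associator3 star x (P z) y + associator3 star x z (P y) -
        associator3 star x (P z) (P y) := by
  refine ind (fun y => ∀ z, (2 : k) • associator3 star x y z = associator3 star x z y +
      associator3 star x (P z) y + associator3 star x z (P y) -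
        associator3 star x (P z) (P y)) (fun q y hy z => ?_) (fun y y' hy hy' z => ?_) y z
  · refine ind (fun z => (2 : k) • associator3 star x y z = associator3 star x z y +
      associator3 star x (P z) y + associator3 star x z (P y) -
        associator3 star x (P z) (P y)) (fun r z hz => ?_) (fun z z' hz hz' => ?_) z
    · have h1 := hP q y hy
      have h2 := hP r z hz
      have h3 := h x q r y z hy hz
      rw [← units_smul_eq] at h1 h2 h3
      exact parity_identity h1 h2 h3
    · simp only [associator3, map_add, LinearMap.add_apply, smul_add, smul_sub] at hz hz' ⊢
      linear_combination (norm := module) hz + hz'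
  · have h1 := hy z
    have h2 := hy' z
    simp only [associator3, map_add, LinearMap.add_apply, smul_add, smul_sub] at h1 h2 ⊢
    linear_combination (norm := module) h1 + h2

/-- A graded pre-Lie product on a family of subspaces. -/
structure IsPreLieFamily (star : M →ₗ[k] M →ₗ[k] M) (P : M →ₗ[k] M) (𝒞 : ℤ → Submodule k M) :
    Prop where
  indep : iSupIndep 𝒞
  star_mem : ∀ p q, ∀ x ∈ 𝒞 p, ∀ y ∈ 𝒞 q, star x y ∈ 𝒞 (p + q)
  P_eq : ∀ p, ∀ x ∈ 𝒞 p, P x = ((p.negOnePow : ℤ) : k) • x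
  associator : ∀ p q r, ∀ x ∈ 𝒞 p, ∀ y ∈ 𝒞 q, ∀ z ∈ 𝒞 r, associator3 star x y z =
    (((q * r).negOnePow : ℤ) : k) • associator3 star x z y

variable {𝒞 : ℤ → Submodule k M}

theorem iSup_subtype_induction {C : (⨆ p, 𝒞 p : Submodule k M) → Prop}
    (mem : ∀ p (x : (⨆ p, 𝒞 p : Submodule k M)), (x : M) ∈ 𝒞 p → C x)
    (add : ∀ x y, C x → C y → C (x + y)) (x : (⨆ p, 𝒞 p : Submodule k M)) : C x := by
  obtain ⟨x, hx⟩ := x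
  exact Submodule.iSup_induction' 𝒞 (motive := fun x hx => C ⟨x, hx⟩)
    (fun p x hx => mem p ⟨x, _⟩ hx) (mem 0 0 (zero_mem _))
    (fun x y hx hy h h' => add ⟨x, hx⟩ ⟨y, hy⟩ h h') hx

namespace IsPreLieFamily

variable {star : M →ₗ[k] M →ₗ[k] M} {P : M →ₗ[k] M} (h : IsPreLieFamily star P 𝒞)
include h

theorem star_mem_iSup (x y : (⨆ p, 𝒞 p : Submodule k M)) :
    star (x : M) (y : M) ∈ ⨆ p, 𝒞 p := by
  induction x using iSup_subtype_induction with
  | mem p x hx =>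
    induction y using iSup_subtype_induction with
    | mem q y hy => exact Submodule.mem_iSup_of_mem _ (h.star_mem p q _ hx _ hy)
    | add y y' hy hy' =>
      rw [Submodule.coe_add, map_add]
      exact add_mem hy hy'
  | add x x' hx hx' =>
    rw [Submodule.coe_add, map_add]
    exact add_mem hx hx'

/-- The product on the total space. -/
def starTotal : (⨆ p, 𝒞 p : Submodule k M) →ₗ[k] (⨆ p, 𝒞 p : Submodule k M) →ₗ[k]
    (⨆ p, 𝒞 p : Submodule k M) :=
  LinearMap.mk₂ k (fun x y => ⟨_, h.star_mem_iSup x y⟩)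
    (fun x x' y => Subtype.ext (by simp)) (fun c x y => Subtype.ext (by simp))
    (fun x y y' => Subtype.ext (by simp)) (fun c x y => Subtype.ext (by simp))

/-- The parity involution of the total space. -/
def parityTotal : (⨆ p, 𝒞 p : Submodule k M) →ₗ[k] (⨆ p, 𝒞 p : Submodule k M) :=
  P.restrict fun x hx => by
    refine iSup_subtype_induction (C := fun x : (⨆ p, 𝒞 p : Submodule k M) => P (x : M) ∈ ⨆ p, 𝒞 p)
      (fun p x hx => ?_) (fun x y hx hy => ?_) ⟨x, hx⟩
    · rw [h.P_eq p _ hx]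
      exact Submodule.mem_iSup_of_mem p (Submodule.smul_mem _ _ hx)
    · rw [Submodule.coe_add, map_add]
      exact add_mem hx hy

theorem parityTotal_of_mem {p : ℤ} {x : (⨆ p, 𝒞 p : Submodule k M)} (hx : (x : M) ∈ 𝒞 p) :
    h.parityTotal x = ((p.negOnePow : ℤ) : k) • x :=
  Subtype.ext (h.P_eq p _ hx)

theorem associator_starTotal (x : (⨆ p, 𝒞 p : Submodule k M)) {q r : ℤ}
    {y z : (⨆ p, 𝒞 p : Submodule k M)} (hy : (y : M) ∈ 𝒞 q) (hz : (z : M) ∈ 𝒞 r) :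
    associator3 h.starTotal x y z =
      (((q * r).negOnePow : ℤ) : k) • associator3 h.starTotal x z y := by
  induction x using iSup_subtype_induction with
  | mem p x hx => exact Subtype.ext (h.associator p q r _ hx _ hy _ hz)
  | add x x' hx hx' =>
    simp only [associator3, map_add, LinearMap.add_apply, smul_sub, smul_add] at hx hx' ⊢
    linear_combination (norm := module) hx + hx'

/-- The graded pre-Lie algebra with an element `lam` of degree `1` and square zero. -/
def superPreLie {lam : (⨆ p, 𝒞 p : Submodule k M)} (hlam : (lam : M) ∈ 𝒞 1)
    (hsq : star (lam : M) (lam : M) = 0) : SuperPreLie k (⨆ p, 𝒞 p : Submodule k M) where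
  P := h.parityTotal
  star := h.starTotal
  lam := lam
  P_P x := by
    induction x using iSup_subtype_induction with
    | mem p x hx =>
      rw [h.parityTotal_of_mem hx, map_smul, h.parityTotal_of_mem hx, smul_smul, ← Int.cast_mul,
        ← Units.val_mul, Int.units_mul_self, Units.val_one, Int.cast_one, one_smul]
    | add x y hx hy => rw [map_add, map_add, hx, hy]
  P_star x y := by
    induction x using iSup_subtype_induction with
    | mem p x hx =>
      induction y using iSup_subtype_induction with
      | mem q y hy =>
        rw [h.parityTotal_of_mem hx, h.parityTotal_of_mem hy,
          h.parityTotal_of_mem (x := h.starTotal x y) (h.star_mem p q _ hx _ hy),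
          map_smul, map_smul, LinearMap.smul_apply, smul_smul, Int.negOnePow_add, mul_comm,
          Units.val_mul, Int.cast_mul]
      | add x y hx hy => simp only [map_add, hx, hy]
    | add x y hx hy => simp only [map_add, LinearMap.add_apply, hx, hy]
  P_lam := by
    rw [h.parityTotal_of_mem hlam, Int.negOnePow_one, Units.val_neg, Units.val_one, Int.cast_neg,
      Int.cast_one]
    exact neg_one_smul k lam
  star_lam_lam := Subtype.ext hsq
  preLie := preLie_of_parity (two_smul_associator_of_homogeneous
    (fun p (x : (⨆ p, 𝒞 p : Submodule k M)) => (x : M) ∈ 𝒞 p)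
    (fun _ h1 h2 x => iSup_subtype_induction h1 h2 x) (fun _ _ hx => h.parityTotal_of_mem hx)
    (fun x _ _ _ _ hy hz => h.associator_starTotal x hy hz))

variable {lam : (⨆ p, 𝒞 p : Submodule k M)} (hlam : (lam : M) ∈ 𝒞 1)
  (hsq : star (lam : M) (lam : M) = 0)

theorem coe_delta {p : ℤ} {x : (⨆ p, 𝒞 p : Submodule k M)} (hx : (x : M) ∈ 𝒞 p) :
    ((h.superPreLie hlam hsq).delta x : M) =
      ((p.negOnePow : ℤ) : k) • star (x : M) (lam : M) - star (lam : M) (x : M) := by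
  rw [SuperPreLie.delta_apply]
  change ((h.starTotal (h.parityTotal x) lam - h.starTotal lam x :
    (⨆ p, 𝒞 p : Submodule k M)) : M) = _
  rw [h.parityTotal_of_mem hx, map_smul, LinearMap.smul_apply]
  rfl

/-- The dg vector space with the differential given by the commutator with `lam`. -/
def dg : DGStruct k (⨆ p, 𝒞 p : Submodule k M) where
  gr p := (𝒞 p).comap (⨆ p, 𝒞 p).subtype
  internal := isInternal_comap_iSup h.indep
  d := (h.superPreLie hlam hsq).delta
  d_mem p x hx := by
    rw [Submodule.mem_comap, Submodule.subtype_apply, h.coe_delta hlam hsq hx]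
    refine sub_mem (Submodule.smul_mem _ _ (h.star_mem _ _ _ hx _ hlam)) ?_
    rw [add_comm]
    exact h.star_mem _ _ _ hlam _ hx
  d_d x := SuperPreLie.delta_delta _ x

theorem isGraded : (h.superPreLie hlam hsq).IsGraded (h.dg hlam hsq) where
  P_eq _ _ hx := (h.parityTotal_of_mem hx).trans (units_smul_eq _ _).symm
  star_mem _ _ _ hx _ hy := h.star_mem _ _ _ hx _ hy
  lam_mem := hlam
  d_eq _ := rfl

end IsPreLieFamily

end GradedFamily

end

/-! ### The pre-Lie algebra of coderivations. -/

noncomputable section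

open GSym

section CEAction

variable {k : Type*} [Field k] [CharZero k] {L : Type*} [AddCommGroup L] [Module k L]
  {ℒ : ℤ → Submodule k L} [DirectSum.Decomposition ℒ]
  {𝒞 : ℤ → Submodule k (Module.End k (GSym (desusp ℒ)))}

/-- Graded spaces of coderivations that are closed under the pre-Lie product. -/
structure IsCoderFamily (𝒞 : ℤ → Submodule k (Module.End k (GSym (desusp ℒ)))) : Prop where
  le : ∀ p, 𝒞 p ≤ coder (desusp ℒ) p
  coext_mem : ∀ p q, ∀ Θ ∈ 𝒞 p, ∀ Ω ∈ 𝒞 q,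
    coext (proj (desusp ℒ) ∘ₗ Θ ∘ₗ Ω) ∈ 𝒞 (p + q)

theorem isHomog_proj_comp_comp {p q : ℤ} {Θ Ω : Module.End k (GSym (desusp ℒ))}
    (hΘ : Θ ∈ coder (desusp ℒ) p) (hΩ : Ω ∈ coder (desusp ℒ) q) :
    IsHomog (proj (desusp ℒ) ∘ₗ Θ ∘ₗ Ω) (p + q) :=
  IsHomog.proj_comp fun r s hs => by
    have := hΘ.1 _ _ (hΩ.1 r s hs)
    rwa [add_assoc, add_comm q p] at this

theorem isCoderFamily_coder : IsCoderFamily (coder (desusp ℒ)) :=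
  ⟨fun _ => le_rfl, fun _ _ _ hΘ _ hΩ => coext_mem_coder (isHomog_proj_comp_comp hΘ hΩ)⟩

/-- A coextension takes `1` to the value of its corestriction at `1`, and that is zero as soon as `Ω
1 = 0`. -/
theorem isCoderFamily_coder₀ : IsCoderFamily (coder₀ (desusp ℒ)) := by
  refine ⟨fun _ => inf_le_left, fun p q Θ hΘ Ω hΩ =>
    ⟨coext_mem_coder (isHomog_proj_comp_comp hΘ.1 hΩ.1), ?_⟩⟩
  change coext (proj (desusp ℒ) ∘ₗ Θ ∘ₗ Ω) 1 = 0
  have h1 : Ω 1 = 0 := hΩ.2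
  rw [coext_one, LinearMap.comp_apply, LinearMap.comp_apply, h1, map_zero, map_zero, map_zero]

namespace CE

theorem units_smul (s : ℤˣ) (Θ : CE 𝒞) : s • Θ = ((s : ℤ) : k) • Θ := by
  refine Subtype.ext ?_
  rw [Units.smul_def, Submodule.coe_smul_of_tower, Submodule.coe_smul, Int.cast_smul_eq_zsmul]

/-- The pre-Lie product of coderivations, extended to all endomorphisms. -/
def star : Module.End k (GSym (desusp ℒ)) →ₗ[k] Module.End k (GSym (desusp ℒ)) →ₗ[k]
    Module.End k (GSym (desusp ℒ)) :=
  LinearMap.mk₂ k (fun Θ Ω => coext (proj (desusp ℒ) ∘ₗ Θ ∘ₗ Ω))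
    (fun Θ Θ' Ω => by simp only [LinearMap.add_comp, LinearMap.comp_add, map_add])
    (fun c Θ Ω => by simp only [LinearMap.smul_comp, LinearMap.comp_smul, map_smul])
    (fun Θ Ω Ω' => by simp only [LinearMap.comp_add, map_add])
    (fun c Θ Ω => by simp only [LinearMap.comp_smul, map_smul])

theorem star_apply (Θ Ω : Module.End k (GSym (desusp ℒ))) :
    star Θ Ω = coext (proj (desusp ℒ) ∘ₗ Θ ∘ₗ Ω) := rfl

theorem proj_star {p q : ℤ} {Θ Ω : Module.End k (GSym (desusp ℒ))}
    (hΘ : Θ ∈ coder (desusp ℒ) p) (hΩ : Ω ∈ coder (desusp ℒ) q) :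
    proj (desusp ℒ) ∘ₗ star Θ Ω = proj (desusp ℒ) ∘ₗ Θ ∘ₗ Ω :=
  LinearMap.ext fun s => proj_coext (isHomog_proj_comp_comp hΘ hΩ) s

/-- The graded commutator of coderivations is the graded commutator for the pre-Lie product. -/
theorem star_sub_star {p q : ℤ} {Θ Ω : Module.End k (GSym (desusp ℒ))}
    (hΘ : Θ ∈ coder (desusp ℒ) p) (hΩ : Ω ∈ coder (desusp ℒ) q) :
    star Θ Ω - (((p * q).negOnePow : ℤ) : k) • star Ω Θ =
      Θ ∘ₗ Ω - (((p * q).negOnePow : ℤ) : k) • (Ω ∘ₗ Θ) := by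
  have h := commutator_mem_coder hΘ hΩ
  rw [units_smul_eq (k := k)] at h
  rw [← coext_proj_comp h, star_apply, star_apply, LinearMap.comp_sub, map_sub,
    LinearMap.comp_smul, map_smul]

/-- `(Θ ⋆ Ω) ⋆ Ξ` has corestriction `Θ̄ Ω Ξ` and `Θ ⋆ (Ω ⋆ Ξ)` has corestriction `Θ̄ (Ω ⋆ Ξ)`. So
the graded antisymmetrisation of the associator in `Ω`, `Ξ` is `Θ̄` applied to the difference of two
commutators, which agree by `star_sub_star`. -/
theorem associator_star {p q r : ℤ} {Θ Ω Ξ : Module.End k (GSym (desusp ℒ))}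
    (hΘ : Θ ∈ coder (desusp ℒ) p) (hΩ : Ω ∈ coder (desusp ℒ) q) (hΞ : Ξ ∈ coder (desusp ℒ) r) :
    associator3 star Θ Ω Ξ = (((q * r).negOnePow : ℤ) : k) • associator3 star Θ Ξ Ω := by
  have h := congrArg (fun T => coext (proj (desusp ℒ) ∘ₗ Θ ∘ₗ T)) (star_sub_star hΩ hΞ)
  simp only [LinearMap.comp_sub, LinearMap.comp_smul, map_sub, map_smul] at h
  have h2 : ∀ {q r : ℤ} {Ω Ξ : Module.End k (GSym (desusp ℒ))}, Ω ∈ coder (desusp ℒ) q →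
      Ξ ∈ coder (desusp ℒ) r →
      star (star Θ Ω) Ξ = coext (proj (desusp ℒ) ∘ₗ Θ ∘ₗ Ω ∘ₗ Ξ) := by
    intro q r Ω Ξ hΩ hΞ
    rw [star_apply (star Θ Ω), ← LinearMap.comp_assoc, proj_star hΘ hΩ, LinearMap.comp_assoc,
      LinearMap.comp_assoc]
  rw [associator3, associator3, h2 hΩ hΞ, h2 hΞ hΩ, star_apply Θ, star_apply Θ, smul_sub]
  linear_combination (norm := module) -h

variable (ℒ) in
/-- Conjugation by the parity automorphism. -/
def parity : Module.End k (GSym (desusp ℒ)) →ₗ[k] Module.End k (GSym (desusp ℒ)) :=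
  LinearMap.lcomp k _ (paritySign (desusp ℒ) 1) ∘ₗ
    LinearMap.llcomp k _ _ _ (paritySign (desusp ℒ) 1)

theorem parity_of_mem {p : ℤ} {Θ : Module.End k (GSym (desusp ℒ))}
    (hΘ : Θ ∈ coder (desusp ℒ) p) : parity ℒ Θ = ((p.negOnePow : ℤ) : k) • Θ := by
  refine LinearMap.ext fun s => ?_
  change paritySign (desusp ℒ) 1 (Θ (paritySign (desusp ℒ) 1 s)) = _
  rw [paritySign_map hΘ.1, paritySign_paritySign, one_mul, units_smul_eq (k := k),
    LinearMap.smul_apply]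
  congr 2

variable (h𝒞 : IsCoderFamily 𝒞)
include h𝒞

theorem isPreLieFamily : IsPreLieFamily star (parity ℒ) 𝒞 where
  indep := iSupIndep_coder.mono h𝒞.le
  star_mem p q _ hΘ _ hΩ := h𝒞.coext_mem p q _ hΘ _ hΩ
  P_eq p _ hΘ := parity_of_mem (h𝒞.le p hΘ)
  associator p q r _ hΘ _ hΩ _ hΞ := associator_star (h𝒞.le p hΘ) (h𝒞.le q hΩ) (h𝒞.le r hΞ)

theorem isCoderProduct_starTotal : IsCoderProduct (isPreLieFamily h𝒞).starTotal := by
  refine ⟨fun Θ Ω => ?_, fun p q Θ Ω hΘ hΩ => h𝒞.coext_mem p q _ hΘ _ hΩ,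
    fun q r Θ Ω Ξ hΩ hΞ => ((isPreLieFamily h𝒞).associator_starTotal Θ hΩ hΞ).trans
      (units_smul _ _).symm⟩
  induction Θ using iSup_subtype_induction with
  | mem p Θ hΘ =>
    induction Ω using iSup_subtype_induction with
    | mem q Ω hΩ => exact proj_star (h𝒞.le p hΘ) (h𝒞.le q hΩ)
    | add Ω Ω' h h' => simp only [map_add, Submodule.coe_add, LinearMap.comp_add, h, h']
  | add Θ Θ' h h' =>
    simp only [map_add, LinearMap.add_apply, Submodule.coe_add, LinearMap.comp_add,
      LinearMap.add_comp, h, h']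

theorem rplActs {lam : CE 𝒞} (hlam : (lam : Module.End k (GSym (desusp ℒ))) ∈ 𝒞 1)
    (hsq : (lam : Module.End k (GSym (desusp ℒ))) ∘ₗ
    (lam : Module.End k (GSym (desusp ℒ))) = 0) :
    RplActs (rplOperad k) (rplOperad k).cohomology lam := by
  have hst : star (lam : Module.End k (GSym (desusp ℒ)))
      (lam : Module.End k (GSym (desusp ℒ))) = 0 := by
    rw [star_apply, hsq, LinearMap.comp_zero, map_zero]
  refine ⟨(isPreLieFamily h𝒞).starTotal, isCoderProduct_starTotal h𝒞,
    (isPreLieFamily h𝒞).dg hlam hst, ⟨fun _ => rfl, fun p Θ hΘ => ?_⟩,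
    ((isPreLieFamily h𝒞).isGraded hlam hst).rplAlgebra, fun n m U hm hU p f hf => ?_,
    ((isPreLieFamily h𝒞).dg hlam hst).cohomology,
    ((isPreLieFamily h𝒞).dg hlam hst).isCohomology_cohomology,
    ((isPreLieFamily h𝒞).isGraded hlam hst).rplAlgebra.cohomology,
    ((isPreLieFamily h𝒞).isGraded hlam hst).rplAlgebra.isInducedAction_cohomology⟩
  · refine ((isPreLieFamily h𝒞).coe_delta hlam hst hΘ).trans ?_
    -- The commutator identity for `Θ` and `λ`, multiplied by `(-1)^p`, turns the expression with
    -- `⋆` into the one with compositions.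
    have h := congrArg (fun T => ((p.negOnePow : ℤ) : k) • T)
      (star_sub_star (h𝒞.le p hΘ) (h𝒞.le 1 hlam))
    have h2 : ((p.negOnePow : ℤ) : k) * ((p.negOnePow : ℤ) : k) = 1 := by
      rw [← Int.cast_mul, ← Units.val_mul, Int.units_mul_self, Units.val_one, Int.cast_one]
    rw [units_smul_eq (k := k)]
    simpa only [mul_one, smul_sub, smul_smul, h2, one_smul] using h
  · refine (((isPreLieFamily h𝒞).superPreLie hlam hst).act_mono (fun i =>
      ((isPreLieFamily h𝒞).isGraded hlam hst).P_eq (p i) (f i) (hf i)) hm hU).trans ?_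
    exact (units_smul_eq (X := CE 𝒞) _ _).trans (CE.units_smul _ _).symm

end CE

end CEAction

end

/-! ### A space in degree zero: `S(↓L)` as an exterior algebra. -/

noncomputable section

section DegMinusOne

variable {k : Type*} [Field k] {L : Type*} [AddCommGroup L] [Module k L]

theorem mem_desusp_degZero (v : L) : v ∈ desusp (degZero k L) (-1) := by
  simp [desusp, degZero]

theorem eq_zero_of_mem_desusp_degZero {p : ℤ} (hp : p ≠ -1) {v : L}
    (hv : v ∈ desusp (degZero k L) p) : v = 0 := by
  have h : p + 1 ≠ 0 := fun h => hp (by omega)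
  simpa [desusp, degZero, h] using hv

namespace GSym

variable (k) in
/-- The product `↓x₁ ⋯ ↓xₙ` in `S(↓L)`. -/
def wedge {n : ℕ} (x : Fin n → L) : GSym (desusp (degZero k L)) :=
  (List.ofFn fun i => ι (desusp (degZero k L)) (x i)).prod

theorem wedge_zero (x : Fin 0 → L) : wedge k x = 1 := by
  rw [wedge, List.ofFn_zero, List.prod_nil]

theorem wedge_succ {n : ℕ} (x : Fin (n + 1) → L) :
    wedge k x = ι _ (x 0) * wedge k (fun i => x i.succ) := by
  rw [wedge, List.ofFn_succ, List.prod_cons, wedge]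

theorem wedge_cons {n : ℕ} (v : L) (x : Fin n → L) :
    wedge k (Fin.cons v x : Fin (n + 1) → L) = ι _ v * wedge k x := wedge_succ _

theorem list_prod_eq_wedge (l : List L) :
    (l.map (ι (desusp (degZero k L)))).prod = wedge k l.get := by
  rw [wedge]
  congr 1
  conv_lhs => rw [← List.ofFn_get l, List.map_ofFn]
  rfl

theorem wedge_mem_gr {n : ℕ} (x : Fin n → L) :
    wedge k x ∈ gr (desusp (degZero k L)) (-n) := by
  induction n with
  | zero => rw [wedge_zero]; exact one_mem_gr _
  | succ n ih =>
    rw [wedge_succ, Nat.cast_succ, neg_add_rev]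
    exact ι_mul_mem_gr _ (mem_desusp_degZero _) (ih _)

/-- As `↓L` is concentrated in degree `-1`, the degree of a product is minus its length; a factor of
any other degree is zero. -/
theorem gr_le_span_wedge {q : ℤ} {s : GSym (desusp (degZero k L))}
    (hs : s ∈ gr (desusp (degZero k L)) q) :
    s ∈ Submodule.span k {s | ∃ (n : ℕ) (x : Fin n → L), -(n : ℤ) = q ∧ s = wedge k x} := by
  refine gr_induction (desusp (degZero k L)) (C := fun q s => s ∈ Submodule.span k
    {s | ∃ (n : ℕ) (x : Fin n → L), -(n : ℤ) = q ∧ s = wedge k x}) ?_ (fun p q v hv s _ ih => ?_)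
    (fun q => zero_mem _) (fun q s t hs ht => add_mem hs ht)
    (fun q c s hs => Submodule.smul_mem _ c hs) hs
  · exact Submodule.subset_span ⟨0, Fin.elim0, rfl, (wedge_zero _).symm⟩
  · by_cases hp : p = -1
    · subst hp
      refine Submodule.span_induction (p := fun s _ => ι _ v * s ∈ Submodule.span k
        {s | ∃ (n : ℕ) (x : Fin n → L), -(n : ℤ) = -1 + q ∧ s = wedge k x}) ?_ (by simp)
        (fun s t _ _ hs ht => by rw [mul_add]; exact add_mem hs ht)
        (fun c s _ hs => by rw [mul_smul_comm]; exact Submodule.smul_mem _ _ hs) ih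
      rintro _ ⟨n, x, rfl, rfl⟩
      exact Submodule.subset_span ⟨n + 1, Fin.cons v x, by push_cast; ring, (wedge_cons _ _).symm⟩
    · rw [eq_zero_of_mem_desusp_degZero hp hv, map_zero, zero_mul]
      exact zero_mem _

theorem linearMap_ext_wedge {W : Type*} [AddCommGroup W] [Module k W]
    {f g : GSym (desusp (degZero k L)) →ₗ[k] W}
    (h : ∀ (n : ℕ) (x : Fin n → L), f (wedge k x) = g (wedge k x)) : f = g :=
  linearMap_ext_gr fun q s hs => by
    refine Submodule.span_induction (p := fun s _ => f s = g s) ?_ (by simp)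
      (fun s t _ _ hs ht => by rw [map_add, map_add, hs, ht])
      (fun c s _ hs => by rw [map_smul, map_smul, hs]) (gr_le_span_wedge hs)
    rintro _ ⟨n, x, -, rfl⟩
    exact h n x

/-- Products of `n` elements have degree `-n` and values have degree `-1`, so a map supported on
length `n` has degree `n - 1`. -/
theorem isHomog_of_wedge {f : GSym (desusp (degZero k L)) →ₗ[k] L} {n : ℕ}
    (h : ∀ m ≠ n, ∀ x : Fin m → L, f (wedge k x) = 0) : IsHomog f ((n : ℤ) - 1) := fun q s hs => by
  refine Submodule.span_induction (p := fun s _ => f s ∈ desusp (degZero k L) (q + (n - 1))) ?_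
    (by simp) (fun s t _ _ hs ht => by rw [map_add]; exact add_mem hs ht)
    (fun c s _ hs => by rw [map_smul]; exact Submodule.smul_mem _ _ hs) (gr_le_span_wedge hs)
  rintro _ ⟨m, x, rfl, rfl⟩
  by_cases hm : m = n
  · subst hm
    rw [show -(m : ℤ) + (m - 1) = -1 by ring]
    exact mem_desusp_degZero _
  · rw [h m hm x]
    exact zero_mem _

theorem IsHomog.wedge_eq_zero {f : GSym (desusp (degZero k L)) →ₗ[k] L} {p : ℤ} (hf : IsHomog f p)
    {m : ℕ} (hm : (m : ℤ) - 1 ≠ p) (x : Fin m → L) : f (wedge k x) = 0 :=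
  eq_zero_of_mem_desusp_degZero (p := -(m : ℤ) + p) (by omega) (hf _ _ (wedge_mem_gr x))

theorem ι_mul_ι_self [CharZero k] (v : L) :
    ι (desusp (degZero k L)) v * ι (desusp (degZero k L)) v = 0 := by
  have h := ι_comm (desusp (degZero k L)) (mem_desusp_degZero v) (mem_desusp_degZero v)
  rw [show ((-1 : ℤ) * -1).negOnePow = -1 from rfl, Units.smul_def, Units.val_neg, Units.val_one,
    neg_one_smul, eq_neg_iff_add_eq_zero, ← two_smul k] at h
  exact (smul_eq_zero.1 h).resolve_left two_ne_zero

variable (k L) in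
/-- The algebra `S(↓L)` mapped to the exterior algebra of `L`. -/
def toExterior : GSym (desusp (degZero k L)) →ₐ[k] ExteriorAlgebra k L :=
  GSym.lift _ (ExteriorAlgebra.ι k) (fun p q x y hx hy => by
    by_cases hp : p = -1
    · by_cases hq : q = -1
      · subst hp hq
        rw [show ((-1 : ℤ) * -1).negOnePow = -1 from rfl, Units.smul_def, Units.val_neg,
          Units.val_one, neg_one_smul, eq_neg_iff_add_eq_zero]
        exact ExteriorAlgebra.ι_add_mul_swap x y
      · rw [eq_zero_of_mem_desusp_degZero hq hy]
        simp
    · rw [eq_zero_of_mem_desusp_degZero hp hx]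
      simp)

theorem toExterior_wedge {n : ℕ} (x : Fin n → L) :
    toExterior k L (wedge k x) = ExteriorAlgebra.ιMulti k n x := by
  rw [ExteriorAlgebra.ιMulti_apply, wedge, map_list_prod, List.map_ofFn]
  congr 2
  funext i
  exact lift_ι _ _ _ _

variable (k L) in
/-- The exterior algebra of `L` mapped to `S(↓L)`. -/
def ofExterior [CharZero k] : ExteriorAlgebra k L →ₐ[k] GSym (desusp (degZero k L)) :=
  ExteriorAlgebra.lift k ⟨ι _, ι_mul_ι_self⟩

theorem ofExterior_ιMulti [CharZero k] {n : ℕ} (x : Fin n → L) :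
    ofExterior k L (ExteriorAlgebra.ιMulti k n x) = wedge k x := by
  rw [ExteriorAlgebra.ιMulti_apply, wedge, map_list_prod, List.map_ofFn]
  congr 2
  funext i
  exact ExteriorAlgebra.lift_ι_apply _ _ _ _

/-- The linear map on `S(↓L)` given by an alternating map on the products of `n` elements and zero
on the products of any other length. -/
def ofAlternating {n : ℕ} (c : L [⋀^Fin n]→ₗ[k] L) : GSym (desusp (degZero k L)) →ₗ[k] L :=
  ExteriorAlgebra.liftAlternating (R := k) (Pi.single n c) ∘ₗ (toExterior k L).toLinearMap

theorem ofAlternating_wedge {n : ℕ} (c : L [⋀^Fin n]→ₗ[k] L) (x : Fin n → L) :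
    ofAlternating c (wedge k x) = c x := by
  rw [ofAlternating, LinearMap.comp_apply, AlgHom.toLinearMap_apply, toExterior_wedge,
    ExteriorAlgebra.liftAlternating_apply_ιMulti, Pi.single_eq_same]

theorem ofAlternating_wedge_of_ne {n m : ℕ} (c : L [⋀^Fin n]→ₗ[k] L) (h : m ≠ n) (x : Fin m → L) :
    ofAlternating c (wedge k x) = 0 := by
  rw [ofAlternating, LinearMap.comp_apply, AlgHom.toLinearMap_apply, toExterior_wedge,
    ExteriorAlgebra.liftAlternating_apply_ιMulti, Pi.single_eq_of_ne h, AlternatingMap.zero_apply]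

theorem isHomog_ofAlternating {n : ℕ} (c : L [⋀^Fin n]→ₗ[k] L) :
    IsHomog (ofAlternating c) ((n : ℤ) - 1) :=
  isHomog_of_wedge fun _ h x => ofAlternating_wedge_of_ne c h x

end GSym

open GSym

/-- A corestriction of degree `p` can be nonzero only on products of `p + 1` elements, and there are
none of negative length. -/
theorem coder_eq_bot_of_lt_neg_one [CharZero k] {p : ℤ} (hp : p < -1) :
    coder (desusp (degZero k L)) p = ⊥ :=
  (Submodule.eq_bot_iff _).2 fun _ hΘ => coder_eq_zero hΘ (linearMap_ext_wedge fun m x =>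
    (IsHomog.proj_comp hΘ.1).wedge_eq_zero (by omega) x)

variable (k L) in
/-- The alternating cochain of a coderivation. -/
def coderToAlternating [CharZero k] (n : ℕ) :
    coder (desusp (degZero k L)) ((n : ℤ) - 1) →ₗ[k] (L [⋀^Fin n]→ₗ[k] L) where
  toFun Θ := (proj _ ∘ₗ (Θ : Module.End k (GSym (desusp (degZero k L)))) ∘ₗ
    (ofExterior k L).toLinearMap).compAlternatingMap (ExteriorAlgebra.ιMulti k n)
  map_add' Θ Ω := AlternatingMap.ext fun x => by simp
  map_smul' c Θ := AlternatingMap.ext fun x => by simp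

theorem coderToAlternating_apply [CharZero k] (n : ℕ)
    (Θ : coder (desusp (degZero k L)) ((n : ℤ) - 1)) (x : Fin n → L) :
    coderToAlternating k L n Θ x =
      proj _ ((Θ : Module.End k (GSym (desusp (degZero k L)))) (wedge k x)) :=
  congrArg (fun s => proj _ ((Θ : Module.End k (GSym (desusp (degZero k L)))) s))
    (ofExterior_ιMulti x)

/-- A coderivation of degree `n - 1` has its corestriction supported on length `n`, hence is
determined by the cochain. Conversely, an alternating map factors through the exterior algebra and
is coextended. -/
theorem coderToAlternating_bijective [CharZero k] (n : ℕ) :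
    Function.Bijective (coderToAlternating k L n) := by
  refine ⟨(injective_iff_map_eq_zero _).2 fun Θ h => Subtype.ext (coder_eq_zero Θ.2
    (linearMap_ext_wedge fun m x => ?_)), fun c => ⟨⟨coext (ofAlternating c),
      coext_mem_coder (isHomog_ofAlternating c)⟩, AlternatingMap.ext fun x => ?_⟩⟩
  · by_cases hm : m = n
    · subst hm
      refine (coderToAlternating_apply m Θ x).symm.trans ?_
      rw [h]
      rfl
    · exact (IsHomog.proj_comp Θ.2.1).wedge_eq_zero (by omega) x
  · rw [coderToAlternating_apply]
    exact (proj_coext (isHomog_ofAlternating c) _).trans (ofAlternating_wedge c x)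

end DegMinusOne

end

/-! ### The coderivation of a Lie bracket and the classical differential. -/

noncomputable section

open GSym

section LieCE

variable (k : Type*) [Field k] (L : Type*) [LieRing L] [LieAlgebra k L]

/-- The Lie bracket as an alternating map. -/
def lieAlternating : L [⋀^Fin 2]→ₗ[k] L where
  toFun x := ⁅x 0, x 1⁆
  map_update_add' x i a b := by
    fin_cases i <;> simp [Function.update_of_ne]
  map_update_smul' x i c a := by
    fin_cases i <;> simp [Function.update_of_ne]
  map_eq_zero_of_eq' x i j h hij := by
    fin_cases i <;> fin_cases j <;> simp_all

/-- The coextension of the desuspended Lie bracket. -/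
def lieLam : Module.End k (GSym (desusp (degZero k L))) := coext (ofAlternating (-lieAlternating k L))

variable {k L}

/-- The bracket is supported on length two, so once `v` is fixed only the part of `s` of length one
is seen. -/
theorem lieBracket_ι_mul (v : L) (s : GSym (desusp (degZero k L))) :
    ofAlternating (-lieAlternating k L) (ι _ v * s) = -⁅v, proj _ s⁆ := by
  have h : ofAlternating (-lieAlternating k L) ∘ₗ mulι v =
      (-LieAlgebra.ad k L v) ∘ₗ proj (desusp (degZero k L)) := linearMap_ext_wedge fun n x => by
    rw [LinearMap.comp_apply, LinearMap.mulLeft_apply, ← wedge_cons, LinearMap.comp_apply]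
    by_cases hn : n = 1
    · subst hn
      rw [ofAlternating_wedge, wedge_succ, wedge_zero, mul_one, proj_ι]
      rfl
    · rw [ofAlternating_wedge_of_ne _ (by omega), (isHomog_proj).wedge_eq_zero (by omega), map_zero]
  exact LinearMap.congr_fun h s

theorem lieBracket_one : ofAlternating (-lieAlternating k L) 1 = 0 := by
  rw [← wedge_zero (k := k) (L := L) Fin.elim0, ofAlternating_wedge_of_ne _ (by omega)]

theorem isHomog_lieBracket : IsHomog (ofAlternating (-lieAlternating k L)) 1 :=
  isHomog_ofAlternating _

theorem lieLam_mem_coder : lieLam k L ∈ coder (desusp (degZero k L)) 1 :=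
  coext_mem_coder isHomog_lieBracket

theorem lieLam_one : lieLam k L 1 = 0 := by
  rw [lieLam, coext_one, lieBracket_one, map_zero]

theorem proj_lieLam (s : GSym (desusp (degZero k L))) :
    proj _ (lieLam k L s) = ofAlternating (-lieAlternating k L) s :=
  proj_coext isHomog_lieBracket s

/-- The coderivation of `S(↓L)` extending `w ↦ -[v, w]`. -/
def lieAd (v : L) : Module.End k (GSym (desusp (degZero k L))) :=
  coext (ofAlternating (-lieAlternating k L) ∘ₗ mulι v)

theorem isHomog_lieBracket_comp_mulι (v : L) :
    IsHomog (ofAlternating (-lieAlternating k L) ∘ₗ mulι v) 0 :=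
  isHomog_lieBracket.comp_mulι (mem_desusp_degZero v)

theorem proj_lieAd (v : L) (s : GSym (desusp (degZero k L))) :
    proj _ (lieAd v s) = -⁅v, proj _ s⁆ :=
  (proj_coext (isHomog_lieBracket_comp_mulι v) s).trans (lieBracket_ι_mul v s)

theorem lieAd_one (v : L) : lieAd (k := k) v 1 = 0 := by
  rw [lieAd, coext_one, LinearMap.comp_apply, LinearMap.mulLeft_apply, lieBracket_ι_mul, proj_one,
    lie_zero, neg_zero, map_zero]

theorem lieAd_ι_mul (v w : L) (s : GSym (desusp (degZero k L))) :
    lieAd v (ι _ w * s) = -(ι _ ⁅v, w⁆ * s) + ι _ w * lieAd v s := by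
  have h : (ofAlternating (-lieAlternating k L) ∘ₗ mulι v) ∘ₗ mulι w =
      (counit (desusp (degZero k L))).toLinearMap.smulRight (-⁅v, w⁆) := LinearMap.ext fun s => by
    rw [LinearMap.comp_apply, LinearMap.comp_apply, LinearMap.mulLeft_apply,
      LinearMap.mulLeft_apply, lieBracket_ι_mul, proj_ι_mul, lie_smul, ← smul_neg]
    rfl
  rw [lieAd, coext_ι_mul (isHomog_lieBracket_comp_mulι v) (mem_desusp_degZero w), zero_mul,
    Int.negOnePow_zero, one_smul, h, coext_smulRight_counit, map_neg, neg_mul]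

/-- Either `v` is one of the bracketed elements or it is passed over, with a sign as both `λ` and
`v` are odd. This recursion replaces the explicit formula for `λ` in the proof that `λ² = 0`. -/
theorem lieLam_ι_mul (v : L) (s : GSym (desusp (degZero k L))) :
    lieLam k L (ι _ v * s) = lieAd v s - ι _ v * lieLam k L s := by
  rw [lieLam, coext_ι_mul isHomog_lieBracket (mem_desusp_degZero v), one_mul,
    show (-1 : ℤ).negOnePow = -1 from rfl, Units.smul_def, Units.val_neg, Units.val_one,
    neg_one_smul, ← sub_eq_add_neg]
  rfl

/-- The coderivation extending `-[v, ·]` is compatible with the bracket: this is the Jacobi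
identity. -/
theorem lieBracket_lieAd (v : L) (s : GSym (desusp (degZero k L))) :
    ofAlternating (-lieAlternating k L) (lieAd v s) =
      -⁅v, ofAlternating (-lieAlternating k L) s⁆ := by
  induction s using GSym.induction with
  | one => rw [lieAd_one, map_zero, lieBracket_one, lie_zero, neg_zero]
  | ι_mul p w _ s _ =>
    rw [lieAd_ι_mul, map_add, map_neg, lieBracket_ι_mul, lieBracket_ι_mul, lieBracket_ι_mul,
      proj_lieAd, lie_neg, lie_neg, leibniz_lie v w]
    abel
  | add s t hs ht => rw [map_add, map_add, hs, ht, map_add, lie_add, neg_add]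
  | smul c s hs => rw [map_smul, map_smul, hs, map_smul, lie_smul, smul_neg]

/-- The corestriction of `λ²`. At `v s` the recursion gives two terms, and they cancel by
`lieBracket_lieAd`. -/
theorem lieBracket_lieLam (s : GSym (desusp (degZero k L))) :
    ofAlternating (-lieAlternating k L) (lieLam k L s) = 0 := by
  induction s using GSym.induction with
  | one => rw [lieLam_one, map_zero]
  | ι_mul p v _ s _ =>
    rw [lieLam_ι_mul, map_sub, lieBracket_lieAd, lieBracket_ι_mul, proj_lieLam, sub_neg_eq_add,
      neg_add_cancel]
  | add s t hs ht => rw [map_add, map_add, hs, ht, add_zero]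
  | smul c s hs => rw [map_smul, map_smul, hs, smul_zero]

theorem lieLam_comp_lieLam [CharZero k] : lieLam k L ∘ₗ lieLam k L = 0 :=
  coder_eq_zero (comp_self_mem_coder lieLam_mem_coder)
    (LinearMap.ext fun s => (proj_lieLam _).trans (lieBracket_lieLam s))

theorem isLInfinity_lieLam [CharZero k] : IsLInfinity (degZero k L) (lieLam k L) :=
  ⟨⟨lieLam_mem_coder, lieLam_one⟩, lieLam_comp_lieLam⟩

theorem isDesuspBracket_lieLam : IsDesuspBracket (lieLam k L) := by
  refine ⟨fun x y => ?_, fun l hl => ?_⟩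
  · rw [proj_lieLam, lieBracket_ι_mul, proj_ι]
  · rw [proj_lieLam, list_prod_eq_wedge, ofAlternating_wedge_of_ne _ hl]

theorem lieAd_wedge (v : L) {n : ℕ} (y : Fin (n + 1) → L) :
    lieAd v (wedge k y) =
      -∑ j : Fin (n + 1), (-1 : ℤ) ^ (j : ℕ) • (ι _ ⁅v, y j⁆ * wedge k (fun l => y (j.succAbove l))) := by
  induction n with
  | zero =>
    rw [wedge_succ, lieAd_ι_mul, wedge_zero, lieAd_one]
    simp [wedge_zero]
  | succ n ih =>
    have h : ∀ w z : L, ∀ s, ι (desusp (degZero k L)) w * (ι _ z * s) = -(ι _ z * (ι _ w * s)) := by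
      intro w z s
      have h := ι_comm (desusp (degZero k L)) (mem_desusp_degZero w) (mem_desusp_degZero z)
      rw [show ((-1 : ℤ) * -1).negOnePow = -1 from rfl, Units.smul_def, Units.val_neg,
        Units.val_one, neg_one_smul] at h
      rw [← mul_assoc, h, neg_mul, mul_assoc]
    rw [Fin.sum_univ_succ, wedge_succ, lieAd_ι_mul, ih]
    simp only [Fin.val_zero, pow_zero, one_smul, Fin.succAbove_zero, neg_add, mul_neg,
      Finset.mul_sum, ← Finset.sum_neg_distrib]
    congr 1
    refine Finset.sum_congr rfl fun j _ => ?_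
    rw [wedge_succ (fun l => y (j.succ.succAbove l)), Fin.succ_succAbove_zero, h]
    simp only [Fin.succ_succAbove_succ, Fin.val_succ, pow_succ, mul_neg_one, neg_smul, smul_neg,
      mul_smul_comm, neg_neg]

/-- The terms in which the first element is bracketed with a later one are given by `lieAd_wedge`;
the others are the first element times the formula for the remaining ones, with the sign of the
shift of `j` by one. -/
theorem lieLam_wedge {n : ℕ} (x : Fin (n + 1) → L) :
    lieLam k L (wedge k x) = ∑ j : Fin (n + 1), ∑ i with i < j, (-1 : ℤ) ^ (j : ℕ) •
      wedge k (fun l => Function.update x i ⁅x i, x j⁆ (j.succAbove l)) := by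
  induction n with
  | zero =>
    have h : ∀ j : Fin 1, (Finset.univ.filter (· < j)) = ∅ := by decide
    rw [wedge_succ, lieLam_ι_mul, wedge_zero, lieAd_one, lieLam_one]
    simp [h]
  | succ n ih =>
    -- `hA` describes the summands with `i = 0`, where the bracket takes the first place; `hB` those
    -- with `i > 0`, where the first factor splits off.
    have hA : ∀ (w : L) (j : Fin (n + 1)), wedge k (fun l => Function.update x 0 w
        (j.succ.succAbove l)) = ι _ w * wedge k (fun l => x (j.succAbove l).succ) := by
      intro w j
      rw [wedge_succ, Fin.succ_succAbove_zero, Function.update_self]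
      simp only [Fin.succ_succAbove_succ, Function.update_of_ne (Fin.succ_ne_zero _)]
    have hu : ∀ (w : L) (i m : Fin (n + 1)), Function.update x i.succ w m.succ =
        Function.update (fun l => x l.succ) i w m := by
      intro w i m
      by_cases h : m = i
      · subst h
        simp
      · rw [Function.update_of_ne h, Function.update_of_ne ((Fin.succ_injective _).ne h)]
    have hB : ∀ (w : L) (i j : Fin (n + 1)), wedge k (fun l => Function.update x i.succ w
        (j.succ.succAbove l)) = ι _ (x 0) *
          wedge k (fun l => Function.update (fun l => x l.succ) i w (j.succAbove l)) := by
      intro w i j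
      rw [wedge_succ, Fin.succ_succAbove_zero, Function.update_of_ne (Fin.succ_ne_zero i).symm]
      simp only [Fin.succ_succAbove_succ, hu]
    simp only [Finset.sum_filter] at ih ⊢
    rw [Fin.sum_univ_succ]
    simp only [Fin.sum_univ_succ (n := n + 1), hA, hB]
    rw [wedge_succ, lieLam_ι_mul, lieAd_wedge, ih, Finset.sum_add_distrib, sub_eq_add_neg,
      Finset.mul_sum]
    simp only [Fin.not_lt_zero, if_false, Finset.sum_const_zero, zero_add, Fin.succ_pos, if_true,
      Fin.succ_lt_succ_iff, Finset.mul_sum, ← Finset.sum_neg_distrib, Fin.val_succ, pow_succ,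
      mul_neg_one, neg_smul]
    congr 1
    refine Finset.sum_congr rfl fun j _ => Finset.sum_congr rfl fun i _ => ?_
    split_ifs
    · rw [mul_smul_comm]
    · rw [mul_zero, neg_zero]

/-- The bracket of a coextension. -/
theorem lieBracket_coext {n : ℕ} {h : GSym (desusp (degZero k L)) →ₗ[k] L} {p : ℤ}
    (hh : IsHomog h p) (x : Fin (n + 1) → L) :
    ofAlternating (-lieAlternating k L) (coext h (wedge k x)) =
      -(p.negOnePow • ∑ i : Fin (n + 1), (-1 : ℤ) ^ (i : ℕ) •
        ⁅x i, h (wedge k fun l => x (i.succAbove l))⁆) := by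
  -- When `v` stays outside the coextension, the bracket pairs it with the length one part of the
  -- rest, which is the value of `h`.
  have h0 : ∀ {p : ℤ} {h : GSym (desusp (degZero k L)) →ₗ[k] L}, IsHomog h p → ∀ v s,
      ofAlternating (-lieAlternating k L) (coext h (ι _ v * s)) =
      ofAlternating (-lieAlternating k L) (coext (h ∘ₗ mulι v) s) +
        p.negOnePow • -⁅v, h s⁆ := by
    intro p h hh v s
    rw [coext_ι_mul hh (mem_desusp_degZero v), mul_neg_one, Int.negOnePow_neg, map_add,
      Units.smul_def, map_zsmul, lieBracket_ι_mul, proj_coext hh, Units.smul_def]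
  induction n generalizing h p with
  | zero =>
    rw [wedge_succ, h0 hh, wedge_zero, coext_one, ← mul_one (ι _ (_ : L)), lieBracket_ι_mul,
      proj_one]
    simp [wedge_zero, -lie_skew]
  | succ n ih =>
    rw [Fin.sum_univ_succ, wedge_succ, h0 hh, ih (hh.comp_mulι (mem_desusp_degZero _))]
    simp only [Fin.val_zero, pow_zero, one_smul, Fin.succAbove_zero, LinearMap.comp_apply,
      LinearMap.mulLeft_apply, Fin.val_succ, pow_succ, mul_neg_one, neg_smul,
      Finset.sum_neg_distrib]
    have hr : ∀ i : Fin (n + 1), wedge k (fun l => x (i.succ.succAbove l)) =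
        ι _ (x 0) * wedge k (fun l => x (i.succAbove l).succ) := by
      intro i
      rw [wedge_succ, Fin.succ_succAbove_zero]
      simp only [Fin.succ_succAbove_succ]
    simp only [hr, Int.negOnePow_add, Units.smul_def, Units.val_mul,
      show (-1 : ℤ).negOnePow = -1 from rfl, Units.val_neg, Units.val_one]
    module

/-- Since `Θ` is the coextension of its corestriction, `lieBracket_coext` turns `-λ Θ` into the
terms `[xᵢ, c(…)]`; its leading minus cancels the one of the commutator. `lieLam_wedge` turns `Θ λ`
into the terms `c([xᵢ, xⱼ], …)`. -/
theorem isClassicalCE_lieLam [CharZero k] : IsClassicalCE (lieLam k L) := by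
  refine ⟨fun p hp => coder_eq_bot_of_lt_neg_one hp,
    fun n => ⟨LinearEquiv.ofBijective (coderToAlternating k L n) (coderToAlternating_bijective n),
      coderToAlternating_apply n⟩, fun n Θ hΘ x => ?_⟩
  have hθ := IsHomog.proj_comp hΘ.1
  have h1 : proj _ (lieLam k L (Θ (wedge k x))) = _ :=
    (proj_lieLam _).trans ((congrArg (fun T : Module.End k (GSym (desusp (degZero k L))) =>
      ofAlternating (-lieAlternating k L) (T (wedge k x))) (coext_proj_comp hΘ)).symm.trans
        (lieBracket_coext hθ x))
  have h2 : proj _ (Θ (lieLam k L (wedge k x))) = _ :=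
    congrArg (proj _ ∘ₗ Θ) (lieLam_wedge x)
  change proj _ (((n : ℤ) - 1).negOnePow • Θ (lieLam k L (wedge k x)) -
    lieLam k L (Θ (wedge k x))) = _
  rw [map_sub, h1, Units.smul_def, map_zsmul, h2]
  simp only [map_sum, map_zsmul]
  rw [sub_neg_eq_add, ← Units.smul_def, ← smul_add, add_comm]
  rfl

end LieCE

end

theorem mainTheorem6 (k : Type u) [Field k] [CharZero k] :
    ∃ d : ∀ n, Rpl k n →ₗ[k] Rpl k n, (∀ n, Rpl.IsDifferential (d n)) ∧
    ∃ 𝒪 : DGOperad k (RplColl k), IsRplOperad d 𝒪 ∧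
    ∃ ℋ : DGOperad k (fun n => (𝒪.dg n).H), 𝒪.IsCohomology ℋ ∧
      -- the Chevalley–Eilenberg complex of an `L∞`-algebra, without or with cochains of arity `0`
      (∀ (L : Type v) [AddCommGroup L] [Module k L] (ℒ : ℤ → Submodule k L)
        [DirectSum.Decomposition ℒ] (𝒞 : ℤ → Submodule k (Module.End k (GSym (desusp ℒ)))),
        𝒞 = coder₀ (desusp ℒ) ∨ 𝒞 = coder (desusp ℒ) →
        ∀ lam : CE 𝒞, IsLInfinity ℒ (lam : Module.End k (GSym (desusp ℒ))) → RplActs 𝒪 ℋ lam) ∧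
      -- a Lie algebra is a special case
      (∀ (L : Type v) [LieRing L] [LieAlgebra k L],
        ∃ lam : Module.End k (GSym (desusp (degZero k L))),
          IsDesuspBracket lam ∧ IsLInfinity (degZero k L) lam ∧ IsClassicalCE lam ∧
          ∀ 𝒞 : ℤ → Submodule k (Module.End k (GSym (desusp (degZero k L)))),
            𝒞 = coder₀ (desusp (degZero k L)) ∨ 𝒞 = coder (desusp (degZero k L)) →
            ∀ lam' : CE 𝒞, (lam' : Module.End k (GSym (desusp (degZero k L)))) = lam →
              RplActs 𝒪 ℋ lam') := by

  -- Isolated because the Lie algebra case is the instance of it at `lieLam`.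
  have key : ∀ (L : Type v) [AddCommGroup L] [Module k L] (ℒ : ℤ → Submodule k L)
      [DirectSum.Decomposition ℒ] (𝒞 : ℤ → Submodule k (Module.End k (GSym (desusp ℒ)))),
      𝒞 = coder₀ (desusp ℒ) ∨ 𝒞 = coder (desusp ℒ) →
      ∀ lam : CE 𝒞, IsLInfinity ℒ (lam : Module.End k (GSym (desusp ℒ))) →
        RplActs (rplOperad k) (rplOperad k).cohomology lam := by
    rintro L _ _ ℒ _ 𝒞 (rfl | rfl) lam ⟨hlam, hsq⟩
    · exact CE.rplActs isCoderFamily_coder₀ hlam hsq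
    · exact CE.rplActs isCoderFamily_coder hlam.1 hsq
  exact ⟨Rpl.diff k, fun _ => Rpl.isDifferential_diff, rplOperad k, isRplOperad_rplOperad k,
    (rplOperad k).cohomology, (rplOperad k).isCohomology_cohomology, key, fun L _ _ =>
      ⟨lieLam k L, isDesuspBracket_lieLam, isLInfinity_lieLam, isClassicalCE_lieLam,
        fun 𝒞 h𝒞 lam' hlam' => key L (degZero k L) 𝒞 h𝒞 lam' (hlam' ▸ isLInfinity_lieLam)⟩⟩
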